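/- \textbf{Setting.} Let $(M^5,T^{1,0})$ be a CR five-manifold: $M$ is a smooth real five-manifold and $T^{1,0}\subset TM\otimes\mathbb{C}$ is a smooth complex rank $2$ distribution with $T^{1,0}\cap\overline{T^{1,0}}=0$, $[T^{1,0},T^{1,0}]\subset T^{1,0}$, and nondegenerate Levi form $(Z,W)\mapsto -i\,d\theta(Z,\overline W)$ for every contact form $\theta$, i.e. every real one-form with $\ker\theta=H:=\operatorname{Re}(T^{1,0}\oplus\overline{T^{1,0}})$. Fix a contact form $\theta$. \textbf{Rumin complex.} Let $\mathscr{R}^k$ be the space of smooth complex-valued $k$-forms $\omega$ with $\theta\wedge\omega\wedge d\theta^{3-k}=0$ and $\theta\wedge d\omega\wedge d\theta^{2-k}=0$ if $k\le 2$, and with $\theta\wedge\omega=0$ and $\theta\wedge d\omega=0$ if $k\ge 3$. For $p+q=k$ let $\mathscr{R}^{p,q}\subset\mathscr{R}^k$ be the subspace of those $\omega$ such that $\omega|_{H\otimes\mathbb{C}}$ has type $(p,q)$ (if $k\le2$), respectively $\omega=\theta\wedge\eta$ with $\eta|_{H\otimes\mathbb{C}}$ of type $(p-1,q)$ (if $k\ge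 3$). Then $\mathscr{R}^k=\bigoplus_{p+q=k}\mathscr{R}^{p,q}$, with projections $\pi^{p,q}$. On $\mathscr{R}^{p,q}$ the exterior derivative is $d=\partial_b+\overline{\partial}_b$ if $p+q\ne2$ and $d=\partial_b+\partial_0+\overline{\partial}_b$ if $p+q=2$, where $\overline{\partial}_b$ is the component in $\mathscr{R}^{p,q+1}$, $\partial_0$ (for $p+q=2$) the component in $\mathscr{R}^{p+1,q}$, and $\partial_b$ the component in $\mathscr{R}^{p+1,q}$ if $p+q\neq2$ and in $\mathscr{R}^{p+2,q-1}$ if $p+q=2$. \textbf{Products.} For a $k$-form $\omega$ let $\Gamma\omega=\theta\wedge\xi$, where $\theta\wedge\omega\wedge d\theta^{3-k}=\theta\wedge\xi\wedge d\theta^{4-k}$, if $k\le2$, and $\Gamma\omega=\theta\wedge\xi\wedge d\theta^{k-3}$, where $\theta\wedge\omega=\theta\wedge\xi\wedge d\theta^{k-2}$, if $k\ge3$ ($\Gamma=0$ for $k\in\{0,1,5\}$). Put $\pi:=1-d\Gamma-\Gamma d$. For $\omega\in\mathscr{R}^{p,q}$ and $\tau\in\mathscr{R}^{r,s}$ put $\omega\curlywedge\tau:=\pi(\omega\wedge\tau)$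 and $\omega\barwedge\tau:=\pi^{p+r,q+s}(\omega\curlywedge\tau)$. For a function $f$ and $\omega\in\mathscr{R}^{1,1}$, the element $f\curlywedge\omega=f\barwedge\omega\in\mathscr{R}^{1,1}$ is written $f\omega$. \textbf{Hodge star.} For $\omega\in\mathscr{R}^{p,q}$, let $\star\omega:=-i^{q-p}\,\theta\wedge\omega\wedge d\theta$ if $p+q=1$ and $\star\omega:=-i^{q-p}\,\theta\wedge\omega$ if $p+q=2$; these are isomorphisms $\mathscr{R}^{p,q}\to\mathscr{R}^{3-q,2-p}$, and $\star$ on the targets is defined by $\star^2=1$. On $\mathscr{R}^{1,1}$ put $\partial_b^\ast:=\star\overline{\partial}_b\star$ and $\overline{\partial}_b^\ast:=\star\partial_b\star$. \textbf{Curvature.} In a local admissible coframe $\{\theta^\alpha\}_{\alpha=1}^2$ (one-forms annihilating $\overline{T^{1,0}}$ and the Reeb field, and restricting to a coframe of $T^{1,0}$), $d\theta=ih_{\alpha\bar\beta}\theta^\alpha\wedge\theta^{\bar\beta}$, the Tanaka--Webster connection forms $\omega_\alpha{}^\gamma$ and the torsion are determined by $d\theta^\alpha=\theta^\mu\wedge\omega_\mu{}^\alpha+A^\alpha{}_{\bar\beta}\theta\wedge\theta^{\bar\beta}$,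 $dh_{\alpha\bar\beta}=\omega_{\alpha\bar\beta}+\omega_{\bar\beta\alpha}$, $A_{\alpha\gamma}=A_{\gamma\alpha}$; $R_\alpha{}^\gamma{}_{\rho\bar\sigma}$ is the coefficient of $\theta^\rho\wedge\theta^{\bar\sigma}$ in $d\omega_\alpha{}^\gamma-\omega_\alpha{}^\mu\wedge\omega_\mu{}^\gamma$, $R_{\alpha\bar\beta}:=R_{\alpha\bar\beta\mu}{}^\mu$, $R:=R_\mu{}^\mu$, and $E_{\alpha\bar\beta}:=\frac14\bigl(R_{\alpha\bar\beta}-\frac R2h_{\alpha\bar\beta}\bigr)$. The Lee form $\ell^\theta$ is the unique element of $\mathscr{R}^{1,1}$ with $\ell^\theta\equiv-iE_{\alpha\bar\beta}\,\theta^\alpha\wedge\theta^{\bar\beta}$ modulo $\theta$. \textbf{Theorem.} For $\omega\in\mathscr{R}^{1,1}$ define $$\mathcal{D}\omega:=\star\partial_b^\ast\Bigl(\partial_b\partial_b^\ast+\overline{\partial}_b\overline{\partial}_b^\ast+\frac R6\,\barwedge\Bigr)\omega+2\ell^\theta\barwedge\omega,\qquad Q_{1,1}^d\omega:=-i\overline{\mathcal{D}}\omega+i\mathcal{D}\omega,$$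 where $\overline{\mathcal{D}}\omega:=\overline{\mathcal{D}\overline\omega}$. Then $Q_{1,1}^d$ maps $\mathscr{R}^{1,1}$ into $\mathscr{R}^{3,1}\oplus\mathscr{R}^{2,2}$, and $$(Q_{1,1}^d)^{e^\Upsilon\theta}\omega=(Q_{1,1}^d)^\theta\omega+d\partial_0(\Upsilon\omega)$$ for all $\omega\in\mathscr{R}^{1,1}$ with $d\omega=0$ and all real-valued $\Upsilon\in C^\infty(M)$, where $\Upsilon\omega=\Upsilon\curlywedge\omega\in\mathscr{R}^{1,1}$ and $L_{1,1}^{\mathrm{BC}}:=d\partial_0$ is the Bott--Chern GJMS operator. -/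

import Mathlib

open scoped Manifold TensorProduct

noncomputable section

/-! ### Complex-valued differential forms on a smooth five-manifold -/

/-- The model space of a smooth five-manifold (without boundary). -/
abbrev E5 : Type := EuclideanSpace ℝ (Fin 5)

/-- The tangent space of a five-manifold at a point. -/
abbrev TS {M : Type*} [TopologicalSpace M] [ChartedSpace E5 M] (x : M) : Type :=
  TangentSpace 𝓘(ℝ, E5) x

/-- The element characterised by `P` if there is exactly one, and `0` otherwise. -/
def theUnique {α : Type*} [Zero α] (P : α → Prop) : α :=
  open Classical in if h : ∃! a, P a then h.choose else 0

section PointwiseAlgebra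

variable {V : Type*} [AddCommGroup V] [Module ℝ V]

/-- The value of the complex-multilinear extension of a complex-valued alternating form on `V`
on vectors of the complexification `ℂ ⊗ V`. -/
def cEval : {k : ℕ} → (V [⋀^Fin k]→ₗ[ℝ] ℂ) → (Fin k → ℂ ⊗[ℝ] V) → ℂ
  | 0, ω, _ => ω ![]
  | _ + 1, ω, Z => cEval (LinearMap.liftBaseChange ℂ ω.curryLeft (Z 0)) (Fin.tail Z)

/-- Complex conjugation on `ℂ ⊗ V`. -/
def conjC : ℂ ⊗[ℝ] V →ₗ[ℝ] ℂ ⊗[ℝ] V :=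
  LinearMap.rTensor V Complex.conjAe.toLinearMap

/-- The complex vector `u + i v`. -/
def cVec (u v : V) : ℂ ⊗[ℝ] V := 1 ⊗ₜ[ℝ] u + Complex.I ⊗ₜ[ℝ] v

variable [TopologicalSpace V]

/-- The multilinear map `(v₁,…,v_{k+l}) ↦ f (v₁,…,v_k) * g (v_{k+1},…,v_{k+l})`. -/
def mulForm {k l : ℕ} (f : V [⋀^Fin k]→L[ℝ] ℂ) (g : V [⋀^Fin l]→L[ℝ] ℂ) :
    ContinuousMultilinearMap ℝ (fun _ : Fin (k + l) => V) ℂ where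
  toMultilinearMap :=
    ((LinearMap.mul' ℝ ℂ).compMultilinearMap
      (MultilinearMap.domCoprod f.toMultilinearMap g.toMultilinearMap)).domDomCongr finSumFinEquiv
  cont := by
    have h : Continuous fun v : Fin (k + l) → V =>
        f (fun i => v (Fin.castAdd l i)) * g (fun i => v (Fin.natAdd k i)) :=
      (f.cont.comp (by fun_prop)).mul (g.cont.comp (by fun_prop))
    exact h

/-- The wedge product,
`(f ∧ g)(v) = (k! l!)⁻¹ ∑_σ sign σ · f (v_{σ 1},…,v_{σ k}) g (v_{σ (k+1)},…,v_{σ (k+l)})`. -/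
def wedgeAt {k l : ℕ} (f : V [⋀^Fin k]→L[ℝ] ℂ) (g : V [⋀^Fin l]→L[ℝ] ℂ) :
    V [⋀^Fin (k + l)]→L[ℝ] ℂ :=
  ((k.factorial * l.factorial : ℝ)⁻¹) • ContinuousMultilinearMap.alternatization (mulForm f g)

end PointwiseAlgebra

/-- Complex-valued differential `k`-forms, not necessarily smooth. -/
abbrev CForm (M : Type*) [TopologicalSpace M] [ChartedSpace E5 M] (k : ℕ) :=
  ∀ x : M, TS x [⋀^Fin k]→L[ℝ] ℂ

section Forms

variable {M : Type*} [TopologicalSpace M] [ChartedSpace E5 M] {k l : ℕ}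

/-- The pull-back of a form to the target of the preferred chart at `x₀`. -/
def inChart (ω : CForm M k) (x₀ : M) (y : E5) : E5 [⋀^Fin k]→L[ℝ] ℂ :=
  (ω ((extChartAt 𝓘(ℝ, E5) x₀).symm y)).compContinuousLinearMap
    (mfderiv 𝓘(ℝ, E5) 𝓘(ℝ, E5) (extChartAt 𝓘(ℝ, E5) x₀).symm y)

/-- Smoothness of a form on an open set. -/
def SmoothOn (ω : CForm M k) (U : Set M) : Prop :=
  ∀ x₀ : M, ContDiffOn ℝ (⊤ : ℕ∞) (inChart ω x₀)
    ((extChartAt 𝓘(ℝ, E5) x₀).target ∩ (extChartAt 𝓘(ℝ, E5) x₀).symm ⁻¹' U)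

/-- The exterior derivative. -/
def extD (ω : CForm M k) : CForm M (k + 1) := fun x =>
  (extDeriv (inChart ω x) (extChartAt 𝓘(ℝ, E5) x x)).compContinuousLinearMap
    (mfderiv 𝓘(ℝ, E5) 𝓘(ℝ, E5) (extChartAt 𝓘(ℝ, E5) x) x)

/-- The wedge product of forms. -/
def wedge (ω : CForm M k) (η : CForm M l) : CForm M (k + l) := fun x => wedgeAt (ω x) (η x)

infixl:70 " ∧ᶠ " => wedge

/-- A function as a `0`-form. -/
def fnForm (f : M → ℂ) : CForm M 0 := fun x =>
  ContinuousAlternatingMap.constOfIsEmpty ℝ (TS x) (Fin 0) (f x)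

/-- The product of a function and a form. -/
def fsmul (f : M → ℂ) (ω : CForm M k) : CForm M k := fun x => f x • ω x

/-- Complex conjugation of forms. -/
def conjF (ω : CForm M k) : CForm M k := fun x =>
  (Complex.conjCLE : ℂ →L[ℝ] ℂ).compContinuousAlternatingMap (ω x)

/-- The value of a form on complex tangent vectors. -/
def evalC {x : M} (ω : TS x [⋀^Fin k]→L[ℝ] ℂ) (Z : Fin k → ℂ ⊗[ℝ] TS x) : ℂ :=
  cEval ω.toAlternatingMap Z

/-- A real vector field is smooth on `U`. -/
def SmoothVF [IsManifold 𝓘(ℝ, E5) (⊤ : ℕ∞) M] (X : ∀ x : M, TS x) (U : Set M) : Prop :=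
  ContMDiffOn 𝓘(ℝ, E5) 𝓘(ℝ, E5).tangent (⊤ : ℕ∞)
    (fun x => (⟨x, X x⟩ : TangentBundle 𝓘(ℝ, E5) M)) U

end Forms

/-! ### CR structures and contact forms -/

/-- A family of complex subspaces of the complexified tangent spaces. -/
abbrev CDistribution (M : Type*) [TopologicalSpace M] [ChartedSpace E5 M] :=
  ∀ x : M, Submodule ℂ (ℂ ⊗[ℝ] TS x)

section CR

variable {M : Type*} [TopologicalSpace M] [ChartedSpace E5 M]

/-- A contact form: a smooth real one-form whose kernel is `Re (T¹⁰ ⊕ conj T¹⁰)`. -/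
structure IsContactForm (T10 : CDistribution M) (θ : CForm M 1) : Prop where
  smooth : SmoothOn θ Set.univ
  real : conjF θ = θ
  ker : ∀ (x : M) (v : TS x), θ x ![v] = 0 ↔
    ∃ Z ∈ T10 x, ∃ W ∈ T10 x, (1 : ℂ) ⊗ₜ[ℝ] v = Z + conjC W

/-- A (nondegenerate, integrable) CR structure on a five-manifold. -/
structure IsCRStructure [IsManifold 𝓘(ℝ, E5) (⊤ : ℕ∞) M] (T10 : CDistribution M) : Prop where
  rank : ∀ x, Module.finrank ℂ (T10 x) = 2
  /-- smooth local frames `Z_a = X_a + i Y_a` -/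
  smooth : ∀ x : M, ∃ U : Set M, IsOpen U ∧ x ∈ U ∧ ∃ X Y : Fin 2 → ∀ y : M, TS y,
    (∀ a, SmoothVF (X a) U ∧ SmoothVF (Y a) U) ∧
    ∀ y ∈ U, T10 y = Submodule.span ℂ (Set.range fun a => cVec (X a y) (Y a y))
  disjoint : ∀ x, ∀ Z ∈ T10 x, conjC Z ∈ T10 x → Z = 0
  /-- `[T¹⁰, T¹⁰] ⊆ T¹⁰`, for local sections `X + i Y` and `X' + i Y'` of `T¹⁰` -/
  involutive : ∀ U : Set M, IsOpen U → ∀ X Y X' Y' : ∀ y : M, TS y,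
    SmoothVF X U → SmoothVF Y U → SmoothVF X' U → SmoothVF Y' U →
    (∀ y ∈ U, cVec (X y) (Y y) ∈ T10 y) → (∀ y ∈ U, cVec (X' y) (Y' y) ∈ T10 y) →
    ∀ y ∈ U, cVec
      (VectorField.mlieBracket 𝓘(ℝ, E5) X X' y - VectorField.mlieBracket 𝓘(ℝ, E5) Y Y' y)
      (VectorField.mlieBracket 𝓘(ℝ, E5) X Y' y + VectorField.mlieBracket 𝓘(ℝ, E5) Y X' y) ∈ T10 y
  /-- the Levi form `(Z, W) ↦ -i dθ(Z, conj W)` of every contact form is nondegenerate -/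
  nondegenerate : ∀ θ : CForm M 1, IsContactForm T10 θ → ∀ x, ∀ Z ∈ T10 x,
    (∀ W ∈ T10 x, -Complex.I * evalC (extD θ x) ![Z, conjC W] = 0) → Z = 0

/-! ### The bigraded Rumin complex -/

/-- On `T¹⁰ ⊕ conj T¹⁰`, the alternating form `η` on `T_xM` only has components for which `r` plus
the number of slots of type `(1,0)` equals `p`, the other slots being of type `(0,1)`. -/
def HasType (T10 : CDistribution M) {k : ℕ} (x : M) (r p : ℕ) (η : TS x [⋀^Fin k]→ₗ[ℝ] ℂ) : Prop :=
  ∀ (s : Finset (Fin k)) (Z : Fin k → ℂ ⊗[ℝ] TS x),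
    (∀ i ∈ s, Z i ∈ T10 x) → (∀ i ∉ s, conjC (Z i) ∈ T10 x) → r + s.card ≠ p → cEval η Z = 0

/-- The Rumin spaces `𝓡ᵏ`, realised as spaces of differential forms:
`θ ∧ ω ∧ dθ^{3-k} = 0` and `θ ∧ dω ∧ dθ^{2-k} = 0` if `k ≤ 2`, and
`θ ∧ ω = 0` and `θ ∧ dω = 0` if `k ≥ 3`. For `k ≤ 1` the equations between forms of degree greater
than five, which hold trivially, are omitted. -/
def IsRumin (θ : CForm M 1) : {k : ℕ} → CForm M k → Prop
  | 0, _ => True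
  | 1, ω => θ ∧ᶠ extD ω ∧ᶠ extD θ = 0
  | 2, ω => θ ∧ᶠ ω ∧ᶠ extD θ = 0 ∧ θ ∧ᶠ extD ω = 0
  | _ + 3, ω => θ ∧ᶠ ω = 0 ∧ θ ∧ᶠ extD ω = 0

/-- Bidegree in the Rumin complex: for `k ≤ 2`, `ω` is of type `(p,q)` on `H ⊗ ℂ`; for `k ≥ 3`,
`ω = θ ∧ η` with `η` of type `(p-1,q)` on `H ⊗ ℂ` (here `θ ∧ ω = 0`, so that on `H` the contraction
of `ω` with a vector `v` is `θ(v) η`). -/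
def HasBidegree (T10 : CDistribution M) (p : ℕ) : {k : ℕ} → CForm M k → Prop
  | _ + 3, ω => ∀ (x : M) (v : TS x), HasType T10 x 1 p ((ω x).toAlternatingMap.curryLeft v)
  | _, ω => ∀ x, HasType T10 x 0 p (ω x).toAlternatingMap

/-- The space `𝓡^{p,q}`, `p + q = k`, of `(p,q)`-forms in the bigraded Rumin complex. -/
def RSpace (T10 : CDistribution M) (θ : CForm M 1) (k p q : ℕ) : Set (CForm M k) :=
  {ω | p + q = k ∧ SmoothOn ω Set.univ ∧ IsRumin θ ω ∧ HasBidegree T10 p ω}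

/-- The `𝓡^{p,q}`-component of an element of `𝓡ᵏ = ⨁_{p+q=k} 𝓡^{p,q}`. -/
def component (T10 : CDistribution M) (θ : CForm M 1) {k : ℕ} (p q : ℕ) (ω : CForm M k) :
    CForm M k :=
  theUnique fun α => ∃ c : ℕ × ℕ → CForm M k,
    (∀ a ∈ Finset.HasAntidiagonal.antidiagonal k, c a ∈ RSpace T10 θ k a.1 a.2) ∧
    ω = ∑ a ∈ Finset.HasAntidiagonal.antidiagonal k, c a ∧ α = c (p, q)

/-- `∂_b` on `𝓡^{p,q}`: the component of the exterior derivative in `𝓡^{p+1,q}` if `p + q ≠ 2`,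
and in `𝓡^{p+2,q-1}` if `p + q = 2`. -/
def delB (T10 : CDistribution M) (θ : CForm M 1) {k : ℕ} (p q : ℕ) (ω : CForm M k) :
    CForm M (k + 1) :=
  if p + q = 2 then component T10 θ (p + 2) (q - 1) (extD ω)
  else component T10 θ (p + 1) q (extD ω)

/-- `∂̄_b` on `𝓡^{p,q}`: the component of the exterior derivative in `𝓡^{p,q+1}`. -/
def delBbar (T10 : CDistribution M) (θ : CForm M 1) {k : ℕ} (p q : ℕ) (ω : CForm M k) :
    CForm M (k + 1) :=
  component T10 θ p (q + 1) (extD ω)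

/-- `∂₀` on `𝓡^{p,q}`, `p + q = 2`: the component of the exterior derivative in `𝓡^{p+1,q}`. -/
def delZero (T10 : CDistribution M) (θ : CForm M 1) (p q : ℕ) (ω : CForm M 2) : CForm M 3 :=
  component T10 θ (p + 1) q (extD ω)

/-! ### The projection onto the Rumin complex and the products -/

/-- `Γω = θ ∧ ξ`, where `θ ∧ ω ∧ dθ = θ ∧ ξ ∧ dθ²`, on two-forms. -/
def gammaTwo (θ : CForm M 1) (ω : CForm M 2) : CForm M 1 :=
  theUnique fun α => ∃ ξ : M → ℂ, α = fsmul ξ θ ∧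
    θ ∧ᶠ ω ∧ᶠ extD θ = fsmul ξ (θ ∧ᶠ extD θ ∧ᶠ extD θ)

/-- `Γω = θ ∧ ξ`, where `θ ∧ ω = θ ∧ ξ ∧ dθ`, on three-forms. -/
def gammaThree (θ : CForm M 1) (ω : CForm M 3) : CForm M 2 :=
  theUnique fun α => ∃ ξ : CForm M 1, α = θ ∧ᶠ ξ ∧ θ ∧ᶠ ω = θ ∧ᶠ ξ ∧ᶠ extD θ

/-- `Γω = θ ∧ ξ ∧ dθ`, where `θ ∧ ω = θ ∧ ξ ∧ dθ²`, on four-forms. -/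
def gammaFour (θ : CForm M 1) (ω : CForm M 4) : CForm M 3 :=
  theUnique fun α => ∃ ξ : M → ℂ, α = fsmul ξ (θ ∧ᶠ extD θ) ∧
    θ ∧ᶠ ω = fsmul ξ (θ ∧ᶠ extD θ ∧ᶠ extD θ)

/-- The projection `π = 1 - dΓ - Γd` onto `𝓡²`. -/
def piTwo (θ : CForm M 1) (ω : CForm M 2) : CForm M 2 :=
  ω - extD (gammaTwo θ ω) - gammaThree θ (extD ω)

/-- The projection `π = 1 - dΓ - Γd` onto `𝓡⁴`; here `Γ` vanishes on five-forms. -/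
def piFour (θ : CForm M 1) (ω : CForm M 4) : CForm M 4 :=
  ω - extD (gammaFour θ ω)

/-- The Rumin product `f ω := π(f ∧ ω)` of a function `f ∈ 𝓡^{0,0}` and `ω ∈ 𝓡²`. -/
def rMulFn (θ : CForm M 1) (f : M → ℂ) (ω : CForm M 2) : CForm M 2 :=
  piTwo θ (fsmul f ω)

/-- The bigraded product `π^{1,1} π (f ∧ ω)` of `f ∈ 𝓡^{0,0}` and `ω ∈ 𝓡^{1,1}`. -/
def krMulFn (T10 : CDistribution M) (θ : CForm M 1) (f : M → ℂ) (ω : CForm M 2) : CForm M 2 :=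
  component T10 θ 1 1 (rMulFn θ f ω)

/-- The bigraded product `π^{2,2} π (ω ∧ τ)` of `ω, τ ∈ 𝓡^{1,1}`. -/
def krWedge (T10 : CDistribution M) (θ : CForm M 1) (ω τ : CForm M 2) : CForm M 4 :=
  component T10 θ 2 2 (piFour θ (ω ∧ᶠ τ))

/-! ### Hodge star and adjoints -/

/-- The Hodge star `𝓡^{p,q} → 𝓡^{3-q,2-p}`, `p + q = 1`: `⋆ω = -θ ∧ Jω ∧ dθ`, `J = i^{q-p}`. -/
def starOne (θ : CForm M 1) (p q : ℕ) (ω : CForm M 1) : CForm M 4 :=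
  -(θ ∧ᶠ (Complex.I ^ ((q : ℤ) - p) • ω) ∧ᶠ extD θ)

/-- The Hodge star `𝓡^{p,q} → 𝓡^{3-q,2-p}`, `p + q = 2`: `⋆ω = -θ ∧ Jω`, `J = i^{q-p}`. -/
def starTwo (θ : CForm M 1) (p q : ℕ) (ω : CForm M 2) : CForm M 3 :=
  -(θ ∧ᶠ (Complex.I ^ ((q : ℤ) - p) • ω))

/-- The Hodge star `𝓡^{3-q,2-p} → 𝓡^{p,q}`, `p + q = 1`, the inverse of `starOne` since `⋆² = 1`. -/
def starFour (T10 : CDistribution M) (θ : CForm M 1) (p q : ℕ) (σ : CForm M 4) : CForm M 1 :=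
  theUnique fun ρ => ρ ∈ RSpace T10 θ 1 p q ∧ starOne θ p q ρ = σ

/-- `∂_b^* = (-1)^{p+q} ⋆ ∂̄_b ⋆ : 𝓡^{1,1} → 𝓡^{2,1} → 𝓡^{2,2} → 𝓡^{0,1}`. -/
def delBStar (T10 : CDistribution M) (θ : CForm M 1) (ω : CForm M 2) : CForm M 1 :=
  (-1 : ℂ) ^ (1 + 1) • starFour T10 θ 0 1 (delBbar T10 θ 2 1 (starTwo θ 1 1 ω))

/-- `∂̄_b^* = (-1)^{p+q} ⋆ ∂_b ⋆ : 𝓡^{1,1} → 𝓡^{2,1} → 𝓡^{3,1} → 𝓡^{1,0}`. -/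
def delBbarStar (T10 : CDistribution M) (θ : CForm M 1) (ω : CForm M 2) : CForm M 1 :=
  (-1 : ℂ) ^ (1 + 1) • starFour T10 θ 1 0 (delB T10 θ 2 1 (starTwo θ 1 1 ω))

/-! ### The Tanaka--Webster connection and its curvature -/

/-- `v` is the value at `x` of the Reeb vector field of `θ`. -/
def IsReebAt (θ : CForm M 1) (x : M) (v : TS x) : Prop :=
  θ x ![v] = 1 ∧ ∀ w : TS x, extD θ x ![v, w] = 0

/-- An admissible coframe on an open set `U`, with its dual frame of `T¹⁰`, the matrix
`h_{αβ̄}` of the Levi form, the connection one-forms `conn α γ = ω_α^γ` of the Tanaka--Webster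
connection, and its torsion `tor x α β = A^α_{β̄}`. -/
structure AdmissibleCoframe (T10 : CDistribution M) (θ : CForm M 1) (U : Set M) where
  coframe : Fin 2 → CForm M 1
  frame : Fin 2 → ∀ x : M, ℂ ⊗[ℝ] TS x
  h : M → Matrix (Fin 2) (Fin 2) ℂ
  conn : Fin 2 → Fin 2 → CForm M 1
  tor : M → Matrix (Fin 2) (Fin 2) ℂ
  isOpen : IsOpen U
  coframe_smooth : ∀ α, SmoothOn (coframe α) U
  conn_smooth : ∀ α γ, SmoothOn (conn α γ) U
  coframe_conj : ∀ α, ∀ x ∈ U, ∀ Z ∈ T10 x, evalC (coframe α x) ![conjC Z] = 0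
  coframe_reeb : ∀ α, ∀ x ∈ U, ∀ v, IsReebAt θ x v → coframe α x ![v] = 0
  frame_mem : ∀ α, ∀ x ∈ U, frame α x ∈ T10 x
  frame_dual : ∀ α β, ∀ x ∈ U, evalC (coframe α x) ![frame β x] = if α = β then 1 else 0
  /-- `dθ = i h_{αβ̄} θ^α ∧ θ^{β̄}` -/
  levi : ∀ x ∈ U, extD θ x =
    ∑ α, ∑ β, (Complex.I * h x α β) • (coframe α ∧ᶠ conjF (coframe β)) x
  /-- `dθ^α = θ^μ ∧ ω_μ^α + A^α_{β̄} θ ∧ θ^{β̄}` -/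
  structure_eq : ∀ α, ∀ x ∈ U, extD (coframe α) x =
    ∑ μ, (coframe μ ∧ᶠ conn μ α) x + ∑ β, tor x α β • (θ ∧ᶠ conjF (coframe β)) x
  /-- `dh_{αβ̄} = ω_{αβ̄} + ω_{β̄α}` -/
  metric : ∀ α β, ∀ x ∈ U, extD (fnForm fun y => h y α β) x =
    ∑ γ, h x γ β • conn α γ x + ∑ γ, h x α γ • conjF (conn β γ) x
  /-- the symmetry of the torsion, with its upper index lowered by `h` -/
  tor_symm : ∀ β γ, ∀ x ∈ U, ∑ α, tor x α β * h x α γ = ∑ α, tor x α γ * h x α β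

namespace AdmissibleCoframe

variable {T10 : CDistribution M} {θ : CForm M 1} {U : Set M} (F : AdmissibleCoframe T10 θ U)

/-- The curvature forms `Ω_α^γ = dω_α^γ - ω_α^μ ∧ ω_μ^γ`. -/
def curvForm (α γ : Fin 2) : CForm M 2 :=
  extD (F.conn α γ) - ∑ μ, F.conn α μ ∧ᶠ F.conn μ γ

/-- The coefficient `R_α^γ_{ρσ̄}` of `θ^ρ ∧ θ^{σ̄}` in `Ω_α^γ`. -/
def riem (x : M) (α γ ρ σ : Fin 2) : ℂ :=
  evalC (F.curvForm α γ x) ![F.frame ρ x, conjC (F.frame σ x)]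

/-- The pseudohermitian Ricci tensor `R_{αβ̄} = R_{αβ̄μ}^μ = h_{γβ̄} h^{ρσ̄} R_α^γ_{ρσ̄}`,
where `h^{ρσ̄} = (h⁻¹) σ ρ`. -/
def ricci (x : M) (α β : Fin 2) : ℂ :=
  ∑ γ, ∑ ρ, ∑ σ, F.h x γ β * (F.h x)⁻¹ σ ρ * F.riem x α γ ρ σ

/-- The pseudohermitian scalar curvature `R = h^{αβ̄} R_{αβ̄}`. -/
def scal (x : M) : ℂ := ∑ α, ∑ β, (F.h x)⁻¹ β α * F.ricci x α β

/-- `E_{αβ̄} = (R_{αβ̄} - (R/2) h_{αβ̄}) / 4`. -/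
def tracefreeE (x : M) (α β : Fin 2) : ℂ :=
  (1 / 4) * (F.ricci x α β - F.scal x / 2 * F.h x α β)

/-- `-i E_{αβ̄} θ^α ∧ θ^{β̄}`. -/
def leeH : CForm M 2 := fun x =>
  ∑ α, ∑ β, (-Complex.I * F.tracefreeE x α β) • (F.coframe α ∧ᶠ conjF (F.coframe β)) x

end AdmissibleCoframe

/-- The pseudohermitian scalar curvature of `θ`. -/
def scalarCurvature (T10 : CDistribution M) (θ : CForm M 1) : M → ℂ :=
  theUnique fun R => ∀ (U : Set M) (F : AdmissibleCoframe T10 θ U), ∀ x ∈ U, R x = F.scal x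

/-- The Lee form: `ℓ ≡ -i E_{αβ̄} θ^α ∧ θ^{β̄}` in `𝓡^{1,1}`, where `≡` means equality modulo `θ`. -/
def leeForm (T10 : CDistribution M) (θ : CForm M 1) : CForm M 2 :=
  theUnique fun ell => ell ∈ RSpace T10 θ 2 1 1 ∧
    ∀ (U : Set M) (F : AdmissibleCoframe T10 θ U), ∀ x ∈ U, (θ ∧ᶠ ell) x = (θ ∧ᶠ F.leeH) x

/-! ### The `Q`-curvature operator -/

/-- `𝒟ω = ⋆∂_b^*(∂_b∂_b^* + ∂̄_b∂̄_b^* + (R/6) ·)ω + 2 ℓ · ω`, with the bigraded products. -/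
def calD (T10 : CDistribution M) (θ : CForm M 1) (ω : CForm M 2) : CForm M 4 :=
  starOne θ 0 1 (delBStar T10 θ
    (delB T10 θ 0 1 (delBStar T10 θ ω) + delBbar T10 θ 1 0 (delBbarStar T10 θ ω)
      + krMulFn T10 θ (fun x => scalarCurvature T10 θ x / 6) ω))
  + (2 : ℂ) • krWedge T10 θ (leeForm T10 θ) ω

/-- `Q_{1,1}^d = -i 𝒟̄ + i 𝒟`, where `𝒟̄ω` is the conjugate of `𝒟` applied to the conjugate of
`ω`. -/
def qOp (T10 : CDistribution M) (θ : CForm M 1) (ω : CForm M 2) : CForm M 4 :=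
  -(Complex.I • conjF (calD T10 θ (conjF ω))) + Complex.I • calD T10 θ ω

/-- The Bott--Chern GJMS operator `d ∂₀` on `𝓡^{1,1}`. -/
def bottChernGJMS (T10 : CDistribution M) (θ : CForm M 1) (ω : CForm M 2) : CForm M 4 :=
  extD (delZero T10 θ 1 1 ω)

/-- The contact form `e^Υ θ`. -/
def rescale (f : M → ℝ) (θ : CForm M 1) : CForm M 1 :=
  fsmul (fun x => (Real.exp (f x) : ℂ)) θ

end CR

end

open Complex (I I_mul_I I_ne_zero conj_I conj_conj real_smul ofRealCLM conjCLE)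
open Set (univ mem_univ subset_univ inter_subset_right inter_subset_left)
open Equiv (Perm)
open Equiv.Perm (sign decomposeFin)
open Fin (castAdd natAdd)
open Finset.HasAntidiagonal (antidiagonal mem_antidiagonal)

noncomputable section

set_option linter.unusedSectionVars false

variable {V : Type*} [AddCommGroup V] [Module ℝ V] {k l : ℕ}

local notation:max "Λ" k:max => V [⋀^Fin k]→ₗ[ℝ] ℂ
local notation "ℂV" => ℂ ⊗[ℝ] V
local notation "cj" => starRingEnd ℂ

/-- The wedge product of complex-valued alternating maps, without continuity. -/
def altWedge (f : Λ k) (g : Λ l) : Λ (k + l) :=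
  ((k.factorial * l.factorial : ℝ)⁻¹) • MultilinearMap.alternatization
    (((LinearMap.mul' ℝ ℂ).compMultilinearMap
      (MultilinearMap.domCoprod f.toMultilinearMap g.toMultilinearMap)).domDomCongr
        finSumFinEquiv)

lemma altWedge_apply (f : Λ k) (g : Λ l) (v : Fin (k + l) → V) :
    altWedge f g v = ((k.factorial * l.factorial : ℝ)⁻¹) • ∑ σ : Perm (Fin (k + l)),
      sign σ • (f (fun i => v (σ (castAdd l i))) * g (fun i => v (σ (natAdd k i)))) := by
  simp only [altWedge, AlternatingMap.smul_apply, MultilinearMap.alternatization_apply]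
  rfl

lemma toAlternatingMap_wedgeAt [TopologicalSpace V] (f : V [⋀^Fin k]→L[ℝ] ℂ)
    (g : V [⋀^Fin l]→L[ℝ] ℂ) :
    (wedgeAt f g).toAlternatingMap = altWedge f.toAlternatingMap g.toAlternatingMap := by
  ext v
  rw [altWedge_apply]
  simp only [wedgeAt, ContinuousAlternatingMap.coe_toAlternatingMap,
    ContinuousAlternatingMap.smul_apply,
    ContinuousMultilinearMap.alternatization_apply_apply]
  rfl

lemma altWedge_add (f : Λ k) (g g' : Λ l) : altWedge f (g + g') = altWedge f g + altWedge f g' := by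
  ext v
  simp only [altWedge_apply, AlternatingMap.add_apply, mul_add, smul_add, Finset.sum_add_distrib]

lemma add_altWedge (f f' : Λ k) (g : Λ l) : altWedge (f + f') g = altWedge f g + altWedge f' g := by
  ext v
  simp only [altWedge_apply, AlternatingMap.add_apply, add_mul, smul_add, Finset.sum_add_distrib]

lemma altWedge_smul (c : ℂ) (f : Λ k) (g : Λ l) : altWedge f (c • g) = c • altWedge f g := by
  ext v
  simp only [altWedge_apply, AlternatingMap.smul_apply, smul_eq_mul, mul_left_comm _ c,
    ← mul_smul_comm, ← Finset.mul_sum]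

lemma smul_altWedge (c : ℂ) (f : Λ k) (g : Λ l) : altWedge (c • f) g = c • altWedge f g := by
  ext v
  simp only [altWedge_apply, AlternatingMap.smul_apply, smul_eq_mul, mul_assoc c,
    ← mul_smul_comm, ← Finset.mul_sum]

lemma sum_altWedge {ι : Type*} (s : Finset ι) (f : ι → Λ k) (g : Λ l) :
    altWedge (∑ i ∈ s, f i) g = ∑ i ∈ s, altWedge (f i) g :=
  map_sum (AddMonoidHom.mk' (fun f => altWedge f g) (fun f f' => add_altWedge f f' g)) f s

lemma sum_perm {X : Type*} {p l n : ℕ} (e : Fin p ⊕ Fin l ≃ Fin n) (m : (Fin p → X) → ℂ)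
    (b : (Fin l → X) → ℂ) (v : Fin n → X) :
    ∑ σ : Perm (Fin n), sign σ • ((∑ τ : Perm (Fin p), sign τ •
      m (fun i => v (σ (e (.inl (τ i)))))) * b (fun i => v (σ (e (.inr i))))) =
    (p.factorial : ℂ) * ∑ σ : Perm (Fin n), sign σ •
      (m (fun i => v (σ (e (.inl i)))) * b (fun i => v (σ (e (.inr i))))) := by
  simp_rw [Finset.sum_mul, Finset.smul_sum]
  rw [Finset.sum_comm]
  have key : ∀ τ : Perm (Fin p), ∑ σ : Perm (Fin n), sign σ •
      ((sign τ • m (fun i => v (σ (e (.inl (τ i)))))) * b (fun i => v (σ (e (.inr i))))) =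
      ∑ σ : Perm (Fin n), sign σ •
        (m (fun i => v (σ (e (.inl i)))) * b (fun i => v (σ (e (.inr i))))) := by
    intro τ
    refine Fintype.sum_equiv (Equiv.mulRight
      (e.permCongr (Equiv.sumCongr τ (Equiv.refl (Fin l))))) _ _ fun σ => ?_
    have h1 : sign (e.permCongr (Equiv.sumCongr τ (Equiv.refl (Fin l)))) = sign τ := by
      rw [Equiv.Perm.sign_permCongr, Equiv.Perm.sign_sumCongr]; simp
    simp only [Equiv.coe_mulRight, Equiv.Perm.sign_mul, h1, mul_smul]
    rcases Int.units_eq_one_or (sign τ) with h | h <;> simp [h, Equiv.permCongr_apply]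
  simp_rw [key]
  simp [Fintype.card_perm]

lemma altWedge_assoc {k l m : ℕ} (f : Λ k) (g : Λ l) (h : Λ m) (v : Fin (k + l + m) → V) :
    altWedge (altWedge f g) h v =
      altWedge f (altWedge g h) (v ∘ Fin.cast (Nat.add_assoc k l m).symm) := by
  have hL := sum_perm finSumFinEquiv
    (fun w : Fin (k + l) → V => f (fun i => w (castAdd l i)) * g (fun i => w (natAdd k i))) h v
  have hR := sum_perm ((Equiv.sumComm _ _).trans finSumFinEquiv)
    (fun w : Fin (l + m) → V => g (fun i => w (castAdd m i)) * h (fun i => w (natAdd l i)))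
    f (v ∘ Fin.cast (Nat.add_assoc k l m).symm)
  simp only [finSumFinEquiv_apply_left, finSumFinEquiv_apply_right, Equiv.trans_apply,
    Equiv.sumComm_apply, Sum.swap_inl, Sum.swap_inr] at hL hR
  simp only [mul_comm _ (f _)] at hR
  have hE : ∑ σ : Perm (Fin (k + l + m)), sign σ •
      ((f (fun i => v (σ (castAdd m (castAdd l i)))) *
        g (fun i => v (σ (castAdd m (natAdd k i))))) *
        h (fun i => v (σ (natAdd (k + l) i)))) =
      ∑ σ : Perm (Fin (k + (l + m))), sign σ •
      (f (fun i => (v ∘ Fin.cast (Nat.add_assoc k l m).symm) (σ (castAdd (l + m) i))) *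
        (g (fun i => (v ∘ Fin.cast (Nat.add_assoc k l m).symm)
          (σ (natAdd k (castAdd m i)))) *
        h (fun i => (v ∘ Fin.cast (Nat.add_assoc k l m).symm)
          (σ (natAdd k (natAdd l i)))))) := by
    refine Fintype.sum_equiv (finCongr (Nat.add_assoc k l m)).permCongr _ _ fun σ => ?_
    rw [Equiv.Perm.sign_permCongr, mul_assoc]
    congr 3
    congr 1
    funext i
    simp only [Equiv.permCongr_apply, Function.comp]
    simp only [finCongr_apply, finCongr_symm, Fin.cast_cast, Fin.cast_eq_self]
    congr 2
    ext
    simp [Nat.add_assoc]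
  have e1 : altWedge (altWedge f g) h v = (((k + l).factorial * m.factorial : ℝ)⁻¹) •
      ((k.factorial * l.factorial : ℝ)⁻¹) •
      ∑ σ : Perm (Fin (k + l + m)), sign σ •
      ((∑ τ : Perm (Fin (k + l)), sign τ •
        (f (fun i => v (σ (castAdd m (τ (castAdd l i))))) *
          g (fun i => v (σ (castAdd m (τ (natAdd k i))))))) *
        h (fun i => v (σ (natAdd (k + l) i)))) := by
    rw [altWedge_apply]
    congr 1
    rw [Finset.smul_sum]
    refine Finset.sum_congr rfl fun σ _ => ?_
    rw [altWedge_apply, smul_mul_assoc, smul_comm]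
  have e2 : altWedge f (altWedge g h) (v ∘ Fin.cast (Nat.add_assoc k l m).symm) =
      ((k.factorial * (l + m).factorial : ℝ)⁻¹) •
      ((l.factorial * m.factorial : ℝ)⁻¹) •
      ∑ σ : Perm (Fin (k + (l + m))), sign σ •
      (f (fun i => (v ∘ Fin.cast (Nat.add_assoc k l m).symm) (σ (castAdd (l + m) i))) *
        ∑ τ : Perm (Fin (l + m)), sign τ •
        (g (fun i => (v ∘ Fin.cast (Nat.add_assoc k l m).symm)
            (σ (natAdd k (τ (castAdd m i))))) *
          h (fun i => (v ∘ Fin.cast (Nat.add_assoc k l m).symm)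
            (σ (natAdd k (τ (natAdd l i))))))) := by
    rw [altWedge_apply]
    congr 1
    rw [Finset.smul_sum]
    refine Finset.sum_congr rfl fun σ _ => ?_
    rw [altWedge_apply, mul_smul_comm, smul_comm]
  rw [e1, e2, hL, hR, hE]
  have n1 : ((k + l).factorial : ℂ) ≠ 0 := by exact_mod_cast (k + l).factorial_ne_zero
  have n2 : ((l + m).factorial : ℂ) ≠ 0 := by exact_mod_cast (l + m).factorial_ne_zero
  simp only [real_smul]
  push_cast
  generalize (∑ σ : Perm (Fin (k + (l + m))), _ : ℂ) = S
  have n3 : (k.factorial : ℂ) ≠ 0 := by exact_mod_cast k.factorial_ne_zero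
  have n4 : (l.factorial : ℂ) ≠ 0 := by exact_mod_cast l.factorial_ne_zero
  have n5 : (m.factorial : ℂ) ≠ 0 := by exact_mod_cast m.factorial_ne_zero
  field_simp

/-- The wedge product of a one-form and a form. -/
lemma one_altWedge_apply (a : Λ 1) (f : Λ k) (v : Fin (k + 1) → V) :
    altWedge a f (v ∘ Fin.cast (Nat.add_comm 1 k)) =
      ∑ p : Fin (k + 1), (-1 : ℂ) ^ (p : ℕ) * (a ![v p] * f (fun i => v (p.succAbove i))) := by
  rw [altWedge_apply]
  have h1 : ∑ σ : Perm (Fin (1 + k)), sign σ •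
      (a (fun i => (v ∘ Fin.cast (Nat.add_comm 1 k)) (σ (castAdd k i))) *
        f (fun i => (v ∘ Fin.cast (Nat.add_comm 1 k)) (σ (natAdd 1 i)))) =
      ∑ σ : Perm (Fin (k + 1)), sign σ •
        (a ![v (σ 0)] * f (fun i => v (σ i.succ))) := by
    refine Fintype.sum_equiv (finCongr (Nat.add_comm 1 k)).permCongr _ _ fun σ => ?_
    rw [Equiv.Perm.sign_permCongr]
    simp only [Equiv.permCongr_apply, Function.comp, finCongr_apply, finCongr_symm]
    congr 3
    · funext i
      rw [Matrix.cons_val_fin_one]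
      congr 3
      ext
      simp [Fin.eq_zero i]
    · funext i
      congr 3
      ext
      simp [Nat.add_comm]
  rw [h1]
  have h2 : ∀ (p : Fin (k + 1)) (s : Perm (Fin k)),
      sign (decomposeFin.symm (p, s)) •
        (a ![v (decomposeFin.symm (p, s) 0)] * f (fun i => v (decomposeFin.symm (p, s) i.succ))) =
      (-1 : ℂ) ^ (p : ℕ) * (a ![v p] * f (fun i => v (p.succAbove i))) := by
    intro p s
    set σ := decomposeFin.symm (p, s) with hσ
    have hs0 : σ 0 = p := by simp [hσ]
    -- `ρ` fixes `0`
    obtain ⟨t, ht⟩ : ∃ t : Perm (Fin k), p.cycleRange * σ =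
        decomposeFin.symm (0, t) := by
      refine ⟨(decomposeFin (p.cycleRange * σ)).2, ?_⟩
      rw [Equiv.eq_symm_apply]
      ext1
      · have h0 : decomposeFin.symm (decomposeFin (p.cycleRange * σ)) 0 =
            (decomposeFin (p.cycleRange * σ)).1 :=
          Equiv.Perm.decomposeFin_symm_apply_zero _ _
        rw [← h0]
        simp [hs0]
      · rfl
    have hσ' : σ = p.cycleRange⁻¹ * decomposeFin.symm (0, t) := by rw [← ht]; simp
    have hsg : sign σ = (-1) ^ (p : ℕ) * sign t := by
      rw [hσ', Equiv.Perm.sign_mul, Equiv.Perm.sign_inv, Fin.sign_cycleRange,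
        Equiv.Perm.decomposeFin.symm_sign]
      simp
    have hsu : ∀ i : Fin k, σ i.succ = p.succAbove (t i) := by
      intro i
      rw [hσ', Equiv.Perm.mul_apply, Equiv.Perm.decomposeFin_symm_apply_succ]
      simp
    simp_rw [hsu, hs0]
    have hf : f (fun i => v (p.succAbove (t i))) = sign t • f (fun i => v (p.succAbove i)) :=
      f.map_perm (fun i => v (p.succAbove i)) t
    rw [hf, hsg]
    rcases Int.units_eq_one_or (sign t) with h | h
    · rw [h]; simp [Units.smul_def]
    · rw [h]; simp [Units.smul_def]
  rw [← Equiv.sum_comp Equiv.Perm.decomposeFin.symm, Fintype.sum_prod_type]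
  simp_rw [h2]
  simp only [Finset.sum_const, Finset.card_univ, Fintype.card_perm, Fintype.card_fin,
    Nat.factorial_one, Nat.cast_one, one_mul]
  rw [← Finset.smul_sum]
  have n3 : (k.factorial : ℂ) ≠ 0 := by exact_mod_cast k.factorial_ne_zero
  simp only [nsmul_eq_mul, real_smul]
  push_cast
  field_simp

attribute [irreducible] altWedge

/-- Contraction of a complex-valued alternating form with a complex vector. -/
def iC (Z : ℂV) (f : Λ (k + 1)) : Λ k := LinearMap.liftBaseChange ℂ f.curryLeft Z

lemma cEval_succ (f : Λ (k + 1)) (Z : Fin (k + 1) → ℂV) :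
    cEval f Z = cEval (iC (Z 0) f) (Fin.tail Z) := rfl

lemma cEval_cons (f : Λ (k + 1)) (a : ℂV) (Z : Fin k → ℂV) :
    cEval f (Matrix.vecCons a Z) = cEval (iC a f) Z := rfl

lemma iC_tmul (c : ℂ) (v : V) (f : Λ (k + 1)) : iC (c ⊗ₜ v) f = c • f.curryLeft v := by simp [iC]

lemma iC_add_left (Z W : ℂV) (f : Λ (k + 1)) : iC (Z + W) f = iC Z f + iC W f := by simp [iC]

lemma iC_smul_left (c : ℂ) (Z : ℂV) (f : Λ (k + 1)) : iC (c • Z) f = c • iC Z f := by simp [iC]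

lemma iC_zero_left (f : Λ (k + 1)) : iC (0 : ℂV) f = 0 := by simp [iC]

lemma iC_add (Z : ℂV) (f g : Λ (k + 1)) : iC Z (f + g) = iC Z f + iC Z g := by
  induction Z using TensorProduct.induction_on with
  | zero => simp [iC_zero_left]
  | tmul c v => simp [iC_tmul]
  | add x y hx hy => rw [iC_add_left, hx, hy, iC_add_left, iC_add_left]; abel

lemma iC_smul (c : ℂ) (Z : ℂV) (f : Λ (k + 1)) : iC Z (c • f) = c • iC Z f := by
  induction Z using TensorProduct.induction_on with
  | zero => simp [iC_zero_left]
  | tmul d v =>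
    rw [iC_tmul, iC_tmul, smul_comm]
    rfl
  | add x y hx hy => rw [iC_add_left, hx, hy, iC_add_left, smul_add]

/-- `iC` as a linear map of the form. -/
def iCLin (Z : ℂV) : (Λ (k + 1)) →ₗ[ℂ] (Λ k) where
  toFun := iC Z
  map_add' := iC_add Z
  map_smul' c f := iC_smul c Z f

lemma iC_zero (Z : ℂV) : iC Z (0 : Λ (k + 1)) = 0 := map_zero (iCLin Z)

lemma iC_neg (Z : ℂV) (f : Λ (k + 1)) : iC Z (-f) = -iC Z f := map_neg (iCLin Z) f

lemma iC_sum {ι : Type*} (s : Finset ι) (Z : ℂV) (f : ι → Λ (k + 1)) :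
    iC Z (∑ i ∈ s, f i) = ∑ i ∈ s, iC Z (f i) :=
  map_sum (iCLin Z) f s

lemma iC_swap (Z W : ℂV) (f : Λ (k + 2)) : iC Z (iC W f) = -iC W (iC Z f) := by
  induction Z using TensorProduct.induction_on with
  | zero => simp [iC_zero_left, iC_zero]
  | add x y hx hy => rw [iC_add_left, hx, hy, iC_add_left, iC_add]; abel
  | tmul c v =>
    induction W using TensorProduct.induction_on with
    | zero => simp [iC_zero_left, iC_zero]
    | add x y hx hy => rw [iC_add_left, iC_add, hx, hy, iC_add_left]; abel
    | tmul d w =>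
      simp only [iC_tmul, iC_smul]
      ext u
      have h := f.map_swap (Matrix.vecCons v (Matrix.vecCons w u)) (i := 0) (j := 1) (by simp)
      have h2 : (Matrix.vecCons v (Matrix.vecCons w u)) ∘ (Equiv.swap (0 : Fin (k + 2)) 1) =
          Matrix.vecCons w (Matrix.vecCons v u) := by
        funext i
        refine Fin.cases ?_ (fun i => Fin.cases ?_ (fun i => ?_) i) i
        · simp
        · simp
        · have : Equiv.swap (0 : Fin (k + 2)) 1 i.succ.succ = i.succ.succ :=
            Equiv.swap_apply_of_ne_of_ne (Fin.succ_ne_zero _)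
              (by rw [← Fin.succ_zero_eq_one, Ne, Fin.succ_inj]; exact Fin.succ_ne_zero _)
          simp [this]
      rw [h2] at h
      simp only [AlternatingMap.smul_apply, AlternatingMap.curryLeft_apply_apply,
        AlternatingMap.neg_apply, smul_eq_mul, h]
      ring

lemma cEval_add (f g : Λ k) (Z : Fin k → ℂV) : cEval (f + g) Z = cEval f Z + cEval g Z := by
  induction k with
  | zero => simp [cEval]
  | succ k ih => simp only [cEval_succ, iC_add, ih]

lemma cEval_smul (c : ℂ) (f : Λ k) (Z : Fin k → ℂV) : cEval (c • f) Z = c * cEval f Z := by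
  induction k with
  | zero => simp [cEval]
  | succ k ih => simp only [cEval_succ, iC_smul, ih]

/-- `cEval` as a linear map of the form. -/
def cEvalLin (Z : Fin k → ℂV) : (Λ k) →ₗ[ℂ] ℂ where
  toFun f := cEval f Z
  map_add' f g := cEval_add f g Z
  map_smul' c f := cEval_smul c f Z

lemma cEval_zero (Z : Fin k → ℂV) : cEval (0 : Λ k) Z = 0 := map_zero (cEvalLin Z)

lemma cEval_neg (f : Λ k) (Z : Fin k → ℂV) : cEval (-f) Z = -cEval f Z := map_neg (cEvalLin Z) f

lemma cEval_sub (f g : Λ k) (Z : Fin k → ℂV) :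
    cEval (f - g) Z = cEval f Z - cEval g Z := map_sub (cEvalLin Z) f g

lemma cEval_tmul (f : Λ k) (v : Fin k → V) : cEval f (fun i => (1 : ℂ) ⊗ₜ[ℝ] v i) = f v := by
  induction k with
  | zero => simp only [cEval]; congr 1; exact Subsingleton.elim _ _
  | succ k ih =>
    rw [cEval_succ, iC_tmul, one_smul]
    have := ih (f.curryLeft (v 0)) (fun i => v i.succ)
    refine this.trans ?_
    rw [AlternatingMap.curryLeft_apply_apply]
    congr 1
    exact Fin.cons_self_tail v

lemma cEval_update_add (f : Λ k) (Z : Fin k → ℂV) (i : Fin k) (x y : ℂV) :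
    cEval f (Function.update Z i (x + y)) =
      cEval f (Function.update Z i x) + cEval f (Function.update Z i y) := by
  induction k with
  | zero => exact i.elim0
  | succ k ih =>
    simp only [cEval_succ]
    refine Fin.cases ?_ (fun i => ?_) i
    · simp [iC_add_left, cEval_add, Fin.tail_update_zero]
    · rw [Fin.tail_update_succ, Fin.tail_update_succ, Fin.tail_update_succ,
        Function.update_of_ne (Fin.succ_ne_zero i).symm,
        Function.update_of_ne (Fin.succ_ne_zero i).symm,
        Function.update_of_ne (Fin.succ_ne_zero i).symm, ih]

lemma cEval_update_smul (f : Λ k) (Z : Fin k → ℂV) (i : Fin k) (c : ℂ) (x : ℂV) :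
    cEval f (Function.update Z i (c • x)) = c * cEval f (Function.update Z i x) := by
  induction k with
  | zero => exact i.elim0
  | succ k ih =>
    simp only [cEval_succ]
    refine Fin.cases ?_ (fun i => ?_) i
    · simp [iC_smul_left, cEval_smul, Fin.tail_update_zero]
    · rw [Fin.tail_update_succ, Fin.tail_update_succ,
        Function.update_of_ne (Fin.succ_ne_zero i).symm,
        Function.update_of_ne (Fin.succ_ne_zero i).symm, ih]

/-- The complex-multilinear extension. -/
def cMult (f : Λ k) : MultilinearMap ℂ (fun _ : Fin k => ℂV) ℂ where
  toFun := cEval f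
  map_update_add' Z i x y := by
    convert cEval_update_add f Z i x y
  map_update_smul' Z i c x := by
    rw [smul_eq_mul]
    convert cEval_update_smul f Z i c x

lemma cMult_apply (f : Λ k) (Z : Fin k → ℂV) : cMult f Z = cEval f Z := rfl

/-! ### Contraction of wedge products -/

lemma curryLeft_one_altWedge (a : Λ 1) (f : Λ (k + 1)) (v : V) (w : Fin (k + 1) → V) :
    altWedge a f (Fin.cons v w ∘ Fin.cast (Nat.add_comm 1 (k + 1))) =
      a ![v] * f w - altWedge a (f.curryLeft v) (w ∘ Fin.cast (Nat.add_comm 1 k)) := by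
  rw [one_altWedge_apply, one_altWedge_apply, Fin.sum_univ_succ, sub_eq_add_neg,
    ← Finset.sum_neg_distrib]
  congr 1
  · simp
  · refine Finset.sum_congr rfl fun p _ => ?_
    rw [AlternatingMap.curryLeft_apply_apply]
    have : (fun i => (Fin.cons v w : Fin (k + 2) → V) (p.succ.succAbove i)) =
        Matrix.vecCons v (fun i => w (p.succAbove i)) := by
      funext i
      refine Fin.cases ?_ (fun i => ?_) i <;> simp
    rw [this]
    simp [pow_succ]

lemma iC_wedge_one_one (Z : ℂV) (a b : Λ 1) :
    iC Z (altWedge a b : Λ 2) = cEval a ![Z] • b - cEval b ![Z] • a := by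
  induction Z using TensorProduct.induction_on with
  | zero => simp [iC_zero_left, cEval_cons, cEval_zero]
  | add x y hx hy => simp only [iC_add_left, hx, hy, cEval_cons, cEval_add]; module
  | tmul c v =>
    rw [iC_tmul, cEval_cons, cEval_cons, iC_tmul, iC_tmul, cEval_smul, cEval_smul]
    ext w
    have h := one_altWedge_apply a b (Fin.cons v w : Fin 2 → V)
    have h0 : ∀ (g : Λ 0), cEval g ![] = g ![] := fun g => rfl
    have hw : w = ![w 0] := by funext i; rw [Fin.eq_zero i]; rfl
    have hv : (fun i : Fin 1 => (Fin.cons v w : Fin 2 → V) (Fin.succAbove 1 i)) = ![v] := by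
      funext i; rw [Fin.eq_zero i]; rfl
    have e : (altWedge a b : Λ 2) (Fin.cons v w : Fin 2 → V) =
      a ![v] * b w - a ![w 0] * b ![v] := by
      refine h.trans ?_
      rw [Fin.sum_univ_two, hv]
      simp
      rfl
    simp only [AlternatingMap.smul_apply, AlternatingMap.sub_apply, h0,
      AlternatingMap.curryLeft_apply_apply, smul_eq_mul]
    rw [show Matrix.vecCons v w = (Fin.cons v w : Fin 2 → V) from rfl, e, ← hw]
    ring

/-- The wedge product of a one-form and a `k`-form, as a form of degree `k + 1`. -/
def oneWedge (a : Λ 1) (f : Λ k) : Λ (k + 1) :=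
  (altWedge a f).domDomCongr (finCongr (Nat.add_comm 1 k))

lemma iC_oneWedge (Z : ℂV) (a : Λ 1) (f : Λ (k + 1)) :
    iC Z (oneWedge a f) = cEval a ![Z] • f - oneWedge a (iC Z f) := by
  have h1 : ∀ f g : Λ k, oneWedge a (f + g) = oneWedge a f + oneWedge a g := fun f g => by
    ext; simp [oneWedge, altWedge_add]
  have h2 : ∀ (c : ℂ) (f : Λ k), oneWedge a (c • f) = c • oneWedge a f := fun c f => by
    ext; simp [oneWedge, altWedge_smul]
  induction Z using TensorProduct.induction_on with
  | zero =>
    have := h2 0 0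
    simp only [zero_smul] at this
    simp only [iC_zero_left, cEval_cons, cEval_zero, this, zero_smul, sub_zero]
  | add x y hx hy => simp only [iC_add_left, hx, hy, cEval_cons, cEval_add, h1]; module
  | tmul c v =>
    rw [iC_tmul, cEval_cons, iC_tmul, iC_tmul, cEval_smul, h2]
    ext w
    have h : (oneWedge a f).curryLeft v w = a ![v] * f w - oneWedge a (f.curryLeft v) w :=
      curryLeft_one_altWedge a f v w
    have h0 : ∀ (g : Λ 0), cEval g ![] = g ![] := fun g => rfl
    simp only [AlternatingMap.smul_apply, AlternatingMap.sub_apply, h0, smul_eq_mul, h]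
    rw [AlternatingMap.curryLeft_apply_apply]
    ring

lemma iC_wedge_one_two (Z : ℂV) (a : Λ 1) (f : Λ 2) :
    iC Z (altWedge a f : Λ 3) = cEval a ![Z] • f - (altWedge a (iC Z f) : Λ 2) :=
  iC_oneWedge Z a f

lemma iC_wedge_one_three (Z : ℂV) (a : Λ 1) (f : Λ 3) :
    iC Z (altWedge a f : Λ 4) = cEval a ![Z] • f - (altWedge a (iC Z f) : Λ 3) :=
  iC_oneWedge Z a f

lemma iC_wedge_one_four (Z : ℂV) (a : Λ 1) (f : Λ 4) :
    iC Z (altWedge a f : Λ 5) = cEval a ![Z] • f - (altWedge a (iC Z f) : Λ 4) :=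
  iC_oneWedge Z a f

lemma wedge_assoc_one_one_one (a b c : Λ 1) :
    (altWedge (altWedge a b) c : Λ 3) = altWedge a (altWedge b c) := by
  ext v; exact altWedge_assoc a b c v

lemma wedge_assoc_one_one_two (a b : Λ 1) (c : Λ 2) :
    (altWedge (altWedge a b) c : Λ 4) = altWedge a (altWedge b c) := by
  ext v; exact altWedge_assoc a b c v

lemma wedge_assoc_one_one_three (a b : Λ 1) (c : Λ 3) :
    (altWedge (altWedge a b) c : Λ 5) = altWedge a (altWedge b c) := by
  ext v; exact altWedge_assoc a b c v

lemma wedge_assoc_one_two_two (a : Λ 1) (b c : Λ 2) :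
    (altWedge (altWedge a b) c : Λ 5) = altWedge a (altWedge b c) := by
  ext v; exact altWedge_assoc a b c v

lemma sum_alternating_apply {ι : Type*} (s : Finset ι) (f : ι → Λ k)
    (v : Fin k → V) : (∑ i ∈ s, f i) v = ∑ i ∈ s, f i v := by
  classical
  induction s using Finset.induction_on with
  | empty => simp
  | insert a s ha ih => rw [Finset.sum_insert ha, Finset.sum_insert ha, AlternatingMap.add_apply, ih]

/-- A two-form is a sum of products of one-forms. -/
lemma exists_sum_wedge [Module.Finite ℝ V] (f : Λ 2) :
    ∃ (n : ℕ) (a b : Fin n → Λ 1), f = ∑ i, altWedge (a i) (b i) := by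
  let B := Module.finBasis ℝ V
  let d : Fin (Module.finrank ℝ V) → Λ 1 := fun i =>
    AlternatingMap.ofSubsingleton ℝ V ℂ (0 : Fin 1) (ofRealCLM.toLinearMap ∘ₗ B.coord i)
  refine ⟨_, d, fun i => (1 / 2 : ℂ) • f.curryLeft (B i), ?_⟩
  ext v
  have key : ∀ u w : V, ∑ i, (B.coord i u : ℂ) * f ![B i, w] = f ![u, w] := by
    intro u w
    conv_rhs => rw [← B.sum_repr u]
    have h1 : ∀ x, f ![x, w] = (f.curryLeft x) ![w] := fun x => rfl
    simp only [h1]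
    rw [map_sum, sum_alternating_apply]
    refine Finset.sum_congr rfl fun i _ => ?_
    rw [map_smul, AlternatingMap.smul_apply, real_smul]
    rfl
  have h : ∀ i, (altWedge (d i) ((1 / 2 : ℂ) • f.curryLeft (B i)) : Λ 2) v =
      (1 / 2 : ℂ) * ((B.coord i (v 0) : ℂ) * f ![B i, v 1] - (B.coord i (v 1) : ℂ) *
        f ![B i, v 0]) := by
    intro i
    refine (one_altWedge_apply (d i) ((1 / 2 : ℂ) • f.curryLeft (B i)) v).trans ?_
    have e1 : (fun j : Fin 1 => v (Fin.succAbove 0 j)) = ![v 1] := by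
      funext j; rw [Fin.eq_zero j]; rfl
    have e2 : (fun j : Fin 1 => v (Fin.succAbove 1 j)) = ![v 0] := by
      funext j; rw [Fin.eq_zero j]; rfl
    rw [Fin.sum_univ_two, e1, e2]
    simp only [AlternatingMap.smul_apply, AlternatingMap.curryLeft_apply_apply, smul_eq_mul, d,
      AlternatingMap.ofSubsingleton_apply_apply]
    simp
    ring
  rw [sum_alternating_apply]
  simp_rw [h]
  rw [← Finset.mul_sum, Finset.sum_sub_distrib, key, key]
  have h3 : f ![v 1, v 0] = -f v := by
    have := f.map_swap v (i := 0) (j := 1) (by simp)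
    rw [← this]
    congr 1
    funext i
    fin_cases i <;> rfl
  rw [h3, show ![v 0, v 1] = v by funext i; fin_cases i <;> rfl]
  ring

lemma iC_wedge_two_one [Module.Finite ℝ V] (Z : ℂV) (f : Λ 2) (a : Λ 1) :
    iC Z (altWedge f a : Λ 3) = (altWedge (iC Z f) a : Λ 2) + cEval a ![Z] • f := by
  obtain ⟨n, p, q, rfl⟩ := exists_sum_wedge f
  rw [sum_altWedge, iC_sum, iC_sum, sum_altWedge, Finset.smul_sum, ← Finset.sum_add_distrib]
  refine Finset.sum_congr rfl fun i _ => ?_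
  rw [wedge_assoc_one_one_one, iC_wedge_one_two, iC_wedge_one_one, iC_wedge_one_one]
  simp only [sub_eq_add_neg, add_altWedge, altWedge_add, smul_altWedge, altWedge_smul, ← neg_smul]
  module

lemma iC_wedge_two_two [Module.Finite ℝ V] (Z : ℂV) (f g : Λ 2) : iC Z (altWedge f g : Λ 4) =
      (altWedge (iC Z f) g : Λ 3) + altWedge f (iC Z g) := by
  obtain ⟨n, p, q, rfl⟩ := exists_sum_wedge f
  rw [sum_altWedge, iC_sum, iC_sum, sum_altWedge, sum_altWedge, ← Finset.sum_add_distrib]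
  refine Finset.sum_congr rfl fun i _ => ?_
  rw [wedge_assoc_one_one_two, iC_wedge_one_three, iC_wedge_one_two, iC_wedge_one_one,
    wedge_assoc_one_one_one]
  simp only [sub_eq_add_neg, add_altWedge, altWedge_add, smul_altWedge, altWedge_smul, ← neg_smul,
    ← neg_one_smul ℂ (altWedge (q i) (iC Z g))]
  module

lemma iC_wedge_two_three [Module.Finite ℝ V] (Z : ℂV) (f : Λ 2) (g : Λ 3) :
    iC Z (altWedge f g : Λ 5) = (altWedge (iC Z f) g : Λ 4) + altWedge f (iC Z g) := by
  obtain ⟨n, p, q, rfl⟩ := exists_sum_wedge f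
  rw [sum_altWedge, iC_sum, iC_sum, sum_altWedge, sum_altWedge, ← Finset.sum_add_distrib]
  refine Finset.sum_congr rfl fun i _ => ?_
  rw [wedge_assoc_one_one_three, iC_wedge_one_four, iC_wedge_one_three, iC_wedge_one_one,
    wedge_assoc_one_one_two]
  simp only [sub_eq_add_neg, add_altWedge, altWedge_add, smul_altWedge, altWedge_smul, ← neg_smul,
    ← neg_one_smul ℂ (altWedge (q i) (iC Z g))]
  module

lemma cEval_swap_two (f : Λ 2) (x y : ℂV) : cEval f ![x, y] = -cEval f ![y, x] := by
  simp only [cEval_cons]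
  rw [iC_swap, cEval_neg]

lemma cEval_wedge_one_one (a b : Λ 1) (x y : ℂV) : cEval (altWedge a b : Λ 2) ![x, y] =
      cEval a ![x] * cEval b ![y] - cEval b ![x] * cEval a ![y] := by
  rw [cEval_cons, iC_wedge_one_one, cEval_sub, cEval_smul, cEval_smul]

lemma cEval_wedge_one_two (a : Λ 1) (f : Λ 2) (x y z : ℂV) : cEval (altWedge a f : Λ 3) ![x, y, z] =
      cEval a ![x] * cEval f ![y, z] - cEval a ![y] * cEval f ![x, z]
        + cEval a ![z] * cEval f ![x, y] := by
  rw [cEval_cons, iC_wedge_one_two, cEval_sub, cEval_smul, cEval_wedge_one_one]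
  simp only [← cEval_cons]
  ring

lemma cEval_wedge_two_one [Module.Finite ℝ V] (f : Λ 2) (a : Λ 1) (x y z : ℂV) :
    cEval (altWedge f a : Λ 3) ![x, y, z] =
      cEval a ![x] * cEval f ![y, z] - cEval a ![y] * cEval f ![x, z]
        + cEval a ![z] * cEval f ![x, y] := by
  rw [cEval_cons, iC_wedge_two_one, cEval_add, cEval_smul, cEval_wedge_one_one]
  simp only [← cEval_cons]
  ring

lemma cEval_wedge_one_three (a : Λ 1) (f : Λ 3) (x y z w : ℂV) :
    cEval (altWedge a f : Λ 4) ![x, y, z, w] =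
      cEval a ![x] * cEval f ![y, z, w] - cEval a ![y] * cEval f ![x, z, w]
        + cEval a ![z] * cEval f ![x, y, w] - cEval a ![w] * cEval f ![x, y, z] := by
  rw [cEval_cons, iC_wedge_one_three, cEval_sub, cEval_smul, cEval_wedge_one_two]
  simp only [← cEval_cons]
  ring

lemma cEval_wedge_two_two [Module.Finite ℝ V] (f g : Λ 2) (x y z w : ℂV) :
    cEval (altWedge f g : Λ 4) ![x, y, z, w] =
      cEval f ![x, y] * cEval g ![z, w] - cEval f ![x, z] * cEval g ![y, w]
        + cEval f ![x, w] * cEval g ![y, z] + cEval f ![y, z] * cEval g ![x, w]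
        - cEval f ![y, w] * cEval g ![x, z] + cEval f ![z, w] * cEval g ![x, y] := by
  rw [cEval_cons, iC_wedge_two_two, cEval_add, cEval_wedge_one_two, cEval_wedge_two_one]
  simp only [← cEval_cons]
  ring

lemma cEval_wedge_one_four (a : Λ 1) (f : Λ 4) (x y z w u : ℂV) :
    cEval (altWedge a f : Λ 5) ![x, y, z, w, u] =
      cEval a ![x] * cEval f ![y, z, w, u] - cEval a ![y] * cEval f ![x, z, w, u]
        + cEval a ![z] * cEval f ![x, y, w, u] - cEval a ![w] * cEval f ![x, y, z, u]
        + cEval a ![u] * cEval f ![x, y, z, w] := by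
  rw [cEval_cons, iC_wedge_one_four, cEval_sub, cEval_smul, cEval_wedge_one_three]
  simp only [← cEval_cons]
  ring

lemma cEval_wedge_two_three [Module.Finite ℝ V] (f : Λ 2) (g : Λ 3) (x y z w u : ℂV) :
    cEval (altWedge f g : Λ 5) ![x, y, z, w, u] =
      cEval f ![x, y] * cEval g ![z, w, u] - cEval f ![x, z] * cEval g ![y, w, u]
        + cEval f ![x, w] * cEval g ![y, z, u] - cEval f ![x, u] * cEval g ![y, z, w]
        + cEval f ![y, z] * cEval g ![x, w, u] - cEval f ![y, w] * cEval g ![x, z, u]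
        + cEval f ![y, u] * cEval g ![x, z, w] + cEval f ![z, w] * cEval g ![x, y, u]
        - cEval f ![z, u] * cEval g ![x, y, w] + cEval f ![w, u] * cEval g ![x, y, z] := by
  rw [cEval_cons, iC_wedge_two_three, cEval_add, cEval_wedge_one_three, cEval_wedge_two_two]
  simp only [← cEval_cons]
  ring

/-! ### Reality -/

lemma conjC_tmul (c : ℂ) (v : V) : conjC (c ⊗ₜ[ℝ] v) = (cj c) ⊗ₜ[ℝ] v := rfl

lemma conjC_smul (c : ℂ) (Z : ℂV) : conjC (c • Z) = (cj c) • conjC Z := by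
  induction Z using TensorProduct.induction_on with
  | zero => simp
  | tmul d v => simp [TensorProduct.smul_tmul', conjC_tmul]
  | add x y hx hy => rw [smul_add, map_add, hx, hy, map_add, smul_add]

lemma conjC_conjC (Z : ℂV) : conjC (conjC Z) = Z := by
  induction Z using TensorProduct.induction_on with
  | zero => simp
  | tmul d v => simp [conjC_tmul]
  | add x y hx hy => rw [map_add, map_add, hx, hy]

lemma conjC_cVec (u v : V) : conjC (cVec u v) = cVec u (-v) := by
  simp [cVec, conjC_tmul, TensorProduct.tmul_neg, TensorProduct.neg_tmul]

/-- Every complex vector is `u + i v`. -/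
lemma exists_cVec (Z : ℂV) : ∃ u v : V, Z = cVec u v := by
  induction Z using TensorProduct.induction_on with
  | zero => exact ⟨0, 0, by simp [cVec]⟩
  | tmul c v =>
    refine ⟨c.re • v, c.im • v, ?_⟩
    rw [cVec, TensorProduct.tmul_smul, TensorProduct.tmul_smul, TensorProduct.smul_tmul',
      TensorProduct.smul_tmul', ← TensorProduct.add_tmul]
    congr 1
    apply Complex.ext <;> simp
  | add x y hx hy =>
    obtain ⟨u, v, rfl⟩ := hx
    obtain ⟨u', v', rfl⟩ := hy
    refine ⟨u + u', v + v', ?_⟩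
    simp only [cVec, TensorProduct.tmul_add]
    abel

/-- A complex vector fixed by conjugation is real. -/
lemma exists_real_of_conjC_eq {Z : ℂV} (h : conjC Z = Z) : ∃ v : V, Z = 1 ⊗ₜ[ℝ] v := by
  obtain ⟨u, v, rfl⟩ := exists_cVec Z
  refine ⟨u, ?_⟩
  have h2 : cVec u v = (1 / 2 : ℂ) • (cVec u v + conjC (cVec u v)) := by
    rw [h, ← two_smul ℂ, smul_smul]; norm_num
  rw [h2, conjC_cVec]
  simp only [cVec, TensorProduct.tmul_neg]
  rw [show ((1 : ℂ) ⊗ₜ[ℝ] u + I ⊗ₜ[ℝ] v + (1 ⊗ₜ[ℝ] u + -(I ⊗ₜ[ℝ] v))) =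
    (2 : ℂ) • ((1 : ℂ) ⊗ₜ[ℝ] u) by rw [two_smul]; abel, smul_smul]
  norm_num

/-- Complex conjugation of alternating maps. -/
def conjA (f : Λ k) : Λ k := Complex.conjAe.toLinearMap.compAlternatingMap f

lemma conjA_add (f g : Λ k) : conjA (f + g) = conjA f + conjA g := by ext v; simp [conjA]

lemma conjA_smul (c : ℂ) (f : Λ k) : conjA (c • f) = cj c • conjA f := by ext v; simp [conjA]

lemma iC_conjA (Z : ℂV) (f : Λ (k + 1)) : iC Z (conjA f) = conjA (iC (conjC Z) f) := by
  induction Z using TensorProduct.induction_on with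
  | zero => rw [map_zero, iC_zero_left, iC_zero_left]; ext v; simp [conjA]
  | tmul c v => rw [conjC_tmul, iC_tmul, iC_tmul, conjA_smul, conj_conj]; rfl
  | add x y hx hy => rw [map_add, iC_add_left, iC_add_left, hx, hy, conjA_add]

lemma cEval_conjA (f : Λ k) (Z : Fin k → ℂV) :
    cEval (conjA f) Z = cj (cEval f (fun i => conjC (Z i))) := by
  induction k with
  | zero => rfl
  | succ k ih =>
    rw [cEval_succ, iC_conjA, ih, cEval_succ]
    rfl

section Flat

lemma apply_eq_cEval_one (f : Λ 1) (x : V) : f ![x] = cEval f ![1 ⊗ₜ[ℝ] x] := by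
  rw [← cEval_tmul]; congr 1; funext i; fin_cases i; rfl

lemma apply_eq_cEval_two (f : Λ 2) (x y : V) : f ![x, y] = cEval f ![1 ⊗ₜ[ℝ] x, 1 ⊗ₜ[ℝ] y] := by
  rw [← cEval_tmul]; congr 1; funext i; fin_cases i <;> rfl

lemma apply_eq_cEval_three (f : Λ 3) (x y z : V) :
    f ![x, y, z] = cEval f ![1 ⊗ₜ[ℝ] x, 1 ⊗ₜ[ℝ] y, 1 ⊗ₜ[ℝ] z] := by
  rw [← cEval_tmul]; congr 1; funext i; fin_cases i <;> rfl

lemma apply_eq_cEval_four (f : Λ 4) (x y z w : V) :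
    f ![x, y, z, w] = cEval f ![1 ⊗ₜ[ℝ] x, 1 ⊗ₜ[ℝ] y, 1 ⊗ₜ[ℝ] z, 1 ⊗ₜ[ℝ] w] := by
  rw [← cEval_tmul]; congr 1; funext i; fin_cases i <;> rfl

lemma apply_eq_cEval_five (f : Λ 5) (x y z w u : V) : f ![x, y, z, w, u] =
      cEval f ![1 ⊗ₜ[ℝ] x, 1 ⊗ₜ[ℝ] y, 1 ⊗ₜ[ℝ] z, 1 ⊗ₜ[ℝ] w, 1 ⊗ₜ[ℝ] u] := by
  rw [← cEval_tmul]; congr 1; funext i; fin_cases i <;> rfl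

variable [TopologicalSpace V]

lemma toAlternatingMap_injective' {f g : V [⋀^Fin k]→L[ℝ] ℂ}
    (h : f.toAlternatingMap = g.toAlternatingMap) : f = g :=
  ContinuousAlternatingMap.toAlternatingMap_injective h

lemma wedgeAt_add (f : V [⋀^Fin k]→L[ℝ] ℂ) (g g' : V [⋀^Fin l]→L[ℝ] ℂ) :
    wedgeAt f (g + g') = wedgeAt f g + wedgeAt f g' := by
  apply toAlternatingMap_injective'
  simp only [toAlternatingMap_wedgeAt, ContinuousAlternatingMap.toAlternatingMap_add, altWedge_add]

lemma add_wedgeAt (f f' : V [⋀^Fin k]→L[ℝ] ℂ) (g : V [⋀^Fin l]→L[ℝ] ℂ) :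
    wedgeAt (f + f') g = wedgeAt f g + wedgeAt f' g := by
  apply toAlternatingMap_injective'
  simp only [toAlternatingMap_wedgeAt, ContinuousAlternatingMap.toAlternatingMap_add, add_altWedge]

lemma wedgeAt_smul (c : ℂ) (f : V [⋀^Fin k]→L[ℝ] ℂ) (g : V [⋀^Fin l]→L[ℝ] ℂ) :
    wedgeAt f (c • g) = c • wedgeAt f g := by
  apply toAlternatingMap_injective'
  simp only [toAlternatingMap_wedgeAt, ContinuousAlternatingMap.toAlternatingMap_smul,
    altWedge_smul]

lemma smul_wedgeAt (c : ℂ) (f : V [⋀^Fin k]→L[ℝ] ℂ) (g : V [⋀^Fin l]→L[ℝ] ℂ) :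
    wedgeAt (c • f) g = c • wedgeAt f g := by
  apply toAlternatingMap_injective'
  simp only [toAlternatingMap_wedgeAt, ContinuousAlternatingMap.toAlternatingMap_smul,
    smul_altWedge]

lemma wedgeAt_one_one_apply (a b : V [⋀^Fin 1]→L[ℝ] ℂ) (x y : V) :
    (wedgeAt a b : V [⋀^Fin 2]→L[ℝ] ℂ) ![x, y] = a ![x] * b ![y] - b ![x] * a ![y] := by
  have h := cEval_wedge_one_one a.toAlternatingMap b.toAlternatingMap (1 ⊗ₜ x) (1 ⊗ₜ y)
  simp only [← apply_eq_cEval_one, ← apply_eq_cEval_two, ← toAlternatingMap_wedgeAt] at h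
  exact h

lemma wedgeAt_one_two_apply (a : V [⋀^Fin 1]→L[ℝ] ℂ) (f : V [⋀^Fin 2]→L[ℝ] ℂ) (x y z : V) :
    (wedgeAt a f : V [⋀^Fin 3]→L[ℝ] ℂ) ![x, y, z] =
      a ![x] * f ![y, z] - a ![y] * f ![x, z] + a ![z] * f ![x, y] := by
  have h := cEval_wedge_one_two a.toAlternatingMap f.toAlternatingMap (1 ⊗ₜ x) (1 ⊗ₜ y) (1 ⊗ₜ z)
  simp only [← apply_eq_cEval_one, ← apply_eq_cEval_two, ← apply_eq_cEval_three,
    ← toAlternatingMap_wedgeAt] at h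
  exact h

lemma wedgeAt_two_one_apply [Module.Finite ℝ V] (f : V [⋀^Fin 2]→L[ℝ] ℂ)
    (a : V [⋀^Fin 1]→L[ℝ] ℂ) (x y z : V) : (wedgeAt f a : V [⋀^Fin 3]→L[ℝ] ℂ) ![x, y, z] =
      a ![x] * f ![y, z] - a ![y] * f ![x, z] + a ![z] * f ![x, y] := by
  have h := cEval_wedge_two_one f.toAlternatingMap a.toAlternatingMap (1 ⊗ₜ x) (1 ⊗ₜ y) (1 ⊗ₜ z)
  simp only [← apply_eq_cEval_one, ← apply_eq_cEval_two, ← apply_eq_cEval_three,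
    ← toAlternatingMap_wedgeAt] at h
  exact h

lemma wedgeAt_one_three_apply (a : V [⋀^Fin 1]→L[ℝ] ℂ) (f : V [⋀^Fin 3]→L[ℝ] ℂ) (x y z w : V) :
    (wedgeAt a f : V [⋀^Fin 4]→L[ℝ] ℂ) ![x, y, z, w] =
      a ![x] * f ![y, z, w] - a ![y] * f ![x, z, w] + a ![z] * f ![x, y, w]
        - a ![w] * f ![x, y, z] := by
  have h := cEval_wedge_one_three a.toAlternatingMap f.toAlternatingMap
    (1 ⊗ₜ x) (1 ⊗ₜ y) (1 ⊗ₜ z) (1 ⊗ₜ w)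
  simp only [← apply_eq_cEval_one, ← apply_eq_cEval_four, ← apply_eq_cEval_three,
    ← toAlternatingMap_wedgeAt] at h
  exact h

lemma wedgeAt_two_two_apply [Module.Finite ℝ V] (f g : V [⋀^Fin 2]→L[ℝ] ℂ) (x y z w : V) :
    (wedgeAt f g : V [⋀^Fin 4]→L[ℝ] ℂ) ![x, y, z, w] =
      f ![x, y] * g ![z, w] - f ![x, z] * g ![y, w] + f ![x, w] * g ![y, z]
        + f ![y, z] * g ![x, w] - f ![y, w] * g ![x, z] + f ![z, w] * g ![x, y] := by
  have h := cEval_wedge_two_two f.toAlternatingMap g.toAlternatingMap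
    (1 ⊗ₜ x) (1 ⊗ₜ y) (1 ⊗ₜ z) (1 ⊗ₜ w)
  simp only [← apply_eq_cEval_two, ← apply_eq_cEval_four, ← toAlternatingMap_wedgeAt] at h
  exact h

set_option maxRecDepth 4000 in
lemma wedgeAt_one_four_apply (a : V [⋀^Fin 1]→L[ℝ] ℂ) (f : V [⋀^Fin 4]→L[ℝ] ℂ) (x y z w u : V) :
    (wedgeAt a f : V [⋀^Fin 5]→L[ℝ] ℂ) ![x, y, z, w, u] =
      a ![x] * f ![y, z, w, u] - a ![y] * f ![x, z, w, u] + a ![z] * f ![x, y, w, u]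
        - a ![w] * f ![x, y, z, u] + a ![u] * f ![x, y, z, w] := by
  have h := cEval_wedge_one_four a.toAlternatingMap f.toAlternatingMap
    (1 ⊗ₜ x) (1 ⊗ₜ y) (1 ⊗ₜ z) (1 ⊗ₜ w) (1 ⊗ₜ u)
  simp only [← apply_eq_cEval_one, ← apply_eq_cEval_four, ← apply_eq_cEval_five,
    ← toAlternatingMap_wedgeAt] at h
  exact h

set_option maxRecDepth 4000 in
lemma wedgeAt_two_three_apply [Module.Finite ℝ V] (f : V [⋀^Fin 2]→L[ℝ] ℂ)
    (g : V [⋀^Fin 3]→L[ℝ] ℂ) (x y z w u : V) : (wedgeAt f g : V [⋀^Fin 5]→L[ℝ] ℂ) ![x, y, z, w, u] =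
      f ![x, y] * g ![z, w, u] - f ![x, z] * g ![y, w, u] + f ![x, w] * g ![y, z, u]
        - f ![x, u] * g ![y, z, w] + f ![y, z] * g ![x, w, u] - f ![y, w] * g ![x, z, u]
        + f ![y, u] * g ![x, z, w] + f ![z, w] * g ![x, y, u] - f ![z, u] * g ![x, y, w]
        + f ![w, u] * g ![x, y, z] := by
  have h := cEval_wedge_two_three f.toAlternatingMap g.toAlternatingMap
    (1 ⊗ₜ x) (1 ⊗ₜ y) (1 ⊗ₜ z) (1 ⊗ₜ w) (1 ⊗ₜ u)
  simp only [← apply_eq_cEval_two, ← apply_eq_cEval_three, ← apply_eq_cEval_five,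
    ← toAlternatingMap_wedgeAt] at h
  exact h

lemma wedgeAt_compContinuousLinearMap {W : Type*} [AddCommGroup W] [Module ℝ W]
    [TopologicalSpace W] (f : V [⋀^Fin k]→L[ℝ] ℂ) (g : V [⋀^Fin l]→L[ℝ] ℂ) (T : W →L[ℝ] V) :
    (wedgeAt f g).compContinuousLinearMap T =
      wedgeAt (f.compContinuousLinearMap T) (g.compContinuousLinearMap T) := by
  ext v
  have h : ∀ {W : Type _} [AddCommGroup W] [Module ℝ W] [TopologicalSpace W]
    (f : W [⋀^Fin k]→L[ℝ] ℂ) (g : W [⋀^Fin l]→L[ℝ] ℂ) (v), wedgeAt f g v =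
    altWedge f.toAlternatingMap g.toAlternatingMap v := fun f g v => by
      rw [← toAlternatingMap_wedgeAt]; rfl
  rw [h, altWedge_apply, ContinuousAlternatingMap.compContinuousLinearMap_apply]
  rw [← ContinuousAlternatingMap.coe_toAlternatingMap, toAlternatingMap_wedgeAt, altWedge_apply]
  rfl

end Flat

/-- Complex-valued alternating forms on the model space. -/
abbrev A5 (k : ℕ) : Type := E5 [⋀^Fin k]→L[ℝ] ℂ

/-- The values of a form on the tuples of basis vectors. -/
def evalBasis (k : ℕ) : A5 k →ₗ[ℝ] ((Fin k → Fin 5) → ℂ) where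
  toFun f I := f (fun i => EuclideanSpace.single (I i) (1 : ℝ))
  map_add' _ _ := rfl
  map_smul' _ _ := rfl

lemma evalBasis_injective (k : ℕ) : Function.Injective (evalBasis k) := by
  intro f g h
  apply toAlternatingMap_injective'
  refine Module.Basis.ext_alternating (EuclideanSpace.basisFun (Fin 5) ℝ).toBasis fun I _ => ?_
  have := congrFun h I
  simpa [evalBasis] using this

instance (k : ℕ) : FiniteDimensional ℝ (A5 k) :=
  FiniteDimensional.of_injective _ (evalBasis_injective k)

lemma contDiffOn_iff_apply {n : WithTop ℕ∞} {F : E5 → A5 k} {s : Set E5} :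
    ContDiffOn ℝ n F s ↔ ∀ v : Fin k → E5, ContDiffOn ℝ n (fun y => F y v) s := by
  constructor
  · intro h v
    exact (ContinuousAlternatingMap.apply ℝ E5 ℂ v).contDiff.comp_contDiffOn h
  · intro h
    obtain ⟨L, hL⟩ := LinearMap.exists_leftInverse_of_injective (evalBasis k)
      (LinearMap.ker_eq_bot.2 (evalBasis_injective k))
    have h2 : F = fun y => (LinearMap.toContinuousLinearMap L) (evalBasis k (F y)) := by
      funext y
      exact (LinearMap.congr_fun hL (F y)).symm
    rw [h2]
    refine (LinearMap.toContinuousLinearMap L).contDiff.comp_contDiffOn ?_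
    exact contDiffOn_pi.2 fun I => h _

lemma ofReal_smul_form (c : ℝ) (f : A5 k) : (c : ℂ) • f = c • f := by ext v; simp

/-- The wedge product as a continuous bilinear map. -/
def wedgeBil (k l : ℕ) : A5 k →L[ℝ] A5 l →L[ℝ] A5 (k + l) :=
  LinearMap.toContinuousBilinearMap (LinearMap.mk₂ ℝ wedgeAt add_wedgeAt
    (fun c f g => by rw [← ofReal_smul_form, ← ofReal_smul_form, smul_wedgeAt]) wedgeAt_add
    (fun c f g => by rw [← ofReal_smul_form, ← ofReal_smul_form, wedgeAt_smul]))

lemma contDiffOn_wedgeAt {n : WithTop ℕ∞} {F : E5 → A5 k} {G : E5 → A5 l} {s : Set E5}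
    (hF : ContDiffOn ℝ n F s) (hG : ContDiffOn ℝ n G s) :
    ContDiffOn ℝ n (fun y => wedgeAt (F y) (G y)) s := by
  exact ((wedgeBil k l).contDiff.comp_contDiffOn hF).clm_apply hG

lemma fderiv_wedgeAt {F : E5 → A5 k} {G : E5 → A5 l} {x : E5}
    (hF : DifferentiableAt ℝ F x) (hG : DifferentiableAt ℝ G x) (u : E5) :
    fderiv ℝ (fun y => wedgeAt (F y) (G y)) x u =
      wedgeAt (F x) (fderiv ℝ G x u) + wedgeAt (fderiv ℝ F x u) (G x) := by
  change fderiv ℝ (fun y => wedgeBil k l (F y) (G y)) x u = _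
  rw [((wedgeBil k l).hasFDerivAt_of_bilinear hF.hasFDerivAt hG.hasFDerivAt).fderiv]
  rfl

lemma fderiv_smul_form {f : E5 → ℂ} {G : E5 → A5 k} {x : E5}
    (hf : DifferentiableAt ℝ f x) (hG : DifferentiableAt ℝ G x) (u : E5) :
    fderiv ℝ (fun y => f y • G y) x u = f x • fderiv ℝ G x u + fderiv ℝ f x u • G x := by
  have h := (hf.hasFDerivAt.smul hG.hasFDerivAt).fderiv
  have h2 : fderiv ℝ (fun y => f y • G y) x = _ := h
  rw [h2]
  rfl

lemma removeNth_two (v : Fin 2 → E5) : (0 : Fin 2).removeNth v = ![v 1] ∧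
    (1 : Fin 2).removeNth v = ![v 0] := by
  constructor <;> (funext i; fin_cases i; rfl)

lemma removeNth_three (v : Fin 3 → E5) : (0 : Fin 3).removeNth v = ![v 1, v 2] ∧
    (1 : Fin 3).removeNth v = ![v 0, v 2] ∧ (2 : Fin 3).removeNth v = ![v 0, v 1] := by
  refine ⟨?_, ?_, ?_⟩ <;> (funext i; fin_cases i <;> rfl)

lemma removeNth_four (v : Fin 4 → E5) : (0 : Fin 4).removeNth v = ![v 1, v 2, v 3] ∧
    (1 : Fin 4).removeNth v = ![v 0, v 2, v 3] ∧ (2 : Fin 4).removeNth v = ![v 0, v 1, v 3] ∧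
    (3 : Fin 4).removeNth v = ![v 0, v 1, v 2] := by
  refine ⟨?_, ?_, ?_, ?_⟩ <;> (funext i; fin_cases i <;> rfl)

lemma removeNth_five (v : Fin 5 → E5) : (0 : Fin 5).removeNth v = ![v 1, v 2, v 3, v 4] ∧
    (1 : Fin 5).removeNth v = ![v 0, v 2, v 3, v 4] ∧
    (2 : Fin 5).removeNth v = ![v 0, v 1, v 3, v 4] ∧
    (3 : Fin 5).removeNth v = ![v 0, v 1, v 2, v 4] ∧
    (4 : Fin 5).removeNth v = ![v 0, v 1, v 2, v 3] := by
  refine ⟨?_, ?_, ?_, ?_, ?_⟩ <;> (funext i; fin_cases i <;> rfl)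

lemma extDeriv_one_apply (F : E5 → A5 1) (x : E5) (v : Fin 2 → E5) :
    extDeriv F x v = fderiv ℝ F x (v 0) ![v 1] - fderiv ℝ F x (v 1) ![v 0] := by
  rw [extDeriv, ContinuousAlternatingMap.alternatizeUncurryFin_apply, Fin.sum_univ_two,
    (removeNth_two v).1, (removeNth_two v).2]
  simp [sub_eq_add_neg]

lemma extDeriv_two_apply (F : E5 → A5 2) (x : E5) (v : Fin 3 → E5) :
    extDeriv F x v = fderiv ℝ F x (v 0) ![v 1, v 2] - fderiv ℝ F x (v 1) ![v 0, v 2]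
      + fderiv ℝ F x (v 2) ![v 0, v 1] := by
  rw [extDeriv, ContinuousAlternatingMap.alternatizeUncurryFin_apply, Fin.sum_univ_three,
    (removeNth_three v).1, (removeNth_three v).2.1, (removeNth_three v).2.2]
  simp [sub_eq_add_neg]

lemma extDeriv_three_apply (F : E5 → A5 3) (x : E5) (v : Fin 4 → E5) :
    extDeriv F x v = fderiv ℝ F x (v 0) ![v 1, v 2, v 3] - fderiv ℝ F x (v 1) ![v 0, v 2, v 3]
      + fderiv ℝ F x (v 2) ![v 0, v 1, v 3] - fderiv ℝ F x (v 3) ![v 0, v 1, v 2] := by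
  obtain ⟨h0, h1, h2, h3⟩ := removeNth_four v
  rw [extDeriv, ContinuousAlternatingMap.alternatizeUncurryFin_apply, Fin.sum_univ_four,
    h0, h1, h2, h3]
  simp [sub_eq_add_neg, pow_succ]

lemma extDeriv_four_apply (F : E5 → A5 4) (x : E5) (v : Fin 5 → E5) :
    extDeriv F x v = fderiv ℝ F x (v 0) ![v 1, v 2, v 3, v 4]
      - fderiv ℝ F x (v 1) ![v 0, v 2, v 3, v 4]
      + fderiv ℝ F x (v 2) ![v 0, v 1, v 3, v 4] - fderiv ℝ F x (v 3) ![v 0, v 1, v 2, v 4]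
      + fderiv ℝ F x (v 4) ![v 0, v 1, v 2, v 3] := by
  obtain ⟨h0, h1, h2, h3, h4⟩ := removeNth_five v
  rw [extDeriv, ContinuousAlternatingMap.alternatizeUncurryFin_apply, Fin.sum_univ_five,
    h0, h1, h2, h3, h4]
  simp [sub_eq_add_neg, pow_succ]

lemma vec_two (v : Fin 2 → E5) : v = ![v 0, v 1] := by funext i; fin_cases i <;> rfl

lemma vec_three (v : Fin 3 → E5) : v = ![v 0, v 1, v 2] := by funext i; fin_cases i <;> rfl

lemma vec_four (v : Fin 4 → E5) : v = ![v 0, v 1, v 2, v 3] := by funext i; fin_cases i <;> rfl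

lemma vec_five (v : Fin 5 → E5) : v = ![v 0, v 1, v 2, v 3, v 4] := by funext i; fin_cases i <;> rfl

lemma extDeriv_wedge_one_one {F G : E5 → A5 1} {x : E5} (hF : DifferentiableAt ℝ F x)
    (hG : DifferentiableAt ℝ G x) : (extDeriv (fun y => (wedgeAt (F y) (G y) : A5 2)) x : A5 3) =
      (wedgeAt (extDeriv F x) (G x) : A5 3) - (wedgeAt (F x) (extDeriv G x) : A5 3) := by
  ext v
  rw [extDeriv_two_apply]
  have h := fderiv_wedgeAt hF hG
  have h' : ∀ u, fderiv ℝ (fun y => (wedgeAt (F y) (G y) : A5 2)) x u =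
    (wedgeAt (F x) (fderiv ℝ G x u) : A5 2) + (wedgeAt (fderiv ℝ F x u) (G x) : A5 2) := h
  rw [h', h', h', ContinuousAlternatingMap.sub_apply, vec_three v, wedgeAt_two_one_apply,
    wedgeAt_one_two_apply]
  simp only [ContinuousAlternatingMap.add_apply, wedgeAt_one_one_apply, extDeriv_one_apply,
    Matrix.cons_val]
  ring

lemma extDeriv_wedge_one_two {F : E5 → A5 1} {G : E5 → A5 2} {x : E5}
    (hF : DifferentiableAt ℝ F x) (hG : DifferentiableAt ℝ G x) :
    (extDeriv (fun y => (wedgeAt (F y) (G y) : A5 3)) x : A5 4) =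
      (wedgeAt (extDeriv F x) (G x) : A5 4) - (wedgeAt (F x) (extDeriv G x) : A5 4) := by
  ext v
  rw [extDeriv_three_apply]
  have h := fderiv_wedgeAt hF hG
  have h' : ∀ u, fderiv ℝ (fun y => (wedgeAt (F y) (G y) : A5 3)) x u =
    (wedgeAt (F x) (fderiv ℝ G x u) : A5 3) + (wedgeAt (fderiv ℝ F x u) (G x) : A5 3) := h
  rw [h', h', h', h', ContinuousAlternatingMap.sub_apply, vec_four v, wedgeAt_two_two_apply,
    wedgeAt_one_three_apply]
  simp only [ContinuousAlternatingMap.add_apply, wedgeAt_one_two_apply, extDeriv_one_apply,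
    extDeriv_two_apply, Matrix.cons_val]
  ring

lemma extDeriv_wedge_one_three {F : E5 → A5 1} {G : E5 → A5 3} {x : E5}
    (hF : DifferentiableAt ℝ F x) (hG : DifferentiableAt ℝ G x) :
    (extDeriv (fun y => (wedgeAt (F y) (G y) : A5 4)) x : A5 5) =
      (wedgeAt (extDeriv F x) (G x) : A5 5) - (wedgeAt (F x) (extDeriv G x) : A5 5) := by
  ext v
  rw [extDeriv_four_apply]
  have h := fderiv_wedgeAt hF hG
  have h' : ∀ u, fderiv ℝ (fun y => (wedgeAt (F y) (G y) : A5 4)) x u =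
    (wedgeAt (F x) (fderiv ℝ G x u) : A5 4) + (wedgeAt (fderiv ℝ F x u) (G x) : A5 4) := h
  rw [h', h', h', h', h', ContinuousAlternatingMap.sub_apply, vec_five v, wedgeAt_two_three_apply,
    wedgeAt_one_four_apply]
  simp only [ContinuousAlternatingMap.add_apply, wedgeAt_one_three_apply, extDeriv_one_apply,
    extDeriv_three_apply, Matrix.cons_val]
  ring

/-- The differential of a function as a one-form on the model space. -/
def flatD (f : E5 → ℂ) (x : E5) : A5 1 :=
  extDeriv (fun y => ContinuousAlternatingMap.constOfIsEmpty ℝ E5 (Fin 0) (f y)) x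

lemma flatD_apply (f : E5 → ℂ) (x u : E5) : flatD f x ![u] = fderiv ℝ f x u := by
  rw [flatD, extDeriv_constOfIsEmpty]
  rfl

lemma extDeriv_smul_one {f : E5 → ℂ} {G : E5 → A5 1} {x : E5} (hf : DifferentiableAt ℝ f x)
    (hG : DifferentiableAt ℝ G x) :
    extDeriv (fun y => f y • G y) x = (wedgeAt (flatD f x) (G x) : A5 2) + f x • extDeriv G x := by
  ext v
  rw [extDeriv_one_apply, fderiv_smul_form hf hG, fderiv_smul_form hf hG, vec_two v]
  simp only [ContinuousAlternatingMap.add_apply, ContinuousAlternatingMap.smul_apply,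
    wedgeAt_one_one_apply, extDeriv_one_apply, flatD_apply, Matrix.cons_val, smul_eq_mul]
  ring

lemma extDeriv_smul_two {f : E5 → ℂ} {G : E5 → A5 2} {x : E5} (hf : DifferentiableAt ℝ f x)
    (hG : DifferentiableAt ℝ G x) :
    extDeriv (fun y => f y • G y) x = (wedgeAt (flatD f x) (G x) : A5 3) + f x • extDeriv G x := by
  ext v
  rw [extDeriv_two_apply, fderiv_smul_form hf hG, fderiv_smul_form hf hG, fderiv_smul_form hf hG,
    vec_three v]
  simp only [ContinuousAlternatingMap.add_apply, ContinuousAlternatingMap.smul_apply,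
    wedgeAt_one_two_apply, extDeriv_two_apply, flatD_apply, Matrix.cons_val, smul_eq_mul]
  ring

lemma extDeriv_smul_three {f : E5 → ℂ} {G : E5 → A5 3} {x : E5} (hf : DifferentiableAt ℝ f x)
    (hG : DifferentiableAt ℝ G x) :
    extDeriv (fun y => f y • G y) x = (wedgeAt (flatD f x) (G x) : A5 4) + f x • extDeriv G x := by
  ext v
  rw [extDeriv_three_apply, fderiv_smul_form hf hG, fderiv_smul_form hf hG,
    fderiv_smul_form hf hG, fderiv_smul_form hf hG, vec_four v]
  simp only [ContinuousAlternatingMap.add_apply, ContinuousAlternatingMap.smul_apply,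
    wedgeAt_one_three_apply, extDeriv_three_apply, flatD_apply, Matrix.cons_val, smul_eq_mul]
  ring

lemma contDiffOn_extDeriv {F : E5 → A5 k} {s : Set E5} (hs : IsOpen s)
    (hF : ContDiffOn ℝ (⊤ : ℕ∞) F s) : ContDiffOn ℝ (⊤ : ℕ∞) (extDeriv F) s := by
  have h : ContDiffOn ℝ (⊤ : ℕ∞) (fderiv ℝ F) s := hF.fderiv_of_isOpen hs (by simp)
  exact (ContinuousAlternatingMap.alternatizeUncurryFinCLM ℝ E5 ℂ).contDiff.comp_contDiffOn h

variable {M : Type*} [TopologicalSpace M] [ChartedSpace E5 M] {U : Set M}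

local notation "𝓔" => 𝓘(ℝ, E5)
local notation "Φ" => extChartAt 𝓘(ℝ, E5)
local notation:max "ℂT" x:max => TensorProduct ℝ ℂ (TS x)
local notation "Ω" => CForm M

lemma minSmoothness_two_le_top : minSmoothness ℝ 2 ≤ (((⊤ : ℕ∞) : WithTop ℕ∞)) := by
  rw [minSmoothness_of_isRCLikeNormedField]; exact WithTop.coe_le_coe.2 le_top

instance finite_tangentSpace (x : M) : Module.Finite ℝ (TS x) :=
  inferInstanceAs (Module.Finite ℝ E5)

/-- The derivative of the inverse of a preferred chart. -/
def dS (x₀ : M) (y : E5) : E5 →L[ℝ] E5 := mfderiv 𝓔 𝓔 (Φ x₀).symm y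

/-- The derivative of a preferred chart. -/
def dC (x₀ p : M) : E5 →L[ℝ] E5 := mfderiv 𝓔 𝓔 (Φ x₀) p

/-- The domain, in a preferred chart, of the forms on `U`. -/
def chDom (x₀ : M) (U : Set M) : Set E5 := (Φ x₀).target ∩ (Φ x₀).symm ⁻¹' U

lemma isOpen_chDom (x₀ : M) (hU : IsOpen U) : IsOpen (chDom x₀ U) :=
  (continuousOn_extChartAt_symm x₀).isOpen_inter_preimage (isOpen_extChartAt_target x₀) hU

lemma mem_chDom {x₀ x : M} (hx : x ∈ (Φ x₀).source) (hxU : x ∈ U) : Φ x₀ x ∈ chDom x₀ U :=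
  ⟨(Φ x₀).map_source hx, by
    rw [Set.mem_preimage, (Φ x₀).left_inv hx]; exact hxU⟩

lemma mem_chDom_self {x : M} (hxU : x ∈ U) : Φ x x ∈ chDom x U :=
  mem_chDom (mem_extChartAt_source x) hxU

/-- A form as a function with values in the forms on the model space. -/
def asA (ω : Ω k) (x : M) : A5 k := ω x

lemma inChart_eq (ω : Ω k) (x₀ : M) (y : E5) : inChart ω x₀ y =
      (asA ω ((Φ x₀).symm y)).compContinuousLinearMap (dS x₀ y) := rfl

variable [IsManifold 𝓔 (⊤ : ℕ∞) M]

lemma isManifold_one : IsManifold 𝓔 1 M :=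
  IsManifold.of_le (n := (⊤ : ℕ∞)) (by exact_mod_cast le_top)

lemma dC_dS {x₀ : M} {y : E5} (hy : y ∈ (Φ x₀).target) (v : E5) :
    dC x₀ ((Φ x₀).symm y) (dS x₀ y v) = v := by
  have : IsManifold 𝓔 1 M := isManifold_one
  have h := mfderiv_extChartAt_comp_mfderivWithin_extChartAt_symm (I := 𝓔) hy
  rw [ModelWithCorners.range_eq_univ, mfderivWithin_univ] at h
  exact congrArg (fun T : E5 →L[ℝ] E5 => T v) h

lemma dS_dC {x₀ p : M} (hp : p ∈ (Φ x₀).source) (v : E5) : dS x₀ (Φ x₀ p) (dC x₀ p v) = v := by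
  have : IsManifold 𝓔 1 M := isManifold_one
  have h := mfderivWithin_extChartAt_symm_comp_mfderiv_extChartAt' (I := 𝓔) hp
  rw [ModelWithCorners.range_eq_univ, mfderivWithin_univ] at h
  exact congrArg (fun T : E5 →L[ℝ] E5 => T v) h

/-- The change of coordinates between preferred charts. -/
def chTrans (x₀ x₁ : M) (y : E5) : E5 := Φ x₁ ((Φ x₀).symm y)

lemma contDiffAt_chTrans {x₀ x₁ : M} {y : E5} (hy : y ∈ (Φ x₀).target)
    (hy' : (Φ x₀).symm y ∈ (Φ x₁).source) : ContDiffAt ℝ (⊤ : ℕ∞) (chTrans x₀ x₁) y := by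
  rw [← contMDiffAt_iff_contDiffAt]
  refine ContMDiffAt.comp y (contMDiffAt_extChartAt' (by simpa using hy')) ?_
  exact (contMDiffOn_extChartAt_symm x₀).contMDiffAt
    ((isOpen_extChartAt_target x₀).mem_nhds hy)

lemma fderiv_chTrans {x₀ x₁ : M} {y : E5} (hy : y ∈ (Φ x₀).target)
    (hy' : (Φ x₀).symm y ∈ (Φ x₁).source) (v : E5) :
    fderiv ℝ (chTrans x₀ x₁) y v = dC x₁ ((Φ x₀).symm y) (dS x₀ y v) := by
  have : IsManifold 𝓔 1 M := isManifold_one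
  have h := mfderiv_comp (I := 𝓔) (I' := 𝓔) (I'' := 𝓔) y
    (g := Φ x₁) (f := (Φ x₀).symm)
    (mdifferentiableAt_extChartAt (by simpa using hy'))
    ((mdifferentiableOn_extChartAt_symm (I := 𝓔) (x := x₀)).mdifferentiableAt
      ((isOpen_extChartAt_target x₀).mem_nhds hy))
  rw [mfderiv_eq_fderiv] at h
  exact congrArg (fun T : E5 →L[ℝ] E5 => T v) h

lemma inChart_trans (ω : Ω k) {x₀ x₁ : M} {y : E5} (hy : y ∈ (Φ x₀).target)
    (hy' : (Φ x₀).symm y ∈ (Φ x₁).source) :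
    inChart ω x₀ y = (inChart ω x₁ (chTrans x₀ x₁ y)).compContinuousLinearMap
      (fderiv ℝ (chTrans x₀ x₁) y) := by
  rw [inChart_eq, inChart_eq]
  ext v
  simp only [ContinuousAlternatingMap.compContinuousLinearMap_apply]
  have e1 : (Φ x₁).symm (chTrans x₀ x₁ y) = (Φ x₀).symm y := (Φ x₁).left_inv hy'
  rw [e1]
  congr 1
  funext i
  simp only [Function.comp]
  rw [fderiv_chTrans hy hy']
  exact (dS_dC hy' _).symm

lemma SmoothOn.contDiffAt {ω : Ω k} (hω : SmoothOn ω U) (hU : IsOpen U)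
    {x₀ : M} {y : E5} (hy : y ∈ chDom x₀ U) : ContDiffAt ℝ (⊤ : ℕ∞) (inChart ω x₀) y :=
  (hω x₀).contDiffAt ((isOpen_chDom x₀ hU).mem_nhds hy)

lemma SmoothOn.differentiableAt {ω : Ω k} (hω : SmoothOn ω U) (hU : IsOpen U)
    {x₀ : M} {y : E5} (hy : y ∈ chDom x₀ U) : DifferentiableAt ℝ (inChart ω x₀) y :=
  (hω.contDiffAt hU hy).differentiableAt (by simp)

lemma SmoothOn.diffAt {ω : Ω k} (hω : SmoothOn ω U) (hU : IsOpen U) {x : M}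
    (hx : x ∈ U) : DifferentiableAt ℝ (inChart ω x) (Φ x x) :=
  hω.differentiableAt hU (mem_chDom_self hx)

lemma asA_extD (ω : Ω k) (x : M) : asA (extD ω) x =
    (extDeriv (inChart ω x) (Φ x x)).compContinuousLinearMap (dC x x) := rfl

lemma extD_eq {ω : Ω k} (hω : SmoothOn ω U) (hU : IsOpen U) {x x₀ : M}
    (hxU : x ∈ U) (hx : x ∈ (Φ x₀).source) :
    asA (extD ω) x = (extDeriv (inChart ω x₀) (Φ x₀ x)).compContinuousLinearMap (dC x₀ x) := by
  rw [asA_extD]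
  set y := Φ x₀ x with hy
  have hyt : y ∈ (Φ x₀).target := (Φ x₀).map_source hx
  have hys : (Φ x₀).symm y = x := (Φ x₀).left_inv hx
  have hsrc : (Φ x₀).symm y ∈ (Φ x).source := by rw [hys]; exact mem_extChartAt_source x
  have hev : inChart ω x₀ =ᶠ[nhds y] fun y => (inChart ω x (chTrans x₀ x y)).compContinuousLinearMap
      (fderiv ℝ (chTrans x₀ x) y) := by
    have hm : chDom x₀ (Φ x).source ∈ nhds y :=
      (isOpen_chDom x₀ (isOpen_extChartAt_source x)).mem_nhds ⟨hyt, hsrc⟩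
    filter_upwards [hm] with z hz
    exact inChart_trans ω hz.1 hz.2
  have hg : chTrans x₀ x y = Φ x x := by rw [chTrans, hys]
  rw [hev.extDeriv_eq, extDeriv_pullback (r := (⊤ : ℕ∞)) (by
    rw [hg]; exact hω.diffAt hU hxU)
    (contDiffAt_chTrans hyt hsrc) minSmoothness_two_le_top]
  rw [hg]
  ext v
  simp only [ContinuousAlternatingMap.compContinuousLinearMap_apply]
  congr 1
  funext i
  simp only [Function.comp]
  rw [fderiv_chTrans hyt hsrc, hys]
  congr 1
  exact (dS_dC hx _).symm

lemma inChart_extD {ω : Ω k} (hω : SmoothOn ω U) (hU : IsOpen U) {x₀ : M}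
    {y : E5} (hy : y ∈ chDom x₀ U) : inChart (extD ω) x₀ y = extDeriv (inChart ω x₀) y := by
  rw [inChart_eq, extD_eq hω hU hy.2 ((Φ x₀).map_target hy.1), (Φ x₀).right_inv hy.1]
  ext v
  simp only [ContinuousAlternatingMap.compContinuousLinearMap_apply]
  congr 1
  funext i
  exact dC_dS hy.1 _

lemma SmoothOn.extD {ω : Ω k} (hω : SmoothOn ω U) (hU : IsOpen U) : SmoothOn (extD ω) U := by
  intro x₀
  exact (contDiffOn_extDeriv (isOpen_chDom x₀ hU) (hω x₀)).congr fun y hy =>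
    inChart_extD hω hU hy

lemma extD_congr {ω η : Ω k} (hU : IsOpen U) (h : ∀ y ∈ U, ω y = η y) {x : M}
    (hx : x ∈ U) : extD ω x = extD η x := by
  have hev : inChart ω x =ᶠ[nhds (Φ x x)] inChart η x := by
    filter_upwards [(isOpen_chDom x hU).mem_nhds (mem_chDom_self hx)] with z hz
    simp only [inChart, h _ hz.2]
  simp only [_root_.extD, hev.extDeriv_eq]

lemma extD_extD {ω : Ω k} (hω : SmoothOn ω U) (hU : IsOpen U) {x : M}
    (hx : x ∈ U) : extD (extD ω) x = 0 := by
  have hev : inChart (extD ω) x =ᶠ[nhds (Φ x x)] extDeriv (inChart ω x) := by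
    filter_upwards [(isOpen_chDom x hU).mem_nhds (mem_chDom_self hx)] with z hz
    exact inChart_extD hω hU hz
  have h : asA (extD (extD ω)) x = 0 := by
    rw [asA_extD, hev.extDeriv_eq, extDeriv_extDeriv_apply (r := (⊤ : ℕ∞))
      (hω.contDiffAt hU (mem_chDom_self hx)) minSmoothness_two_le_top]
    ext v
    rfl
  exact h

/-- The value of a form at a point of a chart. -/
lemma asA_eq_inChart (ω : Ω k) {x₀ x : M} (hx : x ∈ (Φ x₀).source) :
    asA ω x = (inChart ω x₀ (Φ x₀ x)).compContinuousLinearMap (dC x₀ x) := by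
  rw [inChart_eq, (Φ x₀).left_inv hx]
  ext v
  simp only [ContinuousAlternatingMap.compContinuousLinearMap_apply]
  congr 1
  funext i
  exact (dS_dC hx _).symm

/-- Smoothness of a complex function on an open set. -/
def SmFn (f : M → ℂ) (U : Set M) : Prop :=
  ∀ x₀ : M, ContDiffOn ℝ (⊤ : ℕ∞) (fun y => f ((Φ x₀).symm y)) (chDom x₀ U)

lemma SmFn.mono {f : M → ℂ} {U W : Set M} (hf : SmFn f U) (h : W ⊆ U) : SmFn f W :=
  fun x₀ => (hf x₀).mono fun _ hy => ⟨hy.1, h hy.2⟩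

lemma SmFn.congr {f g : M → ℂ} (hf : SmFn f U) (h : ∀ x ∈ U, g x = f x) :
    SmFn g U := fun x₀ => (hf x₀).congr fun _ hy => h _ hy.2

lemma smFn_const (c : ℂ) (U : Set M) : SmFn (fun _ => c) U := fun _ => contDiffOn_const

lemma SmFn.add {f g : M → ℂ} (hf : SmFn f U) (hg : SmFn g U) :
    SmFn (fun x => f x + g x) U := fun x₀ => (hf x₀).add (hg x₀)

lemma SmFn.sub {f g : M → ℂ} (hf : SmFn f U) (hg : SmFn g U) :
    SmFn (fun x => f x - g x) U := fun x₀ => (hf x₀).sub (hg x₀)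

lemma SmFn.neg {f : M → ℂ} (hf : SmFn f U) : SmFn (fun x => -f x) U := fun x₀ => (hf x₀).neg

lemma SmFn.mul {f g : M → ℂ} (hf : SmFn f U) (hg : SmFn g U) :
    SmFn (fun x => f x * g x) U := fun x₀ => (hf x₀).mul (hg x₀)

lemma SmFn.inv {f : M → ℂ} (hf : SmFn f U) (h0 : ∀ x ∈ U, f x ≠ 0) :
    SmFn (fun x => (f x)⁻¹) U := fun x₀ => (hf x₀).inv fun _ hy => h0 _ hy.2

lemma SmFn.div {f g : M → ℂ} (hf : SmFn f U) (hg : SmFn g U)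
    (h0 : ∀ x ∈ U, g x ≠ 0) : SmFn (fun x => f x / g x) U := by
  simpa only [div_eq_mul_inv] using hf.mul (hg.inv h0)

lemma SmFn.conj {f : M → ℂ} (hf : SmFn f U) : SmFn (fun x => cj (f x)) U :=
  fun x₀ => conjCLE.contDiff.comp_contDiffOn (hf x₀)

lemma SmFn.cexp {f : M → ℂ} (hf : SmFn f U) : SmFn (fun x => Complex.exp (f x)) U :=
  fun x₀ => (hf x₀).cexp

lemma SmoothOn.mono {ω : Ω k} {U W : Set M} (hω : SmoothOn ω U) (h : W ⊆ U) : SmoothOn ω W :=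
  fun x₀ => (hω x₀).mono fun _ hy => ⟨hy.1, h hy.2⟩

lemma SmoothOn.congr {ω η : Ω k} (hω : SmoothOn ω U) (h : ∀ x ∈ U, η x = ω x) : SmoothOn η U :=
  fun x₀ => (hω x₀).congr fun _ hy => by simp only [inChart, h _ hy.2]

/-- Smoothness is local. -/
lemma smoothOn_of_locally {ω : Ω k}
    (h : ∀ x ∈ U, ∃ W, IsOpen W ∧ x ∈ W ∧ SmoothOn ω W) : SmoothOn ω U := by
  intro x₀ y hy
  obtain ⟨W, hW, hxW, hs⟩ := h _ hy.2
  exact ((hs x₀).contDiffAt ((isOpen_chDom x₀ hW).mem_nhds ⟨hy.1, hxW⟩)).contDiffWithinAt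

lemma smFn_of_locally {f : M → ℂ} (h : ∀ x ∈ U, ∃ W, IsOpen W ∧ x ∈ W ∧ SmFn f W) : SmFn f U := by
  intro x₀ y hy
  obtain ⟨W, hW, hxW, hs⟩ := h _ hy.2
  exact ((hs x₀).contDiffAt ((isOpen_chDom x₀ hW).mem_nhds ⟨hy.1, hxW⟩)).contDiffWithinAt

lemma smoothOn_zero (U : Set M) : SmoothOn (0 : Ω k) U := fun x₀ => by
  have : inChart (0 : Ω k) x₀ = fun _ => 0 := by funext y; ext v; rfl
  rw [this]
  exact contDiffOn_const

lemma SmoothOn.add {ω η : Ω k} (hω : SmoothOn ω U) (hη : SmoothOn η U) :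
    SmoothOn (ω + η) U := fun x₀ => (hω x₀).add (hη x₀)

lemma SmoothOn.sub {ω η : Ω k} (hω : SmoothOn ω U) (hη : SmoothOn η U) :
    SmoothOn (ω - η) U := fun x₀ => (hω x₀).sub (hη x₀)

lemma SmoothOn.neg {ω : Ω k} (hω : SmoothOn ω U) : SmoothOn (-ω) U := fun x₀ => (hω x₀).neg

lemma SmoothOn.const_smul {ω : Ω k} (c : ℂ) (hω : SmoothOn ω U) :
    SmoothOn (c • ω) U := fun x₀ => (hω x₀).const_smul c

lemma SmoothOn.sum {ι : Type*} {s : Finset ι} {ω : ι → Ω k}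
    (h : ∀ i ∈ s, SmoothOn (ω i) U) : SmoothOn (∑ i ∈ s, ω i) U := by
  classical
  induction s using Finset.induction_on with
  | empty => simpa using smoothOn_zero U
  | insert a s ha ih =>
    rw [Finset.sum_insert ha]
    exact (h a (Finset.mem_insert_self a s)).add
      (ih fun i hi => h i (Finset.mem_insert_of_mem hi))

lemma SmoothOn.fsmul {f : M → ℂ} {ω : Ω k} (hf : SmFn f U)
    (hω : SmoothOn ω U) : SmoothOn (fsmul f ω) U := fun x₀ => (hf x₀).smul (hω x₀)

lemma inChart_wedge (ω : Ω k) (η : Ω l) (x₀ : M) (y : E5) :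
    inChart (ω ∧ᶠ η) x₀ y = wedgeAt (inChart ω x₀ y) (inChart η x₀ y) :=
  wedgeAt_compContinuousLinearMap _ _ _

lemma SmoothOn.wedge {ω : Ω k} {η : Ω l} (hω : SmoothOn ω U)
    (hη : SmoothOn η U) : SmoothOn (ω ∧ᶠ η) U := fun x₀ =>
  (contDiffOn_wedgeAt (hω x₀) (hη x₀)).congr fun y _ => inChart_wedge ω η x₀ y

lemma SmoothOn.conjF {ω : Ω k} (hω : SmoothOn ω U) : SmoothOn (conjF ω) U := fun x₀ =>
  (ContinuousLinearMap.compContinuousAlternatingMapCLM ℝ E5 ℂ ℂ (Fin k)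
    (conjCLE : ℂ →L[ℝ] ℂ)).contDiff.comp_contDiffOn (hω x₀)

lemma smoothOn_fnForm {f : M → ℂ} (hf : SmFn f U) : SmoothOn (fnForm f) U :=
  fun x₀ => (ContinuousAlternatingMap.constOfIsEmptyLIE ℝ E5 ℂ (Fin 0)).contDiff.comp_contDiffOn
    (hf x₀)

/-- The differential of a function. -/
def dFn (f : M → ℂ) : Ω 1 := extD (fnForm f)

lemma SmFn.differentiableAt {f : M → ℂ} (hf : SmFn f U) (hU : IsOpen U)
    {x₀ : M} {y : E5} (hy : y ∈ chDom x₀ U) : DifferentiableAt ℝ (fun y => f ((Φ x₀).symm y)) y :=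
  ((hf x₀).contDiffAt ((isOpen_chDom x₀ hU).mem_nhds hy)).differentiableAt (by simp)

lemma SmFn.diffAt {f : M → ℂ} (hf : SmFn f U) (hU : IsOpen U) {x : M} (hx : x ∈ U) :
    DifferentiableAt ℝ (fun y => f ((Φ x).symm y)) (Φ x x) :=
  hf.differentiableAt hU (mem_chDom_self hx)

lemma SmFn.dFn {f : M → ℂ} (hf : SmFn f U) (hU : IsOpen U) : SmoothOn (dFn f) U :=
  (smoothOn_fnForm hf).extD hU

lemma asA_dFn (f : M → ℂ) (x : M) : asA (dFn f) x = (flatD (fun y => f ((Φ x).symm y))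
      (Φ x x)).compContinuousLinearMap (dC x x) := rfl

lemma asA_dFn_apply (f : M → ℂ) (x : M) (v : Fin 1 → E5) : asA (dFn f) x v =
    fderiv ℝ (fun y => f ((Φ x).symm y)) (Φ x x) (dC x x (v 0)) := by
  rw [asA_dFn, ContinuousAlternatingMap.compContinuousLinearMap_apply, ← flatD_apply]
  congr 1
  funext i
  fin_cases i
  rfl

section

variable (hU : IsOpen U) {x : M} (hx : x ∈ U)

include hU hx

lemma extD_add {ω η : Ω k} (hω : SmoothOn ω U) (hη : SmoothOn η U) :
    extD (ω + η) x = extD ω x + extD η x := by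
  have h : asA (extD (ω + η)) x = asA (extD ω) x + asA (extD η) x := by
    rw [asA_extD, asA_extD, asA_extD, show inChart (ω + η) x = inChart ω x + inChart η x from rfl,
      extDeriv_add (hω.diffAt hU hx)
        (hη.diffAt hU hx)]
    rfl
  exact h

lemma extD_const_smul (c : ℂ) {ω : Ω k} (hω : SmoothOn ω U) : extD (c • ω) x = c • extD ω x := by
  have h : asA (extD (c • ω)) x = c • asA (extD ω) x := by
    rw [asA_extD, asA_extD, extDeriv,
      show fderiv ℝ (inChart (c • ω) x) (Φ x x) = c • fderiv ℝ (inChart ω x) (Φ x x) from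
        fderiv_const_smul (hω.diffAt hU hx) c]
    ext v
    simp only [ContinuousAlternatingMap.compContinuousLinearMap_apply,
      ContinuousAlternatingMap.alternatizeUncurryFin_apply, ContinuousAlternatingMap.smul_apply,
      extDeriv, Finset.smul_sum]
    refine Finset.sum_congr rfl fun i _ => ?_
    rw [smul_comm]
    rfl
  exact h

lemma extD_neg {ω : Ω k} (hω : SmoothOn ω U) : extD (-ω) x = -extD ω x := by
  have := extD_const_smul hU hx (-1 : ℂ) hω
  rwa [show (-1 : ℂ) • ω = -ω by funext y; change (-1 : ℂ) • ω y = -ω y; module,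
    show (-1 : ℂ) • extD ω x = -extD ω x by module]
    at this

lemma extD_sub {ω η : Ω k} (hω : SmoothOn ω U) (hη : SmoothOn η U) :
    extD (ω - η) x = extD ω x - extD η x := by
  rw [sub_eq_add_neg, extD_add hU hx hω hη.neg, extD_neg hU hx hη, sub_eq_add_neg]

lemma extD_sum {ι : Type*} {s : Finset ι} {ω : ι → Ω k}
    (h : ∀ i ∈ s, SmoothOn (ω i) U) : extD (∑ i ∈ s, ω i) x = ∑ i ∈ s, extD (ω i) x := by
  classical
  induction s using Finset.induction_on with
  | empty =>
    have := extD_const_smul hU hx (0 : ℂ) (smoothOn_zero (k := k) U)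
    rwa [show (0 : ℂ) • (0 : Ω k) = 0 by
      funext y; change (0 : ℂ) • (0 : TS y [⋀^Fin k]→L[ℝ] ℂ) = 0; module,
      show (0 : ℂ) • extD (0 : Ω k) x = 0 by module] at this
  | insert a s ha ih =>
    rw [Finset.sum_insert ha, Finset.sum_insert ha, extD_add hU hx
      (h a (Finset.mem_insert_self a s))
      (SmoothOn.sum fun i hi => h i (Finset.mem_insert_of_mem hi)),
      ih fun i hi => h i (Finset.mem_insert_of_mem hi)]

lemma extD_wedge_one_one {α β : Ω 1} (hα : SmoothOn α U) (hβ : SmoothOn β U) :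
    (extD (α ∧ᶠ β : Ω 2) x : TS x [⋀^Fin 3]→L[ℝ] ℂ) =
      (extD α ∧ᶠ β : Ω 3) x - (α ∧ᶠ extD β : Ω 3) x := by
  have h : asA (extD (α ∧ᶠ β : Ω 2)) x = (wedgeAt (asA (extD α) x) (asA β x) : A5 3) -
      (wedgeAt (asA α x) (asA (extD β) x) : A5 3) := by
    rw [asA_extD, asA_extD, asA_extD, asA_eq_inChart α (mem_extChartAt_source x),
      asA_eq_inChart β (mem_extChartAt_source x), ← wedgeAt_compContinuousLinearMap,
      ← wedgeAt_compContinuousLinearMap,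
      show inChart (α ∧ᶠ β : Ω 2) x = fun y => (wedgeAt (inChart α x y) (inChart β x y) : A5 2) from
        funext fun y => inChart_wedge α β x y,
      extDeriv_wedge_one_one (hα.diffAt hU hx)
        (hβ.diffAt hU hx)]
    rfl
  exact h

lemma extD_wedge_one_two {α : Ω 1} {β : Ω 2} (hα : SmoothOn α U) (hβ : SmoothOn β U) :
    (extD (α ∧ᶠ β : Ω 3) x : TS x [⋀^Fin 4]→L[ℝ] ℂ) =
      (extD α ∧ᶠ β : Ω 4) x - (α ∧ᶠ extD β : Ω 4) x := by
  have h : asA (extD (α ∧ᶠ β : Ω 3)) x = (wedgeAt (asA (extD α) x) (asA β x) : A5 4) -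
      (wedgeAt (asA α x) (asA (extD β) x) : A5 4) := by
    rw [asA_extD, asA_extD, asA_extD, asA_eq_inChart α (mem_extChartAt_source x),
      asA_eq_inChart β (mem_extChartAt_source x), ← wedgeAt_compContinuousLinearMap,
      ← wedgeAt_compContinuousLinearMap,
      show inChart (α ∧ᶠ β : Ω 3) x = fun y => (wedgeAt (inChart α x y) (inChart β x y) : A5 3) from
        funext fun y => inChart_wedge α β x y,
      extDeriv_wedge_one_two (hα.diffAt hU hx)
        (hβ.diffAt hU hx)]
    rfl
  exact h

set_option maxRecDepth 4000 in
lemma extD_wedge_one_three {α : Ω 1} {β : Ω 3} (hα : SmoothOn α U) (hβ : SmoothOn β U) :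
    (extD (α ∧ᶠ β : Ω 4) x : TS x [⋀^Fin 5]→L[ℝ] ℂ) =
      (extD α ∧ᶠ β : Ω 5) x - (α ∧ᶠ extD β : Ω 5) x := by
  have h : asA (extD (α ∧ᶠ β : Ω 4)) x = (wedgeAt (asA (extD α) x) (asA β x) : A5 5) -
      (wedgeAt (asA α x) (asA (extD β) x) : A5 5) := by
    rw [asA_extD, asA_extD, asA_extD, asA_eq_inChart α (mem_extChartAt_source x),
      asA_eq_inChart β (mem_extChartAt_source x), ← wedgeAt_compContinuousLinearMap,
      ← wedgeAt_compContinuousLinearMap,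
      show inChart (α ∧ᶠ β : Ω 4) x = fun y => (wedgeAt (inChart α x y) (inChart β x y) : A5 4) from
        funext fun y => inChart_wedge α β x y,
      extDeriv_wedge_one_three (hα.diffAt hU hx)
        (hβ.diffAt hU hx)]
    rfl
  exact h

omit hU hx in
lemma inChart_fsmul (f : M → ℂ) (β : Ω k) :
    inChart (fsmul f β) x = fun y => f ((Φ x).symm y) • inChart β x y := rfl

lemma extD_fsmul_one {f : M → ℂ} {β : Ω 1} (hf : SmFn f U) (hβ : SmoothOn β U) :
    (extD (fsmul f β) x : TS x [⋀^Fin 2]→L[ℝ] ℂ) = (dFn f ∧ᶠ β : Ω 2) x + f x • extD β x := by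
  have h : asA (extD (fsmul f β)) x = (wedgeAt (asA (dFn f) x) (asA β x) : A5 2) +
      f x • asA (extD β) x := by
    rw [asA_extD, asA_extD, asA_dFn, asA_eq_inChart β (mem_extChartAt_source x),
      ← wedgeAt_compContinuousLinearMap,
      inChart_fsmul,
      extDeriv_smul_one (hf.diffAt hU hx)
        (hβ.diffAt hU hx),
      (Φ x).left_inv (mem_extChartAt_source x)]
    rfl
  exact h

lemma extD_fsmul_two {f : M → ℂ} {β : Ω 2} (hf : SmFn f U) (hβ : SmoothOn β U) :
    (extD (fsmul f β) x : TS x [⋀^Fin 3]→L[ℝ] ℂ) = (dFn f ∧ᶠ β : Ω 3) x + f x • extD β x := by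
  have h : asA (extD (fsmul f β)) x = (wedgeAt (asA (dFn f) x) (asA β x) : A5 3) +
      f x • asA (extD β) x := by
    rw [asA_extD, asA_extD, asA_dFn, asA_eq_inChart β (mem_extChartAt_source x),
      ← wedgeAt_compContinuousLinearMap,
      inChart_fsmul,
      extDeriv_smul_two (hf.diffAt hU hx)
        (hβ.diffAt hU hx),
      (Φ x).left_inv (mem_extChartAt_source x)]
    rfl
  exact h

lemma extD_fsmul_three {f : M → ℂ} {β : Ω 3} (hf : SmFn f U) (hβ : SmoothOn β U) :
    (extD (fsmul f β) x : TS x [⋀^Fin 4]→L[ℝ] ℂ) = (dFn f ∧ᶠ β : Ω 4) x + f x • extD β x := by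
  have h : asA (extD (fsmul f β)) x = (wedgeAt (asA (dFn f) x) (asA β x) : A5 4) +
      f x • asA (extD β) x := by
    rw [asA_extD, asA_extD, asA_dFn, asA_eq_inChart β (mem_extChartAt_source x),
      ← wedgeAt_compContinuousLinearMap,
      inChart_fsmul,
      extDeriv_smul_three (hf.diffAt hU hx)
        (hβ.diffAt hU hx),
      (Φ x).left_inv (mem_extChartAt_source x)]
    rfl
  exact h

lemma extD_conjF {ω : Ω k} (hω : SmoothOn ω U) : extD (conjF ω) x = conjF (extD ω) x := by
  have hd := hω.diffAt hU hx
  have h : asA (extD (conjF ω)) x = asA (conjF (extD ω)) x := by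
    have h1 : ∀ u, fderiv ℝ (inChart (conjF ω) x) (Φ x x) u =
        (conjCLE : ℂ →L[ℝ] ℂ).compContinuousAlternatingMap
          (fderiv ℝ (inChart ω x) (Φ x x) u) := fun u => by
      have := ((ContinuousLinearMap.compContinuousAlternatingMapCLM ℝ E5 ℂ ℂ (Fin k)
        (conjCLE : ℂ →L[ℝ] ℂ)).hasFDerivAt.comp _ hd.hasFDerivAt).fderiv
      have h2 : fderiv ℝ (inChart (conjF ω) x) (Φ x x) = _ := this
      rw [h2]
      rfl
    have h3 : asA (conjF (extD ω)) x =
      (conjCLE : ℂ →L[ℝ] ℂ).compContinuousAlternatingMap (asA (extD ω) x) := rfl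
    rw [h3, asA_extD, asA_extD]
    ext v
    simp only [ContinuousAlternatingMap.compContinuousLinearMap_apply,
      ContinuousLinearMap.compContinuousAlternatingMap_coe, Function.comp_apply, extDeriv,
      ContinuousAlternatingMap.alternatizeUncurryFin_apply, h1, map_sum, map_zsmul]
  exact h

lemma dFn_add {f g : M → ℂ} (hf : SmFn f U) (hg : SmFn g U) :
    dFn (fun y => f y + g y) x = dFn f x + dFn g x := by
  have h : asA (dFn (fun y => f y + g y)) x = asA (dFn f) x + asA (dFn g) x := by
    ext v
    rw [ContinuousAlternatingMap.add_apply, asA_dFn_apply, asA_dFn_apply, asA_dFn_apply]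
    rw [fderiv_fun_add (hf.diffAt hU hx)
      (hg.diffAt hU hx)]
    rfl
  exact h

lemma dFn_mul {f g : M → ℂ} (hf : SmFn f U) (hg : SmFn g U) :
    dFn (fun y => f y * g y) x = f x • dFn g x + g x • dFn f x := by
  have h : asA (dFn (fun y => f y * g y)) x = f x • asA (dFn g) x + g x • asA (dFn f) x := by
    ext v
    rw [ContinuousAlternatingMap.add_apply, ContinuousAlternatingMap.smul_apply,
      ContinuousAlternatingMap.smul_apply, asA_dFn_apply, asA_dFn_apply, asA_dFn_apply]
    rw [fderiv_fun_mul (hf.diffAt hU hx)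
      (hg.diffAt hU hx),
      (Φ x).left_inv (mem_extChartAt_source x)]
    rfl
  exact h

lemma dFn_cexp {f : M → ℂ} (hf : SmFn f U) :
    dFn (fun y => Complex.exp (f y)) x = Complex.exp (f x) • dFn f x := by
  have h : asA (dFn (fun y => Complex.exp (f y))) x = Complex.exp (f x) • asA (dFn f) x := by
    ext v
    rw [ContinuousAlternatingMap.smul_apply, asA_dFn_apply, asA_dFn_apply]
    rw [((hf.diffAt hU hx).hasFDerivAt.cexp).fderiv, (Φ x).left_inv (mem_extChartAt_source x)]
    rfl
  exact h

lemma dFn_conj {f : M → ℂ} (hf : SmFn f U) : dFn (fun y => cj (f y)) x = conjF (dFn f) x :=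
  extD_conjF hU hx (smoothOn_fnForm hf)

lemma dFn_congr {f g : M → ℂ} (h : ∀ y ∈ U, f y = g y) : dFn f x = dFn g x :=
  extD_congr hU (fun y hy => by simp only [fnForm, h y hy]) hx

end

lemma dFn_const (c : ℂ) (x : M) : dFn (fun _ : M => c) x = 0 := by
  have h : asA (dFn (fun _ : M => c)) x = 0 := by
    ext v
    rw [asA_dFn_apply]
    simp
  exact h

lemma smFn_of_contMDiff {f : M → ℝ} (hf : ContMDiff 𝓔 𝓘(ℝ, ℝ) (⊤ : ℕ∞) f) :
    SmFn (fun x => (f x : ℂ)) univ := by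
  intro x₀
  have h1 : ContMDiffOn 𝓔 𝓘(ℝ, ℝ) (⊤ : ℕ∞)
      (f ∘ (Φ x₀).symm) (Φ x₀).target :=
    hf.comp_contMDiffOn (contMDiffOn_extChartAt_symm x₀)
  exact ofRealCLM.contDiff.comp_contDiffOn
    ((contMDiffOn_iff_contDiffOn.1 h1).mono inter_subset_left)

/-! ### Wedge products and exterior derivatives in fixed degrees -/

/-- The wedge product of one-forms. -/
def w11 (α β : Ω 1) : Ω 2 := α ∧ᶠ β
/-- The wedge product of a one-form and a two-form. -/
def w12 (α : Ω 1) (β : Ω 2) : Ω 3 := α ∧ᶠ β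
/-- The wedge product of a one-form and a three-form. -/
def w13 (α : Ω 1) (β : Ω 3) : Ω 4 := α ∧ᶠ β
/-- The wedge product of a one-form and a four-form. -/
def w14 (α : Ω 1) (β : Ω 4) : Ω 5 := α ∧ᶠ β
/-- The wedge product of two-forms. -/
def w22 (α β : Ω 2) : Ω 4 := α ∧ᶠ β
/-- The exterior derivative of one-forms. -/
def d1 (α : Ω 1) : Ω 2 := extD α
/-- The exterior derivative of two-forms. -/
def d2 (α : Ω 2) : Ω 3 := extD α
/-- The exterior derivative of three-forms. -/
def d3 (α : Ω 3) : Ω 4 := extD α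

/-- The value of a one-form on a complex tangent vector. -/
def e1 (α : Ω 1) (x : M) (a : ℂT x) : ℂ := evalC (α x) ![a]
/-- The value of a two-form on complex tangent vectors. -/
def e2 (α : Ω 2) (x : M) (a b : ℂT x) : ℂ := evalC (α x) ![a, b]
/-- The value of a three-form on complex tangent vectors. -/
def e3 (α : Ω 3) (x : M) (a b c : ℂT x) : ℂ := evalC (α x) ![a, b, c]
/-- The value of a four-form on complex tangent vectors. -/
def e4 (α : Ω 4) (x : M) (a b c d : ℂT x) : ℂ := evalC (α x) ![a, b, c, d]
/-- The value of a five-form on complex tangent vectors. -/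
def e5 (α : Ω 5) (x : M) (a b c d e : ℂT x) : ℂ := evalC (α x) ![a, b, c, d, e]

lemma toAlternatingMap_wedge {l : ℕ} (α : Ω k) (β : Ω l) (x : M) : ((α ∧ᶠ β) x).toAlternatingMap =
      altWedge (α x).toAlternatingMap (β x).toAlternatingMap := toAlternatingMap_wedgeAt _ _

lemma e2_w11 (α β : Ω 1) (x : M) (a b : ℂT x) :
    e2 (w11 α β) x a b = e1 α x a * e1 β x b - e1 β x a * e1 α x b := by
  rw [e2, w11, evalC, toAlternatingMap_wedge]
  exact cEval_wedge_one_one _ _ a b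

lemma e3_w12 (α : Ω 1) (β : Ω 2) (x : M) (a b c : ℂT x) : e3 (w12 α β) x a b c =
      e1 α x a * e2 β x b c - e1 α x b * e2 β x a c + e1 α x c * e2 β x a b := by
  rw [e3, w12, evalC, toAlternatingMap_wedge]
  exact cEval_wedge_one_two _ _ a b c

lemma e4_w13 (α : Ω 1) (β : Ω 3) (x : M) (a b c d : ℂT x) : e4 (w13 α β) x a b c d =
      e1 α x a * e3 β x b c d - e1 α x b * e3 β x a c d + e1 α x c * e3 β x a b d
        - e1 α x d * e3 β x a b c := by
  rw [e4, w13, evalC, toAlternatingMap_wedge]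
  exact cEval_wedge_one_three _ _ a b c d

lemma e5_w14 (α : Ω 1) (β : Ω 4) (x : M) (a b c d e : ℂT x) : e5 (w14 α β) x a b c d e =
      e1 α x a * e4 β x b c d e - e1 α x b * e4 β x a c d e + e1 α x c * e4 β x a b d e
        - e1 α x d * e4 β x a b c e + e1 α x e * e4 β x a b c d := by
  rw [e5, w14, evalC, toAlternatingMap_wedge]
  exact cEval_wedge_one_four _ _ a b c d e

lemma e4_w22 (α β : Ω 2) (x : M) (a b c d : ℂT x) : e4 (w22 α β) x a b c d =
      e2 α x a b * e2 β x c d - e2 α x a c * e2 β x b d + e2 α x a d * e2 β x b c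
        + e2 α x b c * e2 β x a d - e2 α x b d * e2 β x a c + e2 α x c d * e2 β x a b := by
  rw [e4, w22, evalC, toAlternatingMap_wedge]
  exact cEval_wedge_two_two _ _ a b c d

lemma evalC_add {x : M} (f g : TS x [⋀^Fin k]→L[ℝ] ℂ) (Z : Fin k → ℂT x) :
    evalC (f + g) Z = evalC f Z + evalC g Z :=
  cEval_add f.toAlternatingMap g.toAlternatingMap Z
lemma evalC_sub {x : M} (f g : TS x [⋀^Fin k]→L[ℝ] ℂ) (Z : Fin k → ℂT x) :
    evalC (f - g) Z = evalC f Z - evalC g Z :=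
  cEval_sub f.toAlternatingMap g.toAlternatingMap Z
lemma evalC_neg {x : M} (f : TS x [⋀^Fin k]→L[ℝ] ℂ) (Z : Fin k → ℂT x) :
    evalC (-f) Z = -evalC f Z :=
  cEval_neg f.toAlternatingMap Z
lemma evalC_smul {x : M} (c : ℂ) (f : TS x [⋀^Fin k]→L[ℝ] ℂ) (Z : Fin k → ℂT x) :
    evalC (c • f) Z = c * evalC f Z :=
  cEval_smul c f.toAlternatingMap Z
lemma evalC_zero {x : M} (Z : Fin k → ℂT x) :
    evalC (0 : TS x [⋀^Fin k]→L[ℝ] ℂ) Z = 0 := cEval_zero Z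
lemma evalC_sum {x : M} {ι : Type*} (s : Finset ι) (f : ι → TS x [⋀^Fin k]→L[ℝ] ℂ)
    (Z : Fin k → ℂT x) : evalC (∑ i ∈ s, f i) Z = ∑ i ∈ s, evalC (f i) Z := by
  classical
  induction s using Finset.induction_on with
  | empty => simpa using evalC_zero Z
  | insert a s ha ih => rw [Finset.sum_insert ha, Finset.sum_insert ha, evalC_add, ih]

lemma evalC_conjF (α : Ω k) (x : M) (Z : Fin k → ℂT x) :
    evalC (conjF α x) Z = cj (evalC (α x) fun i => conjC (Z i)) :=
  cEval_conjA (α x).toAlternatingMap Z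

section linear
variable (x : M) (a b c d e : ℂT x) (f : M → ℂ) (z : ℂ)

lemma e1_add (α β : Ω 1) : e1 (α + β) x a = e1 α x a + e1 β x a := evalC_add _ _ _
lemma e1_sub (α β : Ω 1) : e1 (α - β) x a = e1 α x a - e1 β x a := evalC_sub _ _ _
lemma e1_neg (α : Ω 1) : e1 (-α) x a = -e1 α x a := evalC_neg _ _
lemma e1_smul (α : Ω 1) : e1 (z • α) x a = z * e1 α x a := evalC_smul z _ _
lemma e1_fsmul (α : Ω 1) : e1 (fsmul f α) x a = f x * e1 α x a := evalC_smul _ _ _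
lemma e1_zero : e1 (0 : Ω 1) x a = 0 := evalC_zero _
lemma e2_add (α β : Ω 2) : e2 (α + β) x a b = e2 α x a b + e2 β x a b := evalC_add _ _ _
lemma e2_sub (α β : Ω 2) : e2 (α - β) x a b = e2 α x a b - e2 β x a b := evalC_sub _ _ _
lemma e2_smul (α : Ω 2) : e2 (z • α) x a b = z * e2 α x a b := evalC_smul z _ _
lemma e2_fsmul (α : Ω 2) : e2 (fsmul f α) x a b = f x * e2 α x a b := evalC_smul _ _ _
lemma e2_zero : e2 (0 : Ω 2) x a b = 0 := evalC_zero _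
lemma e3_add (α β : Ω 3) : e3 (α + β) x a b c = e3 α x a b c + e3 β x a b c := evalC_add _ _ _
lemma e3_sub (α β : Ω 3) : e3 (α - β) x a b c = e3 α x a b c - e3 β x a b c := evalC_sub _ _ _
lemma e3_neg (α : Ω 3) : e3 (-α) x a b c = -e3 α x a b c := evalC_neg _ _
lemma e3_smul (α : Ω 3) : e3 (z • α) x a b c = z * e3 α x a b c := evalC_smul z _ _
lemma e3_fsmul (α : Ω 3) : e3 (fsmul f α) x a b c = f x * e3 α x a b c := evalC_smul _ _ _
lemma e3_zero : e3 (0 : Ω 3) x a b c = 0 := evalC_zero _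
lemma e4_add (α β : Ω 4) : e4 (α + β) x a b c d = e4 α x a b c d + e4 β x a b c d := evalC_add _ _ _
lemma e4_sub (α β : Ω 4) : e4 (α - β) x a b c d = e4 α x a b c d - e4 β x a b c d := evalC_sub _ _ _
lemma e4_neg (α : Ω 4) : e4 (-α) x a b c d = -e4 α x a b c d := evalC_neg _ _
lemma e4_smul (α : Ω 4) : e4 (z • α) x a b c d = z * e4 α x a b c d := evalC_smul z _ _
lemma e4_fsmul (α : Ω 4) : e4 (fsmul f α) x a b c d = f x * e4 α x a b c d := evalC_smul _ _ _
lemma e4_zero : e4 (0 : Ω 4) x a b c d = 0 := evalC_zero _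
lemma e5_sub (α β : Ω 5) :
    e5 (α - β) x a b c d e = e5 α x a b c d e - e5 β x a b c d e := evalC_sub _ _ _
lemma e5_smul (α : Ω 5) : e5 (z • α) x a b c d e = z * e5 α x a b c d e := evalC_smul z _ _
lemma e5_fsmul (α : Ω 5) : e5 (fsmul f α) x a b c d e = f x * e5 α x a b c d e := evalC_smul _ _ _
lemma e5_zero : e5 (0 : Ω 5) x a b c d e = 0 := evalC_zero _

lemma e1_conjF (α : Ω 1) : e1 (conjF α) x a = cj (e1 α x (conjC a)) := by
  rw [e1, e1, evalC_conjF]; congr 2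
lemma e2_conjF (α : Ω 2) : e2 (conjF α) x a b = cj (e2 α x (conjC a) (conjC b)) := by
  rw [e2, e2, evalC_conjF]; congr 2
lemma e3_conjF (α : Ω 3) : e3 (conjF α) x a b c = cj (e3 α x (conjC a) (conjC b) (conjC c)) := by
  rw [e3, e3, evalC_conjF]; congr 2
lemma e4_conjF (α : Ω 4) : e4 (conjF α) x a b c d =
      cj (e4 α x (conjC a) (conjC b) (conjC c) (conjC d)) := by
  rw [e4, e4, evalC_conjF]; congr 2

variable {x}

lemma e1_add_vec (α : Ω 1) : e1 α x (a + b) = e1 α x a + e1 α x b := by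
  simp only [e1, evalC, cEval_cons, iC_add_left, cEval_add]
lemma e1_smul_vec (α : Ω 1) : e1 α x (z • a) = z * e1 α x a := by
  simp only [e1, evalC, cEval_cons, iC_smul_left, cEval_smul]
lemma e1_zero_vec (α : Ω 1) : e1 α x 0 = 0 := by
  simp only [e1, evalC, cEval_cons, iC_zero_left, cEval_zero]
lemma e2_add_left (α : Ω 2) : e2 α x (a + b) c = e2 α x a c + e2 α x b c := by
  simp only [e2, evalC, cEval_cons, iC_add_left, cEval_add, iC_add]
lemma e2_smul_left (α : Ω 2) : e2 α x (z • a) c = z * e2 α x a c := by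
  simp only [e2, evalC, cEval_cons, iC_smul_left, cEval_smul, iC_smul]
lemma e2_add_right (α : Ω 2) : e2 α x a (b + c) = e2 α x a b + e2 α x a c := by
  simp only [e2, evalC, cEval_cons, iC_add_left, cEval_add]
lemma e2_smul_right (α : Ω 2) : e2 α x a (z • b) = z * e2 α x a b := by
  simp only [e2, evalC, cEval_cons, iC_smul_left, cEval_smul]
lemma e2_zero_left (α : Ω 2) : e2 α x 0 c = 0 := by
  simp only [e2, evalC, cEval_cons, iC_zero_left, cEval_zero, iC_zero]
lemma e2_zero_right (α : Ω 2) : e2 α x c 0 = 0 := by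
  simp only [e2, evalC, cEval_cons, iC_zero_left, cEval_zero]
lemma e2_swap (α : Ω 2) : e2 α x a b = -e2 α x b a := cEval_swap_two (α x).toAlternatingMap a b
lemma e2_self (α : Ω 2) : e2 α x a a = 0 := by
  have := e2_swap a a α
  exact self_eq_neg.1 this
lemma e3_swap23 (α : Ω 3) : e3 α x a b c = -e3 α x a c b := by
  simp only [e3, evalC, cEval_cons]
  rw [iC_swap, cEval_neg]
lemma e4_swap12 (α : Ω 4) : e4 α x a b c d = -e4 α x b a c d := by
  simp only [e4, evalC, cEval_cons]
  rw [iC_swap b a, iC_neg, iC_neg, cEval_neg]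
lemma e4_swap23 (α : Ω 4) : e4 α x a b c d = -e4 α x a c b d := by
  simp only [e4, evalC, cEval_cons]
  rw [iC_swap c b, iC_neg, cEval_neg]
lemma e4_swap34 (α : Ω 4) : e4 α x a b c d = -e4 α x a b d c := by
  simp only [e4, evalC, cEval_cons]
  rw [iC_swap, cEval_neg]
end linear

lemma e1_real (α : Ω 1) (x : M) (v : TS x) : e1 α x ((1 : ℂ) ⊗ₜ[ℝ] v) = α x ![v] := by
  have := cEval_tmul (α x).toAlternatingMap ![v]
  rw [e1, evalC]
  refine Eq.trans ?_ this
  congr 1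
  funext i; fin_cases i; rfl

lemma e2_real (α : Ω 2) (x : M) (v w : TS x) :
    e2 α x ((1 : ℂ) ⊗ₜ[ℝ] v) ((1 : ℂ) ⊗ₜ[ℝ] w) = α x ![v, w] := by
  have := cEval_tmul (α x).toAlternatingMap ![v, w]
  rw [e2, evalC]
  refine Eq.trans ?_ this
  congr 1
  funext i; fin_cases i <;> rfl

lemma cform_ext_toAlternatingMap {x : M} {f g : TS x [⋀^Fin k]→L[ℝ] ℂ}
    (h : f.toAlternatingMap = g.toAlternatingMap) : f = g :=
  ContinuousAlternatingMap.toAlternatingMap_injective h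

lemma SmoothOn.w11 {α β : Ω 1} (hα : SmoothOn α U) (hβ : SmoothOn β U) :
    SmoothOn (w11 α β) U := hα.wedge hβ
lemma SmoothOn.w12 {α : Ω 1} {β : Ω 2} (hα : SmoothOn α U)
    (hβ : SmoothOn β U) : SmoothOn (w12 α β) U := hα.wedge hβ
lemma SmoothOn.w13 {α : Ω 1} {β : Ω 3} (hα : SmoothOn α U)
    (hβ : SmoothOn β U) : SmoothOn (w13 α β) U := hα.wedge hβ
lemma SmoothOn.w22 {α β : Ω 2} (hα : SmoothOn α U) (hβ : SmoothOn β U) :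
    SmoothOn (w22 α β) U := hα.wedge hβ

section DerivativeRules

lemma SmoothOn.d1 {α : Ω 1} (hα : SmoothOn α U) (hU : IsOpen U) : SmoothOn (d1 α) U := hα.extD hU
lemma SmoothOn.d2 {α : Ω 2} (hα : SmoothOn α U) (hU : IsOpen U) : SmoothOn (d2 α) U := hα.extD hU
lemma SmoothOn.d3 {α : Ω 3} (hα : SmoothOn α U) (hU : IsOpen U) : SmoothOn (d3 α) U := hα.extD hU

lemma wedge_two_one_eq (α : Ω 1) (β : Ω 2) (x : M) :
    ((β ∧ᶠ α : Ω 3) x : TS x [⋀^Fin 3]→L[ℝ] ℂ) = w12 α β x := by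
  apply cform_ext_toAlternatingMap
  rw [w12, toAlternatingMap_wedge, toAlternatingMap_wedge]
  ext v
  have h1 := cEval_tmul (altWedge (β x).toAlternatingMap (α x).toAlternatingMap :
    TS x [⋀^Fin 3]→ₗ[ℝ] ℂ) v
  have h2 := cEval_tmul (altWedge (α x).toAlternatingMap (β x).toAlternatingMap :
    TS x [⋀^Fin 3]→ₗ[ℝ] ℂ) v
  have h3 : (fun i => (1 : ℂ) ⊗ₜ[ℝ] v i) = ![(1 : ℂ) ⊗ₜ[ℝ] v 0, (1 : ℂ) ⊗ₜ[ℝ] v 1,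
    (1 : ℂ) ⊗ₜ[ℝ] v 2] := by funext i; fin_cases i <;> rfl
  rw [h3] at h1 h2
  rw [← h1, ← h2, cEval_wedge_two_one, cEval_wedge_one_two]

variable (hU : IsOpen U) {x : M} (hx : x ∈ U)

include hU hx

lemma d2_w11 {α β : Ω 1} (hα : SmoothOn α U) (hβ : SmoothOn β U) :
    d2 (w11 α β) x = w12 β (d1 α) x - w12 α (d1 β) x := by
  have := extD_wedge_one_one hU hx hα hβ
  rw [wedge_two_one_eq] at this
  exact this

lemma d3_w12 {α : Ω 1} {β : Ω 2} (hα : SmoothOn α U) (hβ : SmoothOn β U) :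
    d3 (w12 α β) x = w22 (d1 α) β x - w13 α (d2 β) x := extD_wedge_one_two hU hx hα hβ

lemma d1_fsmul {f : M → ℂ} {β : Ω 1} (hf : SmFn f U) (hβ : SmoothOn β U) :
    d1 (fsmul f β) x = w11 (dFn f) β x + f x • d1 β x := extD_fsmul_one hU hx hf hβ
lemma d2_fsmul {f : M → ℂ} {β : Ω 2} (hf : SmFn f U) (hβ : SmoothOn β U) :
    d2 (fsmul f β) x = w12 (dFn f) β x + f x • d2 β x := extD_fsmul_two hU hx hf hβ
lemma d3_fsmul {f : M → ℂ} {β : Ω 3} (hf : SmFn f U) (hβ : SmoothOn β U) :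
    d3 (fsmul f β) x = w13 (dFn f) β x + f x • d3 β x := extD_fsmul_three hU hx hf hβ

lemma d2_d1 {α : Ω 1} (hα : SmoothOn α U) : d2 (d1 α) x = 0 := extD_extD hα hU hx
lemma d3_d2 {α : Ω 2} (hα : SmoothOn α U) : d3 (d2 α) x = 0 := extD_extD hα hU hx
lemma d1_dFn {f : M → ℂ} (hf : SmFn f U) : d1 (dFn f) x = 0 := extD_extD (smoothOn_fnForm hf) hU hx

end DerivativeRules

/-- The representative of a vector field in a preferred chart. -/
def vRep (X : ∀ p : M, TS p) (x₀ : M) (y : E5) : E5 := dC x₀ ((Φ x₀).symm y) (X ((Φ x₀).symm y))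

/-- Smoothness of a real vector field, in all preferred charts. -/
def SmVF (X : ∀ p : M, TS p) (U : Set M) : Prop :=
  ∀ x₀ : M, ContDiffOn ℝ (⊤ : ℕ∞) (vRep X x₀) (chDom x₀ U)

lemma SmVF.mono {X : ∀ p : M, TS p} {U W : Set M} (hX : SmVF X U) (h : W ⊆ U) : SmVF X W :=
  fun x₀ => (hX x₀).mono fun _ hy => ⟨hy.1, h hy.2⟩

lemma SmVF.add {X Y : ∀ p : M, TS p} (hX : SmVF X U) (hY : SmVF Y U) :
    SmVF (fun p => X p + Y p) U := fun x₀ =>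
  ((hX x₀).add (hY x₀)).congr fun _ _ => map_add (dC x₀ _) _ _

lemma SmVF.smul {X : ∀ p : M, TS p} {f : M → ℝ} (hX : SmVF X U)
    (hf : SmFn (fun p => (f p : ℂ)) U) : SmVF (fun p => f p • X p) U := fun x₀ => by
  have h : ContDiffOn ℝ (⊤ : ℕ∞) (fun y => f ((Φ x₀).symm y)) (chDom x₀ U) :=
    (Complex.reCLM.contDiff.comp_contDiffOn (hf x₀)).congr fun _ _ => by simp
  exact (h.smul (hX x₀)).congr fun _ _ => map_smul (dC x₀ _) _ _

/-- Contraction of a form with a real vector field. -/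
def iVF (X : ∀ p : M, TS p) (ω : Ω (k + 1)) : Ω k := fun p =>
  { toMultilinearMap := ((ω p).toAlternatingMap.curryLeft (X p)).toMultilinearMap
    map_eq_zero_of_eq' := ((ω p).toAlternatingMap.curryLeft (X p)).map_eq_zero_of_eq'
    cont := (ω p).cont.comp (continuous_const.matrixVecCons continuous_id) }

lemma SmoothVF.smVF {X : ∀ p : M, TS p} (hU : IsOpen U) (hX : SmoothVF X U) : SmVF X U := by
  have : IsManifold 𝓔 1 M := isManifold_one
  intro x₀
  let e := trivializationAt E5 (TangentSpace 𝓔 : M → Type) x₀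
  have ha : IsOpen (U ∩ e.baseSet) := hU.inter e.open_baseSet
  have h1 := (e.contMDiffOn_section_iff (IB := 𝓔) (n := (⊤ : ℕ∞)) ha
    inter_subset_right).1 (hX.mono inter_subset_left)
  have h2 : ContMDiffOn 𝓔 𝓔 (⊤ : ℕ∞)
      ((fun x => (e ⟨x, X x⟩).2) ∘ (Φ x₀).symm) (chDom x₀ U) :=
    h1.comp ((contMDiffOn_extChartAt_symm x₀).mono inter_subset_left) fun y hy =>
      ⟨hy.2, by
        have := (Φ x₀).map_target hy.1
        simpa [e] using this⟩
  refine (contMDiffOn_iff_contDiffOn.1 h2).congr fun y hy => ?_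
  have hs : (Φ x₀).symm y ∈ (chartAt E5 x₀).source := by
    have := (Φ x₀).map_target hy.1
    simpa using this
  have h3 := TangentBundle.continuousLinearMapAt_trivializationAt (I := 𝓔) hs
  have h4 : e.continuousLinearMapAt ℝ ((Φ x₀).symm y)
      (X ((Φ x₀).symm y)) = (e ⟨_, X ((Φ x₀).symm y)⟩).2 := by
    rw [Bundle.Trivialization.continuousLinearMapAt_apply,
      Bundle.Trivialization.linearMapAt_apply, if_pos]
    simpa [e] using hs
  simp only [Function.comp]
  rw [← h4]
  exact (congrArg (fun L : E5 →L[ℝ] E5 => L (X ((Φ x₀).symm y))) h3).symm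

/-- A constant vector field in a preferred chart. -/
def coordVF (x₀ : M) (v : E5) (p : M) : TS p := dS x₀ (Φ x₀ p) v

lemma smVF_coordVF (x₀ : M) (v : E5) : SmVF (coordVF x₀ v) (Φ x₀).source := by
  intro x₁ y hy
  have hy2 : (Φ x₁).symm y ∈ (Φ x₀).source := hy.2
  have hopen : IsOpen (chDom x₁ (Φ x₀).source) := isOpen_chDom _ (isOpen_extChartAt_source x₀)
  have key : ∀ z ∈ chDom x₁ (Φ x₀).source,
      vRep (coordVF x₀ v) x₁ z = fderiv ℝ (chTrans x₀ x₁) (chTrans x₁ x₀ z) v := by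
    intro z hz
    have e1 : (Φ x₀).symm (chTrans x₁ x₀ z) = (Φ x₁).symm z := (Φ x₀).left_inv hz.2
    have ht : chTrans x₁ x₀ z ∈ (Φ x₀).target := (Φ x₀).map_source hz.2
    have hs : (Φ x₀).symm (chTrans x₁ x₀ z) ∈
        (Φ x₁).source := by
      rw [e1]; exact (Φ x₁).map_target hz.1
    rw [fderiv_chTrans ht hs, e1]
    rfl
  have e1 : (Φ x₀).symm (chTrans x₁ x₀ y) = (Φ x₁).symm y := (Φ x₀).left_inv hy.2
  have ht : chTrans x₁ x₀ y ∈ (Φ x₀).target := (Φ x₀).map_source hy2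
  have hs : (Φ x₀).symm (chTrans x₁ x₀ y) ∈
      (Φ x₁).source := by
    rw [e1]; exact (Φ x₁).map_target hy.1
  have h1 : ContDiffAt ℝ (⊤ : ℕ∞) (fderiv ℝ (chTrans x₀ x₁)) (chTrans x₁ x₀ y) :=
    (contDiffAt_chTrans ht hs).fderiv_right (m := (⊤ : ℕ∞))
      (by simp)
  have h2 : ContDiffAt ℝ (⊤ : ℕ∞) (fun z => fderiv ℝ (chTrans x₀ x₁) (chTrans x₁ x₀ z) v) y :=
    (h1.comp y (contDiffAt_chTrans hy.1 hy2)).clm_apply contDiffAt_const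
  refine (h2.congr_of_eventuallyEq ?_).contDiffWithinAt
  filter_upwards [hopen.mem_nhds hy] with z hz using key z hz

lemma SmoothOn.iVF {X : ∀ p : M, TS p} {ω : Ω (k + 1)} (hX : SmVF X U)
    (hω : SmoothOn ω U) : SmoothOn (iVF X ω) U := by
  intro x₀
  rw [contDiffOn_iff_apply]
  intro v
  have key : ∀ y ∈ chDom x₀ U, inChart (_root_.iVF X ω) x₀ y v =
      ∑ j, ((vRep X x₀ y) j : ℂ) •
        inChart ω x₀ y (Matrix.vecCons (EuclideanSpace.single j (1 : ℝ)) v) := by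
    intro y hy
    have h1 : inChart (_root_.iVF X ω) x₀ y v =
        (inChart ω x₀ y).toAlternatingMap.curryLeft (vRep X x₀ y) v := by
      have e1 : (asA ω ((Φ x₀).symm y))
          (Matrix.vecCons (X ((Φ x₀).symm y)) (fun i => dS x₀ y (v i))) =
          (asA ω ((Φ x₀).symm y))
            (fun i => dS x₀ y ((Matrix.vecCons (vRep X x₀ y) v : Fin (k + 1) → E5) i)) := by
        congr 1
        funext i
        refine Fin.cases ?_ (fun i => rfl) i
        have := dS_dC ((Φ x₀).map_target hy.1)
          (X ((Φ x₀).symm y))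
        rw [(Φ x₀).right_inv hy.1] at this
        exact this.symm
      exact e1
    have h2 : vRep X x₀ y = ∑ j, (vRep X x₀ y) j • EuclideanSpace.single j (1 : ℝ) := by
      have := (EuclideanSpace.basisFun (Fin 5) ℝ).sum_repr (vRep X x₀ y)
      simpa using this.symm
    rw [h1]
    conv_lhs => rw [h2]
    rw [map_sum, sum_alternating_apply]
    refine Finset.sum_congr rfl fun j _ => ?_
    rw [map_smul]
    exact real_smul
  refine ContDiffOn.congr ?_ key
  refine ContDiffOn.sum fun j _ => ContDiffOn.fun_smul ?_ (contDiffOn_iff_apply.1 (hω x₀) _)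
  exact ofRealCLM.contDiff.comp_contDiffOn
    ((EuclideanSpace.proj (𝕜 := ℝ) j).contDiff.comp_contDiffOn (hX x₀))

lemma SmoothOn.smFn_apply_zero {ω : Ω 0} (hω : SmoothOn ω U) :
    SmFn (fun p => ω p ![]) U := fun x₀ => by
  refine (contDiffOn_iff_apply.1 (hω x₀) ![]).congr fun y _ => ?_
  have : inChart ω x₀ y ![] = ω ((Φ x₀).symm y)
    (fun i => dS x₀ y ((![] : Fin 0 → E5) i)) := rfl
  rw [this, show (fun i => dS x₀ y ((![] : Fin 0 → E5) i)) = ![] from Subsingleton.elim _ _]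
  rfl

/-- Smoothness of a complex vector field. -/
def SmCV (Z : ∀ p : M, ℂT p) (U : Set M) : Prop :=
  ∃ X Y : ∀ p : M, TS p, SmVF X U ∧ SmVF Y U ∧ ∀ p ∈ U, Z p = cVec (X p) (Y p)

lemma SmCV.mono {Z : ∀ p : M, ℂT p} {U W : Set M} (hZ : SmCV Z U) (h : W ⊆ U) : SmCV Z W := by
  obtain ⟨X, Y, hX, hY, hZ⟩ := hZ
  exact ⟨X, Y, hX.mono h, hY.mono h, fun p hp => hZ p (h hp)⟩

lemma SmCV.add {Z W : ∀ p : M, ℂT p} (hZ : SmCV Z U) (hW : SmCV W U) :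
    SmCV (fun p => Z p + W p) U := by
  obtain ⟨X, Y, hX, hY, hZ⟩ := hZ
  obtain ⟨X', Y', hX', hY', hW⟩ := hW
  refine ⟨_, _, hX.add hX', hY.add hY', fun p hp => ?_⟩
  simp only []
  rw [hZ p hp, hW p hp, cVec, cVec, cVec, TensorProduct.tmul_add, TensorProduct.tmul_add]
  abel

lemma smul_cVec {V : Type*} [AddCommGroup V] [Module ℝ V] (c : ℂ) (u v : V) :
    c • cVec u v = cVec (c.re • u + (-c.im) • v) (c.im • u + c.re • v) := by
  have h : ∀ (z : ℂ) (w : V), z ⊗ₜ[ℝ] w = (z.re) • ((1 : ℂ) ⊗ₜ[ℝ] w)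
      + z.im • (I ⊗ₜ[ℝ] w) := by
    intro z w
    rw [TensorProduct.smul_tmul', TensorProduct.smul_tmul', ← TensorProduct.add_tmul]
    congr 1
    apply Complex.ext <;> simp
  simp only [cVec, smul_add, TensorProduct.tmul_add, TensorProduct.tmul_smul]
  rw [TensorProduct.smul_tmul', TensorProduct.smul_tmul', smul_eq_mul, smul_eq_mul, mul_one]
  rw [h c u, h (c * I) v]
  simp only [Complex.mul_re, Complex.mul_im, Complex.I_re, Complex.I_im, mul_zero, mul_one,
    zero_sub, add_zero, neg_smul]
  abel

lemma SmFn.re {f : M → ℂ} (hf : SmFn f U) : SmFn (fun p => ((f p).re : ℂ)) U :=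
  fun x₀ => ofRealCLM.contDiff.comp_contDiffOn
    (Complex.reCLM.contDiff.comp_contDiffOn (hf x₀))

lemma SmFn.im {f : M → ℂ} (hf : SmFn f U) : SmFn (fun p => ((f p).im : ℂ)) U :=
  fun x₀ => ofRealCLM.contDiff.comp_contDiffOn
    (Complex.imCLM.contDiff.comp_contDiffOn (hf x₀))

lemma SmCV.smul {Z : ∀ p : M, ℂT p} {f : M → ℂ} (hZ : SmCV Z U)
    (hf : SmFn f U) : SmCV (fun p => f p • Z p) U := by
  obtain ⟨X, Y, hX, hY, hZ⟩ := hZ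
  refine ⟨fun p => (f p).re • X p + (-(f p).im) • Y p, fun p => (f p).im • X p + (f p).re • Y p,
    ?_, ?_, fun p hp => ?_⟩
  · exact (hX.smul hf.re).add (hY.smul (f := fun p => -(f p).im) (by simpa using hf.im.neg))
  · exact (hX.smul hf.im).add (hY.smul hf.re)
  · simp only []
    rw [hZ p hp, smul_cVec]

lemma SmCV.conjC {Z : ∀ p : M, ℂT p} (hZ : SmCV Z U) : SmCV (fun p => conjC (Z p)) U := by
  obtain ⟨X, Y, hX, hY, hZ⟩ := hZ
  refine ⟨X, fun p => (-1 : ℝ) • Y p, hX, hY.smul (f := fun _ => -1) ?_, fun p hp => ?_⟩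
  · simpa using smFn_const (-1) U
  · simp only []
    rw [hZ p hp, conjC_cVec, neg_one_smul]

lemma SmVF.smCV {X : ∀ p : M, TS p} (hX : SmVF X U) : SmCV (fun p => (1 : ℂ) ⊗ₜ[ℝ] X p) U :=
  ⟨X, fun p => (0 : ℝ) • X p, hX, hX.smul (f := fun _ => 0) (by simpa using smFn_const 0 U),
    fun p _ => by simp [cVec]⟩

/-- Contraction with a smooth complex vector field. -/
lemma SmCV.exists_contraction {Z : ∀ p : M, ℂT p} (hZ : SmCV Z U)
    {ω : Ω (k + 1)} (hω : SmoothOn ω U) : ∃ η : Ω k, SmoothOn η U ∧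
      ∀ p ∈ U, (η p).toAlternatingMap = iC (Z p) (ω p).toAlternatingMap := by
  obtain ⟨X, Y, hX, hY, hZ⟩ := hZ
  refine ⟨iVF X ω + I • iVF Y ω, (hω.iVF hX).add ((hω.iVF hY).const_smul _), fun p hp => ?_⟩
  rw [hZ p hp, cVec, iC_add_left, iC_tmul, iC_tmul, one_smul]
  rfl

lemma SmCV.smFn_e1 {Z : ∀ p : M, ℂT p} (hZ : SmCV Z U)
    {ω : Ω 1} (hω : SmoothOn ω U) : SmFn (fun p => e1 ω p (Z p)) U := by
  obtain ⟨η, hη, h⟩ := hZ.exists_contraction hω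
  refine hη.smFn_apply_zero.congr fun p hp => ?_
  rw [e1, evalC, cEval_cons, ← h p hp]
  rfl

lemma SmCV.smFn_e2 {Z W : ∀ p : M, ℂT p} (hZ : SmCV Z U) (hW : SmCV W U)
    {ω : Ω 2} (hω : SmoothOn ω U) : SmFn (fun p => e2 ω p (Z p) (W p)) U := by
  obtain ⟨η, hη, h⟩ := hZ.exists_contraction hω
  refine (hW.smFn_e1 hη).congr fun p hp => ?_
  rw [e2, evalC, cEval_cons, ← h p hp]
  rfl

lemma SmCV.smFn_e3 {Z W Y : ∀ p : M, ℂT p} (hZ : SmCV Z U) (hW : SmCV W U)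
    (hY : SmCV Y U) {ω : Ω 3} (hω : SmoothOn ω U) : SmFn (fun p => e3 ω p (Z p) (W p) (Y p)) U := by
  obtain ⟨η, hη, h⟩ := hZ.exists_contraction hω
  refine (hW.smFn_e2 hY hη).congr fun p hp => ?_
  rw [e3, evalC, cEval_cons, ← h p hp]
  rfl

lemma SmCV.smFn_e4 {Z W Y A : ∀ p : M, ℂT p} (hZ : SmCV Z U)
    (hW : SmCV W U) (hY : SmCV Y U) (hA : SmCV A U) {ω : Ω 4} (hω : SmoothOn ω U) :
    SmFn (fun p => e4 ω p (Z p) (W p) (Y p) (A p)) U := by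
  obtain ⟨η, hη, h⟩ := hZ.exists_contraction hω
  refine (hW.smFn_e3 hY hA hη).congr fun p hp => ?_
  rw [e4, evalC, cEval_cons, ← h p hp]
  rfl

variable {T10 : CDistribution M} {θ : CForm M 1} {x : M} {f : M → ℝ}

lemma vRep_self (X : ∀ p : M, TS p) (x : M) : vRep X x (Φ x x) = dC x x (X x) := by
  rw [vRep, (Φ x).left_inv (mem_extChartAt_source x)]

lemma mpullback_eq_vRep (X : ∀ p : M, TS p) (x : M) {y : E5} (hy : y ∈ (Φ x).target) :
    VectorField.mpullbackWithin 𝓔 𝓔 (Φ x).symm X (Set.range 𝓔) y = vRep X x y := by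
  rw [VectorField.mpullbackWithin_apply, ModelWithCorners.range_eq_univ, mfderivWithin_univ]
  have h : ContinuousLinearMap.inverse (dS x y) = dC x ((Φ x).symm y) := by
    apply ContinuousLinearMap.inverse_eq
    · ext1 v
      have := dS_dC ((Φ x).map_target hy) v
      rwa [(Φ x).right_inv hy] at this
    · ext1 v
      exact dC_dS hy v
  exact congrArg (fun L : E5 →L[ℝ] E5 => L (X ((Φ x).symm y))) h

lemma mlieBracket_eq (X Y : ∀ p : M, TS p) (x : M) : VectorField.mlieBracket 𝓔 X Y x = dS x (Φ x x)
      (VectorField.lieBracket ℝ (vRep X x) (vRep Y x) (Φ x x)) := by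
  rw [← VectorField.mlieBracketWithin_univ, VectorField.mlieBracketWithin_apply,
    Set.preimage_univ, Set.univ_inter]
  have h : ContinuousLinearMap.inverse (dC x x) = dS x (Φ x x) := by
    apply ContinuousLinearMap.inverse_eq
    · ext1 v
      have := dC_dS ((Φ x).map_source (mem_extChartAt_source x)) v
      rwa [(Φ x).left_inv (mem_extChartAt_source x)] at this
    · ext1 v
      exact dS_dC (mem_extChartAt_source x) v
  have hev : ∀ Z : ∀ p : M, TS p, VectorField.mpullbackWithin 𝓔 𝓔
      (Φ x).symm Z (Set.range 𝓔) =ᶠ[nhds (Φ x x)]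
      vRep Z x := by
    intro Z
    filter_upwards [(isOpen_extChartAt_target x).mem_nhds
      ((Φ x).map_source (mem_extChartAt_source x))] with y hy
    exact mpullback_eq_vRep Z x hy
  have h2 : VectorField.lieBracketWithin ℝ
      (VectorField.mpullbackWithin 𝓔 𝓔 (Φ x).symm X
        (Set.range 𝓔))
      (VectorField.mpullbackWithin 𝓔 𝓔 (Φ x).symm Y
        (Set.range 𝓔)) (Set.range 𝓔) (Φ x x) =
      VectorField.lieBracket ℝ (vRep X x) (vRep Y x) (Φ x x) := by
    have hh : ∀ A B : E5 → E5, A =ᶠ[nhds (Φ x x)] vRep X x → B =ᶠ[nhds (Φ x x)] vRep Y x →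
        VectorField.lieBracketWithin ℝ A B (Set.range 𝓔) (Φ x x) =
        VectorField.lieBracket ℝ (vRep X x) (vRep Y x) (Φ x x) := by
      intro A B hA hB
      rw [ModelWithCorners.range_eq_univ, VectorField.lieBracketWithin_univ]
      exact Filter.EventuallyEq.lieBracket_vectorField_eq hA hB
    exact hh _ _ (hev X) (hev Y)
  rw [h2]
  exact congrArg (fun L : E5 →L[ℝ] E5 => L (VectorField.lieBracket ℝ (vRep X x) (vRep Y x)
    (Φ x x))) h

lemma asA_one_apply_dS (α : Ω 1) (x : M) {y : E5} (v : E5) :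
    inChart α x y ![v] = asA α ((Φ x).symm y) ![dS x y v] := by
  rw [inChart_eq, ContinuousAlternatingMap.compContinuousLinearMap_apply]
  congr 1
  funext i; fin_cases i; rfl

/-- Cartan's formula for the exterior derivative of a one-form. -/
lemma d1_apply_vectorFields {α : Ω 1} (hU : IsOpen U) (hα : SmoothOn α U)
    {X Y : ∀ p : M, TS p} (hX : SmVF X U) (hY : SmVF Y U) {x : M} (hx : x ∈ U) :
    d1 α x ![X x, Y x] = dFn (fun p => α p ![Y p]) x ![X x] - dFn (fun p => α p ![X p]) x ![Y x]
      - α x ![VectorField.mlieBracket 𝓔 X Y x] := by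
  have hd := hα.diffAt hU hx
  have hV : ∀ i, DifferentiableAt ℝ ((![vRep X x, vRep Y x] : Fin 2 → E5 → E5) i)
      (Φ x x) := by
    intro i
    fin_cases i
    · exact ((hX x).contDiffAt ((isOpen_chDom x hU).mem_nhds (mem_chDom_self hx))).differentiableAt
        (by simp)
    · exact ((hY x).contDiffAt ((isOpen_chDom x hU).mem_nhds (mem_chDom_self hx))).differentiableAt
        (by simp)
  have key := extDeriv_apply_vectorField hd hV
  have hfun : ∀ Z : ∀ p : M, TS p, (fun y => inChart α x y ![vRep Z x y])
      =ᶠ[nhds (Φ x x)]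
      fun y => (fun p => α p ![Z p]) ((Φ x).symm y) := by
    intro Z
    filter_upwards [(isOpen_extChartAt_target x).mem_nhds
      ((Φ x).map_source (mem_extChartAt_source x))] with y hy
    rw [asA_one_apply_dS]
    have := dS_dC ((Φ x).map_target hy) (Z ((Φ x).symm y))
    rw [(Φ x).right_inv hy] at this
    rw [vRep, this]
    rfl
  have hD : ∀ Z W : ∀ p : M, TS p, fderiv ℝ (fun y => inChart α x y ![vRep Z x y])
      (Φ x x) (vRep W x (Φ x x)) =
      dFn (fun p => α p ![Z p]) x ![W x] := by
    intro Z W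
    rw [(hfun Z).fderiv_eq, vRep_self]
    exact (asA_dFn_apply (fun p => α p ![Z p]) x ![W x]).symm
  have e0 : d1 α x ![X x, Y x] = extDeriv (inChart α x) (Φ x x)
      (fun i => (![vRep X x, vRep Y x] : Fin 2 → E5 → E5) i (Φ x x)) := by
    have h1 : d1 α x ![X x, Y x] = extDeriv (inChart α x) (Φ x x)
      (fun i => dC x x ((![X x, Y x] : Fin 2 → TS x) i)) := rfl
    rw [h1]
    congr 1
    funext i
    fin_cases i
    · exact (vRep_self X x).symm
    · exact (vRep_self Y x).symm
  rw [e0, key, Fin.sum_univ_two]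
  have r0 : ∀ y, (0 : Fin 2).removeNth
      (fun i => (![vRep X x, vRep Y x] : Fin 2 → E5 → E5) i y) = ![vRep Y x y] := by
    intro y; funext i; fin_cases i; rfl
  have r1 : ∀ y, (1 : Fin 2).removeNth
      (fun i => (![vRep X x, vRep Y x] : Fin 2 → E5 → E5) i y) = ![vRep X x y] := by
    intro y; funext i; fin_cases i; rfl
  simp only [r0, r1]
  have h1 := hD Y X
  have h2 := hD X Y
  have h3 : α x ![VectorField.mlieBracket 𝓔 X Y x] = inChart α x (Φ x x)
      ![VectorField.lieBracket ℝ (vRep X x) (vRep Y x) (Φ x x)] := by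
    rw [asA_one_apply_dS, mlieBracket_eq, (Φ x).left_inv
      (mem_extChartAt_source x)]
    rfl
  rw [h3]
  simp only [Matrix.cons_val_zero, Matrix.cons_val_one]
  rw [h1, h2]
  simp
  rw [Subsingleton.elim (Fin.tail _) ![]]
  ring

lemma cVec_eq {V : Type*} [AddCommGroup V] [Module ℝ V] (u v : V) :
    cVec u v = (1 : ℂ) ⊗ₜ[ℝ] u + I • ((1 : ℂ) ⊗ₜ[ℝ] v) := by
  rw [cVec, TensorProduct.smul_tmul', smul_eq_mul, mul_one]

lemma e1_cVec (α : Ω 1) (x : M) (u v : TS x) : e1 α x (cVec u v) = α x ![u] + I * α x ![v] := by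
  rw [cVec_eq, e1_add_vec, e1_smul_vec, e1_real, e1_real]

lemma e2_cVec (α : Ω 2) (x : M) (u v u' v' : TS x) :
    e2 α x (cVec u v) (cVec u' v') = α x ![u, u'] - α x ![v, v']
      + I * (α x ![u, v'] + α x ![v, u']) := by
  rw [cVec_eq, cVec_eq]
  simp only [e2_add_left, e2_add_right, e2_smul_left, e2_smul_right, e2_real]
  linear_combination (α x ![v, v']) * I_mul_I

/-- Smooth one-forms annihilating `T¹⁰` generate a differential ideal. -/
lemma e2_d1_eq_zero (hT10 : IsCRStructure T10) {α : Ω 1} (hU : IsOpen U)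
    (hα : SmoothOn α U) (h0 : ∀ y ∈ U, ∀ Z ∈ T10 y, e1 α y Z = 0) {x : M} (hx : x ∈ U)
    {Z W : ℂT x} (hZ : Z ∈ T10 x) (hW : W ∈ T10 x) : e2 (d1 α) x Z W = 0 := by
  obtain ⟨U', hU', hxU', X, Y, hXY, hspan⟩ := hT10.smooth x
  have hV : IsOpen (U ∩ U') := hU.inter hU'
  have hxV : x ∈ U ∩ U' := ⟨hx, hxU'⟩
  have hmem : ∀ a, ∀ y ∈ U', cVec (X a y) (Y a y) ∈ T10 y := by
    intro a y hy
    rw [hspan y hy]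
    exact Submodule.subset_span ⟨a, rfl⟩
  have hXs : ∀ a, SmVF (X a) (U ∩ U') := fun a => ((hXY a).1.smVF hU').mono inter_subset_right
  have hYs : ∀ a, SmVF (Y a) (U ∩ U') := fun a => ((hXY a).2.smVF hU').mono inter_subset_right
  have hαs : SmoothOn α (U ∩ U') := hα.mono inter_subset_left
  have hfn : ∀ Q : ∀ p : M, TS p, SmVF Q (U ∩ U') → SmFn (fun p => α p ![Q p]) (U ∩ U') :=
    fun Q hQ => (hQ.smCV.smFn_e1 hαs).congr fun p _ => (e1_real α p (Q p)).symm
  have hAB : ∀ a, dFn (fun p => α p ![X a p]) x + I • dFn (fun p => α p ![Y a p]) x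
      = 0 := by
    intro a
    have h1 : dFn (fun p => α p ![X a p] + I * α p ![Y a p]) x = 0 := by
      rw [dFn_congr hV hxV (g := fun _ => 0), dFn_const]
      intro y hy
      rw [← e1_cVec]
      exact h0 y hy.1 _ (hmem a y hy.2)
    rw [dFn_add hV hxV (hfn _ (hXs a)) ((smFn_const _ _).mul (hfn _ (hYs a))),
      dFn_mul hV hxV (smFn_const _ _) (hfn _ (hYs a)), dFn_const] at h1
    rw [← h1]
    module
  have key : ∀ a b, e2 (d1 α) x (cVec (X a x) (Y a x)) (cVec (X b x) (Y b x)) = 0 := by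
    intro a b
    have hb := hT10.involutive (U ∩ U') hV (X a) (Y a) (X b) (Y b)
      ((hXY a).1.mono inter_subset_right) ((hXY a).2.mono inter_subset_right)
      ((hXY b).1.mono inter_subset_right) ((hXY b).2.mono inter_subset_right)
      (fun y hy => hmem a y hy.2) (fun y hy => hmem b y hy.2) x hxV
    have hb2 := h0 x hx _ hb
    rw [e1_cVec] at hb2
    have hsub : ∀ u v : TS x, α x ![u - v] = α x ![u] - α x ![v] := fun u v => by
      rw [← e1_real, ← e1_real, ← e1_real, sub_eq_add_neg, TensorProduct.tmul_add, e1_add_vec,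
        TensorProduct.tmul_neg, ← neg_one_smul ℂ, e1_smul_vec]
      ring
    have hadd : ∀ u v : TS x, α x ![u + v] = α x ![u] + α x ![v] := fun u v => by
      rw [← e1_real, ← e1_real, ← e1_real, TensorProduct.tmul_add, e1_add_vec]
    rw [hsub, hadd] at hb2
    rw [e2_cVec, d1_apply_vectorFields hV hαs (hXs a) (hXs b) hxV,
      d1_apply_vectorFields hV hαs (hYs a) (hYs b) hxV,
      d1_apply_vectorFields hV hαs (hXs a) (hYs b) hxV,
      d1_apply_vectorFields hV hαs (hYs a) (hXs b) hxV]
    have c1 := fun u => congrArg (fun f : TS x [⋀^Fin 1]→L[ℝ] ℂ => f u) (hAB a)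
    have c2 := fun u => congrArg (fun f : TS x [⋀^Fin 1]→L[ℝ] ℂ => f u) (hAB b)
    simp only [ContinuousAlternatingMap.add_apply, ContinuousAlternatingMap.smul_apply,
      ContinuousAlternatingMap.coe_zero, Pi.zero_apply, smul_eq_mul] at c1 c2
    linear_combination c2 ![X a x] + I * c2 ![Y a x] - c1 ![X b x]
      - I * c1 ![Y b x] - hb2 - dFn (fun p => α p ![Y b p]) x ![Y a x] * I_mul_I
      + dFn (fun p => α p ![Y a p]) x ![Y b x] * I_mul_I
  rw [hspan x hxU', Submodule.mem_span_range_iff_exists_fun] at hZ hW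
  obtain ⟨c, rfl⟩ := hZ
  obtain ⟨d, rfl⟩ := hW
  simp only [Fin.sum_univ_two, e2_add_left, e2_add_right, e2_smul_left, e2_smul_right, key]
  ring

lemma e2_d1_eq_zero_conj (hT10 : IsCRStructure T10) {α : Ω 1} (hU : IsOpen U)
    (hα : SmoothOn α U) (h0 : ∀ y ∈ U, ∀ Z, conjC Z ∈ T10 y → e1 α y Z = 0) {x : M} (hx : x ∈ U)
    {Z W : ℂT x} (hZ : conjC Z ∈ T10 x) (hW : conjC W ∈ T10 x) : e2 (d1 α) x Z W = 0 := by
  have h := e2_d1_eq_zero hT10 hU hα.conjF (fun y hy Z hZ => by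
    rw [e1_conjF, h0 y hy _ (by rwa [conjC_conjC]), map_zero]) hx hZ hW
  have h2 : e2 (d1 (conjF α)) x (conjC Z) (conjC W) = e2 (conjF (d1 α)) x (conjC Z) (conjC W) := by
    rw [e2, e2, show d1 (conjF α) x = conjF (d1 α) x from extD_conjF hU hx hα]
  rw [h2, e2_conjF, conjC_conjC, conjC_conjC] at h
  simpa using h

/-- A frame of `ℂ ⊗ T_xM` adapted to a contact form: `T` is the Reeb vector, `Z₁, Z₂` span `T¹⁰`,
`W₁, W₂` span its conjugate, and `dθ(Z_a, W_b) = i δ_ab`. -/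
structure SF (T10 : CDistribution M) (θ : Ω 1) (x : M) where
  T : ℂT x
  Z1 : ℂT x
  Z2 : ℂT x
  W1 : ℂT x
  W2 : ℂT x
  mZ1 : Z1 ∈ T10 x
  mZ2 : Z2 ∈ T10 x
  mW1 : conjC W1 ∈ T10 x
  mW2 : conjC W2 ∈ T10 x
  spanZ : ∀ Z ∈ T10 x, ∃ a b : ℂ, Z = a • Z1 + b • Z2
  tT : e1 θ x T = 1
  tZ1 : e1 θ x Z1 = 0
  tZ2 : e1 θ x Z2 = 0
  tW1 : e1 θ x W1 = 0
  tW2 : e1 θ x W2 = 0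
  dTZ1 : e2 (d1 θ) x T Z1 = 0
  dTZ2 : e2 (d1 θ) x T Z2 = 0
  dTW1 : e2 (d1 θ) x T W1 = 0
  dTW2 : e2 (d1 θ) x T W2 = 0
  dZZ : e2 (d1 θ) x Z1 Z2 = 0
  dWW : e2 (d1 θ) x W1 W2 = 0
  d11 : e2 (d1 θ) x Z1 W1 = I
  d12 : e2 (d1 θ) x Z1 W2 = 0
  d21 : e2 (d1 θ) x Z2 W1 = 0
  d22 : e2 (d1 θ) x Z2 W2 = I

/-- The vectors of an adapted frame as a family. -/
def SF.vec (F : SF T10 θ x) : Fin 5 → ℂT x := ![F.T, F.Z1, F.Z2, F.W1, F.W2]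

lemma SF.linearIndependent (F : SF T10 θ x) : LinearIndependent ℂ F.vec := by
  rw [Fintype.linearIndependent_iff]
  intro g hg
  simp only [Fin.sum_univ_five, SF.vec, Matrix.cons_val] at hg
  have h0 := congrArg (e1 θ x) hg
  have h1 := congrArg (fun v => e2 (d1 θ) x v F.W1) hg
  have h2 := congrArg (fun v => e2 (d1 θ) x v F.W2) hg
  have h3 := congrArg (fun v => e2 (d1 θ) x F.Z1 v) hg
  have h4 := congrArg (fun v => e2 (d1 θ) x F.Z2 v) hg
  have hI := I_ne_zero
  simp only [e1_add_vec, e1_smul_vec, e1_zero_vec, F.tT, F.tZ1, F.tZ2, F.tW1, F.tW2,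
    e2_add_left, e2_smul_left, e2_add_right, e2_smul_right, e2_zero_left, e2_zero_right,
    F.dTW1, F.dTW2, F.d11, F.d12, F.d21, F.d22, F.dZZ, e2_self, e2_swap F.W2 F.W1, F.dWW,
    e2_swap F.Z1 F.T, e2_swap F.Z2 F.T, F.dTZ1, F.dTZ2, e2_swap F.Z2 F.Z1,
    mul_zero, mul_one, add_zero, zero_add, neg_zero, mul_eq_zero, hI, or_false] at h0 h1 h2 h3 h4
  intro i
  fin_cases i <;> assumption

lemma finrank_complexTangent (x : M) : Module.finrank ℂ (ℂT x) = 5 := by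
  rw [Module.finrank_baseChange]
  exact finrank_euclideanSpace_fin

/-- An adapted frame as a basis. -/
def SF.basis (F : SF T10 θ x) : Module.Basis (Fin 5) ℂ (ℂT x) :=
  basisOfLinearIndependentOfCardEqFinrank F.linearIndependent (by
    rw [finrank_complexTangent]; rfl)

lemma SF.basis_apply (F : SF T10 θ x) (i : Fin 5) : F.basis i = F.vec i := by simp [SF.basis]

lemma SF.span (F : SF T10 θ x) : Submodule.span ℂ (Set.range F.vec) = ⊤ := by
  have : Set.range F.vec = Set.range F.basis := by congr 1; funext i; exact (F.basis_apply i).symm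
  rw [this, F.basis.span_eq]

lemma SF.spanW (F : SF T10 θ x) (W : ℂT x) (hW : conjC W ∈ T10 x) :
    ∃ a b : ℂ, W = a • F.W1 + b • F.W2 := by
  obtain ⟨p, q, h1⟩ := F.spanZ _ F.mW1
  obtain ⟨r, s, h2⟩ := F.spanZ _ F.mW2
  obtain ⟨u, v, h3⟩ := F.spanZ _ hW
  have e1 : F.W1 = (cj p) • conjC F.Z1 + (cj q) • conjC F.Z2 := by
    rw [← conjC_conjC F.W1, h1, map_add, conjC_smul, conjC_smul]
  have e2 : F.W2 = (cj r) • conjC F.Z1 + (cj s) • conjC F.Z2 := by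
    rw [← conjC_conjC F.W2, h2, map_add, conjC_smul, conjC_smul]
  have e3 : W = (cj u) • conjC F.Z1 + (cj v) • conjC F.Z2 := by
    rw [← conjC_conjC W, h3, map_add, conjC_smul, conjC_smul]
  by_cases hD : (cj p) * (cj s) - (cj q) * (cj r) = 0
  · exfalso
    have hli := Fintype.linearIndependent_iff.1 F.linearIndependent
    have k1 := hli ![0, 0, 0, cj s, -cj q] (by
      simp only [Fin.sum_univ_five, SF.vec, Matrix.cons_val]
      rw [e1, e2]
      calc _ = ((cj p) * (cj s) - (cj q) * (cj r))
            • conjC F.Z1 := by module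
        _ = 0 := by rw [hD, zero_smul])
    have k2 := hli ![0, 0, 0, cj r, -cj p] (by
      simp only [Fin.sum_univ_five, SF.vec, Matrix.cons_val]
      rw [e1, e2]
      calc _ = -((cj p) * (cj s) - (cj q) * (cj r))
            • conjC F.Z2 := by module
        _ = 0 := by rw [hD, neg_zero, zero_smul])
    have hs : cj s = 0 := k1 3
    have hr : cj r = 0 := k2 3
    have hW2 : F.W2 = 0 := by rw [e2, hs, hr]; simp
    have h := F.d22
    rw [hW2, e2_zero_right] at h
    exact I_ne_zero h.symm
  · obtain ⟨D, hDD⟩ : ∃ D, D = (cj p) * (cj s)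
        - (cj q) * (cj r) := ⟨_, rfl⟩
    rw [← hDD] at hD
    refine ⟨(cj u * cj s - cj v * cj r) / D, (cj v * cj p - cj u * cj q) / D, ?_⟩
    rw [e1, e2, e3]
    match_scalars <;> field_simp <;> rw [hDD] <;> ring

/-- The Reeb vector is unique. -/
lemma SF.eq_T (F : SF T10 θ x) {v : ℂT x} (h1 : e1 θ x v = 1)
    (h2 : ∀ w, e2 (d1 θ) x v w = 0) : v = F.T := by
  have hv : v ∈ Submodule.span ℂ (Set.range F.vec) := by rw [F.span]; trivial
  rw [Submodule.mem_span_range_iff_exists_fun] at hv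
  obtain ⟨c, rfl⟩ := hv
  simp only [Fin.sum_univ_five, SF.vec, Matrix.cons_val] at h1 h2 ⊢
  have k1 := h2 F.W1
  have k2 := h2 F.W2
  have k3 := h2 F.Z1
  have k4 := h2 F.Z2
  have hI := I_ne_zero
  simp only [e1_add_vec, e1_smul_vec, F.tT, F.tZ1, F.tZ2, F.tW1, F.tW2,
    e2_add_left, e2_smul_left, F.dTW1, F.dTW2, F.dTZ1, F.dTZ2, F.d11, F.d12, F.d21, F.d22, e2_self,
    F.dZZ, F.dWW, e2_swap F.W2 F.W1, e2_swap F.Z2 F.Z1, e2_swap F.W1 F.Z1, e2_swap F.W2 F.Z1,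
    e2_swap F.W1 F.Z2, e2_swap F.W2 F.Z2,
    mul_zero, mul_one, add_zero, zero_add, neg_zero, mul_eq_zero, hI, or_false, mul_neg,
    neg_eq_zero] at h1 k1 k2 k3 k4
  rw [h1, k1, k2, k3, k4]
  simp

lemma SF.dT (F : SF T10 θ x) (w : ℂT x) : e2 (d1 θ) x F.T w = 0 := by
  have hw : w ∈ Submodule.span ℂ (Set.range F.vec) := by rw [F.span]; trivial
  rw [Submodule.mem_span_range_iff_exists_fun] at hw
  obtain ⟨c, rfl⟩ := hw
  simp [Fin.sum_univ_five, SF.vec, e2_add_right, e2_smul_right, F.dTZ1, F.dTZ2, F.dTW1, F.dTW2,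
    e2_self]

lemma SF.T_eq (F G : SF T10 θ x) : F.T = G.T := G.eq_T F.tT F.dT

lemma IsContactForm.e1_conj (hθ : IsContactForm T10 θ) (a : ℂT x) :
    e1 θ x (conjC a) = cj (e1 θ x a) := by
  have := e1_conjF x (conjC a) θ
  rwa [hθ.real, conjC_conjC] at this

lemma IsContactForm.conjF_d1 (hθ : IsContactForm T10 θ) : conjF (d1 θ) = d1 θ := by
  funext x
  have : d1 (conjF θ) x = conjF (d1 θ) x := extD_conjF isOpen_univ (mem_univ x) hθ.smooth
  rw [← this, hθ.real]

lemma IsContactForm.e2_conj (hθ : IsContactForm T10 θ) (a b : ℂT x) :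
    e2 (d1 θ) x (conjC a) (conjC b) = cj (e2 (d1 θ) x a b) := by
  have := e2_conjF x (conjC a) (conjC b) (d1 θ)
  rwa [hθ.conjF_d1, conjC_conjC, conjC_conjC] at this

lemma SF.conjT (hθ : IsContactForm T10 θ) (F : SF T10 θ x) : conjC F.T = F.T := by
  apply F.eq_T
  · rw [hθ.e1_conj, F.tT, map_one]
  · intro w
    rw [← conjC_conjC w, hθ.e2_conj, F.dT, map_zero]

lemma IsContactForm.e1_T10 (hθ : IsContactForm T10 θ) {Z : ℂT x}
    (hZ : Z ∈ T10 x) : e1 θ x Z = 0 := by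
  obtain ⟨u, v, rfl⟩ := exists_cVec Z
  have hu : θ x ![u] = 0 := (hθ.ker x u).2 ⟨(1 / 2 : ℂ) • cVec u v, (T10 x).smul_mem _ hZ,
    (1 / 2 : ℂ) • cVec u v, (T10 x).smul_mem _ hZ, by
      rw [conjC_smul, conjC_cVec, cVec_eq, cVec_eq, TensorProduct.tmul_neg,
        show cj (1 / 2 : ℂ) = 1 / 2 by rw [map_div₀, map_one, map_ofNat]]
      module⟩
  have hv : θ x ![v] = 0 := (hθ.ker x v).2 ⟨(-I / 2 : ℂ) • cVec u v,
    (T10 x).smul_mem _ hZ, (-I / 2 : ℂ) • cVec u v, (T10 x).smul_mem _ hZ, by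
      rw [conjC_smul, conjC_cVec, cVec_eq, cVec_eq, TensorProduct.tmul_neg,
        show cj (-I / 2 : ℂ) = I / 2 by
          rw [map_div₀, map_neg, conj_I, map_ofNat, neg_neg]]
      match_scalars
      · linear_combination I_mul_I
      · ring⟩
  rw [e1_cVec, hu, hv]
  simp

lemma IsContactForm.e1_T01 (hθ : IsContactForm T10 θ) {Z : ℂT x}
    (hZ : conjC Z ∈ T10 x) : e1 θ x Z = 0 := by
  rw [← conjC_conjC Z, hθ.e1_conj, hθ.e1_T10 hZ, map_zero]

lemma IsContactForm.e2_T10 (hT10 : IsCRStructure T10) (hθ : IsContactForm T10 θ)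
    {Z W : ℂT x} (hZ : Z ∈ T10 x) (hW : W ∈ T10 x) : e2 (d1 θ) x Z W = 0 :=
  e2_d1_eq_zero hT10 isOpen_univ hθ.smooth (fun _ _ _ h => hθ.e1_T10 h) (mem_univ x) hZ hW

lemma IsContactForm.e2_T01 (hT10 : IsCRStructure T10) (hθ : IsContactForm T10 θ)
    {Z W : ℂT x} (hZ : conjC Z ∈ T10 x) (hW : conjC W ∈ T10 x) : e2 (d1 θ) x Z W = 0 :=
  e2_d1_eq_zero_conj hT10 isOpen_univ hθ.smooth (fun _ _ _ h => hθ.e1_T01 h) (mem_univ x) hZ hW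

lemma SmFn.exists_ne_zero {f : M → ℂ} (hf : SmFn f U) (hU : IsOpen U)
    (hx : x ∈ U) (h0 : f x ≠ 0) : ∃ V, IsOpen V ∧ x ∈ V ∧ V ⊆ U ∧ ∀ y ∈ V, f y ≠ 0 := by
  have hc : ContinuousAt (fun y => f ((Φ x).symm y))
      (Φ x x) :=
    ((hf x).contDiffAt ((isOpen_chDom x hU).mem_nhds (mem_chDom_self hx))).continuousAt
  have h1 : ∀ᶠ y in nhds (Φ x x),
      f ((Φ x).symm y) ≠ 0 := by
    apply hc.eventually_ne
    rwa [(Φ x).left_inv (mem_extChartAt_source x)]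
  have h2 : ∀ᶠ p in nhds x, f ((Φ x).symm (Φ x p)) ≠ 0 := (continuousAt_extChartAt x).eventually h1
  have h3 : ∀ᶠ p in nhds x, f p ≠ 0 ∧ p ∈ U := by
    filter_upwards [h2, extChartAt_source_mem_nhds (I := 𝓔) x, hU.mem_nhds hx] with p hp hs hu
    rw [(Φ x).left_inv hs] at hp
    exact ⟨hp, hu⟩
  obtain ⟨V, hV, hVo, hxV⟩ := eventually_nhds_iff.1 h3
  exact ⟨V, hVo, hxV, fun y hy => (hV y hy).2, fun y hy => (hV y hy).1⟩

lemma SmCV.congr {Z Z' : ∀ p : M, ℂT p} (hZ : SmCV Z U) (h : ∀ p ∈ U, Z' p = Z p) : SmCV Z' U := by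
  obtain ⟨X, Y, hX, hY, hZ⟩ := hZ
  exact ⟨X, Y, hX, hY, fun p hp => (h p hp).trans (hZ p hp)⟩

/-- Two vectors spanning a plane are independent. -/
lemma coeff_eq_zero_of_finrank {V : Type*} [AddCommGroup V] [Module ℂ V] {z : Fin 2 → V}
    (h : Module.finrank ℂ (Submodule.span ℂ (Set.range z)) = 2) : LinearIndependent ℂ z :=
  linearIndependent_iff_card_eq_finrank_span.2 (by rw [Set.finrank, h]; rfl)

lemma exists_theta_ne_zero (hT10 : IsCRStructure T10) (hθ : IsContactForm T10 θ) (x : M) :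
    ∃ v : TS x, θ x ![v] ≠ 0 := by
  by_contra! hcon
  have hfin : Module.Finite ℂ (ℂT x) := inferInstance
  have h2 := hT10.rank x
  obtain ⟨U, _, hxU, X, Y, _, hspan⟩ := hT10.smooth x
  have hs := hspan x hxU
  set z : Fin 2 → ℂT x := fun a => cVec (X a x) (Y a x)
  let S : Submodule ℂ (ℂT x) := Submodule.span ℂ (Set.range ![z 0, z 1, conjC (z 0), conjC (z 1)])
  have hz : ∀ i, ![z 0, z 1, conjC (z 0), conjC (z 1)] i ∈ S := fun i => Submodule.subset_span ⟨i, rfl⟩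
  have hreal : ∀ v : TS x, (1 : ℂ) ⊗ₜ[ℝ] v ∈ S := by
    intro v
    obtain ⟨Z, hZ, W, hW, h⟩ := (hθ.ker x v).1 (hcon v)
    rw [hs, Submodule.mem_span_range_iff_exists_fun] at hZ hW
    obtain ⟨c, rfl⟩ := hZ
    obtain ⟨d, rfl⟩ := hW
    rw [h]
    simp only [Fin.sum_univ_two, map_add, conjC_smul]
    exact S.add_mem (S.add_mem (S.smul_mem _ (hz 0)) (S.smul_mem _ (hz 1)))
      (S.add_mem (S.smul_mem _ (hz 2)) (S.smul_mem _ (hz 3)))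
  have htop : S = ⊤ := by
    rw [eq_top_iff]
    intro w _
    induction w using TensorProduct.induction_on with
    | zero => exact S.zero_mem
    | tmul c v =>
      have := S.smul_mem c (hreal v)
      rwa [TensorProduct.smul_tmul', smul_eq_mul, mul_one] at this
    | add a b ha hb => exact S.add_mem (ha trivial) (hb trivial)
  have hle : Module.finrank ℂ S ≤ 4 := by
    have := finrank_range_le_card (R := ℂ) (![z 0, z 1, conjC (z 0), conjC (z 1)])
    simpa [Set.finrank] using this
  rw [htop, finrank_top, finrank_complexTangent] at hle
  omega

/-- Smooth local adapted frames. -/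
structure SmSF (F : ∀ y, SF T10 θ y) (U : Set M) : Prop where
  isOpen : IsOpen U
  T : SmCV (fun y => (F y).T) U
  Z1 : SmCV (fun y => (F y).Z1) U
  Z2 : SmCV (fun y => (F y).Z2) U
  W1 : SmCV (fun y => (F y).W1) U
  W2 : SmCV (fun y => (F y).W2) U

lemma exists_local_frame_aux (hT10 : IsCRStructure T10) (hθ : IsContactForm T10 θ) (x : M) :
    ∃ U : Set M, IsOpen U ∧ x ∈ U ∧ ∃ T Z1 Z2 W1 W2 : ∀ y : M, ℂT y,
      SmCV T U ∧ SmCV Z1 U ∧ SmCV Z2 U ∧ SmCV W1 U ∧ SmCV W2 U ∧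
      ∀ y ∈ U, ∃ F : SF T10 θ y, F.T = T y ∧ F.Z1 = Z1 y ∧ F.Z2 = Z2 y ∧ F.W1 = W1 y ∧
        F.W2 = W2 y := by
  obtain ⟨U₀, hU₀, hxU₀, X, Y, hXY, hspan⟩ := hT10.smooth x
  obtain ⟨v, hv⟩ := exists_theta_ne_zero hT10 hθ x
  have hθU : ∀ U : Set M, SmoothOn θ U := fun U => hθ.smooth.mono (subset_univ U)
  have hdθU : ∀ U : Set M, SmoothOn (d1 θ) U := fun U =>
    (hθ.smooth.d1 isOpen_univ).mono (subset_univ U)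
  let T0 : ∀ y : M, TS y := coordVF x (dC x x v)
  have hT0 : SmVF T0 (Φ x).source := smVF_coordVF x _
  have hT0x : T0 x = v := dS_dC (mem_extChartAt_source x) v
  have ht : SmFn (fun y => e1 θ y ((1 : ℂ) ⊗ₜ[ℝ] T0 y))
      (U₀ ∩ (Φ x).source) :=
    (hT0.mono inter_subset_right).smCV.smFn_e1 (hθU _)
  obtain ⟨U, hU, hxU, hUsub, hne⟩ := ht.exists_ne_zero
    (hU₀.inter (isOpen_extChartAt_source x)) ⟨hxU₀, mem_extChartAt_source x⟩ (by
      simp only [hT0x]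
      rw [e1_real]
      exact hv)
  let z : Fin 2 → ∀ y : M, ℂT y := fun a y => cVec (X a y) (Y a y)
  have hzs : ∀ a, SmCV (z a) U := fun a =>
    ⟨X a, Y a, ((hXY a).1.smVF hU₀).mono fun y hy => (hUsub hy).1,
      ((hXY a).2.smVF hU₀).mono fun y hy => (hUsub hy).1, fun _ _ => rfl⟩
  have hzm : ∀ a, ∀ y ∈ U, z a y ∈ T10 y := by
    intro a y hy
    rw [hspan y (hUsub hy).1]
    exact Submodule.subset_span ⟨a, rfl⟩
  let h : Fin 2 → Fin 2 → M → ℂ := fun a b y =>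
    -I * e2 (d1 θ) y (z a y) (conjC (z b y))
  have hhs : ∀ a b, SmFn (h a b) U := fun a b =>
    (smFn_const _ _).mul ((hzs a).smFn_e2 (hzs b).conjC (hdθU U))
  have hhe : ∀ a b y, e2 (d1 θ) y (z a y) (conjC (z b y)) = I * h a b y := by
    intro a b y
    simp only [h]
    linear_combination (e2 (d1 θ) y (z a y) (conjC (z b y))) * I_mul_I
  let D : M → ℂ := fun y => h 0 0 y * h 1 1 y - h 0 1 y * h 1 0 y
  have hDs : SmFn D U := ((hhs 0 0).mul (hhs 1 1)).sub ((hhs 0 1).mul (hhs 1 0))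
  have hD : ∀ y ∈ U, D y ≠ 0 := by
    intro y hy h0
    have hsp := hspan y (hUsub hy).1
    have hli : LinearIndependent ℂ (fun a => z a y) :=
      coeff_eq_zero_of_finrank (by have := hT10.rank y; rw [hsp] at this; exact this)
    rw [Fintype.linearIndependent_iff] at hli
    have hdeg : ∀ c : Fin 2 → ℂ, (∀ b, c 0 * h 0 b y + c 1 * h 1 b y = 0) → ∀ i, c i = 0 := by
      intro c hc
      apply hli
      apply hT10.nondegenerate θ hθ y _ (Submodule.sum_mem _ fun a _ =>
        (T10 y).smul_mem _ (hzm a y hy))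
      intro W hW
      rw [hsp, Submodule.mem_span_range_iff_exists_fun] at hW
      obtain ⟨d, rfl⟩ := hW
      have : evalC (extD θ y) ![∑ i, c i • z i y, conjC (∑ i, d i • cVec (X i y) (Y i y))] =
        e2 (d1 θ) y (∑ i, c i • z i y) (conjC (∑ i, d i • z i y)) := rfl
      rw [this]
      simp only [Fin.sum_univ_two, map_add, conjC_smul, e2_add_left, e2_add_right, e2_smul_left,
        e2_smul_right, hhe]
      linear_combination (cj (d 0)) * hc 0 + (cj (d 1)) * hc 1
        - ((cj (d 0)) * (c 0 * h 0 0 y + c 1 * h 1 0 y)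
          + (cj (d 1)) * (c 0 * h 0 1 y + c 1 * h 1 1 y)) * I_mul_I
    have k1 := hdeg ![h 1 1 y, -h 0 1 y] (by
      intro b; fin_cases b
      · simp only [D, Matrix.cons_val, Fin.zero_eta] at h0 ⊢; linear_combination h0
      · simp only [Matrix.cons_val, Fin.mk_one]; ring)
    have k2 := hdeg ![h 1 0 y, -h 0 0 y] (by
      intro b; fin_cases b
      · simp only [Matrix.cons_val, Fin.zero_eta]; ring
      · simp only [D, Matrix.cons_val, Fin.mk_one] at h0 ⊢; linear_combination -h0)
    have a1 : h 1 1 y = 0 := k1 0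
    have a2 : -h 0 1 y = 0 := k1 1
    have a3 : h 1 0 y = 0 := k2 0
    have a4 : -h 0 0 y = 0 := k2 1
    have k3 := hdeg ![1, 0] (by
      intro b; fin_cases b
      · simpa using a4
      · simpa using a2)
    exact one_ne_zero (k3 0)
  let W1 : ∀ y : M, ℂT y := fun y =>
    (h 1 1 y / D y) • conjC (z 0 y) + (-(h 1 0 y) / D y) • conjC (z 1 y)
  let W2 : ∀ y : M, ℂT y := fun y =>
    (-(h 0 1 y) / D y) • conjC (z 0 y) + (h 0 0 y / D y) • conjC (z 1 y)
  have hW1s : SmCV W1 U := ((hzs 0).conjC.smul ((hhs 1 1).div hDs hD)).add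
    ((hzs 1).conjC.smul ((hhs 1 0).neg.div hDs hD))
  have hW2s : SmCV W2 U := ((hzs 0).conjC.smul ((hhs 0 1).neg.div hDs hD)).add
    ((hzs 1).conjC.smul ((hhs 0 0).div hDs hD))
  let t : M → ℂ := fun y => e1 θ y ((1 : ℂ) ⊗ₜ[ℝ] T0 y)
  have hts : SmFn t U := ht.mono hUsub
  let T1 : ∀ y : M, ℂT y := fun y => (t y)⁻¹ • ((1 : ℂ) ⊗ₜ[ℝ] T0 y)
  have hT1s : SmCV T1 U := (hT0.mono fun y hy => (hUsub hy).2).smCV.smul (hts.inv hne)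
  let T : ∀ y : M, ℂT y := fun y => T1 y
    + (I * e2 (d1 θ) y (T1 y) (W1 y)) • z 0 y
    + (I * e2 (d1 θ) y (T1 y) (W2 y)) • z 1 y
    + (-I * e2 (d1 θ) y (T1 y) (z 0 y)) • W1 y
    + (-I * e2 (d1 θ) y (T1 y) (z 1 y)) • W2 y
  have hTs : SmCV T U := (((hT1s.add
    ((hzs 0).smul ((smFn_const _ _).mul (hT1s.smFn_e2 hW1s (hdθU U))))).add
    ((hzs 1).smul ((smFn_const _ _).mul (hT1s.smFn_e2 hW2s (hdθU U))))).add
    (hW1s.smul ((smFn_const _ _).mul (hT1s.smFn_e2 (hzs 0) (hdθU U))))).add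
    (hW2s.smul ((smFn_const _ _).mul (hT1s.smFn_e2 (hzs 1) (hdθU U))))
  refine ⟨U, hU, hxU, T, z 0, z 1, W1, W2, hTs, hzs 0, hzs 1, hW1s, hW2s, fun y hy => ?_⟩
  have hDy := hD y hy
  have mz := fun a => hzm a y hy
  have mzc : ∀ a, conjC (conjC (z a y)) ∈ T10 y := fun a => by rw [conjC_conjC]; exact mz a
  have mW1 : conjC (W1 y) ∈ T10 y := by
    simp only [W1, map_add, conjC_smul]
    exact (T10 y).add_mem ((T10 y).smul_mem _ (mzc 0)) ((T10 y).smul_mem _ (mzc 1))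
  have mW2 : conjC (W2 y) ∈ T10 y := by
    simp only [W2, map_add, conjC_smul]
    exact (T10 y).add_mem ((T10 y).smul_mem _ (mzc 0)) ((T10 y).smul_mem _ (mzc 1))
  have d11 : e2 (d1 θ) y (z 0 y) (W1 y) = I := by
    simp only [W1, e2_add_right, e2_smul_right, hhe]
    field_simp; simp only [D]; ring
  have d12 : e2 (d1 θ) y (z 0 y) (W2 y) = 0 := by
    simp only [W2, e2_add_right, e2_smul_right, hhe]
    field_simp; ring
  have d21 : e2 (d1 θ) y (z 1 y) (W1 y) = 0 := by
    simp only [W1, e2_add_right, e2_smul_right, hhe]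
    field_simp; ring
  have d22 : e2 (d1 θ) y (z 1 y) (W2 y) = I := by
    simp only [W2, e2_add_right, e2_smul_right, hhe]
    field_simp; simp only [D]; ring
  have dZZ : e2 (d1 θ) y (z 0 y) (z 1 y) = 0 := hθ.e2_T10 hT10 (mz 0) (mz 1)
  have dWW : e2 (d1 θ) y (W1 y) (W2 y) = 0 := hθ.e2_T01 hT10 mW1 mW2
  have tT1 : e1 θ y (T1 y) = 1 := by
    simp only [T1, e1_smul_vec]
    exact inv_mul_cancel₀ (hne y hy)
  have hII := I_mul_I
  have hsw : ∀ a b : ℂT y, e2 (d1 θ) y a b = -e2 (d1 θ) y b a := fun a b => e2_swap a b _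
  have tz : ∀ a, e1 θ y (z a y) = 0 := fun a => hθ.e1_T10 (mz a)
  have tW1 : e1 θ y (W1 y) = 0 := hθ.e1_T01 mW1
  have tW2 : e1 θ y (W2 y) = 0 := hθ.e1_T01 mW2
  have tT : e1 θ y (T y) = 1 := by simp only [T, e1_add_vec, e1_smul_vec, tT1, tz, tW1, tW2]; ring
  have dTZ1 : e2 (d1 θ) y (T y) (z 0 y) = 0 := by
    simp only [T, e2_add_left, e2_smul_left, e2_self, hsw (z 1 y) (z 0 y), dZZ,
      hsw (W1 y) (z 0 y), hsw (W2 y) (z 0 y), d11, d12]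
    linear_combination (e2 (d1 θ) y (T1 y) (z 0 y)) * hII
  have dTZ2 : e2 (d1 θ) y (T y) (z 1 y) = 0 := by
    simp only [T, e2_add_left, e2_smul_left, e2_self, dZZ,
      hsw (W1 y) (z 1 y), hsw (W2 y) (z 1 y), d21, d22]
    linear_combination (e2 (d1 θ) y (T1 y) (z 1 y)) * hII
  have dTW1 : e2 (d1 θ) y (T y) (W1 y) = 0 := by
    simp only [T, e2_add_left, e2_smul_left, e2_self, hsw (W2 y) (W1 y), dWW, d11, d21]
    linear_combination (e2 (d1 θ) y (T1 y) (W1 y)) * hII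
  have dTW2 : e2 (d1 θ) y (T y) (W2 y) = 0 := by
    simp only [T, e2_add_left, e2_smul_left, e2_self, dWW, d12, d22]
    linear_combination (e2 (d1 θ) y (T1 y) (W2 y)) * hII
  have hspanZ : ∀ Z ∈ T10 y, ∃ a b : ℂ, Z = a • z 0 y + b • z 1 y := by
    intro Z hZ
    rw [hspan y (hUsub hy).1, Submodule.mem_span_range_iff_exists_fun] at hZ
    obtain ⟨c, rfl⟩ := hZ
    exact ⟨c 0, c 1, by simp only [Fin.sum_univ_two]; rfl⟩
  exact ⟨⟨T y, z 0 y, z 1 y, W1 y, W2 y, mz 0, mz 1, mW1, mW2, hspanZ, tT, tz 0, tz 1, tW1,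
    tW2, dTZ1, dTZ2, dTW1, dTW2, dZZ, dWW, d11, d12, d21, d22⟩, rfl, rfl, rfl, rfl, rfl⟩

lemma exists_SF (hT10 : IsCRStructure T10) (hθ : IsContactForm T10 θ) (x : M) :
    Nonempty (SF T10 θ x) := by
  obtain ⟨U, _, hx, _, _, _, _, _, _, _, _, _, _, h⟩ := exists_local_frame_aux hT10 hθ x
  obtain ⟨F, _⟩ := h x hx
  exact ⟨F⟩

/-- Smooth adapted frames exist locally. -/
lemma exists_local_frame (hT10 : IsCRStructure T10) (hθ : IsContactForm T10 θ) (x : M) :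
    ∃ U : Set M, x ∈ U ∧ ∃ F : ∀ y, SF T10 θ y, SmSF F U := by
  classical
  obtain ⟨U, hU, hx, T, Z1, Z2, W1, W2, hT, hZ1, hZ2, hW1, hW2, h⟩ :=
    exists_local_frame_aux hT10 hθ x
  have h' : ∀ y, ∃ F : SF T10 θ y, y ∈ U → F.T = T y ∧ F.Z1 = Z1 y ∧ F.Z2 = Z2 y ∧
      F.W1 = W1 y ∧ F.W2 = W2 y := by
    intro y
    by_cases hy : y ∈ U
    · obtain ⟨F, hF⟩ := h y hy
      exact ⟨F, fun _ => hF⟩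
    · exact ⟨(exists_SF hT10 hθ y).some, fun hy' => absurd hy' hy⟩
  choose G hG using h'
  exact ⟨U, hx, G, hU, hT.congr fun y hy => (hG y hy).1, hZ1.congr fun y hy => (hG y hy).2.1,
    hZ2.congr fun y hy => (hG y hy).2.2.1, hW1.congr fun y hy => (hG y hy).2.2.2.1,
    hW2.congr fun y hy => (hG y hy).2.2.2.2⟩

lemma cMult_real_ext [Module.Finite ℝ V] {A B : MultilinearMap ℂ (fun _ : Fin k => ℂV) ℂ}
    (h : ∀ v : Fin k → V, A (fun i => (1 : ℂ) ⊗ₜ[ℝ] v i) = B (fun i => (1 : ℂ) ⊗ₜ[ℝ] v i)) :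
    A = B := by
  let b := (Module.finBasis ℝ V).baseChange ℂ
  refine Module.Basis.ext_multilinear (fun _ => b) fun v => ?_
  have hb : (fun i => b (v i)) = fun i => (1 : ℂ) ⊗ₜ[ℝ] (Module.finBasis ℝ V (v i)) := by
    funext i; exact Module.Basis.baseChange_apply ℂ (Module.finBasis ℝ V) (v i)
  rw [hb]
  exact h _

lemma cEval_perm [Module.Finite ℝ V] (f : Λ k) (σ : Perm (Fin k))
    (Z : Fin k → ℂV) : cEval f (Z ∘ σ) = ((sign σ : ℤ) : ℂ) * cEval f Z := by
  have h : (cMult f).domDomCongr σ = ((sign σ : ℤ) : ℂ) • cMult f := by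
    apply cMult_real_ext
    intro v
    have h1 := f.map_perm v σ
    rw [MultilinearMap.domDomCongr_apply, smul_apply, cMult_apply, cMult_apply,
      cEval_tmul f v, cEval_tmul f (fun i => v (σ i))]
    simp only [smul_eq_mul]
    rw [show (fun i => v (σ i)) = v ∘ σ from rfl, h1, Units.smul_def, zsmul_eq_mul]
  exact congrArg (fun A : MultilinearMap ℂ (fun _ : Fin k => ℂV) ℂ => A Z) h

/-- A form vanishes if it vanishes on increasing tuples from a basis. -/
lemma eq_zero_of_strictMono [Module.Finite ℝ V] {n : ℕ} (b : Module.Basis (Fin n) ℂ (ℂV)) {f : Λ k}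
    (h : ∀ u : Fin k → Fin n, StrictMono u → cEval f (fun i => b (u i)) = 0) : f = 0 := by
  have h1 : cMult f = 0 := by
    refine Module.Basis.ext_multilinear (fun _ => b) fun v => ?_
    rw [cMult_apply, zero_apply]
    by_cases hv : Function.Injective v
    · have hs : StrictMono (v ∘ Tuple.sort v) :=
        (Tuple.monotone_sort v).strictMono_of_injective (hv.comp (Tuple.sort v).injective)
      have h2 := h _ hs
      have h3 := cEval_perm f (Tuple.sort v) (fun i => b (v i))
      rw [show ((fun i => b (v i)) ∘ (Tuple.sort v)) = fun i => b ((v ∘ Tuple.sort v) i) from rfl,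
        h2] at h3
      rcases mul_eq_zero.1 h3.symm with h4 | h4
      · rcases Int.units_eq_one_or (sign (Tuple.sort v)) with h5 | h5 <;> simp [h5] at h4
      · exact h4
    · simp only [Function.Injective, not_forall] at hv
      obtain ⟨i, j, hij, hne⟩ := hv
      have h3 := cEval_perm f (Equiv.swap i j) (fun i => b (v i))
      have h4 : (fun i => b (v i)) ∘ (Equiv.swap i j) = fun i => b (v i) := by
        funext l
        simp only [Function.comp]
        by_cases hl : l = i
        · rw [hl, Equiv.swap_apply_left, hij]
        · by_cases hl' : l = j
          · rw [hl', Equiv.swap_apply_right, hij]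
          · rw [Equiv.swap_apply_of_ne_of_ne hl hl']
      rw [h4, Equiv.Perm.sign_swap hne] at h3
      have : cEval f (fun i => b (v i)) = -cEval f (fun i => b (v i)) := by simpa using h3
      exact self_eq_neg.1 this
  ext v
  rw [← cEval_tmul f v, ← cMult_apply, h1]
  rfl

lemma SF.ext_strictMono (F : SF T10 θ x) {f g : TS x [⋀^Fin k]→L[ℝ] ℂ}
    (h : ∀ u : Fin k → Fin 5, StrictMono u →
      evalC f (fun i => F.vec (u i)) = evalC g (fun i => F.vec (u i))) : f = g := by
  apply cform_ext_toAlternatingMap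
  rw [← sub_eq_zero]
  refine eq_zero_of_strictMono F.basis fun u hu => ?_
  have := h u hu
  simp only [F.basis_apply]
  rw [cEval_sub]
  exact sub_eq_zero.2 this

lemma SF.ext1 (F : SF T10 θ x) {α β : Ω 1} (h0 : e1 α x F.T = e1 β x F.T)
    (h1 : e1 α x F.Z1 = e1 β x F.Z1) (h2 : e1 α x F.Z2 = e1 β x F.Z2)
    (h3 : e1 α x F.W1 = e1 β x F.W1) (h4 : e1 α x F.W2 = e1 β x F.W2) : α x = β x := by
  refine F.ext_strictMono fun u _ => ?_
  have hu : (fun i => F.vec (u i)) = ![F.vec (u 0)] := by funext i; fin_cases i; rfl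
  rw [hu]
  generalize u 0 = a
  fin_cases a
  · exact h0
  · exact h1
  · exact h2
  · exact h3
  · exact h4

lemma SF.ext2 (F : SF T10 θ x) {α β : Ω 2}
    (h01 : e2 α x F.T F.Z1 = e2 β x F.T F.Z1) (h02 : e2 α x F.T F.Z2 = e2 β x F.T F.Z2)
    (h03 : e2 α x F.T F.W1 = e2 β x F.T F.W1) (h04 : e2 α x F.T F.W2 = e2 β x F.T F.W2)
    (h12 : e2 α x F.Z1 F.Z2 = e2 β x F.Z1 F.Z2) (h13 : e2 α x F.Z1 F.W1 = e2 β x F.Z1 F.W1)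
    (h14 : e2 α x F.Z1 F.W2 = e2 β x F.Z1 F.W2) (h23 : e2 α x F.Z2 F.W1 = e2 β x F.Z2 F.W1)
    (h24 : e2 α x F.Z2 F.W2 = e2 β x F.Z2 F.W2) (h34 : e2 α x F.W1 F.W2 = e2 β x F.W1 F.W2) :
    α x = β x := by
  refine F.ext_strictMono fun u hu' => ?_
  have hu : (fun i => F.vec (u i)) = ![F.vec (u 0), F.vec (u 1)] := by funext i; fin_cases i <;> rfl
  have hm : u 0 < u 1 := hu' (by decide)
  rw [hu]
  revert hm
  generalize u 0 = a
  generalize u 1 = b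
  fin_cases a <;> fin_cases b <;> intro hm <;> first | exact absurd hm (by decide) | skip
  · exact h01
  · exact h02
  · exact h03
  · exact h04
  · exact h12
  · exact h13
  · exact h14
  · exact h23
  · exact h24
  · exact h34

lemma SF.ext3 (F : SF T10 θ x) {α β : Ω 3} (h012 : e3 α x F.T F.Z1 F.Z2 = e3 β x F.T F.Z1 F.Z2)
    (h013 : e3 α x F.T F.Z1 F.W1 = e3 β x F.T F.Z1 F.W1)
    (h014 : e3 α x F.T F.Z1 F.W2 = e3 β x F.T F.Z1 F.W2)
    (h023 : e3 α x F.T F.Z2 F.W1 = e3 β x F.T F.Z2 F.W1)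
    (h024 : e3 α x F.T F.Z2 F.W2 = e3 β x F.T F.Z2 F.W2)
    (h034 : e3 α x F.T F.W1 F.W2 = e3 β x F.T F.W1 F.W2)
    (h123 : e3 α x F.Z1 F.Z2 F.W1 = e3 β x F.Z1 F.Z2 F.W1)
    (h124 : e3 α x F.Z1 F.Z2 F.W2 = e3 β x F.Z1 F.Z2 F.W2)
    (h134 : e3 α x F.Z1 F.W1 F.W2 = e3 β x F.Z1 F.W1 F.W2)
    (h234 : e3 α x F.Z2 F.W1 F.W2 = e3 β x F.Z2 F.W1 F.W2) : α x = β x := by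
  refine F.ext_strictMono fun u hu' => ?_
  have hu : (fun i => F.vec (u i)) = ![F.vec (u 0), F.vec (u 1), F.vec (u 2)] := by
    funext i; fin_cases i <;> rfl
  have hm : u 0 < u 1 := hu' (by decide)
  have hn : u 1 < u 2 := hu' (by decide)
  rw [hu]
  revert hm hn
  generalize u 0 = a
  generalize u 1 = b
  generalize u 2 = c
  have key : ∀ a b : Fin 5, a < b → ∀ c, b < c → (a, b, c) ∈ ([(0, 1, 2), (0, 1, 3), (0, 1, 4),
    (0, 2, 3), (0, 2, 4), (0, 3, 4), (1, 2, 3), (1, 2, 4), (1, 3, 4), (2, 3, 4)] :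
    List (Fin 5 × Fin 5 × Fin 5)) := by decide
  intro hm hn
  have := key a b hm c hn
  simp only [List.mem_cons, Prod.mk.injEq, List.not_mem_nil, or_false] at this
  rcases this with ⟨rfl, rfl, rfl⟩ | ⟨rfl, rfl, rfl⟩ | ⟨rfl, rfl, rfl⟩ | ⟨rfl, rfl, rfl⟩ |
    ⟨rfl, rfl, rfl⟩ | ⟨rfl, rfl, rfl⟩ | ⟨rfl, rfl, rfl⟩ | ⟨rfl, rfl, rfl⟩ | ⟨rfl, rfl, rfl⟩ |
    ⟨rfl, rfl, rfl⟩
  · exact h012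
  · exact h013
  · exact h014
  · exact h023
  · exact h024
  · exact h034
  · exact h123
  · exact h124
  · exact h134
  · exact h234

lemma SF.ext4 (F : SF T10 θ x) {α β : Ω 4}
    (h0123 : e4 α x F.T F.Z1 F.Z2 F.W1 = e4 β x F.T F.Z1 F.Z2 F.W1)
    (h0124 : e4 α x F.T F.Z1 F.Z2 F.W2 = e4 β x F.T F.Z1 F.Z2 F.W2)
    (h0134 : e4 α x F.T F.Z1 F.W1 F.W2 = e4 β x F.T F.Z1 F.W1 F.W2)
    (h0234 : e4 α x F.T F.Z2 F.W1 F.W2 = e4 β x F.T F.Z2 F.W1 F.W2)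
    (h1234 : e4 α x F.Z1 F.Z2 F.W1 F.W2 = e4 β x F.Z1 F.Z2 F.W1 F.W2) : α x = β x := by
  refine F.ext_strictMono fun u hu' => ?_
  have hu : (fun i => F.vec (u i)) = ![F.vec (u 0), F.vec (u 1), F.vec (u 2), F.vec (u 3)] := by
    funext i; fin_cases i <;> rfl
  have hm : u 0 < u 1 := hu' (by decide)
  have hn : u 1 < u 2 := hu' (by decide)
  have ho : u 2 < u 3 := hu' (by decide)
  rw [hu]
  revert hm hn ho
  generalize u 0 = a
  generalize u 1 = b
  generalize u 2 = c
  generalize u 3 = d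
  have key : ∀ a b : Fin 5, a < b → ∀ c, b < c → ∀ d, c < d → (a, b, c, d) ∈
    ([(0, 1, 2, 3), (0, 1, 2, 4), (0, 1, 3, 4), (0, 2, 3, 4), (1, 2, 3, 4)] :
    List (Fin 5 × Fin 5 × Fin 5 × Fin 5)) := by decide
  intro hm hn ho
  have := key a b hm c hn d ho
  simp only [List.mem_cons, Prod.mk.injEq, List.not_mem_nil, or_false] at this
  rcases this with ⟨rfl, rfl, rfl, rfl⟩ | ⟨rfl, rfl, rfl, rfl⟩ | ⟨rfl, rfl, rfl, rfl⟩ |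
    ⟨rfl, rfl, rfl, rfl⟩ | ⟨rfl, rfl, rfl, rfl⟩
  · exact h0123
  · exact h0124
  · exact h0134
  · exact h0234
  · exact h1234

lemma SF.ext5 (F : SF T10 θ x) {α β : Ω 5}
    (h : e5 α x F.T F.Z1 F.Z2 F.W1 F.W2 = e5 β x F.T F.Z1 F.Z2 F.W1 F.W2) : α x = β x := by
  refine F.ext_strictMono fun u hu' => ?_
  have hid : u = id := by
    have hm : u 0 < u 1 := hu' (by decide)
    have hn : u 1 < u 2 := hu' (by decide)
    have ho : u 2 < u 3 := hu' (by decide)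
    have hp : u 3 < u 4 := hu' (by decide)
    funext i
    fin_cases i <;> simp <;> omega
  subst hid
  have hu : (fun i => F.vec (id i)) = ![F.T, F.Z1, F.Z2, F.W1, F.W2] := by
    funext i; fin_cases i <;> rfl
  rw [hu]
  exact h

lemma SF.six_form_eq_zero (F : SF T10 θ x) (f : TS x [⋀^Fin 6]→L[ℝ] ℂ) : f = 0 := by
  refine F.ext_strictMono fun u hu' => ?_
  exact absurd (Fintype.card_le_of_injective u hu'.injective) (by simp)

variable {p : ℕ}

lemma hasBidegree_one {α : Ω 1} : HasBidegree T10 p α ↔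
    ∀ x, (p ≠ 1 → ∀ Z ∈ T10 x, e1 α x Z = 0) ∧ (p ≠ 0 → ∀ W, conjC W ∈ T10 x → e1 α x W = 0) := by
  constructor
  · intro h x
    refine ⟨fun hp Z hZ => h x {0} ![Z] ?_ ?_ ?_, fun hp W hW => h x ∅ ![W] ?_ ?_ ?_⟩ <;>
      simp [Fin.forall_fin_one] <;> first | assumption | omega
  · intro h x s Z h1 h2 hs
    have hZ : Z = ![Z 0] := by funext i; fin_cases i; rfl
    rw [hZ]
    by_cases h0 : (0 : Fin 1) ∈ s
    · have : s = {0} := by ext i; fin_cases i; simpa using h0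
      subst this
      exact (h x).1 (by simpa [eq_comm] using hs) _ (h1 0 h0)
    · have : s = ∅ := by ext i; fin_cases i; simpa using h0
      subst this
      exact (h x).2 (by simpa [eq_comm] using hs) _ (h2 0 h0)

/-- The condition for a two-form to be of type `p` up to shift `r`. -/
lemma hasType_two {r : ℕ} {η : TS x [⋀^Fin 2]→ₗ[ℝ] ℂ} : HasType T10 x r p η ↔
    (r + 2 ≠ p → ∀ Z ∈ T10 x, ∀ Z' ∈ T10 x, cEval η ![Z, Z'] = 0) ∧
    (r + 1 ≠ p → ∀ Z ∈ T10 x, ∀ W, conjC W ∈ T10 x → cEval η ![Z, W] = 0) ∧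
    (r ≠ p → ∀ W, conjC W ∈ T10 x → ∀ W', conjC W' ∈ T10 x → cEval η ![W, W'] = 0) := by
  constructor
  · intro h
    refine ⟨fun hp Z hZ Z' hZ' => h {0, 1} _ ?_ ?_ ?_, fun hp Z hZ W hW => h {0} _ ?_ ?_ ?_,
      fun hp W hW W' hW' => h ∅ _ ?_ ?_ ?_⟩
    all_goals simp [Fin.forall_fin_two]
    all_goals first | assumption | exact ⟨hZ, hZ'⟩ | exact ⟨hW, hW'⟩
  · rintro ⟨hA, hB, hC⟩ s Z h1 h2 hs
    have hZ : Z = ![Z 0, Z 1] := by funext i; fin_cases i <;> rfl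
    rw [hZ]
    by_cases h0 : (0 : Fin 2) ∈ s <;> by_cases h1' : (1 : Fin 2) ∈ s
    · have : s = {0, 1} := by ext i; fin_cases i <;> simpa
      subst this
      exact hA (by simpa using hs) _ (h1 0 h0) _ (h1 1 h1')
    · have : s = {0} := by ext i; fin_cases i <;> simpa
      subst this
      exact hB (by simpa using hs) _ (h1 0 h0) _ (h2 1 h1')
    · have : s = {1} := by ext i; fin_cases i <;> simpa
      subst this
      rw [cEval_swap_two, hB (by simpa using hs) _ (h1 1 h1') _ (h2 0 h0), neg_zero]
    · have : s = ∅ := by ext i; fin_cases i <;> simpa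
      subst this
      exact hC (by simpa using hs) _ (h2 0 h0) _ (h2 1 h1')

lemma hasBidegree_two {α : Ω 2} : HasBidegree T10 p α ↔
    ∀ x, (p ≠ 2 → ∀ Z ∈ T10 x, ∀ Z' ∈ T10 x, e2 α x Z Z' = 0) ∧
    (p ≠ 1 → ∀ Z ∈ T10 x, ∀ W, conjC W ∈ T10 x → e2 α x Z W = 0) ∧
    (p ≠ 0 → ∀ W, conjC W ∈ T10 x → ∀ W', conjC W' ∈ T10 x → e2 α x W W' = 0) := by
  change (∀ x, HasType T10 x 0 p (α x).toAlternatingMap) ↔ _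
  refine forall_congr' fun x => ?_
  rw [hasType_two]
  simp only [zero_add, ne_comm (b := p)]
  rfl

lemma cEval_curryLeft (f : TS x [⋀^Fin (k + 1)]→ₗ[ℝ] ℂ) (v : TS x) (Z : Fin k → ℂT x) :
    cEval (f.curryLeft v) Z = cEval f (Matrix.vecCons ((1 : ℂ) ⊗ₜ[ℝ] v) Z) := by
  rw [cEval_cons, iC_tmul, one_smul]

lemma hasBidegree_three {α : Ω 3} : HasBidegree T10 p α ↔
    ∀ x (v : TS x), (p ≠ 3 → ∀ Z ∈ T10 x, ∀ Z' ∈ T10 x, e3 α x ((1 : ℂ) ⊗ₜ[ℝ] v) Z Z' = 0) ∧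
    (p ≠ 2 → ∀ Z ∈ T10 x, ∀ W, conjC W ∈ T10 x → e3 α x ((1 : ℂ) ⊗ₜ[ℝ] v) Z W = 0) ∧
    (p ≠ 1 → ∀ W, conjC W ∈ T10 x → ∀ W', conjC W' ∈ T10 x →
      e3 α x ((1 : ℂ) ⊗ₜ[ℝ] v) W W' = 0) := by
  change (∀ x (v : TS x), HasType T10 x 1 p ((α x).toAlternatingMap.curryLeft v)) ↔ _
  refine forall_congr' fun x => forall_congr' fun v => ?_
  rw [hasType_two]
  simp only [ne_comm (b := p), cEval_curryLeft]
  rfl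

lemma cEval_three_swap12 (η : TS x [⋀^Fin 3]→ₗ[ℝ] ℂ) (a b c : ℂT x) :
    cEval η ![a, b, c] = -cEval η ![b, a, c] := by
  simp only [cEval_cons]
  rw [iC_swap b a, iC_neg, cEval_neg]

lemma cEval_three_swap23 (η : TS x [⋀^Fin 3]→ₗ[ℝ] ℂ) (a b c : ℂT x) :
    cEval η ![a, b, c] = -cEval η ![a, c, b] := by
  simp only [cEval_cons]
  rw [iC_swap, cEval_neg]

lemma hasType_three {r : ℕ} {η : TS x [⋀^Fin 3]→ₗ[ℝ] ℂ} : HasType T10 x r p η ↔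
    (r + 3 ≠ p → ∀ Z ∈ T10 x, ∀ Z' ∈ T10 x, ∀ Z'' ∈ T10 x, cEval η ![Z, Z', Z''] = 0) ∧
    (r + 2 ≠ p → ∀ Z ∈ T10 x, ∀ Z' ∈ T10 x, ∀ W, conjC W ∈ T10 x → cEval η ![Z, Z', W] = 0) ∧
    (r + 1 ≠ p → ∀ Z ∈ T10 x, ∀ W, conjC W ∈ T10 x → ∀ W', conjC W' ∈ T10 x →
      cEval η ![Z, W, W'] = 0) ∧
    (r ≠ p → ∀ W, conjC W ∈ T10 x → ∀ W', conjC W' ∈ T10 x → ∀ W'', conjC W'' ∈ T10 x →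
      cEval η ![W, W', W''] = 0) := by
  constructor
  · intro h
    refine ⟨fun hp Z hZ Z' hZ' Z'' hZ'' => h {0, 1, 2} _ ?_ ?_ ?_,
      fun hp Z hZ Z' hZ' W hW => h {0, 1} _ ?_ ?_ ?_,
      fun hp Z hZ W hW W' hW' => h {0} _ ?_ ?_ ?_,
      fun hp W hW W' hW' W'' hW'' => h ∅ _ ?_ ?_ ?_⟩
    all_goals simp [Fin.forall_fin_succ]
    all_goals first | assumption | exact ⟨hZ, hZ', hZ''⟩ | exact ⟨hZ, hZ'⟩ | exact ⟨hW, hW'⟩ |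
      exact ⟨hW, hW', hW''⟩
  · rintro ⟨hA, hB, hC, hD⟩ s Z h1 h2 hs
    have hZ : Z = ![Z 0, Z 1, Z 2] := by funext i; fin_cases i <;> rfl
    rw [hZ]
    by_cases h0 : (0 : Fin 3) ∈ s <;> by_cases h1' : (1 : Fin 3) ∈ s <;>
      by_cases h2' : (2 : Fin 3) ∈ s
    · have : s = {0, 1, 2} := by ext i; fin_cases i <;> simpa
      subst this
      exact hA (by simpa using hs) _ (h1 0 h0) _ (h1 1 h1') _ (h1 2 h2')
    · have : s = {0, 1} := by ext i; fin_cases i <;> simpa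
      subst this
      exact hB (by simpa using hs) _ (h1 0 h0) _ (h1 1 h1') _ (h2 2 h2')
    · have : s = {0, 2} := by ext i; fin_cases i <;> simpa
      subst this
      rw [cEval_three_swap23, hB (by simpa using hs) _ (h1 0 h0) _ (h1 2 h2') _ (h2 1 h1'),
        neg_zero]
    · have : s = {0} := by ext i; fin_cases i <;> simpa
      subst this
      exact hC (by simpa using hs) _ (h1 0 h0) _ (h2 1 h1') _ (h2 2 h2')
    · have : s = {1, 2} := by ext i; fin_cases i <;> simpa
      subst this
      rw [cEval_three_swap12, cEval_three_swap23, hB (by simpa using hs) _ (h1 1 h1') _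
        (h1 2 h2') _ (h2 0 h0)]
      simp
    · have : s = {1} := by ext i; fin_cases i <;> simpa
      subst this
      rw [cEval_three_swap12, hC (by simpa using hs) _ (h1 1 h1') _ (h2 0 h0) _ (h2 2 h2'),
        neg_zero]
    · have : s = {2} := by ext i; fin_cases i <;> simpa
      subst this
      rw [cEval_three_swap23, cEval_three_swap12, hC (by simpa using hs) _ (h1 2 h2') _
        (h2 0 h0) _ (h2 1 h1')]
      simp
    · have : s = ∅ := by ext i; fin_cases i <;> simpa
      subst this
      exact hD (by simpa using hs) _ (h2 0 h0) _ (h2 1 h1') _ (h2 2 h2')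

lemma hasBidegree_four {α : Ω 4} : HasBidegree T10 p α ↔ ∀ x (v : TS x),
    (p ≠ 4 → ∀ Z ∈ T10 x, ∀ Z' ∈ T10 x, ∀ Z'' ∈ T10 x, e4 α x ((1 : ℂ) ⊗ₜ[ℝ] v) Z Z' Z'' = 0) ∧
    (p ≠ 3 → ∀ Z ∈ T10 x, ∀ Z' ∈ T10 x, ∀ W, conjC W ∈ T10 x →
      e4 α x ((1 : ℂ) ⊗ₜ[ℝ] v) Z Z' W = 0) ∧
    (p ≠ 2 → ∀ Z ∈ T10 x, ∀ W, conjC W ∈ T10 x → ∀ W', conjC W' ∈ T10 x →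
      e4 α x ((1 : ℂ) ⊗ₜ[ℝ] v) Z W W' = 0) ∧
    (p ≠ 1 → ∀ W, conjC W ∈ T10 x → ∀ W', conjC W' ∈ T10 x → ∀ W'', conjC W'' ∈ T10 x →
      e4 α x ((1 : ℂ) ⊗ₜ[ℝ] v) W W' W'' = 0) := by
  change (∀ x (v : TS x), HasType T10 x 1 p ((α x).toAlternatingMap.curryLeft v)) ↔ _
  refine forall_congr' fun x => forall_congr' fun v => ?_
  rw [hasType_three]
  simp only [ne_comm (b := p), cEval_curryLeft]
  rfl

attribute [simp] e2_w11 e3_w12 e4_w13 e5_w14 e4_w22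
  e1_add e1_sub e1_neg e1_smul e1_fsmul e1_zero e2_add e2_sub e2_smul e2_fsmul e2_zero
  e3_add e3_sub e3_neg e3_smul e3_fsmul e3_zero e4_add e4_sub e4_neg e4_smul e4_fsmul e4_zero
  e5_sub e5_smul e5_fsmul e5_zero e2_self
  SF.tT SF.tZ1 SF.tZ2 SF.tW1 SF.tW2 SF.dZZ SF.dWW SF.d11 SF.d12 SF.d21 SF.d22 SF.dT
  SF.mZ1 SF.mZ2 SF.mW1 SF.mW2

section Tables

@[simp] lemma SF.dT' (F : SF T10 θ x) (w : ℂT x) : e2 (d1 θ) x w F.T = 0 := by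
  rw [e2_swap, F.dT, neg_zero]
@[simp] lemma SF.dZZ' (F : SF T10 θ x) : e2 (d1 θ) x F.Z2 F.Z1 = 0 := by
  rw [e2_swap, F.dZZ, neg_zero]
@[simp] lemma SF.dWW' (F : SF T10 θ x) : e2 (d1 θ) x F.W2 F.W1 = 0 := by
  rw [e2_swap, F.dWW, neg_zero]
@[simp] lemma SF.d11' (F : SF T10 θ x) : e2 (d1 θ) x F.W1 F.Z1 = -I := by rw [e2_swap, F.d11]
@[simp] lemma SF.d12' (F : SF T10 θ x) : e2 (d1 θ) x F.W2 F.Z1 = 0 := by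
  rw [e2_swap, F.d12, neg_zero]
@[simp] lemma SF.d21' (F : SF T10 θ x) : e2 (d1 θ) x F.W1 F.Z2 = 0 := by
  rw [e2_swap, F.d21, neg_zero]
@[simp] lemma SF.d22' (F : SF T10 θ x) : e2 (d1 θ) x F.W2 F.Z2 = -I := by rw [e2_swap, F.d22]

/-- Contraction with a complex vector field. -/
def iot (Z : ∀ y : M, ℂT y) (ω : Ω (k + 1)) : Ω k :=
  iVF (fun y => (exists_cVec (Z y)).choose) ω
    + I • iVF (fun y => (exists_cVec (Z y)).choose_spec.choose) ω

lemma toAlternatingMap_iot (Z : ∀ y : M, ℂT y) (ω : Ω (k + 1)) (y : M) :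
    (iot Z ω y).toAlternatingMap = iC (Z y) (ω y).toAlternatingMap := by
  conv_rhs => rw [(exists_cVec (Z y)).choose_spec.choose_spec]
  rw [cVec, iC_add_left, iC_tmul, iC_tmul, one_smul]
  rfl

@[simp] lemma e1_iot (Z : ∀ y : M, ℂT y) (ω : Ω 2) (y : M) (a : ℂT y) :
    e1 (iot Z ω) y a = e2 ω y (Z y) a := by
  rw [e1, evalC, toAlternatingMap_iot]; rfl

@[simp] lemma e2_iot (Z : ∀ y : M, ℂT y) (ω : Ω 3) (y : M) (a b : ℂT y) :
    e2 (iot Z ω) y a b = e3 ω y (Z y) a b := by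
  rw [e2, evalC, toAlternatingMap_iot]; rfl

variable (F : ∀ y, SF T10 θ y)

/-- The one-form dual to `Z₁`. -/
def cf1 : Ω 1 := I • iot (fun y => (F y).W1) (d1 θ)
/-- The one-form dual to `Z₂`. -/
def cf2 : Ω 1 := I • iot (fun y => (F y).W2) (d1 θ)
/-- The one-form dual to `W₁`. -/
def cf3 : Ω 1 := (-I) • iot (fun y => (F y).Z1) (d1 θ)
/-- The one-form dual to `W₂`. -/
def cf4 : Ω 1 := (-I) • iot (fun y => (F y).Z2) (d1 θ)

@[simp] lemma cf1_T : e1 (cf1 F) x (F x).T = 0 := by simp [cf1]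
@[simp] lemma cf1_Z1 : e1 (cf1 F) x (F x).Z1 = 1 := by simp [cf1]
@[simp] lemma cf1_Z2 : e1 (cf1 F) x (F x).Z2 = 0 := by simp [cf1]
@[simp] lemma cf1_W1 : e1 (cf1 F) x (F x).W1 = 0 := by simp [cf1]
@[simp] lemma cf1_W2 : e1 (cf1 F) x (F x).W2 = 0 := by simp [cf1]
@[simp] lemma cf2_T : e1 (cf2 F) x (F x).T = 0 := by simp [cf2]
@[simp] lemma cf2_Z1 : e1 (cf2 F) x (F x).Z1 = 0 := by simp [cf2]
@[simp] lemma cf2_Z2 : e1 (cf2 F) x (F x).Z2 = 1 := by simp [cf2]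
@[simp] lemma cf2_W1 : e1 (cf2 F) x (F x).W1 = 0 := by simp [cf2]
@[simp] lemma cf2_W2 : e1 (cf2 F) x (F x).W2 = 0 := by simp [cf2]
@[simp] lemma cf3_T : e1 (cf3 F) x (F x).T = 0 := by simp [cf3]
@[simp] lemma cf3_Z1 : e1 (cf3 F) x (F x).Z1 = 0 := by simp [cf3]
@[simp] lemma cf3_Z2 : e1 (cf3 F) x (F x).Z2 = 0 := by simp [cf3]
@[simp] lemma cf3_W1 : e1 (cf3 F) x (F x).W1 = 1 := by simp [cf3]
@[simp] lemma cf3_W2 : e1 (cf3 F) x (F x).W2 = 0 := by simp [cf3]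
@[simp] lemma cf4_T : e1 (cf4 F) x (F x).T = 0 := by simp [cf4]
@[simp] lemma cf4_Z1 : e1 (cf4 F) x (F x).Z1 = 0 := by simp [cf4]
@[simp] lemma cf4_Z2 : e1 (cf4 F) x (F x).Z2 = 0 := by simp [cf4]
@[simp] lemma cf4_W1 : e1 (cf4 F) x (F x).W1 = 0 := by simp [cf4]
@[simp] lemma cf4_W2 : e1 (cf4 F) x (F x).W2 = 1 := by simp [cf4]

variable {F}

lemma cf1_W {W : ℂT x} (hW : conjC W ∈ T10 x) : e1 (cf1 F) x W = 0 := by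
  obtain ⟨a, b, rfl⟩ := (F x).spanW W hW
  simp [e1_add_vec, e1_smul_vec]
lemma cf2_W {W : ℂT x} (hW : conjC W ∈ T10 x) : e1 (cf2 F) x W = 0 := by
  obtain ⟨a, b, rfl⟩ := (F x).spanW W hW
  simp [e1_add_vec, e1_smul_vec]
lemma cf3_Z {Z : ℂT x} (hZ : Z ∈ T10 x) : e1 (cf3 F) x Z = 0 := by
  obtain ⟨a, b, rfl⟩ := (F x).spanZ Z hZ
  simp [e1_add_vec, e1_smul_vec]
lemma cf4_Z {Z : ℂT x} (hZ : Z ∈ T10 x) : e1 (cf4 F) x Z = 0 := by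
  obtain ⟨a, b, rfl⟩ := (F x).spanZ Z hZ
  simp [e1_add_vec, e1_smul_vec]

/-- The contact form vanishes on `T¹⁰`. -/
lemma SF.t_Z (F : SF T10 θ x) {Z : ℂT x} (hZ : Z ∈ T10 x) : e1 θ x Z = 0 := by
  obtain ⟨a, b, rfl⟩ := F.spanZ Z hZ
  simp [e1_add_vec, e1_smul_vec]
lemma SF.t_W (F : SF T10 θ x) {W : ℂT x} (hW : conjC W ∈ T10 x) : e1 θ x W = 0 := by
  obtain ⟨a, b, rfl⟩ := F.spanW W hW
  simp [e1_add_vec, e1_smul_vec]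

variable (F)

/-! ### Types of one-forms -/

/-- The `(1,0)`-part of a one-form. -/
def P10 (α : Ω 1) : Ω 1 :=
  fsmul (fun y => e1 α y (F y).Z1) (cf1 F) + fsmul (fun y => e1 α y (F y).Z2) (cf2 F)
/-- The `(0,1)`-part of a one-form. -/
def P01 (α : Ω 1) : Ω 1 :=
  fsmul (fun y => e1 α y (F y).W1) (cf3 F) + fsmul (fun y => e1 α y (F y).W2) (cf4 F)

@[simp] lemma P10_T (α : Ω 1) (G : SF T10 θ x) : e1 (P10 F α) x G.T = 0 := by
  rw [G.T_eq (F x)]; simp [P10]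
@[simp] lemma P01_T (α : Ω 1) (G : SF T10 θ x) : e1 (P01 F α) x G.T = 0 := by
  rw [G.T_eq (F x)]; simp [P01]
lemma P10_Z (α : Ω 1) {Z : ℂT x} (hZ : Z ∈ T10 x) : e1 (P10 F α) x Z = e1 α x Z := by
  obtain ⟨a, b, rfl⟩ := (F x).spanZ Z hZ
  simp [e1_add_vec, e1_smul_vec, P10]
lemma P10_W (α : Ω 1) {W : ℂT x} (hW : conjC W ∈ T10 x) : e1 (P10 F α) x W = 0 := by
  simp [P10, cf1_W hW, cf2_W hW]
lemma P01_W (α : Ω 1) {W : ℂT x} (hW : conjC W ∈ T10 x) : e1 (P01 F α) x W = e1 α x W := by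
  obtain ⟨a, b, rfl⟩ := (F x).spanW W hW
  simp [e1_add_vec, e1_smul_vec, P01]
lemma P01_Z (α : Ω 1) {Z : ℂT x} (hZ : Z ∈ T10 x) : e1 (P01 F α) x Z = 0 := by
  simp [P01, cf3_Z hZ, cf4_Z hZ]

@[simp] lemma P10_Z1 (α : Ω 1) (G : SF T10 θ x) :
    e1 (P10 F α) x G.Z1 = e1 α x G.Z1 := P10_Z F α G.mZ1
@[simp] lemma P10_Z2 (α : Ω 1) (G : SF T10 θ x) :
    e1 (P10 F α) x G.Z2 = e1 α x G.Z2 := P10_Z F α G.mZ2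
@[simp] lemma P10_W1 (α : Ω 1) (G : SF T10 θ x) : e1 (P10 F α) x G.W1 = 0 := P10_W F α G.mW1
@[simp] lemma P10_W2 (α : Ω 1) (G : SF T10 θ x) : e1 (P10 F α) x G.W2 = 0 := P10_W F α G.mW2
@[simp] lemma P01_Z1 (α : Ω 1) (G : SF T10 θ x) : e1 (P01 F α) x G.Z1 = 0 := P01_Z F α G.mZ1
@[simp] lemma P01_Z2 (α : Ω 1) (G : SF T10 θ x) : e1 (P01 F α) x G.Z2 = 0 := P01_Z F α G.mZ2
@[simp] lemma P01_W1 (α : Ω 1) (G : SF T10 θ x) :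
    e1 (P01 F α) x G.W1 = e1 α x G.W1 := P01_W F α G.mW1
@[simp] lemma P01_W2 (α : Ω 1) (G : SF T10 θ x) :
    e1 (P01 F α) x G.W2 = e1 α x G.W2 := P01_W F α G.mW2

lemma P10_frame (G : ∀ y, SF T10 θ y) (α : Ω 1) : P10 F α = P10 G α := by
  funext y
  apply (F y).ext1 <;> simp
lemma P01_frame (G : ∀ y, SF T10 θ y) (α : Ω 1) : P01 F α = P01 G α := by
  funext y
  apply (F y).ext1 <;> simp

/-! ### Four-forms divisible by the contact form -/

/-- The horizontal one-form `τ` with `μ = θ ∧ τ ∧ dθ`. -/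
def lam (μ : Ω 4) : Ω 1 := fsmul (fun y => -I * e4 μ y (F y).T (F y).Z1 (F y).Z2 (F y).W2) (cf1 F)
  + fsmul (fun y => I * e4 μ y (F y).T (F y).Z1 (F y).Z2 (F y).W1) (cf2 F)
  + fsmul (fun y => I * e4 μ y (F y).T (F y).Z2 (F y).W1 (F y).W2) (cf3 F)
  + fsmul (fun y => -I * e4 μ y (F y).T (F y).Z1 (F y).W1 (F y).W2) (cf4 F)

lemma lam_T (μ : Ω 4) (G : SF T10 θ x) : e1 (lam F μ) x G.T = 0 := by rw [G.T_eq (F x)]; simp [lam]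

lemma I_mul_I_mul (z : ℂ) : I * (I * z) = -z := by rw [← mul_assoc, I_mul_I, neg_one_mul]

/-- Evaluation of `θ ∧ μ` on an adapted frame. -/
lemma e5_w14_theta (G : SF T10 θ x) (μ : Ω 4) :
    e5 (w14 θ μ) x G.T G.Z1 G.Z2 G.W1 G.W2 = e4 μ x G.Z1 G.Z2 G.W1 G.W2 := by
  simp

lemma w14_theta_eq_zero (G : SF T10 θ x) {μ : Ω 4} :
    w14 θ μ x = 0 ↔ e4 μ x G.Z1 G.Z2 G.W1 G.W2 = 0 := by
  rw [← e5_w14_theta]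
  constructor
  · intro h; rw [e5, h, evalC_zero]
  · intro h
    have : w14 θ μ x = (0 : Ω 5) x := G.ext5 (by rw [h, e5_zero])
    exact this

lemma w13_theta_eq_zero (G : SF T10 θ x) {ν : Ω 3} (h : w13 θ ν x = 0) :
    e3 ν x G.Z1 G.Z2 G.W1 = 0 ∧ e3 ν x G.Z1 G.Z2 G.W2 = 0 ∧ e3 ν x G.Z1 G.W1 G.W2 = 0 ∧
      e3 ν x G.Z2 G.W1 G.W2 = 0 := by
  have h' : ∀ a b c d, e4 (w13 θ ν) x a b c d = 0 := fun a b c d => by rw [e4, h, evalC_zero]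
  refine ⟨?_, ?_, ?_, ?_⟩
  · simpa using h' G.T G.Z1 G.Z2 G.W1
  · simpa using h' G.T G.Z1 G.Z2 G.W2
  · simpa using h' G.T G.Z1 G.W1 G.W2
  · simpa using h' G.T G.Z2 G.W1 G.W2

lemma lam_spec {μ : Ω 4} (h : w14 θ μ x = 0) : w13 θ (w12 (lam F μ) (d1 θ)) x = μ x := by
  rw [w14_theta_eq_zero (F x)] at h
  apply (F x).ext4 <;> simp [lam, h]
  all_goals ring_nf
  all_goals simp

lemma lam_unique {μ : Ω 4} {α : Ω 1} (h : w13 θ (w12 α (d1 θ)) x = μ x)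
    (hT : e1 α x (F x).T = 0) : lam F μ x = α x := by
  have h' : ∀ a b c d, e4 μ x a b c d = e4 (w13 θ (w12 α (d1 θ))) x a b c d := fun a b c d => by
    rw [e4, ← h, ← e4]
  apply (F x).ext1 <;> simp [lam, h', hT, I_mul_I_mul, mul_comm _ I]

lemma lam_mod {μ : Ω 4} {α : Ω 1} (h : w13 θ (w12 α (d1 θ)) x = μ x) :
    w11 θ α x = w11 θ (lam F μ) x := by
  have h' : ∀ a b c d, e4 μ x a b c d = e4 (w13 θ (w12 α (d1 θ))) x a b c d := fun a b c d => by
    rw [e4, ← h, ← e4]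
  apply (F x).ext2 <;> simp [lam, h', I_mul_I_mul, mul_comm _ I]

lemma lam_frame (G : ∀ y, SF T10 θ y) {μ : Ω 4} (h : w14 θ μ x = 0) : lam F μ x = lam G μ x :=
  lam_unique F (lam_spec G h) (lam_T G μ _)

/-! ### Three-forms divisible by the contact form -/

/-- The `(3,0)`-part of a three-form. -/
def Q30 (ν : Ω 3) : Ω 3 :=
  fsmul (fun y => e3 ν y (F y).T (F y).Z1 (F y).Z2) (w12 θ (w11 (cf1 F) (cf2 F)))
/-- The `(1,2)`-part of a three-form. -/
def Q12 (ν : Ω 3) : Ω 3 :=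
  fsmul (fun y => e3 ν y (F y).T (F y).W1 (F y).W2) (w12 θ (w11 (cf3 F) (cf4 F)))
/-- The primitive `(2,1)`-part of a three-form. -/
def Q21 (ν : Ω 3) : Ω 3 :=
  fsmul (fun y => (e3 ν y (F y).T (F y).Z1 (F y).W1 - e3 ν y (F y).T (F y).Z2 (F y).W2) / 2)
    (w12 θ (w11 (cf1 F) (cf3 F)) - w12 θ (w11 (cf2 F) (cf4 F)))
  + fsmul (fun y => e3 ν y (F y).T (F y).Z1 (F y).W2) (w12 θ (w11 (cf1 F) (cf4 F)))
  + fsmul (fun y => e3 ν y (F y).T (F y).Z2 (F y).W1) (w12 θ (w11 (cf2 F) (cf3 F)))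

lemma Q_decomp {ν : Ω 3} (h : w13 θ ν x = 0) : ν x = Q30 F ν x + Q21 F ν x + Q12 F ν x + ((-I) *
      (e3 ν x (F x).T (F x).Z1 (F x).W1 + e3 ν x (F x).T (F x).Z2 (F x).W2) / 2) •
        w12 θ (d1 θ) x := by
  obtain ⟨h1, h2, h3, h4⟩ := w13_theta_eq_zero (F x) h
  have : ν x = (Q30 F ν + Q21 F ν + Q12 F ν + fsmul (fun y => (-I) *
      (e3 ν y (F y).T (F y).Z1 (F y).W1 + e3 ν y (F y).T (F y).Z2 (F y).W2) / 2)
      (w12 θ (d1 θ))) x := by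
    have hI := I_mul_I
    apply (F x).ext3 <;> simp [Q30, Q21, Q12, h1, h2, h3, h4]
    · linear_combination ((e3 ν x (F x).T (F x).Z1 (F x).W1
        + e3 ν x (F x).T (F x).Z2 (F x).W2) / 2) * hI
    · linear_combination ((e3 ν x (F x).T (F x).Z1 (F x).W1
        + e3 ν x (F x).T (F x).Z2 (F x).W2) / 2) * hI
  exact this

/-- The pointwise characterization of the `(2,1)`-part. -/
lemma Q21_eq {ν A β B : Ω 3} {ξ : ℂ} (h : ν x = A x + β x + B x + ξ • w12 θ (d1 θ) x)
    (hA : ∀ Z ∈ T10 x, ∀ W, conjC W ∈ T10 x → e3 A x (F x).T Z W = 0)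
    (hB : ∀ Z ∈ T10 x, ∀ W, conjC W ∈ T10 x → e3 B x (F x).T Z W = 0)
    (h0 : w13 θ β x = 0) (hZ : ∀ Z ∈ T10 x, ∀ Z' ∈ T10 x, e3 β x (F x).T Z Z' = 0)
    (hW : ∀ W, conjC W ∈ T10 x → ∀ W', conjC W' ∈ T10 x → e3 β x (F x).T W W' = 0)
    (hp : e3 β x (F x).T (F x).Z1 (F x).W1 + e3 β x (F x).T (F x).Z2 (F x).W2 = 0) :
    Q21 F ν x = β x := by
  obtain ⟨h1, h2, h3, h4⟩ := w13_theta_eq_zero (F x) h0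
  have h' : ∀ a b c, e3 ν x a b c = e3 A x a b c + e3 β x a b c + e3 B x a b c
      + ξ * e3 (w12 θ (d1 θ)) x a b c := fun a b c => by
    rw [e3, h, evalC_add, evalC_add, evalC_add, evalC_smul]; rfl
  have mZ1 := (F x).mZ1
  have mZ2 := (F x).mZ2
  have mW1 := (F x).mW1
  have mW2 := (F x).mW2
  apply (F x).ext3 <;> simp [Q21, h', h1, h2, h3, h4, hA _ mZ1 _ mW1, hA _ mZ1 _ mW2,
    hA _ mZ2 _ mW1, hA _ mZ2 _ mW2, hB _ mZ1 _ mW1, hB _ mZ1 _ mW2, hB _ mZ2 _ mW1,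
    hB _ mZ2 _ mW2, hZ _ mZ1 _ mZ2, hW _ mW1 _ mW2]
  · linear_combination (-1 / 2) * hp
  · linear_combination (-1 / 2) * hp

lemma Q30_T_ZW (ν : Ω 3) (v : ℂT x) {Z W : ℂT x} (hZ : Z ∈ T10 x)
    (hW : conjC W ∈ T10 x) : e3 (Q30 F ν) x v Z W = 0 := by
  simp [Q30, (F x).t_Z hZ, (F x).t_W hW, cf1_W hW, cf2_W hW]
lemma Q30_T_WW (ν : Ω 3) (v : ℂT x) {Z W : ℂT x} (hZ : conjC Z ∈ T10 x)
    (hW : conjC W ∈ T10 x) : e3 (Q30 F ν) x v Z W = 0 := by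
  simp [Q30, (F x).t_W hZ, (F x).t_W hW, cf1_W hW, cf2_W hW]
lemma Q12_T_ZW (ν : Ω 3) (v : ℂT x) {Z W : ℂT x} (hZ : Z ∈ T10 x)
    (hW : conjC W ∈ T10 x) : e3 (Q12 F ν) x v Z W = 0 := by
  simp [Q12, (F x).t_Z hZ, (F x).t_W hW, cf3_Z hZ, cf4_Z hZ]
lemma Q12_T_ZZ (ν : Ω 3) (v : ℂT x) {Z W : ℂT x} (hZ : Z ∈ T10 x)
    (hW : W ∈ T10 x) : e3 (Q12 F ν) x v Z W = 0 := by
  simp [Q12, (F x).t_Z hZ, (F x).t_Z hW, cf3_Z hZ, cf4_Z hZ]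
lemma Q21_T_ZZ (ν : Ω 3) (v : ℂT x) {Z W : ℂT x} (hZ : Z ∈ T10 x)
    (hW : W ∈ T10 x) : e3 (Q21 F ν) x v Z W = 0 := by
  simp [Q21, (F x).t_Z hZ, (F x).t_Z hW, cf3_Z hZ, cf4_Z hZ, cf3_Z hW, cf4_Z hW]
lemma Q21_T_WW (ν : Ω 3) (v : ℂT x) {Z W : ℂT x} (hZ : conjC Z ∈ T10 x)
    (hW : conjC W ∈ T10 x) : e3 (Q21 F ν) x v Z W = 0 := by
  simp [Q21, (F x).t_W hZ, (F x).t_W hW, cf1_W hZ, cf2_W hZ, cf1_W hW, cf2_W hW]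

lemma w13_theta_w12 (G : SF T10 θ x) (α : Ω 2) : w13 θ (w12 θ α) x = 0 := by
  have : w13 θ (w12 θ α) x = (0 : Ω 4) x := by apply G.ext4 <;> simp
  exact this
lemma w13_theta_Q21 (ν : Ω 3) : w13 θ (Q21 F ν) x = 0 := by
  have : w13 θ (Q21 F ν) x = (0 : Ω 4) x := by apply (F x).ext4 <;> simp [Q21]
  exact this
lemma w13_theta_Q30 (ν : Ω 3) : w13 θ (Q30 F ν) x = 0 := by
  have : w13 θ (Q30 F ν) x = (0 : Ω 4) x := by apply (F x).ext4 <;> simp [Q30]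
  exact this
lemma w13_theta_Q12 (ν : Ω 3) : w13 θ (Q12 F ν) x = 0 := by
  have : w13 θ (Q12 F ν) x = (0 : Ω 4) x := by apply (F x).ext4 <;> simp [Q12]
  exact this

end Tables

lemma d2_w11_univ {α β : Ω 1} (hα : SmoothOn α univ) (hβ : SmoothOn β univ) :
    d2 (w11 α β) = w12 β (d1 α) - w12 α (d1 β) :=
  funext fun x => d2_w11 isOpen_univ (mem_univ x) hα hβ
lemma d3_w12_univ {α : Ω 1} {β : Ω 2} (hα : SmoothOn α univ)
    (hβ : SmoothOn β univ) : d3 (w12 α β) = w22 (d1 α) β - w13 α (d2 β) :=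
  funext fun x => d3_w12 isOpen_univ (mem_univ x) hα hβ
lemma d1_fsmul_univ {f : M → ℂ} {β : Ω 1} (hf : SmFn f univ)
    (hβ : SmoothOn β univ) : d1 (fsmul f β) = w11 (dFn f) β + fsmul f (d1 β) :=
  funext fun x => d1_fsmul isOpen_univ (mem_univ x) hf hβ
lemma d2_fsmul_univ {f : M → ℂ} {β : Ω 2} (hf : SmFn f univ)
    (hβ : SmoothOn β univ) : d2 (fsmul f β) = w12 (dFn f) β + fsmul f (d2 β) :=
  funext fun x => d2_fsmul isOpen_univ (mem_univ x) hf hβ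
lemma d3_fsmul_univ {f : M → ℂ} {β : Ω 3} (hf : SmFn f univ)
    (hβ : SmoothOn β univ) : d3 (fsmul f β) = w13 (dFn f) β + fsmul f (d3 β) :=
  funext fun x => d3_fsmul isOpen_univ (mem_univ x) hf hβ
lemma d2_d1_univ {α : Ω 1} (hα : SmoothOn α univ) : d2 (d1 α) = 0 :=
  funext fun x => d2_d1 isOpen_univ (mem_univ x) hα
lemma d3_d2_univ {α : Ω 2} (hα : SmoothOn α univ) : d3 (d2 α) = 0 :=
  funext fun x => d3_d2 isOpen_univ (mem_univ x) hα
lemma d1_dFn_univ {f : M → ℂ} (hf : SmFn f univ) : d1 (dFn f) = 0 :=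
  funext fun x => d1_dFn isOpen_univ (mem_univ x) hf

lemma d1_add {α β : Ω 1} (hα : SmoothOn α univ) (hβ : SmoothOn β univ) :
    d1 (α + β) = d1 α + d1 β := funext fun x => extD_add isOpen_univ (mem_univ x) hα hβ
lemma d2_add {α β : Ω 2} (hα : SmoothOn α univ) (hβ : SmoothOn β univ) :
    d2 (α + β) = d2 α + d2 β := funext fun x => extD_add isOpen_univ (mem_univ x) hα hβ
lemma d3_add {α β : Ω 3} (hα : SmoothOn α univ) (hβ : SmoothOn β univ) :
    d3 (α + β) = d3 α + d3 β := funext fun x => extD_add isOpen_univ (mem_univ x) hα hβ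
lemma d1_sub {α β : Ω 1} (hα : SmoothOn α univ) (hβ : SmoothOn β univ) :
    d1 (α - β) = d1 α - d1 β := funext fun x => extD_sub isOpen_univ (mem_univ x) hα hβ
lemma d2_sub {α β : Ω 2} (hα : SmoothOn α univ) (hβ : SmoothOn β univ) :
    d2 (α - β) = d2 α - d2 β := funext fun x => extD_sub isOpen_univ (mem_univ x) hα hβ
lemma d3_sub {α β : Ω 3} (hα : SmoothOn α univ) (hβ : SmoothOn β univ) :
    d3 (α - β) = d3 α - d3 β := funext fun x => extD_sub isOpen_univ (mem_univ x) hα hβ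
lemma d1_smul (c : ℂ) {α : Ω 1} (hα : SmoothOn α univ) : d1 (c • α) = c • d1 α :=
  funext fun x => extD_const_smul isOpen_univ (mem_univ x) c hα
lemma d2_smul (c : ℂ) {α : Ω 2} (hα : SmoothOn α univ) : d2 (c • α) = c • d2 α :=
  funext fun x => extD_const_smul isOpen_univ (mem_univ x) c hα
lemma d3_smul (c : ℂ) {α : Ω 3} (hα : SmoothOn α univ) : d3 (c • α) = c • d3 α :=
  funext fun x => extD_const_smul isOpen_univ (mem_univ x) c hα
lemma d3_neg {α : Ω 3} (hα : SmoothOn α univ) : d3 (-α) = -d3 α :=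
  funext fun x => extD_neg isOpen_univ (mem_univ x) hα

lemma extD_zero_apply (k : ℕ) (x : M) : extD (0 : Ω k) x = 0 := by
  have := extD_sum (s := (∅ : Finset ℕ)) (ω := fun _ => (0 : Ω k)) isOpen_univ
    (mem_univ x) (by simp)
  simpa using this

/-- The wedge product of a two-form and a three-form. -/
def w23 (α : Ω 2) (β : Ω 3) : Ω 5 := α ∧ᶠ β

lemma e5_w23 (α : Ω 2) (β : Ω 3) (x : M) (a b c d e : ℂT x) : e5 (w23 α β) x a b c d e =
      e2 α x a b * e3 β x c d e - e2 α x a c * e3 β x b d e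
        + e2 α x a d * e3 β x b c e - e2 α x a e * e3 β x b c d
        + e2 α x b c * e3 β x a d e - e2 α x b d * e3 β x a c e
        + e2 α x b e * e3 β x a c d + e2 α x c d * e3 β x a b e
        - e2 α x c e * e3 β x a b d + e2 α x d e * e3 β x a b c := by
  rw [e5, w23, evalC, toAlternatingMap_wedge]
  exact cEval_wedge_two_three _ _ a b c d e

/-- The exterior derivative of four-forms. -/
def d4 (μ : Ω 4) : Ω 5 := extD μ

set_option maxRecDepth 4000 in
lemma d4_w13 (hU : IsOpen U) (hx : x ∈ U) {α : Ω 1} {β : Ω 3}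
    (hα : SmoothOn α U) (hβ : SmoothOn β U) : d4 (w13 α β) x = w23 (d1 α) β x - w14 α (d3 β) x := by
  have h := extD_wedge_one_three hU hx hα hβ
  exact ContinuousAlternatingMap.ext fun v => congrArg (fun f : TS x [⋀^Fin 5]→L[ℝ] ℂ => f v) h

/-- If `θ ∧ ν = 0` then `θ ∧ dν = dθ ∧ ν`. -/
lemma w14_d3_of_theta {θ : Ω 1} (hU : IsOpen U)
    (hθ : SmoothOn θ U) {ν : Ω 3} (hν : SmoothOn ν U) (h0 : ∀ y ∈ U, w13 θ ν y = 0)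
    (hx : x ∈ U) : w14 θ (d3 ν) x = w23 (d1 θ) ν x := by
  have h1 : d4 (w13 θ ν) x = 0 := by
    rw [d4, extD_congr (η := (0 : Ω 4)) hU h0 hx]
    exact extD_zero_apply 4 x
  rw [d4_w13 hU hx hθ hν] at h1
  exact (sub_eq_zero.1 h1).symm

lemma e4_d3_of_theta {T10 : CDistribution M} {θ : Ω 1} (hU : IsOpen U)
    (hθ : SmoothOn θ U) {ν : Ω 3} (hν : SmoothOn ν U) (h0 : ∀ y ∈ U, w13 θ ν y = 0)
    (hx : x ∈ U) (G : SF T10 θ x) : e4 (d3 ν) x G.Z1 G.Z2 G.W1 G.W2 =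
      -I * (e3 ν x G.T G.Z1 G.W1 + e3 ν x G.T G.Z2 G.W2) := by
  rw [← e5_w14_theta, e5, w14_d3_of_theta hU hθ hν h0 hx, ← e5, e5_w23]
  simp
  ring

section Smoothness

lemma SmCV.smoothOn_iot {Z : ∀ p : M, ℂT p} (hZ : SmCV Z U)
    {ω : Ω (k + 1)} (hω : SmoothOn ω U) : SmoothOn (iot Z ω) U := by
  obtain ⟨η, hη, h⟩ := hZ.exists_contraction hω
  refine hη.congr fun y hy => cform_ext_toAlternatingMap ?_
  rw [toAlternatingMap_iot, h y hy]

variable {F : ∀ y, SF T10 θ y}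

lemma SmSF.mono (hF : SmSF F U) {V : Set M} (hV : IsOpen V) (h : V ⊆ U) : SmSF F V :=
  ⟨hV, hF.T.mono h, hF.Z1.mono h, hF.Z2.mono h, hF.W1.mono h, hF.W2.mono h⟩

lemma SmSF.cf1 (hθ : IsContactForm T10 θ) (hF : SmSF F U) : SmoothOn (cf1 F) U :=
  (hF.W1.smoothOn_iot ((hθ.smooth.mono (subset_univ U)).d1 hF.isOpen)).const_smul _
lemma SmSF.cf2 (hθ : IsContactForm T10 θ) (hF : SmSF F U) : SmoothOn (cf2 F) U :=
  (hF.W2.smoothOn_iot ((hθ.smooth.mono (subset_univ U)).d1 hF.isOpen)).const_smul _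
lemma SmSF.cf3 (hθ : IsContactForm T10 θ) (hF : SmSF F U) : SmoothOn (cf3 F) U :=
  (hF.Z1.smoothOn_iot ((hθ.smooth.mono (subset_univ U)).d1 hF.isOpen)).const_smul _
lemma SmSF.cf4 (hθ : IsContactForm T10 θ) (hF : SmSF F U) : SmoothOn (cf4 F) U :=
  (hF.Z2.smoothOn_iot ((hθ.smooth.mono (subset_univ U)).d1 hF.isOpen)).const_smul _

/-- The trace of a two-form with respect to `dθ`. -/
def tr2 (F : ∀ y, SF T10 θ y) (X : Ω 2) (y : M) : ℂ :=
  e2 X y (F y).Z1 (F y).W1 + e2 X y (F y).Z2 (F y).W2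

/-- The coefficient of `θ ∧ μ` with respect to `θ ∧ dθ²`, doubled. -/
def top4 (F : ∀ y, SF T10 θ y) (μ : Ω 4) (y : M) : ℂ := e4 μ y (F y).Z1 (F y).Z2 (F y).W1 (F y).W2

lemma top4_w22 (F : ∀ y, SF T10 θ y) (X : Ω 2) (y : M) :
    top4 F (w22 X (d1 θ)) y = -I * tr2 F X y := by
  simp [top4, tr2]; ring

lemma top4_spec (F : ∀ y, SF T10 θ y) (μ : Ω 4) (y : M) :
    w14 θ μ y = (top4 F μ y / 2) • w14 θ (w22 (d1 θ) (d1 θ)) y := by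
  have : w14 θ μ y = fsmul (fun z => top4 F μ z / 2) (w14 θ (w22 (d1 θ) (d1 θ))) y := by
    apply (F y).ext5
    simp [top4]
    ring_nf
  exact this

lemma top4_dtheta (F : ∀ y, SF T10 θ y) (y : M) : top4 F (w22 (d1 θ) (d1 θ)) y = 2 := by
  simp [top4]; ring_nf

lemma top4_eq (F : ∀ y, SF T10 θ y) {μ : Ω 4} {y : M} {c : ℂ}
    (h : w14 θ μ y = c • w14 θ (w22 (d1 θ) (d1 θ)) y) : top4 F μ y = 2 * c := by
  have h1 : e5 (w14 θ μ) y (F y).T (F y).Z1 (F y).Z2 (F y).W1 (F y).W2 =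
      c * e5 (w14 θ (w22 (d1 θ) (d1 θ))) y (F y).T (F y).Z1 (F y).Z2 (F y).W1 (F y).W2 := by
    rw [e5, h, evalC_smul]; rfl
  rw [e5_w14_theta, e5_w14_theta] at h1
  have h2 := top4_dtheta F y
  simp only [top4] at h2 ⊢
  rw [h1, h2]; ring

lemma top4_frame (F G : ∀ y, SF T10 θ y) (μ : Ω 4) : top4 F μ = top4 G μ := by
  funext y
  rw [top4_eq F (top4_spec G μ y)]; ring

lemma tr2_frame (F G : ∀ y, SF T10 θ y) (X : Ω 2) : tr2 F X = tr2 G X := by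
  funext y
  have h1 := top4_w22 F X y
  rw [top4_frame F G, top4_w22 G] at h1
  exact (mul_left_cancel₀ (neg_ne_zero.2 I_ne_zero) h1).symm

lemma w14_theta_eq_zero_iff (F : ∀ y, SF T10 θ y) {μ : Ω 4} : w14 θ μ = 0 ↔ top4 F μ = 0 := by
  constructor
  · intro h; funext y; exact (w14_theta_eq_zero (F y)).1 (congrFun h y)
  · intro h; funext y; exact (w14_theta_eq_zero (F y)).2 (congrFun h y)

lemma Q21_frame (F G : ∀ y, SF T10 θ y) {ν : Ω 3} (h : w13 θ ν x = 0) : Q21 F ν x = Q21 G ν x := by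
  refine Q21_eq F (Q_decomp G h) (fun Z hZ W hW => Q30_T_ZW G ν _ hZ hW)
    (fun Z hZ W hW => Q12_T_ZW G ν _ hZ hW) (w13_theta_Q21 G ν)
    (fun Z hZ Z' hZ' => Q21_T_ZZ G ν _ hZ hZ') (fun W hW W' hW' => Q21_T_WW G ν _ hW hW') ?_
  have h1 := congrFun (tr2_frame F G (iot (fun y => (F y).T) (Q21 G ν))) x
  simp only [tr2, e2_iot] at h1
  rw [h1, (F x).T_eq (G x)]
  simp [Q21]

lemma Q30_frame (F G : ∀ y, SF T10 θ y) (ν : Ω 3) : Q30 F ν x = Q30 G ν x := by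
  obtain ⟨a, b, h1⟩ := (G x).spanZ _ (F x).mZ1
  obtain ⟨c, d, h2⟩ := (G x).spanZ _ (F x).mZ2
  have e1 : e3 ν x (F x).T (F x).Z1 (F x).Z2 = (a * d - b * c) * e3 ν x (G x).T (G x).Z1 (G x).Z2 := by
    have := e2_iot (fun y => (F y).T) ν x
    simp only [(F x).T_eq (G x)] at this ⊢
    rw [← this, ← this, h1, h2]
    simp only [e2_add_left, e2_smul_left, e2_add_right, e2_smul_right, e2_self]
    rw [e2_swap (G x).Z2 (G x).Z1]
    ring
  have hW1 := cf1_W (F := G) (F x).mW1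
  have hW2 := cf1_W (F := G) (F x).mW2
  have hW3 := cf2_W (F := G) (F x).mW1
  have hW4 := cf2_W (F := G) (F x).mW2
  have hT1 := cf1_T (x := x) G
  have hT2 := cf2_T (x := x) G
  rw [← (F x).T_eq (G x)] at hT1 hT2
  have k1 : _root_.e1 (cf1 G) x (F x).Z1 = a := by rw [h1]; simp [e1_add_vec, e1_smul_vec]
  have k2 : _root_.e1 (cf2 G) x (F x).Z1 = b := by rw [h1]; simp [e1_add_vec, e1_smul_vec]
  have k3 : _root_.e1 (cf1 G) x (F x).Z2 = c := by rw [h2]; simp [e1_add_vec, e1_smul_vec]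
  have k4 : _root_.e1 (cf2 G) x (F x).Z2 = d := by rw [h2]; simp [e1_add_vec, e1_smul_vec]
  apply (F x).ext3 <;> simp [Q30, hW1, hW2, hW3, hW4, hT1, hT2, k1, k2, k3, k4, e1]
  ring

lemma Q12_frame (F G : ∀ y, SF T10 θ y) {ν : Ω 3} (h : w13 θ ν x = 0) : Q12 F ν x = Q12 G ν x := by
  have h1 := Q_decomp F h
  have h2 := Q_decomp G h
  have h3 := congrFun (tr2_frame F G (iot (fun y => (F y).T) ν)) x
  simp only [tr2, e2_iot] at h3
  rw [(F x).T_eq (G x)] at h3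
  rw [h1, Q21_frame F G h, Q30_frame F G, (F x).T_eq (G x), h3] at h2
  exact add_left_cancel (add_right_cancel h2)

variable (hT10 : IsCRStructure T10) (hθ : IsContactForm T10 θ)

include hT10 hθ

/-- Smoothness on an open set may be checked with smooth local frames. -/
lemma smoothOn_of_frames {V : Set M} (hV : IsOpen V) {ω : Ω k}
    (h : ∀ (G : ∀ y, SF T10 θ y) (W : Set M), SmSF G W → W ⊆ V → SmoothOn ω W) : SmoothOn ω V := by
  refine smoothOn_of_locally fun x hx => ?_
  obtain ⟨U, hxU, G, hG⟩ := exists_local_frame hT10 hθ x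
  have hW : IsOpen (U ∩ V) := hG.isOpen.inter hV
  exact ⟨U ∩ V, hW, ⟨hxU, hx⟩, h G _ (hG.mono hW inter_subset_left) inter_subset_right⟩

lemma smFn_of_frames {V : Set M} (hV : IsOpen V) {f : M → ℂ}
    (h : ∀ (G : ∀ y, SF T10 θ y) (W : Set M), SmSF G W → W ⊆ V → SmFn f W) : SmFn f V := by
  refine smFn_of_locally fun x hx => ?_
  obtain ⟨U, hxU, G, hG⟩ := exists_local_frame hT10 hθ x
  have hW : IsOpen (U ∩ V) := hG.isOpen.inter hV
  exact ⟨U ∩ V, hW, ⟨hxU, hx⟩, h G _ (hG.mono hW inter_subset_left) inter_subset_right⟩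

variable (F : ∀ y, SF T10 θ y) {V : Set M} (hV : IsOpen V)

include hV

lemma smoothOn_P10 {α : Ω 1} (hα : SmoothOn α V) : SmoothOn (P10 F α) V := by
  refine smoothOn_of_frames hT10 hθ hV fun G W hG hW => ?_
  rw [P10_frame F G]
  exact (SmoothOn.fsmul (hG.Z1.smFn_e1 (hα.mono hW)) (hG.cf1 hθ)).add
    (SmoothOn.fsmul (hG.Z2.smFn_e1 (hα.mono hW)) (hG.cf2 hθ))

lemma smoothOn_P01 {α : Ω 1} (hα : SmoothOn α V) : SmoothOn (P01 F α) V := by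
  refine smoothOn_of_frames hT10 hθ hV fun G W hG hW => ?_
  rw [P01_frame F G]
  exact (SmoothOn.fsmul (hG.W1.smFn_e1 (hα.mono hW)) (hG.cf3 hθ)).add
    (SmoothOn.fsmul (hG.W2.smFn_e1 (hα.mono hW)) (hG.cf4 hθ))

lemma smoothOn_lam {μ : Ω 4} (hμ : SmoothOn μ V) (h : ∀ y ∈ V, w14 θ μ y = 0) :
    SmoothOn (lam F μ) V := by
  refine smoothOn_of_frames hT10 hθ hV fun G W hG hW => ?_
  have hm := hμ.mono hW
  refine SmoothOn.congr (ω := lam G μ) ?_ fun y hy => lam_frame F G (h y (hW hy))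
  have c := smFn_const (M := M)
  exact (((SmoothOn.fsmul ((c _ W).mul (hG.T.smFn_e4 hG.Z1 hG.Z2 hG.W2 hm)) (hG.cf1 hθ)).add
    (SmoothOn.fsmul ((c _ W).mul (hG.T.smFn_e4 hG.Z1 hG.Z2 hG.W1 hm)) (hG.cf2 hθ))).add
    (SmoothOn.fsmul ((c _ W).mul (hG.T.smFn_e4 hG.Z2 hG.W1 hG.W2 hm)) (hG.cf3 hθ))).add
    (SmoothOn.fsmul ((c _ W).mul (hG.T.smFn_e4 hG.Z1 hG.W1 hG.W2 hm)) (hG.cf4 hθ))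

lemma smoothOn_Q21 {ν : Ω 3} (hν : SmoothOn ν V) (h : ∀ y ∈ V, w13 θ ν y = 0) :
    SmoothOn (Q21 F ν) V := by
  refine smoothOn_of_frames hT10 hθ hV fun G W hG hW => ?_
  have hm := hν.mono hW
  have ht := hθ.smooth.mono (subset_univ W)
  refine SmoothOn.congr (ω := Q21 G ν) ?_ fun y hy => Q21_frame F G (h y (hW hy))
  exact ((SmoothOn.fsmul (((hG.T.smFn_e3 hG.Z1 hG.W1 hm).sub (hG.T.smFn_e3 hG.Z2 hG.W2 hm)).div
    (smFn_const _ W) (by simp)) ((ht.w12 ((hG.cf1 hθ).w11 (hG.cf3 hθ))).sub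
      (ht.w12 ((hG.cf2 hθ).w11 (hG.cf4 hθ))))).add
    (SmoothOn.fsmul (hG.T.smFn_e3 hG.Z1 hG.W2 hm) (ht.w12 ((hG.cf1 hθ).w11 (hG.cf4 hθ))))).add
    (SmoothOn.fsmul (hG.T.smFn_e3 hG.Z2 hG.W1 hm) (ht.w12 ((hG.cf2 hθ).w11 (hG.cf3 hθ))))

lemma smoothOn_Q30 {ν : Ω 3} (hν : SmoothOn ν V) : SmoothOn (Q30 F ν) V := by
  refine smoothOn_of_frames hT10 hθ hV fun G W hG hW => ?_
  have hm := hν.mono hW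
  have ht := hθ.smooth.mono (subset_univ W)
  refine SmoothOn.congr (ω := Q30 G ν) ?_ fun y hy => Q30_frame F G ν
  exact SmoothOn.fsmul (hG.T.smFn_e3 hG.Z1 hG.Z2 hm) (ht.w12 ((hG.cf1 hθ).w11 (hG.cf2 hθ)))

lemma smoothOn_Q12 {ν : Ω 3} (hν : SmoothOn ν V) (h : ∀ y ∈ V, w13 θ ν y = 0) :
    SmoothOn (Q12 F ν) V := by
  refine smoothOn_of_frames hT10 hθ hV fun G W hG hW => ?_
  have hm := hν.mono hW
  have ht := hθ.smooth.mono (subset_univ W)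
  refine SmoothOn.congr (ω := Q12 G ν) ?_ fun y hy => Q12_frame F G (h y (hW hy))
  exact SmoothOn.fsmul (hG.T.smFn_e3 hG.W1 hG.W2 hm) (ht.w12 ((hG.cf3 hθ).w11 (hG.cf4 hθ)))

lemma smFn_top4 {μ : Ω 4} (hμ : SmoothOn μ V) : SmFn (top4 F μ) V := by
  refine smFn_of_frames hT10 hθ hV fun G W hG hW => ?_
  rw [top4_frame F G]
  exact hG.Z1.smFn_e4 hG.Z2 hG.W1 hG.W2 (hμ.mono hW)

lemma smFn_tr2 {X : Ω 2} (hX : SmoothOn X V) : SmFn (tr2 F X) V := by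
  refine smFn_of_frames hT10 hθ hV fun G W hG hW => ?_
  rw [tr2_frame F G]
  exact (hG.Z1.smFn_e2 hG.W1 (hX.mono hW)).add (hG.Z2.smFn_e2 hG.W2 (hX.mono hW))

lemma smoothOn_iotT {ω : Ω (k + 1)} (hω : SmoothOn ω V) :
    SmoothOn (iot (fun y => (F y).T) ω) V := by
  refine smoothOn_of_frames hT10 hθ hV fun G W hG hW => ?_
  rw [show (fun y => (F y).T) = fun y => (G y).T from funext fun y => (F y).T_eq (G y)]
  exact hG.T.smoothOn_iot (hω.mono hW)

end Smoothness

lemma theUnique_eq {α : Type*} [Zero α] {P : α → Prop} {a : α} (h : P a)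
    (hu : ∀ b, P b → b = a) : theUnique P = a := by
  have h' : ∃! a, P a := ⟨a, h, hu⟩
  rw [theUnique, dif_pos h']
  exact hu _ h'.choose_spec.1

section Rumin

lemma wedge_assoc_theta (α : Ω 1) (ω η : Ω 2) : (α ∧ᶠ ω ∧ᶠ η : Ω 5) = w14 α (w22 ω η) := by
  funext x
  apply cform_ext_toAlternatingMap
  rw [toAlternatingMap_wedge, toAlternatingMap_wedge, w14, toAlternatingMap_wedge, w22,
    toAlternatingMap_wedge]
  exact wedge_assoc_one_two_two _ _ _

lemma wedge_assoc_one (α β : Ω 1) (η : Ω 2) : (α ∧ᶠ β ∧ᶠ η : Ω 4) = w13 α (w12 β η) := by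
  funext x
  apply cform_ext_toAlternatingMap
  rw [toAlternatingMap_wedge, toAlternatingMap_wedge, w13, toAlternatingMap_wedge, w12,
    toAlternatingMap_wedge]
  exact wedge_assoc_one_one_two _ _ _

lemma isRumin_one {ρ : Ω 1} : IsRumin θ ρ ↔ w14 θ (w22 (d1 ρ) (d1 θ)) = 0 := by
  rw [← wedge_assoc_theta]; rfl
lemma isRumin_two {ω : Ω 2} : IsRumin θ ω ↔ w14 θ (w22 ω (d1 θ)) = 0 ∧ w13 θ (d2 ω) = 0 := by
  rw [← wedge_assoc_theta]; rfl
lemma isRumin_three {ν : Ω 3} : IsRumin θ ν ↔ w13 θ ν = 0 ∧ w14 θ (d3 ν) = 0 := Iff.rfl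
lemma isRumin_four (F : ∀ y, SF T10 θ y) {μ : Ω 4} : IsRumin θ μ ↔ w14 θ μ = 0 :=
  ⟨fun h => h.1, fun h => ⟨h, funext fun x => (F x).six_form_eq_zero _⟩⟩

lemma SF.exists_real (hθ : IsContactForm T10 θ) (F : SF T10 θ x) :
    ∃ v : TS x, F.T = (1 : ℂ) ⊗ₜ[ℝ] v := exists_real_of_conjC_eq (SF.conjT hθ F)

lemma e3_of_theta (G : SF T10 θ x) {ν : Ω 3} (h : w13 θ ν x = 0)
    (v : ℂT x) {a b : ℂT x} (ha : e1 θ x a = 0) (hb : e1 θ x b = 0) :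
    e3 ν x v a b = e1 θ x v * e3 ν x G.T a b := by
  have h' : e4 (w13 θ ν) x G.T v a b = 0 := by rw [e4, h, evalC_zero]
  rw [e4_w13, G.tT, ha, hb] at h'
  linear_combination h'

lemma e4_of_theta (G : SF T10 θ x) {μ : Ω 4} (h : w14 θ μ x = 0)
    (v : ℂT x) {a b c : ℂT x} (ha : e1 θ x a = 0) (hb : e1 θ x b = 0)
    (hc : e1 θ x c = 0) : e4 μ x v a b c = e1 θ x v * e4 μ x G.T a b c := by
  have h' : e5 (w14 θ μ) x G.T v a b c = 0 := by rw [e5, h, evalC_zero]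
  rw [e5_w14, G.tT, ha, hb, hc] at h'
  linear_combination h'

section

variable (F : ∀ y, SF T10 θ y)

include F

lemma w12_add (α : Ω 1) (a b : Ω 2) : w12 α (a + b) = w12 α a + w12 α b := by
  funext x; apply (F x).ext3 <;> simp <;> ring
lemma w12_sub (α : Ω 1) (a b : Ω 2) : w12 α (a - b) = w12 α a - w12 α b := by
  funext x; apply (F x).ext3 <;> simp <;> ring
lemma w12_smul (α : Ω 1) (c : ℂ) (a : Ω 2) : w12 α (c • a) = c • w12 α a := by
  funext x; apply (F x).ext3 <;> simp <;> ring
lemma w13_add (α : Ω 1) (a b : Ω 3) : w13 α (a + b) = w13 α a + w13 α b := by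
  funext x; apply (F x).ext4 <;> simp <;> ring
lemma w13_sub (α : Ω 1) (a b : Ω 3) : w13 α (a - b) = w13 α a - w13 α b := by
  funext x; apply (F x).ext4 <;> simp <;> ring
lemma w13_smul (α : Ω 1) (c : ℂ) (a : Ω 3) : w13 α (c • a) = c • w13 α a := by
  funext x; apply (F x).ext4 <;> simp <;> ring

lemma isRumin_two_add {a b : Ω 2} (ha : SmoothOn a univ) (hb : SmoothOn b univ)
    (ra : IsRumin θ a) (rb : IsRumin θ b) : IsRumin θ (a + b) := by
  rw [isRumin_two] at *
  refine ⟨?_, by rw [d2_add ha hb, w13_add F, ra.2, rb.2, add_zero]⟩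
  rw [w14_theta_eq_zero_iff F] at *
  funext y
  have e := congrFun ra.1 y
  have e' := congrFun rb.1 y
  rw [top4_w22, tr2] at e e' ⊢
  simp only [e2_add, Pi.zero_apply] at e e' ⊢
  linear_combination e + e'

end

variable (hT10 : IsCRStructure T10) (hθ : IsContactForm T10 θ) (F : ∀ y, SF T10 θ y)

include hθ in
lemma hasBidegree_three_iff {p : ℕ} {ν : Ω 3} (h0 : w13 θ ν = 0) : HasBidegree T10 p ν ↔
    ∀ x, (p ≠ 3 → ∀ Z ∈ T10 x, ∀ Z' ∈ T10 x, e3 ν x (F x).T Z Z' = 0) ∧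
    (p ≠ 2 → ∀ Z ∈ T10 x, ∀ W, conjC W ∈ T10 x → e3 ν x (F x).T Z W = 0) ∧
    (p ≠ 1 → ∀ W, conjC W ∈ T10 x → ∀ W', conjC W' ∈ T10 x → e3 ν x (F x).T W W' = 0) := by
  rw [hasBidegree_three]
  constructor
  · intro h x
    obtain ⟨v, hv⟩ := (F x).exists_real hθ
    rw [hv]
    exact h x v
  · intro h x v
    obtain ⟨h1, h2, h3⟩ := h x
    have k := fun {a b : ℂT x} => e3_of_theta (F x) (congrFun h0 x) ((1 : ℂ) ⊗ₜ[ℝ] v)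
      (a := a) (b := b)
    refine ⟨fun hp Z hZ Z' hZ' => ?_, fun hp Z hZ W hW => ?_, fun hp W hW W' hW' => ?_⟩
    · rw [k ((F x).t_Z hZ) ((F x).t_Z hZ'), h1 hp Z hZ Z' hZ', mul_zero]
    · rw [k ((F x).t_Z hZ) ((F x).t_W hW), h2 hp Z hZ W hW, mul_zero]
    · rw [k ((F x).t_W hW) ((F x).t_W hW'), h3 hp W hW W' hW', mul_zero]

include hθ in
lemma hasBidegree_four_iff {p : ℕ} {μ : Ω 4} (h0 : w14 θ μ = 0) : HasBidegree T10 p μ ↔ ∀ x,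
    (p ≠ 4 → ∀ Z ∈ T10 x, ∀ Z' ∈ T10 x, ∀ Z'' ∈ T10 x, e4 μ x (F x).T Z Z' Z'' = 0) ∧
    (p ≠ 3 → ∀ Z ∈ T10 x, ∀ Z' ∈ T10 x, ∀ W, conjC W ∈ T10 x → e4 μ x (F x).T Z Z' W = 0) ∧
    (p ≠ 2 → ∀ Z ∈ T10 x, ∀ W, conjC W ∈ T10 x → ∀ W', conjC W' ∈ T10 x →
      e4 μ x (F x).T Z W W' = 0) ∧
    (p ≠ 1 → ∀ W, conjC W ∈ T10 x → ∀ W', conjC W' ∈ T10 x → ∀ W'', conjC W'' ∈ T10 x →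
      e4 μ x (F x).T W W' W'' = 0) := by
  rw [hasBidegree_four]
  constructor
  · intro h x
    obtain ⟨v, hv⟩ := (F x).exists_real hθ
    rw [hv]
    exact h x v
  · intro h x v
    obtain ⟨h1, h2, h3, h4⟩ := h x
    have k := fun {a b c : ℂT x} => e4_of_theta (F x) (congrFun h0 x) ((1 : ℂ) ⊗ₜ[ℝ] v)
      (a := a) (b := b) (c := c)
    have tZ := fun {Z} => (F x).t_Z (Z := Z)
    have tW := fun {W} => (F x).t_W (W := W)
    refine ⟨fun hp Z hZ Z' hZ' Z'' hZ'' => ?_, fun hp Z hZ Z' hZ' W hW => ?_,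
      fun hp Z hZ W hW W' hW' => ?_, fun hp W hW W' hW' W'' hW'' => ?_⟩
    · rw [k (tZ hZ) (tZ hZ') (tZ hZ''), h1 hp Z hZ Z' hZ' Z'' hZ'', mul_zero]
    · rw [k (tZ hZ) (tZ hZ') (tW hW), h2 hp Z hZ Z' hZ' W hW, mul_zero]
    · rw [k (tZ hZ) (tW hW) (tW hW'), h3 hp Z hZ W hW W' hW', mul_zero]
    · rw [k (tW hW) (tW hW') (tW hW''), h4 hp W hW W' hW' W'' hW'', mul_zero]

lemma component_eq {k p q : ℕ} {ω α : Ω k} (c : ℕ × ℕ → Ω k)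
    (hc : ∀ a ∈ antidiagonal k, c a ∈ RSpace T10 θ k a.1 a.2)
    (hω : ω = ∑ a ∈ antidiagonal k, c a) (hα : α = c (p, q)) (hu : ∀ c' : ℕ × ℕ → Ω k,
      (∀ a ∈ antidiagonal k, c' a ∈ RSpace T10 θ k a.1 a.2) →
      ω = ∑ a ∈ antidiagonal k, c' a → c' (p, q) = α) : component T10 θ p q ω = α := by
  refine theUnique_eq ⟨c, hc, hω, hα⟩ ?_
  rintro b ⟨c', hc', hω', rfl⟩
  exact hu c' hc' hω'

lemma sum_antidiagonal_two {A : Type*} [AddCommMonoid A] (c : ℕ × ℕ → A) :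
    ∑ a ∈ antidiagonal 2, c a = c (0, 2) + c (1, 1) + c (2, 0) := by
  rw [Finset.Nat.sum_antidiagonal_eq_sum_range_succ_mk]; simp [Finset.sum_range_succ]
lemma sum_antidiagonal_three {A : Type*} [AddCommMonoid A] (c : ℕ × ℕ → A) :
    ∑ a ∈ antidiagonal 3, c a = c (0, 3) + c (1, 2) + c (2, 1) + c (3, 0) := by
  rw [Finset.Nat.sum_antidiagonal_eq_sum_range_succ_mk]; simp [Finset.sum_range_succ]
lemma sum_antidiagonal_four {A : Type*} [AddCommMonoid A] (c : ℕ × ℕ → A) :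
    ∑ a ∈ antidiagonal 4, c a = c (0, 4) + c (1, 3) + c (2, 2) + c (3, 1) + c (4, 0) := by
  rw [Finset.Nat.sum_antidiagonal_eq_sum_range_succ_mk]; simp [Finset.sum_range_succ]

/-! ### Four-forms -/

/-- The `(2,2)`-part of a four-form divisible by the contact form. -/
def C22 (μ : Ω 4) : Ω 4 := w13 θ (w12 (P01 F (lam F μ)) (d1 θ))
/-- The `(3,1)`-part of a four-form divisible by the contact form. -/
def C31 (μ : Ω 4) : Ω 4 := w13 θ (w12 (P10 F (lam F μ)) (d1 θ))

lemma w14_theta_w13 (G : SF T10 θ x) (ν : Ω 3) : w14 θ (w13 θ ν) x = 0 := by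
  rw [w14_theta_eq_zero G]; simp

include hT10 hθ F

lemma theta_w13_mem_22 {α : Ω 1} (hα : SmoothOn α univ)
    (h0 : ∀ x, ∀ Z ∈ T10 x, e1 α x Z = 0) : w13 θ (w12 α (d1 θ)) ∈ RSpace T10 θ 4 2 2 := by
  have hz : w14 θ (w13 θ (w12 α (d1 θ))) = 0 := funext fun x => w14_theta_w13 (F x) _
  refine ⟨rfl, hθ.smooth.w13 (hα.w12 (hθ.smooth.d1 isOpen_univ)), (isRumin_four F).2 hz, ?_⟩
  rw [hasBidegree_four_iff hθ F hz]
  intro x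
  have tZ := fun {Z} => (F x).t_Z (Z := Z)
  have tW := fun {W} => (F x).t_W (W := W)
  refine ⟨fun _ Z hZ Z' hZ' Z'' hZ'' => ?_, fun _ Z hZ Z' hZ' W hW => ?_, fun h => absurd rfl h,
    fun _ W hW W' hW' W'' hW'' => ?_⟩
  · simp [tZ hZ, tZ hZ', tZ hZ'', h0 x Z hZ, h0 x Z' hZ', h0 x Z'' hZ'']
  · simp [tZ hZ, tZ hZ', tW hW, h0 x Z hZ, h0 x Z' hZ', hθ.e2_T10 hT10 hZ hZ']
  · simp [tW hW, tW hW', tW hW'', hθ.e2_T01 hT10 hW hW', hθ.e2_T01 hT10 hW hW'',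
      hθ.e2_T01 hT10 hW' hW'']

lemma theta_w13_mem_31 {α : Ω 1} (hα : SmoothOn α univ)
    (h0 : ∀ x, ∀ W, conjC W ∈ T10 x → e1 α x W = 0) :
    w13 θ (w12 α (d1 θ)) ∈ RSpace T10 θ 4 3 1 := by
  have hz : w14 θ (w13 θ (w12 α (d1 θ))) = 0 := funext fun x => w14_theta_w13 (F x) _
  refine ⟨rfl, hθ.smooth.w13 (hα.w12 (hθ.smooth.d1 isOpen_univ)), (isRumin_four F).2 hz, ?_⟩
  rw [hasBidegree_four_iff hθ F hz]
  intro x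
  have tZ := fun {Z} => (F x).t_Z (Z := Z)
  have tW := fun {W} => (F x).t_W (W := W)
  refine ⟨fun _ Z hZ Z' hZ' Z'' hZ'' => ?_, fun h => absurd rfl h, fun _ Z hZ W hW W' hW' => ?_,
    fun _ W hW W' hW' W'' hW'' => ?_⟩
  · simp [tZ hZ, tZ hZ', tZ hZ'', hθ.e2_T10 hT10 hZ hZ', hθ.e2_T10 hT10 hZ hZ'',
      hθ.e2_T10 hT10 hZ' hZ'']
  · simp [tZ hZ, tW hW, tW hW', h0 x W hW, h0 x W' hW', hθ.e2_T01 hT10 hW hW']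
  · simp [tW hW, tW hW', tW hW'', h0 x W hW, h0 x W' hW', h0 x W'' hW'']

lemma C22_mem {μ : Ω 4} (hμ : SmoothOn μ univ) (h0 : w14 θ μ = 0) : C22 F μ ∈ RSpace T10 θ 4 2 2 :=
  theta_w13_mem_22 hT10 hθ F (smoothOn_P01 hT10 hθ F isOpen_univ
    (smoothOn_lam hT10 hθ F isOpen_univ hμ fun y _ => congrFun h0 y)) fun _ _ hZ => P01_Z F _ hZ

lemma C31_mem {μ : Ω 4} (hμ : SmoothOn μ univ) (h0 : w14 θ μ = 0) : C31 F μ ∈ RSpace T10 θ 4 3 1 :=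
  theta_w13_mem_31 hT10 hθ F (smoothOn_P10 hT10 hθ F isOpen_univ
    (smoothOn_lam hT10 hθ F isOpen_univ hμ fun y _ => congrFun h0 y)) fun _ _ hW => P10_W F _ hW

omit hT10 hθ in
lemma C31_add_C22 {μ : Ω 4} (h0 : w14 θ μ = 0) : C31 F μ + C22 F μ = μ := by
  funext x
  rw [← lam_spec F (congrFun h0 x)]
  apply (F x).ext4 <;> simp [C31, C22]

lemma zero_mem_four {p q : ℕ} (h : p + q = 4) : (0 : Ω 4) ∈ RSpace T10 θ 4 p q := by
  have hz : w14 θ (0 : Ω 4) = 0 := by rw [w14_theta_eq_zero_iff F]; funext y; simp [top4]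
  refine ⟨h, smoothOn_zero _, (isRumin_four F).2 hz, ?_⟩
  rw [hasBidegree_four_iff hθ F hz]
  simp

lemma components_four {μ : Ω 4} (hμ : SmoothOn μ univ) (h0 : w14 θ μ = 0) :
    component T10 θ 2 2 μ = C22 F μ ∧ component T10 θ 3 1 μ = C31 F μ := by
  set c : ℕ × ℕ → Ω 4 := fun a => if a = (2, 2) then C22 F μ else
    if a = (3, 1) then C31 F μ else 0 with hcdef
  have hc : ∀ a ∈ antidiagonal 4, c a ∈ RSpace T10 θ 4 a.1 a.2 := by
    intro a ha
    rw [mem_antidiagonal] at ha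
    simp only [hcdef]
    split_ifs with h1 h2
    · rw [h1]; exact C22_mem hT10 hθ F hμ h0
    · rw [h2]; exact C31_mem hT10 hθ F hμ h0
    · exact zero_mem_four hT10 hθ F ha
  have hs : μ = ∑ a ∈ antidiagonal 4, c a := by
    rw [sum_antidiagonal_four]
    simp only [hcdef]
    simp only [Prod.mk.injEq]
    norm_num
    rw [add_comm]
    exact (C31_add_C22 F h0).symm
  have hl : ∀ x, ∀ a b c d, e4 μ x a b c d = e4 (w13 θ (w12 (lam F μ) (d1 θ))) x a b c d := by
    intro x a b c d
    rw [e4, ← lam_spec F (congrFun h0 x), ← e4]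
  have key : ∀ c' : ℕ × ℕ → Ω 4, (∀ a ∈ antidiagonal 4, c' a ∈ RSpace T10 θ 4 a.1 a.2) →
      μ = ∑ a ∈ antidiagonal 4, c' a →
      c' (2, 2) = C22 F μ ∧ c' (3, 1) = C31 F μ := by
    intro c' hc' hs'
    rw [sum_antidiagonal_four] at hs'
    have z : ∀ p q, p + q = 4 → w14 θ (c' (p, q)) = 0 := fun p q h =>
      (isRumin_four F).1 (hc' (p, q) (mem_antidiagonal.2 h)).2.2.1
    have hb : ∀ p q, p + q = 4 → _ := fun p q h =>
      (hasBidegree_four_iff hθ F (z p q h)).1 (hc' (p, q) (mem_antidiagonal.2 h)).2.2.2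
    have hsum : ∀ x a b c d, e4 μ x a b c d = e4 (c' (0, 4)) x a b c d + e4 (c' (1, 3)) x a b c d
        + e4 (c' (2, 2)) x a b c d + e4 (c' (3, 1)) x a b c d + e4 (c' (4, 0)) x a b c d := by
      intro x a b c d
      rw [hs']; simp
    have A : ∀ x, ∀ Z ∈ T10 x, ∀ W, conjC W ∈ T10 x → ∀ W', conjC W' ∈ T10 x →
        e4 (c' (2, 2)) x (F x).T Z W W' = e4 μ x (F x).T Z W W' := by
      intro x Z hZ W hW W' hW'
      have h := fun p q e n => (hb p q e x).2.2.1 n Z hZ W hW W' hW'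
      simp [hsum, h 0 4, h 1 3, h 3 1, h 4 0]
    have B : ∀ x, ∀ Z ∈ T10 x, ∀ Z' ∈ T10 x, ∀ W, conjC W ∈ T10 x →
        e4 (c' (3, 1)) x (F x).T Z Z' W = e4 μ x (F x).T Z Z' W := by
      intro x Z hZ W hW W' hW'
      have h := fun p q e n => (hb p q e x).2.1 n Z hZ W hW W' hW'
      simp [hsum, h 0 4, h 1 3, h 2 2, h 4 0]
    constructor
    · funext x
      have m := (w14_theta_eq_zero (F x)).1 (congrFun (z 2 2 rfl) x)
      obtain ⟨-, n, -, -⟩ := hb 2 2 rfl x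
      have n := n (by norm_num)
      have A := A x
      apply (F x).ext4
      · rw [n _ (F x).mZ1 _ (F x).mZ2 _ (F x).mW1]; simp [C22]
      · rw [n _ (F x).mZ1 _ (F x).mZ2 _ (F x).mW2]; simp [C22]
      · rw [A _ (F x).mZ1 _ (F x).mW1 _ (F x).mW2, hl]; simp [C22]
      · rw [A _ (F x).mZ2 _ (F x).mW1 _ (F x).mW2, hl]; simp [C22]
      · rw [m]; simp [C22]
    · funext x
      have m := (w14_theta_eq_zero (F x)).1 (congrFun (z 3 1 rfl) x)
      obtain ⟨-, -, n, -⟩ := hb 3 1 rfl x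
      have n := n (by norm_num)
      have B := B x
      apply (F x).ext4
      · rw [B _ (F x).mZ1 _ (F x).mZ2 _ (F x).mW1, hl]; simp [C31]
      · rw [B _ (F x).mZ1 _ (F x).mZ2 _ (F x).mW2, hl]; simp [C31]
      · rw [n _ (F x).mZ1 _ (F x).mW1 _ (F x).mW2]; simp [C31]
      · rw [n _ (F x).mZ2 _ (F x).mW1 _ (F x).mW2]; simp [C31]
      · rw [m]; simp [C31]
  exact ⟨component_eq c hc hs (by simp [hcdef]) fun c' h h' => (key c' h h').1,
    component_eq c hc hs (by simp [hcdef]) fun c' h h' => (key c' h h').2⟩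

/-! ### Three-forms -/

lemma zero_mem_three {p q : ℕ} (h : p + q = 3) : (0 : Ω 3) ∈ RSpace T10 θ 3 p q := by
  have hz : w13 θ (0 : Ω 3) = 0 := by funext x; apply (F x).ext4 <;> simp
  have hz' : w14 θ (d3 (0 : Ω 3)) = 0 := by
    rw [w14_theta_eq_zero_iff F, show d3 (0 : Ω 3) = 0 from funext (extD_zero_apply 3)]
    funext y; simp [top4]
  refine ⟨h, smoothOn_zero _, ⟨hz, hz'⟩, ?_⟩
  rw [hasBidegree_three_iff hθ F hz]
  simp

omit hT10 in
lemma isRumin_three_iff {ν : Ω 3} (hν : SmoothOn ν univ) (h0 : w13 θ ν = 0) :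
    w14 θ (d3 ν) = 0 ↔ ∀ x, e3 ν x (F x).T (F x).Z1 (F x).W1 + e3 ν x (F x).T (F x).Z2 (F x).W2 = 0 := by
  rw [w14_theta_eq_zero_iff F]
  have h : ∀ x, top4 F (d3 ν) x = -I *
      (e3 ν x (F x).T (F x).Z1 (F x).W1 + e3 ν x (F x).T (F x).Z2 (F x).W2) := fun x =>
    e4_d3_of_theta isOpen_univ hθ.smooth hν (fun y _ => congrFun h0 y) (mem_univ x) (F x)
  constructor
  · intro k x
    have := h x
    rw [k] at this
    exact (mul_eq_zero.1 this.symm).resolve_left (neg_ne_zero.2 I_ne_zero)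
  · intro k
    funext x
    rw [h x, k x, mul_zero]; rfl

lemma Q21_mem {ν : Ω 3} (hν : SmoothOn ν univ) (h0 : w13 θ ν = 0) :
    Q21 F ν ∈ RSpace T10 θ 3 2 1 := by
  have hs := smoothOn_Q21 hT10 hθ F isOpen_univ hν fun y _ => congrFun h0 y
  have hz : w13 θ (Q21 F ν) = 0 := funext fun x => w13_theta_Q21 F ν
  refine ⟨rfl, hs, ⟨hz, (isRumin_three_iff hθ F hs hz).2 fun x => ?_⟩, ?_⟩
  · simp [Q21]
  · rw [hasBidegree_three_iff hθ F hz]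
    exact fun x => ⟨fun _ Z hZ Z' hZ' => Q21_T_ZZ F ν _ hZ hZ', fun h => absurd rfl h,
      fun _ W hW W' hW' => Q21_T_WW F ν _ hW hW'⟩

lemma Q30_mem {ν : Ω 3} (hν : SmoothOn ν univ) : Q30 F ν ∈ RSpace T10 θ 3 3 0 := by
  have hs := smoothOn_Q30 hT10 hθ F isOpen_univ hν
  have hz : w13 θ (Q30 F ν) = 0 := funext fun x => w13_theta_Q30 F ν
  refine ⟨rfl, hs, ⟨hz, (isRumin_three_iff hθ F hs hz).2 fun x => ?_⟩, ?_⟩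
  · simp [Q30]
  · rw [hasBidegree_three_iff hθ F hz]
    exact fun x => ⟨fun h => absurd rfl h, fun _ Z hZ W hW => Q30_T_ZW F ν _ hZ hW,
      fun _ W hW W' hW' => Q30_T_WW F ν _ hW hW'⟩

lemma Q12_mem {ν : Ω 3} (hν : SmoothOn ν univ) (h0 : w13 θ ν = 0) :
    Q12 F ν ∈ RSpace T10 θ 3 1 2 := by
  have hs := smoothOn_Q12 hT10 hθ F isOpen_univ hν fun y _ => congrFun h0 y
  have hz : w13 θ (Q12 F ν) = 0 := funext fun x => w13_theta_Q12 F ν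
  refine ⟨rfl, hs, ⟨hz, (isRumin_three_iff hθ F hs hz).2 fun x => ?_⟩, ?_⟩
  · simp [Q12]
  · rw [hasBidegree_three_iff hθ F hz]
    exact fun x => ⟨fun _ Z hZ Z' hZ' => Q12_T_ZZ F ν _ hZ hZ',
      fun _ Z hZ W hW => Q12_T_ZW F ν _ hZ hW, fun h => absurd rfl h⟩

omit hT10 in
lemma rumin_three_decomp {ν : Ω 3} (hν : SmoothOn ν univ) (h0 : w13 θ ν = 0)
    (h1 : w14 θ (d3 ν) = 0) : ν = Q30 F ν + Q21 F ν + Q12 F ν := by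
  funext x
  refine (Q_decomp F (congrFun h0 x)).trans ?_
  rw [(isRumin_three_iff hθ F hν h0).1 h1 x]
  change _ = Q30 F ν x + Q21 F ν x + Q12 F ν x
  module

lemma component_three {ν : Ω 3} (hν : SmoothOn ν univ) (h0 : w13 θ ν = 0)
    (h1 : w14 θ (d3 ν) = 0) : component T10 θ 2 1 ν = Q21 F ν := by
  set c : ℕ × ℕ → Ω 3 := fun a => if a = (2, 1) then Q21 F ν else
    if a = (3, 0) then Q30 F ν else if a = (1, 2) then Q12 F ν else 0 with hcdef
  have hc : ∀ a ∈ antidiagonal 3, c a ∈ RSpace T10 θ 3 a.1 a.2 := by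
    intro a ha
    rw [mem_antidiagonal] at ha
    simp only [hcdef]
    split_ifs with h2 h3 h4
    · rw [h2]; exact Q21_mem hT10 hθ F hν h0
    · rw [h3]; exact Q30_mem hT10 hθ F hν
    · rw [h4]; exact Q12_mem hT10 hθ F hν h0
    · exact zero_mem_three hT10 hθ F ha
  refine component_eq c hc ?_ (by simp [hcdef]) ?_
  · rw [sum_antidiagonal_three]
    simp only [hcdef]
    simp only [Prod.mk.injEq]
    norm_num
    refine (rumin_three_decomp hθ F hν h0 h1).trans ?_
    abel
  · intro c' hc' hs'
    rw [sum_antidiagonal_three] at hs'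
    have z : ∀ p q, p + q = 3 → w13 θ (c' (p, q)) = 0 := fun p q h =>
      (hc' (p, q) (mem_antidiagonal.2 h)).2.2.1.1
    have hb : ∀ p q, p + q = 3 → _ := fun p q h =>
      (hasBidegree_three_iff hθ F (z p q h)).1 (hc' (p, q) (mem_antidiagonal.2 h)).2.2.2
    funext x
    have htr := (isRumin_three_iff hθ F (hc' (2, 1) (mem_antidiagonal.2 rfl)).2.1
      (z 2 1 rfl)).1 (hc' (2, 1) (mem_antidiagonal.2 rfl)).2.2.1.2 x
    symm
    refine Q21_eq F (A := c' (0, 3) + c' (1, 2)) (B := c' (3, 0)) (ξ := 0) ?_ ?_ ?_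
      (congrFun (z 2 1 rfl) x) ((hb 2 1 rfl x).1 (by norm_num)) ((hb 2 1 rfl x).2.2 (by norm_num))
      htr
    · rw [hs']
      change _ = (c' (0, 3) + c' (1, 2) + c' (2, 1) + c' (3, 0)) x + _
      module
    · intro Z hZ W hW
      rw [e3_add, (hb 0 3 rfl x).2.1 (by norm_num) Z hZ W hW,
        (hb 1 2 rfl x).2.1 (by norm_num) Z hZ W hW, add_zero]
    · exact (hb 3 0 rfl x).2.1 (by norm_num)

/-! ### Two-forms -/

omit hT10 in
/-- An element of the Rumin complex in degree two is determined by its horizontal part. -/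
lemma rumin_two_eq_zero {ω : Ω 2} (hω : SmoothOn ω univ) (h1 : w13 θ (d2 ω) = 0)
    (h2 : w12 θ ω = 0) : ω = 0 := by
  have h3 : w22 (d1 θ) ω = 0 := by
    have := d3_w12_univ hθ.smooth hω
    rw [h2, h1, sub_zero] at this
    rw [← this]; exact funext (extD_zero_apply 3)
  funext x
  have k : ∀ a b c, e3 (w12 θ ω) x a b c = 0 := fun a b c => by rw [h2, e3_zero]
  have k' : ∀ a b c d, e4 (w22 (d1 θ) ω) x a b c d = 0 := fun a b c d => by rw [h3, e4_zero]
  have hI := I_ne_zero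
  have q := fun {a b} (ha : e1 θ x a = 0) (hb : e1 θ x b = 0) => by
    simpa [ha, hb] using k (F x).T a b
  have q12 := q (F x).tZ1 (F x).tZ2
  apply (F x).ext2
  · simpa [q12] using k' (F x).T (F x).Z1 (F x).Z2 (F x).W2
  · simpa [q12] using k' (F x).T (F x).Z1 (F x).Z2 (F x).W1
  · simpa [q12] using k' (F x).T (F x).Z2 (F x).W1 (F x).W2
  · simpa [q12] using k' (F x).T (F x).Z1 (F x).W1 (F x).W2
  all_goals simp [q]

omit hT10 hθ in
lemma w12_theta_iotT {ν : Ω 3} (h : w13 θ ν x = 0) : w12 θ (iot (fun y => (F y).T) ν) x = ν x := by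
  obtain ⟨h1, h2, h3, h4⟩ := w13_theta_eq_zero (F x) h
  apply (F x).ext3 <;> simp [h1, h2, h3, h4]

omit hT10 in
lemma w13_theta_lift {X : Ω 2} (hX : SmoothOn X univ) {α : Ω 1} (hα : SmoothOn α univ)
    (h : w13 θ (w12 α (d1 θ)) = w13 θ (d2 X)) : w13 θ (d2 (X - w11 θ α)) = 0 := by
  rw [d2_sub hX (hθ.smooth.w11 hα), d2_w11_univ hθ.smooth hα]
  funext x
  have k : ∀ a b c d, e4 (w13 θ (d2 X)) x a b c d = e4 (w13 θ (w12 α (d1 θ))) x a b c d := by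
    intro a b c d; rw [h]
  have k1 := k (F x).T (F x).Z1 (F x).Z2 (F x).W1
  simp at k1
  have k2 := k (F x).T (F x).Z1 (F x).Z2 (F x).W2
  simp at k2
  have k3 := k (F x).T (F x).Z1 (F x).W1 (F x).W2
  simp at k3
  have k4 := k (F x).T (F x).Z2 (F x).W1 (F x).W2
  simp at k4
  apply (F x).ext4 <;> simp [k1, k2, k3, k4]

/-- `𝓡²` is isomorphic to `𝓡³` by multiplication with the contact form. -/
lemma exists_rumin_two {ν : Ω 3} (hν : SmoothOn ν univ) (h0 : w13 θ ν = 0) (h1 : w14 θ (d3 ν) = 0) :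
    ∃ σ : Ω 2, SmoothOn σ univ ∧ IsRumin θ σ ∧ w12 θ σ = ν := by
  set X := iot (fun y => (F y).T) ν with hX
  have hXs : SmoothOn X univ := smoothOn_iotT hT10 hθ F isOpen_univ hν
  have hz : w14 θ (w13 θ (d2 X)) = 0 := funext fun x => w14_theta_w13 (F x) _
  have hμ : SmoothOn (w13 θ (d2 X)) univ := hθ.smooth.w13 (hXs.d2 isOpen_univ)
  have hl := smoothOn_lam hT10 hθ F isOpen_univ hμ fun y _ => congrFun hz y
  set α := lam F (w13 θ (d2 X)) with hα
  have htr := (isRumin_three_iff hθ F hν h0).1 h1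
  refine ⟨X - w11 θ α, hXs.sub (hθ.smooth.w11 hl), isRumin_two.2 ⟨?_, ?_⟩, ?_⟩
  · rw [w14_theta_eq_zero_iff F]
    funext y
    rw [top4_w22, tr2]
    simp [hX, htr y]
  · exact w13_theta_lift hθ F hXs hl (funext fun x => lam_spec F (congrFun hz x))
  · funext x
    rw [← w12_theta_iotT F (congrFun h0 x), ← hX]
    apply (F x).ext3 <;> simp

omit hT10 in
lemma hasBidegree_two_iff {p : ℕ} {σ : Ω 2} :
    HasBidegree T10 p σ ↔ HasBidegree T10 (p + 1) (w12 θ σ) := by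
  rw [hasBidegree_two, hasBidegree_three_iff hθ F (funext fun x => w13_theta_w12 (F x) _)]
  refine forall_congr' fun x => ?_
  have tZ := fun {Z} => (F x).t_Z (Z := Z)
  have tW := fun {W} => (F x).t_W (W := W)
  refine and_congr ?_ (and_congr ?_ ?_)
  · refine imp_congr (by omega) (forall₂_congr fun Z hZ => forall₂_congr fun Z' hZ' => ?_)
    simp [tZ hZ, tZ hZ']
  · refine imp_congr (by omega) (forall₂_congr fun Z hZ => forall₂_congr fun Z' hZ' => ?_)
    simp [tZ hZ, tW hZ']
  · refine imp_congr (by omega) (forall₂_congr fun Z hZ => forall₂_congr fun Z' hZ' => ?_)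
    simp [tW hZ, tW hZ']

omit hT10 in
lemma rumin_two_three {σ : Ω 2} (hσ : SmoothOn σ univ)
    (h : w14 θ (w22 σ (d1 θ)) = 0) : w14 θ (d3 (w12 θ σ)) = 0 := by
  rw [isRumin_three_iff hθ F (hθ.smooth.w12 hσ) (funext fun x => w13_theta_w12 (F x) _)]
  intro x
  have := congrFun ((w14_theta_eq_zero_iff F).1 h) x
  rw [top4_w22] at this
  have := (mul_eq_zero.1 this).resolve_left (neg_ne_zero.2 I_ne_zero)
  rw [tr2] at this
  simpa using this

lemma component_two {σ : Ω 2} (hσ : SmoothOn σ univ) (hr : IsRumin θ σ) :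
    component T10 θ 1 1 σ ∈ RSpace T10 θ 2 1 1 ∧
      w12 θ (component T10 θ 1 1 σ) = Q21 F (w12 θ σ) := by
  have hs : SmoothOn (w12 θ σ) univ := hθ.smooth.w12 hσ
  have h0 : w13 θ (w12 θ σ) = 0 := funext fun x => w13_theta_w12 (F x) _
  have h1 : w14 θ (d3 (w12 θ σ)) = 0 := rumin_two_three hθ F hσ (isRumin_two.1 hr).1
  have m30 := Q30_mem hT10 hθ F hs
  have m21 := Q21_mem hT10 hθ F hs h0
  have m12 := Q12_mem hT10 hθ F hs h0
  obtain ⟨A, hAs, hAr, hA⟩ := exists_rumin_two hT10 hθ F m30.2.1 m30.2.2.1.1 m30.2.2.1.2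
  obtain ⟨H, hHs, hHr, hH⟩ := exists_rumin_two hT10 hθ F m21.2.1 m21.2.2.1.1 m21.2.2.1.2
  obtain ⟨B, hBs, hBr, hB⟩ := exists_rumin_two hT10 hθ F m12.2.1 m12.2.2.1.1 m12.2.2.1.2
  have hdec := rumin_three_decomp hθ F hs h0 h1
  have mH : H ∈ RSpace T10 θ 2 1 1 := ⟨rfl, hHs, hHr, (hasBidegree_two_iff hθ F).2 (hH ▸ m21.2.2.2)⟩
  have mA : A ∈ RSpace T10 θ 2 2 0 := ⟨rfl, hAs, hAr, (hasBidegree_two_iff hθ F).2 (hA ▸ m30.2.2.2)⟩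
  have mB : B ∈ RSpace T10 θ 2 0 2 := ⟨rfl, hBs, hBr, (hasBidegree_two_iff hθ F).2 (hB ▸ m12.2.2.2)⟩
  suffices h : component T10 θ 1 1 σ = H by rw [h]; exact ⟨mH, hH⟩
  have inj : ∀ a b : Ω 2, SmoothOn a univ → SmoothOn b univ → IsRumin θ a →
      IsRumin θ b → w12 θ a = w12 θ b → a = b := by
    intro a b ha hb ra rb h
    refine sub_eq_zero.1 (rumin_two_eq_zero hθ F (ha.sub hb) ?_ ?_)
    · rw [d2_sub ha hb, w13_sub F, (isRumin_two.1 ra).2, (isRumin_two.1 rb).2, sub_zero]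
    · rw [w12_sub F, h, sub_self]
  set c : ℕ × ℕ → Ω 2 := fun a => if a = (1, 1) then H else
    if a = (2, 0) then A else B with hcdef
  have hc : ∀ a ∈ antidiagonal 2, c a ∈ RSpace T10 θ 2 a.1 a.2 := by
    intro a ha
    rw [mem_antidiagonal] at ha
    simp only [hcdef]
    split_ifs with h2 h3
    · rw [h2]; exact mH
    · rw [h3]; exact mA
    · obtain ⟨p, q⟩ := a
      have : p = 0 ∧ q = 2 := by
        simp only [Prod.mk.injEq] at h2 h3
        change p + q = 2 at ha
        omega
      rw [this.1, this.2]; exact mB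
  refine component_eq c hc ?_ (by simp [hcdef]) ?_
  · rw [sum_antidiagonal_two]
    simp only [hcdef]
    simp only [Prod.mk.injEq]
    norm_num
    refine inj _ _ hσ ((hBs.add hHs).add hAs) hr
      (isRumin_two_add F (hBs.add hHs) hAs (isRumin_two_add F hBs hHs hBr hHr) hAr) ?_
    rw [w12_add F, w12_add F, hA, hB, hH]
    refine hdec.trans ?_
    abel
  · intro c' hc' hs'
    rw [sum_antidiagonal_two] at hs'
    have m02 := hc' (0, 2) (mem_antidiagonal.2 rfl)
    have m11 := hc' (1, 1) (mem_antidiagonal.2 rfl)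
    have m20 := hc' (2, 0) (mem_antidiagonal.2 rfl)
    refine inj _ _ m11.2.1 hHs m11.2.2.1 hHr ?_
    rw [hH, hs', w12_add F, w12_add F]
    funext x
    have z : ∀ a : Ω 2, w13 θ (w12 θ a) = 0 := fun a => funext fun x => w13_theta_w12 (F x) _
    have hb := fun {p : ℕ} {a : Ω 2} (h : HasBidegree T10 p a) =>
      (hasBidegree_three_iff hθ F (z a)).1 ((hasBidegree_two_iff hθ F).1 h)
    have htr := (isRumin_three_iff hθ F (hθ.smooth.w12 m11.2.1) (z _)).1
      (rumin_two_three hθ F m11.2.1 (isRumin_two.1 m11.2.2.1).1) x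
    symm
    refine Q21_eq F (A := w12 θ (c' (0, 2))) (B := w12 θ (c' (2, 0))) (ξ := 0) ?_
      ((hb m02.2.2.2 x).2.1 (by norm_num)) ((hb m20.2.2.2 x).2.1 (by norm_num)) (congrFun (z _) x)
      ((hb m11.2.2.2 x).1 (by norm_num)) ((hb m11.2.2.2 x).2.2 (by norm_num)) htr
    change w12 θ (c' (0, 2)) x + w12 θ (c' (1, 1)) x + w12 θ (c' (2, 0)) x = _
    module

end Rumin

section Operators

lemma smul_cform_eq (c : ℂ) (ω : Ω k) (y : M) : (c • ω) y = c • ω y := rfl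

lemma starTwo_one_one (ω : Ω 2) : starTwo θ 1 1 ω = -w12 θ ω := by
  have : (I ^ (((1 : ℕ) : ℤ) - ((1 : ℕ) : ℤ)) • ω) = ω := by
    funext y
    rw [smul_cform_eq, sub_self, zpow_zero]
    module
  rw [starTwo, this]; rfl

variable (F : ∀ y, SF T10 θ y)

include F

lemma starOne_zero_one (ρ : Ω 1) : starOne θ 0 1 ρ = (-I) • w13 θ (w12 ρ (d1 θ)) := by
  have h1 : starOne θ 0 1 ρ = -w13 θ (w12 (I ^ (1 - 0 : ℤ) • ρ) (d1 θ)) :=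
    congrArg Neg.neg (wedge_assoc_one _ _ _)
  rw [h1]
  funext x; apply (F x).ext4 <;> simp [mul_assoc]

lemma starOne_one_zero (ρ : Ω 1) : starOne θ 1 0 ρ = I • w13 θ (w12 ρ (d1 θ)) := by
  have h1 : starOne θ 1 0 ρ = -w13 θ (w12 (I ^ (0 - 1 : ℤ) • ρ) (d1 θ)) :=
    congrArg Neg.neg (wedge_assoc_one _ _ _)
  rw [h1]
  funext x; apply (F x).ext4 <;> simp [mul_assoc]

/-! ### Linearity -/

lemma Q21_add (a b : Ω 3) : Q21 F (a + b) = Q21 F a + Q21 F b := by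
  funext x; apply (F x).ext3 <;> simp [Q21] <;> ring
lemma Q21_sub (a b : Ω 3) : Q21 F (a - b) = Q21 F a - Q21 F b := by
  funext x; apply (F x).ext3 <;> simp [Q21] <;> ring
lemma Q21_smul (c : ℂ) (a : Ω 3) : Q21 F (c • a) = c • Q21 F a := by
  funext x; apply (F x).ext3 <;> simp [Q21] <;> ring
lemma Q21_congr {a b : Ω 3}
    (h : ∀ Z ∈ T10 x, ∀ W, conjC W ∈ T10 x → e3 a x (F x).T Z W = e3 b x (F x).T Z W) :
    Q21 F a x = Q21 F b x := by
  have h11 := h _ (F x).mZ1 _ (F x).mW1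
  have h12 := h _ (F x).mZ1 _ (F x).mW2
  have h21 := h _ (F x).mZ2 _ (F x).mW1
  have h22 := h _ (F x).mZ2 _ (F x).mW2
  apply (F x).ext3 <;> simp [Q21, h11, h12, h21, h22]

lemma lam_add (a b : Ω 4) : lam F (a + b) = lam F a + lam F b := by
  funext x; apply (F x).ext1 <;> simp [lam] <;> ring
lemma lam_sub (a b : Ω 4) : lam F (a - b) = lam F a - lam F b := by
  funext x; apply (F x).ext1 <;> simp [lam] <;> ring
lemma lam_smul (c : ℂ) (a : Ω 4) : lam F (c • a) = c • lam F a := by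
  funext x; apply (F x).ext1 <;> simp [lam] <;> ring
lemma lam_neg (a : Ω 4) : lam F (-a) = -lam F a := by funext x; apply (F x).ext1 <;> simp [lam]

lemma C22_add (a b : Ω 4) : C22 F (a + b) = C22 F a + C22 F b := by
  rw [C22, lam_add]; funext x; apply (F x).ext4 <;> simp [C22] <;> ring
lemma C22_sub (a b : Ω 4) : C22 F (a - b) = C22 F a - C22 F b := by
  rw [C22, lam_sub]; funext x; apply (F x).ext4 <;> simp [C22] <;> ring
lemma C22_smul (c : ℂ) (a : Ω 4) : C22 F (c • a) = c • C22 F a := by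
  rw [C22, lam_smul]; funext x; apply (F x).ext4 <;> simp [C22] <;> ring

/-! ### The homotopy `Γ` -/

lemma gammaTwo_eq (X : Ω 2) : gammaTwo θ X = fsmul (fun y => top4 F (w22 X (d1 θ)) y / 2) θ := by
  have key : ∀ ξ : M → ℂ, θ ∧ᶠ X ∧ᶠ extD θ = fsmul ξ (θ ∧ᶠ extD θ ∧ᶠ extD θ) ↔
      w14 θ (w22 X (d1 θ)) = fsmul ξ (w14 θ (w22 (d1 θ) (d1 θ))) := fun ξ => by
    rw [← wedge_assoc_theta, ← wedge_assoc_theta]; rfl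
  refine theUnique_eq ⟨_, rfl, (key _).2 (funext fun y => top4_spec F _ y)⟩ ?_
  rintro b ⟨ξ, rfl, h⟩
  congr 1
  funext y
  rw [top4_eq F (congrFun ((key ξ).1 h) y)]; ring

lemma gammaThree_eq (ν : Ω 3) : gammaThree θ ν = w11 θ (lam F (w13 θ ν)) := by
  have key : ∀ ξ : Ω 1, (θ ∧ᶠ ν : Ω 4) = θ ∧ᶠ ξ ∧ᶠ extD θ ↔
      w13 θ ν = w13 θ (w12 ξ (d1 θ)) := fun ξ => by
    rw [← wedge_assoc_one]; rfl
  refine theUnique_eq ⟨lam F (w13 θ ν), rfl, (key _).2 (funext fun y => ?_)⟩ ?_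
  · exact (lam_spec F (w14_theta_w13 (F y) _)).symm
  · rintro b ⟨ξ, rfl, h⟩
    exact funext fun y => lam_mod F (congrFun ((key ξ).1 h) y).symm

lemma gammaFour_eq (μ : Ω 4) : gammaFour θ μ = fsmul (fun y => top4 F μ y / 2) (w12 θ (d1 θ)) := by
  have key : ∀ ξ : M → ℂ, (θ ∧ᶠ μ : Ω 5) = fsmul ξ (θ ∧ᶠ extD θ ∧ᶠ extD θ) ↔
      w14 θ μ = fsmul ξ (w14 θ (w22 (d1 θ) (d1 θ))) := fun ξ => by
    rw [← wedge_assoc_theta]; rfl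
  refine theUnique_eq ⟨_, rfl, (key _).2 (funext fun y => top4_spec F _ y)⟩ ?_
  rintro b ⟨ξ, rfl, h⟩
  have : ξ = fun y => top4 F μ y / 2 := by
    funext y
    rw [top4_eq F (congrFun ((key ξ).1 h) y)]; ring
  rw [this]; rfl

lemma piFour_eq (μ : Ω 4) :
    piFour θ μ = μ - d3 (fsmul (fun y => top4 F μ y / 2) (w12 θ (d1 θ))) := by
  rw [piFour, gammaFour_eq F]; rfl

variable (hT10 : IsCRStructure T10) (hθ : IsContactForm T10 θ)

include hT10 hθ

lemma smoothOn_piFour {μ : Ω 4} (hμ : SmoothOn μ univ) : SmoothOn (piFour θ μ) univ := by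
  rw [piFour_eq F]
  exact hμ.sub ((SmoothOn.fsmul ((smFn_top4 hT10 hθ F isOpen_univ hμ).div (smFn_const 2 _) (by simp))
    (hθ.smooth.w12 (hθ.smooth.d1 isOpen_univ))).d3 isOpen_univ)

lemma w14_piFour {μ : Ω 4} (hμ : SmoothOn μ univ) : w14 θ (piFour θ μ) = 0 := by
  rw [w14_theta_eq_zero_iff F, piFour_eq F,
    d3_fsmul_univ ((smFn_top4 hT10 hθ F isOpen_univ hμ).div (smFn_const 2 _) (by simp))
      (hθ.smooth.w12 (hθ.smooth.d1 isOpen_univ)),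
    d3_w12_univ hθ.smooth (hθ.smooth.d1 isOpen_univ), d2_d1_univ hθ.smooth]
  funext y
  simp [top4]
  ring_nf

/-! ### One-forms -/

omit hT10 hθ in
lemma top4_d1_theta_smul {α : Ω 1} {a : M → ℂ} (hθ : IsContactForm T10 θ)
    (hα : SmoothOn α univ) (ha : SmFn a univ) (y : M) : top4 F (w22 (d1 (α + fsmul a θ)) (d1 θ)) y =
      -I * (tr2 F (d1 α) y + 2 * I * a y) := by
  rw [d1_add hα (SmoothOn.fsmul ha hθ.smooth), d1_fsmul_univ ha hθ.smooth, top4_w22]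
  simp [tr2]
  ring_nf

lemma exists_rumin_one {α : Ω 1} (hα : SmoothOn α univ) :
    ∃ a : M → ℂ, SmFn a univ ∧ IsRumin θ (α + fsmul a θ) := by
  have ha : SmFn (fun y => I / 2 * tr2 F (d1 α) y) univ :=
    (smFn_const _ _).mul (smFn_tr2 hT10 hθ F isOpen_univ (hα.d1 isOpen_univ))
  refine ⟨_, ha, isRumin_one.2 ((w14_theta_eq_zero_iff F).2 (funext fun y => ?_))⟩
  rw [top4_d1_theta_smul F hθ hα ha]
  simp only [Pi.zero_apply]
  linear_combination (-I * tr2 F (d1 α) y) * I_mul_I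

lemma rumin_one_unique {α ρ : Ω 1} {a : M → ℂ} (hα : SmoothOn α univ)
    (ha : SmFn a univ) (hr : IsRumin θ (α + fsmul a θ)) (hρ : SmoothOn ρ univ)
    (hρr : IsRumin θ ρ) (h : w13 θ (w12 ρ (d1 θ)) = w13 θ (w12 α (d1 θ))) : ρ = α + fsmul a θ := by
  have hb : SmFn (fun y => e1 (ρ - α) y (F y).T) univ :=
    smFn_of_frames hT10 hθ isOpen_univ fun G W hG _ =>
      (hG.T.smFn_e1 ((hρ.sub hα).mono (subset_univ W))).congr fun y _ => by rw [(F y).T_eq (G y)]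
  have hρ' : ρ = α + fsmul (fun y => e1 (ρ - α) y (F y).T) θ := by
    funext x
    have k : ∀ a b c d, e4 (w13 θ (w12 ρ (d1 θ))) x a b c d =
      e4 (w13 θ (w12 α (d1 θ))) x a b c d := fun a b c d => by rw [h]
    have k1 := k (F x).T (F x).Z1 (F x).Z2 (F x).W1
    have k2 := k (F x).T (F x).Z1 (F x).Z2 (F x).W2
    have k3 := k (F x).T (F x).Z1 (F x).W1 (F x).W2
    have k4 := k (F x).T (F x).Z2 (F x).W1 (F x).W2
    simp at k1 k2 k3 k4
    apply (F x).ext1 <;> simp [k1, k2, k3, k4]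
  have e := (w14_theta_eq_zero_iff F).1 (isRumin_one.1 hr)
  rw [hρ'] at hρr
  have e' := (w14_theta_eq_zero_iff F).1 (isRumin_one.1 hρr)
  rw [hρ']
  congr 2
  funext y
  have e := congrFun e y
  have e' := congrFun e' y
  rw [top4_d1_theta_smul F hθ hα ha] at e
  rw [top4_d1_theta_smul F hθ hα hb] at e'
  simp only [Pi.zero_apply] at e e'
  linear_combination (1 / 2) * (e' - e) + (e1 (ρ - α) y (F y).T - a y) * I_mul_I

lemma starFour_zero_one {β : Ω 1} (hβ : SmoothOn β univ) (h0 : ∀ x, ∀ Z ∈ T10 x, e1 β x Z = 0) :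
    ∃ a : M → ℂ, SmFn a univ ∧ IsRumin θ (I • β + fsmul a θ) ∧
      starFour T10 θ 0 1 (w13 θ (w12 β (d1 θ))) = I • β + fsmul a θ ∧
      starOne θ 0 1 (starFour T10 θ 0 1 (w13 θ (w12 β (d1 θ)))) = w13 θ (w12 β (d1 θ)) := by
  have hs := hβ.const_smul I
  obtain ⟨a, ha, hr⟩ := exists_rumin_one F hT10 hθ hs
  have hst : starOne θ 0 1 (I • β + fsmul a θ) = w13 θ (w12 β (d1 θ)) := by
    rw [starOne_zero_one F]
    funext x; apply (F x).ext4 <;> simp [← mul_assoc]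
  have key : starFour T10 θ 0 1 (w13 θ (w12 β (d1 θ))) = I • β + fsmul a θ := by
    refine theUnique_eq ⟨⟨rfl, hs.add (SmoothOn.fsmul ha hθ.smooth), hr, ?_⟩, hst⟩ ?_
    · rw [hasBidegree_one]
      refine fun x => ⟨fun _ Z hZ => ?_, fun h => absurd rfl h⟩
      simp [h0 x Z hZ, (F x).t_Z hZ]
    · rintro ρ ⟨⟨-, hρs, hρr, -⟩, h⟩
      refine rumin_one_unique F hT10 hθ hs ha hr hρs hρr ?_
      rw [← hst, starOne_zero_one F, starOne_zero_one F] at h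
      exact (smul_right_injective _ (neg_ne_zero.2 I_ne_zero) h).trans
        (by funext x; apply (F x).ext4 <;> simp)
  exact ⟨a, ha, hr, key, by rw [key, hst]⟩

lemma starFour_one_zero {β : Ω 1} (hβ : SmoothOn β univ)
    (h0 : ∀ x, ∀ W, conjC W ∈ T10 x → e1 β x W = 0) :
    ∃ a : M → ℂ, SmFn a univ ∧ IsRumin θ ((-I) • β + fsmul a θ) ∧
      starFour T10 θ 1 0 (w13 θ (w12 β (d1 θ))) = (-I) • β + fsmul a θ := by
  have hs := hβ.const_smul (-I)
  obtain ⟨a, ha, hr⟩ := exists_rumin_one F hT10 hθ hs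
  have hst : starOne θ 1 0 ((-I) • β + fsmul a θ) = w13 θ (w12 β (d1 θ)) := by
    rw [starOne_one_zero F]
    funext x; apply (F x).ext4 <;> simp [← mul_assoc]
  refine ⟨a, ha, hr, theUnique_eq ⟨⟨rfl, hs.add (SmoothOn.fsmul ha hθ.smooth), hr, ?_⟩, hst⟩ ?_⟩
  · rw [hasBidegree_one]
    refine fun x => ⟨fun h => absurd rfl h, fun _ Z hZ => ?_⟩
    simp [h0 x Z hZ, (F x).t_W hZ]
  · rintro ρ ⟨⟨-, hρs, hρr, -⟩, h⟩
    refine rumin_one_unique F hT10 hθ hs ha hr hρs hρr ?_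
    rw [← hst, starOne_one_zero F, starOne_one_zero F] at h
    exact (smul_right_injective _ I_ne_zero h).trans (by funext x; apply (F x).ext4 <;> simp)

/-! ### The adjoints on `𝓡^{1,1}` -/

omit hT10 in
lemma theta_d3_w12 {ω : Ω 2} (hω : ω ∈ RSpace T10 θ 2 1 1) :
    w14 θ (d3 (w12 θ ω)) = 0 := rumin_two_three hθ F hω.2.1 (isRumin_two.1 hω.2.2.1).1

lemma component_starTwo {ω : Ω 2} (hω : ω ∈ RSpace T10 θ 2 1 1) :
    component T10 θ 2 2 (extD (starTwo θ 1 1 ω)) = C22 F (-d3 (w12 θ ω)) ∧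
    component T10 θ 3 1 (extD (starTwo θ 1 1 ω)) = C31 F (-d3 (w12 θ ω)) := by
  have hs := hθ.smooth.w12 hω.2.1
  have h1 : extD (starTwo θ 1 1 ω) = -d3 (w12 θ ω) := by rw [starTwo_one_one]; exact d3_neg hs
  rw [h1]
  refine components_four hT10 hθ F (hs.d3 isOpen_univ).neg ?_
  have h := (w14_theta_eq_zero_iff F).1 (theta_d3_w12 F hθ hω)
  rw [w14_theta_eq_zero_iff F]
  funext y
  have h := congrFun h y
  simp only [top4, e4_neg] at h ⊢
  rw [h]; simp

/-- The horizontal one-form `τ` with `d(θ ∧ ω) = θ ∧ τ ∧ dθ`. -/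
def tauF (F : ∀ y, SF T10 θ y) (ω : Ω 2) : Ω 1 := lam F (d3 (w12 θ ω))

lemma smoothOn_tauF {ω : Ω 2} (hω : ω ∈ RSpace T10 θ 2 1 1) : SmoothOn (tauF F ω) univ :=
  smoothOn_lam hT10 hθ F isOpen_univ ((hθ.smooth.w12 hω.2.1).d3 isOpen_univ) fun y _ =>
    congrFun (theta_d3_w12 F hθ hω) y

lemma delBStar_eq {ω : Ω 2} (hω : ω ∈ RSpace T10 θ 2 1 1) : ∃ a : M → ℂ, SmFn a univ ∧
      IsRumin θ ((-I) • P01 F (tauF F ω) + fsmul a θ) ∧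
      delBStar T10 θ ω = (-I) • P01 F (tauF F ω) + fsmul a θ ∧
      starOne θ 0 1 (delBStar T10 θ ω) = C22 F (-d3 (w12 θ ω)) := by
  have hβ : P01 F (lam F (-d3 (w12 θ ω))) = -P01 F (tauF F ω) := by
    rw [lam_neg]; funext x; apply (F x).ext1 <;> simp [tauF]
  have hs := smoothOn_P01 hT10 hθ F isOpen_univ (smoothOn_tauF F hT10 hθ hω)
  obtain ⟨a, ha, hr, h1, h2⟩ := starFour_zero_one F hT10 hθ (β := -P01 F (tauF F ω)) hs.neg
    fun x Z hZ => by rw [e1_neg, P01_Z F _ hZ, neg_zero]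
  have e : I • -P01 F (tauF F ω) = (-I) • P01 F (tauF F ω) := by funext x; apply (F x).ext1 <;> simp
  have hd : delBStar T10 θ ω =
      starFour T10 θ 0 1 (w13 θ (w12 (-P01 F (tauF F ω)) (d1 θ))) := by
    rw [delBStar, delBbar, (component_starTwo F hT10 hθ hω).1, C22, hβ]
    funext x
    rw [smul_cform_eq]
    norm_num
  rw [e] at h1 hr
  refine ⟨a, ha, hr, hd.trans h1, ?_⟩
  rw [hd, h2, C22, hβ]

lemma delBbarStar_eq {ω : Ω 2} (hω : ω ∈ RSpace T10 θ 2 1 1) :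
    ∃ a : M → ℂ, SmFn a univ ∧ IsRumin θ (I • P10 F (tauF F ω) + fsmul a θ) ∧
      delBbarStar T10 θ ω = I • P10 F (tauF F ω) + fsmul a θ := by
  have hβ : P10 F (lam F (-d3 (w12 θ ω))) = -P10 F (tauF F ω) := by
    rw [lam_neg]; funext x; apply (F x).ext1 <;> simp [tauF]
  have hs := smoothOn_P10 hT10 hθ F isOpen_univ (smoothOn_tauF F hT10 hθ hω)
  obtain ⟨a, ha, hr, h1⟩ := starFour_one_zero F hT10 hθ (β := -P10 F (tauF F ω)) hs.neg
    fun x Z hZ => by rw [e1_neg, P10_W F _ hZ, neg_zero]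
  have e : (-I) • -P10 F (tauF F ω) = I • P10 F (tauF F ω) := by funext x; apply (F x).ext1 <;> simp
  have hd : delBbarStar T10 θ ω =
      starFour T10 θ 1 0 (w13 θ (w12 (-P10 F (tauF F ω)) (d1 θ))) := by
    rw [delBbarStar, delB, if_neg (by norm_num), (component_starTwo F hT10 hθ hω).2, C31, hβ]
    funext x
    rw [smul_cform_eq]
    norm_num
  rw [e] at h1 hr
  exact ⟨a, ha, hr, hd.trans h1⟩

/-- The horizontal `(1,1)`-part of the exterior derivative of a one-form. -/
lemma component_d1 {α : Ω 1} {a : M → ℂ} (hα : SmoothOn α univ)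
    (ha : SmFn a univ) (hr : IsRumin θ (α + fsmul a θ)) :
    component T10 θ 1 1 (extD (α + fsmul a θ)) ∈ RSpace T10 θ 2 1 1 ∧
      w12 θ (component T10 θ 1 1 (extD (α + fsmul a θ))) = Q21 F (w12 θ (d1 α)) := by
  have hs := hα.add (SmoothOn.fsmul ha hθ.smooth)
  have hR : IsRumin θ (d1 (α + fsmul a θ)) := by
    refine isRumin_two.2 ⟨isRumin_one.1 hr, ?_⟩
    rw [d2_d1_univ hs]; funext x; apply (F x).ext4 <;> simp
  have := component_two hT10 hθ F (hs.d1 isOpen_univ) hR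
  refine ⟨this.1, this.2.trans ?_⟩
  rw [d1_add hα (SmoothOn.fsmul ha hθ.smooth), d1_fsmul_univ ha hθ.smooth]
  funext x; apply (F x).ext3 <;> simp [Q21]

omit hT10 in
lemma rspace_add {ω η : Ω 2} (hω : ω ∈ RSpace T10 θ 2 1 1) (hη : η ∈ RSpace T10 θ 2 1 1) :
    ω + η ∈ RSpace T10 θ 2 1 1 := by
  refine ⟨rfl, hω.2.1.add hη.2.1, isRumin_two_add F hω.2.1 hη.2.1 hω.2.2.1 hη.2.2.1, ?_⟩
  have b1 := hasBidegree_two.1 hω.2.2.2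
  have b2 := hasBidegree_two.1 hη.2.2.2
  rw [hasBidegree_two]
  refine fun x => ⟨fun h Z hZ Z' hZ' => ?_, fun h => absurd rfl h, fun h Z hZ Z' hZ' => ?_⟩
  · rw [e2_add, (b1 x).1 h Z hZ Z' hZ', (b2 x).1 h Z hZ Z' hZ', add_zero]
  · rw [e2_add, (b1 x).2.2 h Z hZ Z' hZ', (b2 x).2.2 h Z hZ Z' hZ', add_zero]

/-! ### Multiplication by functions -/

omit hT10 in
lemma theta_d2_fsmul {g : M → ℂ} (hg : SmFn g univ) {ω : Ω 2}
    (hω : ω ∈ RSpace T10 θ 2 1 1) : w13 θ (d2 (fsmul g ω)) = w13 θ (w12 (dFn g) ω) := by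
  rw [d2_fsmul_univ hg hω.2.1, w13_add F]
  have h := (isRumin_two.1 hω.2.2.1).2
  have : w13 θ (fsmul g (d2 ω)) = fsmul g (w13 θ (d2 ω)) := by funext x; apply (F x).ext4 <;> simp
  rw [this, h]
  funext x; apply (F x).ext4 <;> simp

lemma rMulFn_eq {g : M → ℂ} (hg : SmFn g univ) {ω : Ω 2}
    (hω : ω ∈ RSpace T10 θ 2 1 1) : rMulFn θ g ω =
      fsmul g ω - w11 θ (lam F (w13 θ (w12 (dFn g) ω))) := by
  rw [rMulFn, piTwo, show extD (fsmul g ω) = d2 (fsmul g ω) from rfl, gammaThree_eq F,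
    gammaTwo_eq F, theta_d2_fsmul F hθ hg hω]
  have e := (w14_theta_eq_zero_iff F).1 (isRumin_two.1 hω.2.2.1).1
  have : (fun y => top4 F (w22 (fsmul g ω) (d1 θ)) y / 2) = fun _ => 0 := by
    funext y
    have e := congrFun e y
    rw [top4_w22, tr2] at e ⊢
    simp only [e2_fsmul, Pi.zero_apply] at e ⊢
    linear_combination (g y / 2) * e
  rw [this, show fsmul (fun _ => (0 : ℂ)) θ = 0 by funext x; apply (F x).ext1 <;> simp,
    show extD (0 : Ω 1) = 0 from funext (extD_zero_apply 1), sub_zero]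

lemma smoothOn_lamFn {g : M → ℂ} (hg : SmFn g univ) {ω : Ω 2}
    (hω : SmoothOn ω univ) : SmoothOn (lam F (w13 θ (w12 (dFn g) ω))) univ :=
  smoothOn_lam hT10 hθ F isOpen_univ (hθ.smooth.w13 ((hg.dFn isOpen_univ).w12 hω))
    fun y _ => w14_theta_w13 (F y) _

lemma rMulFn_mem {g : M → ℂ} (hg : SmFn g univ) {ω : Ω 2}
    (hω : ω ∈ RSpace T10 θ 2 1 1) : rMulFn θ g ω ∈ RSpace T10 θ 2 1 1 := by
  have hl := smoothOn_lamFn F hT10 hθ hg hω.2.1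
  rw [rMulFn_eq F hT10 hθ hg hω]
  refine ⟨rfl, (SmoothOn.fsmul hg hω.2.1).sub (hθ.smooth.w11 hl), isRumin_two.2 ⟨?_, ?_⟩, ?_⟩
  · rw [w14_theta_eq_zero_iff F]
    funext y
    have e := congrFun ((w14_theta_eq_zero_iff F).1 (isRumin_two.1 hω.2.2.1).1) y
    rw [top4_w22, tr2] at e ⊢
    simp at e ⊢
    linear_combination (g y) * e
  · refine w13_theta_lift hθ F (SmoothOn.fsmul hg hω.2.1) hl ?_
    rw [theta_d2_fsmul F hθ hg hω]
    exact funext fun x => lam_spec F (w14_theta_w13 (F x) _)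
  · have b1 := hasBidegree_two.1 hω.2.2.2
    rw [hasBidegree_two]
    refine fun x => ⟨fun h Z hZ Z' hZ' => ?_, fun h => absurd rfl h, fun h Z hZ Z' hZ' => ?_⟩
    · simp [(b1 x).1 h Z hZ Z' hZ', (F x).t_Z hZ, (F x).t_Z hZ']
    · simp [(b1 x).2.2 h Z hZ Z' hZ', (F x).t_W hZ, (F x).t_W hZ']

lemma theta_rMulFn {g : M → ℂ} (hg : SmFn g univ) {ω : Ω 2}
    (hω : ω ∈ RSpace T10 θ 2 1 1) : w12 θ (rMulFn θ g ω) = fsmul g (w12 θ ω) := by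
  rw [rMulFn_eq F hT10 hθ hg hω]
  funext x; apply (F x).ext3 <;> simp

omit hT10 in
lemma Q21_of_mem {ω : Ω 2} (hω : ω ∈ RSpace T10 θ 2 1 1) : Q21 F (w12 θ ω) = w12 θ ω := by
  have z : w13 θ (w12 θ ω) = 0 := funext fun x => w13_theta_w12 (F x) _
  have hb := (hasBidegree_three_iff hθ F z).1 ((hasBidegree_two_iff hθ F).1 hω.2.2.2)
  have htr := (isRumin_three_iff hθ F (hθ.smooth.w12 hω.2.1) z).1 (theta_d3_w12 F hθ hω)
  funext x
  refine Q21_eq F (A := 0) (B := 0) (ξ := 0) ?_ (by simp) (by simp) (congrFun z x)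
    ((hb x).1 (by norm_num)) ((hb x).2.2 (by norm_num)) (htr x)
  change w12 θ ω x = 0 + w12 θ ω x + 0 + _
  module

/-- The operator `𝒟` in terms of horizontal data. -/
lemma calD_eq {ω : Ω 2} (hω : ω ∈ RSpace T10 θ 2 1 1)
    (hR : SmFn (scalarCurvature T10 θ) univ) (hl : SmoothOn (leeForm T10 θ) univ) : calD T10 θ ω =
      C22 F (d3 (I • Q21 F (w12 θ (d1 (P01 F (tauF F ω) - P10 F (tauF F ω))))
        - fsmul (fun x => scalarCurvature T10 θ x / 6) (w12 θ ω)))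
      + (2 : ℂ) • C22 F (piFour θ (w22 (leeForm T10 θ) ω)) := by
  have hτ := smoothOn_tauF F hT10 hθ hω
  have h01 := smoothOn_P01 hT10 hθ F isOpen_univ hτ
  have h10 := smoothOn_P10 hT10 hθ F isOpen_univ hτ
  have hg : SmFn (fun x => scalarCurvature T10 θ x / 6) univ := hR.div (smFn_const 6 _) (by simp)
  obtain ⟨a, ha, hra, hda, -⟩ := delBStar_eq F hT10 hθ hω
  obtain ⟨b, hb, hrb, hdb⟩ := delBbarStar_eq F hT10 hθ hω
  have c1 := component_d1 F hT10 hθ (h01.const_smul _) ha hra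
  have c2 := component_d1 F hT10 hθ (h10.const_smul _) hb hrb
  have mr := rMulFn_mem F hT10 hθ hg hω
  have c3 := component_two hT10 hθ F mr.2.1 mr.2.2.1
  rw [theta_rMulFn F hT10 hθ hg hω] at c3
  have k1 : krWedge T10 θ (leeForm T10 θ) ω = C22 F (piFour θ (w22 (leeForm T10 θ) ω)) :=
    (components_four hT10 hθ F (smoothOn_piFour F hT10 hθ (hl.w22 hω.2.1))
      (w14_piFour F hT10 hθ (hl.w22 hω.2.1))).1
  rw [calD, k1, delB, if_neg (by norm_num), delBbar, krMulFn, hda, hdb]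
  congr 1
  simp only [Nat.zero_add]
  obtain ⟨_, _, _, _, h5⟩ := delBStar_eq F hT10 hθ
    (rspace_add F hθ (rspace_add F hθ c1.1 c2.1) c3.1)
  rw [h5, w12_add F, w12_add F, c1.2, c2.2, c3.2]
  have s21 := fun {α : Ω 1} (hα : SmoothOn α univ) =>
    (Q21_mem hT10 hθ F (hθ.smooth.w12 (hα.d1 isOpen_univ))
      (funext fun x => w13_theta_w12 (F x) _)).2.1
  have e : Q21 F (fsmul (fun x => scalarCurvature T10 θ x / 6) (w12 θ ω)) =
      fsmul (fun x => scalarCurvature T10 θ x / 6) (w12 θ ω) := by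
    rw [← theta_rMulFn F hT10 hθ hg hω]
    exact Q21_of_mem F hθ mr
  have hX := (s21 (h01.const_smul (-I))).add (s21 (h10.const_smul I)) |>.add
    (e ▸ SmoothOn.fsmul hg (hθ.smooth.w12 hω.2.1))
  rw [← d3_neg hX, e, d1_smul _ h01, d1_smul _ h10, d1_sub h01 h10, w12_sub F, w12_smul F,
    w12_smul F, Q21_smul, Q21_smul, Q21_sub]
  congr 2
  funext x; apply (F x).ext3 <;> simp <;> ring

end Operators

section Volume

/-- The `(2,0)`-form of a frame. -/
def psiF (G : ∀ y, SF T10 θ y) : Ω 2 := w11 (cf1 G) (cf2 G)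
/-- The `(0,2)`-form of a frame. -/
def chiF (G : ∀ y, SF T10 θ y) : Ω 2 := w11 (cf3 G) (cf4 G)

/-- `ϖ` is the trace of the Tanaka--Webster connection with respect to the `(2,0)`-form `ψ` and the
dual `(0,2)`-form `χ`. -/
structure IsVp (θ : Ω 1) (ψ χ : Ω 2) (ϖ : Ω 1) (x : M) : Prop where
  left : w13 θ (d2 ψ + w12 ϖ ψ) x = 0
  right : w13 θ (d2 χ - w12 ϖ χ) x = 0
  mid : w23 χ (d2 ψ + w12 ϖ ψ) x = 0

/-- The trace of the Tanaka--Webster connection of a frame. -/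
def vpi (G : ∀ y, SF T10 θ y) : Ω 1 :=
  fsmul (fun y => -e3 (d2 (psiF G)) y (G y).T (G y).Z1 (G y).Z2) θ
  + fsmul (fun y => e3 (d2 (chiF G)) y (G y).Z1 (G y).W1 (G y).W2) (cf1 G)
  + fsmul (fun y => e3 (d2 (chiF G)) y (G y).Z2 (G y).W1 (G y).W2) (cf2 G)
  + fsmul (fun y => -e3 (d2 (psiF G)) y (G y).Z1 (G y).Z2 (G y).W1) (cf3 G)
  + fsmul (fun y => -e3 (d2 (psiF G)) y (G y).Z1 (G y).Z2 (G y).W2) (cf4 G)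

variable {G : ∀ y, SF T10 θ y}

lemma SmSF.psiF (hθ : IsContactForm T10 θ) (hG : SmSF G U) : SmoothOn (psiF G) U :=
  (hG.cf1 hθ).w11 (hG.cf2 hθ)
lemma SmSF.chiF (hθ : IsContactForm T10 θ) (hG : SmSF G U) : SmoothOn (chiF G) U :=
  (hG.cf3 hθ).w11 (hG.cf4 hθ)

lemma SmSF.vpi (hθ : IsContactForm T10 θ) (hG : SmSF G U) : SmoothOn (vpi G) U := by
  have h1 := (hG.psiF hθ).d2 hG.isOpen
  have h2 := (hG.chiF hθ).d2 hG.isOpen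
  have ht := hθ.smooth.mono (subset_univ U)
  exact ((((SmoothOn.fsmul (hG.T.smFn_e3 hG.Z1 hG.Z2 h1).neg ht).add
    (SmoothOn.fsmul (hG.Z1.smFn_e3 hG.W1 hG.W2 h2) (hG.cf1 hθ))).add
    (SmoothOn.fsmul (hG.Z2.smFn_e3 hG.W1 hG.W2 h2) (hG.cf2 hθ))).add
    (SmoothOn.fsmul (hG.Z1.smFn_e3 hG.Z2 hG.W1 h1).neg (hG.cf3 hθ))).add
    (SmoothOn.fsmul (hG.Z1.smFn_e3 hG.Z2 hG.W2 h1).neg (hG.cf4 hθ))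

@[simp] lemma vpi_T (x : M) :
    e1 (vpi G) x (G x).T = -e3 (d2 (psiF G)) x (G x).T (G x).Z1 (G x).Z2 := by simp [vpi]
@[simp] lemma vpi_Z1 (x : M) :
    e1 (vpi G) x (G x).Z1 = e3 (d2 (chiF G)) x (G x).Z1 (G x).W1 (G x).W2 := by simp [vpi]
@[simp] lemma vpi_Z2 (x : M) :
    e1 (vpi G) x (G x).Z2 = e3 (d2 (chiF G)) x (G x).Z2 (G x).W1 (G x).W2 := by simp [vpi]
@[simp] lemma vpi_W1 (x : M) :
    e1 (vpi G) x (G x).W1 = -e3 (d2 (psiF G)) x (G x).Z1 (G x).Z2 (G x).W1 := by simp [vpi]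
@[simp] lemma vpi_W2 (x : M) :
    e1 (vpi G) x (G x).W2 = -e3 (d2 (psiF G)) x (G x).Z1 (G x).Z2 (G x).W2 := by simp [vpi]

section

variable (hT10 : IsCRStructure T10) (hθ : IsContactForm T10 θ) (hG : SmSF G U) (hx : x ∈ U)

include hT10 hθ hG hx

lemma d1_cf1_WW {Z W : ℂT x} (hZ : conjC Z ∈ T10 x) (hW : conjC W ∈ T10 x) :
    e2 (d1 (cf1 G)) x Z W = 0 :=
  e2_d1_eq_zero_conj hT10 hG.isOpen (hG.cf1 hθ) (fun _ _ _ h => cf1_W h) hx hZ hW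
lemma d1_cf2_WW {Z W : ℂT x} (hZ : conjC Z ∈ T10 x) (hW : conjC W ∈ T10 x) :
    e2 (d1 (cf2 G)) x Z W = 0 :=
  e2_d1_eq_zero_conj hT10 hG.isOpen (hG.cf2 hθ) (fun _ _ _ h => cf2_W h) hx hZ hW
lemma d1_cf3_ZZ {Z W : ℂT x} (hZ : Z ∈ T10 x) (hW : W ∈ T10 x) : e2 (d1 (cf3 G)) x Z W = 0 :=
  e2_d1_eq_zero hT10 hG.isOpen (hG.cf3 hθ) (fun _ _ _ h => cf3_Z h) hx hZ hW
lemma d1_cf4_ZZ {Z W : ℂT x} (hZ : Z ∈ T10 x) (hW : W ∈ T10 x) : e2 (d1 (cf4 G)) x Z W = 0 :=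
  e2_d1_eq_zero hT10 hG.isOpen (hG.cf4 hθ) (fun _ _ _ h => cf4_Z h) hx hZ hW

lemma d2_psiF_ZWW {Z W W' : ℂT x} (hW : conjC W ∈ T10 x) (hW' : conjC W' ∈ T10 x) :
    e3 (d2 (psiF G)) x Z W W' = 0 := by
  rw [psiF, e3, d2_w11 hG.isOpen hx (hG.cf1 hθ) (hG.cf2 hθ), evalC_sub]
  change e3 (w12 _ _) x _ _ _ - e3 (w12 _ _) x _ _ _ = 0
  rw [e3_w12, e3_w12, d1_cf1_WW hT10 hθ hG hx hW hW', d1_cf2_WW hT10 hθ hG hx hW hW', cf1_W hW,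
    cf1_W hW', cf2_W hW, cf2_W hW']
  ring

lemma d2_chiF_ZZW {Z W Z' : ℂT x} (hZ : Z ∈ T10 x) (hZ' : Z' ∈ T10 x) :
    e3 (d2 (chiF G)) x Z Z' W = 0 := by
  rw [chiF, e3, d2_w11 hG.isOpen hx (hG.cf3 hθ) (hG.cf4 hθ), evalC_sub]
  change e3 (w12 _ _) x _ _ _ - e3 (w12 _ _) x _ _ _ = 0
  rw [e3_w12, e3_w12, d1_cf3_ZZ hT10 hθ hG hx hZ hZ', d1_cf4_ZZ hT10 hθ hG hx hZ hZ', cf3_Z hZ,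
    cf3_Z hZ', cf4_Z hZ, cf4_Z hZ']
  ring

lemma isVp_vpi : IsVp θ (psiF G) (chiF G) (vpi G) x := by
  have h1 := d2_psiF_ZWW hT10 hθ hG hx (Z := (G x).Z1) (G x).mW1 (G x).mW2
  have h2 := d2_psiF_ZWW hT10 hθ hG hx (Z := (G x).Z2) (G x).mW1 (G x).mW2
  have h3 := d2_chiF_ZZW hT10 hθ hG hx (W := (G x).W1) (G x).mZ1 (G x).mZ2
  have h4 := d2_chiF_ZZW hT10 hθ hG hx (W := (G x).W2) (G x).mZ1 (G x).mZ2
  have z4 : ∀ μ : Ω 4, μ x = (0 : Ω 4) x → μ x = 0 := fun μ h => h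
  have z5 : ∀ μ : Ω 5, μ x = (0 : Ω 5) x → μ x = 0 := fun μ h => h
  have ep : ∀ a b, e2 (psiF G) x a b = e2 (w11 (cf1 G) (cf2 G)) x a b := fun _ _ => rfl
  have ec : ∀ a b, e2 (chiF G) x a b = e2 (w11 (cf3 G) (cf4 G)) x a b := fun _ _ => rfl
  refine ⟨z4 _ ?_, z4 _ ?_, z5 _ ?_⟩
  · apply (G x).ext4 <;> simp [ep, h1, h2]
  · apply (G x).ext4 <;> simp [ec, h3, h4]
  · apply (G x).ext5; simp [e5_w23, ec, ep]

end

lemma IsVp.unique {ψ χ : Ω 2} {ϖ ϖ' : Ω 1} (h : IsVp θ ψ χ ϖ x)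
    (h' : IsVp θ ψ χ ϖ' x) {p q : ℂ} (hp : p ≠ 0) (hq : q ≠ 0) (hψ : ψ x = p • psiF G x)
    (hχ : χ x = q • chiF G x) : ϖ x = ϖ' x := by
  have ep : ∀ a b, e2 ψ x a b = p * e2 (w11 (cf1 G) (cf2 G)) x a b := fun a b => by
    rw [e2, hψ, evalC_smul]; rfl
  have ec : ∀ a b, e2 χ x a b = q * e2 (w11 (cf3 G) (cf4 G)) x a b := fun a b => by
    rw [e2, hχ, evalC_smul]; rfl
  have l : ∀ {μ : Ω 4}, μ x = 0 → ∀ a b c d, e4 μ x a b c d = 0 := fun h a b c d => by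
    rw [e4, h, evalC_zero]
  have l' : ∀ {μ : Ω 5}, μ x = 0 → ∀ a b c d e, e5 μ x a b c d e = 0 :=
    fun h a b c d e => by rw [e5, h, evalC_zero]
  have a1 := l h.left (G x).T (G x).Z1 (G x).Z2 (G x).W1
  have a2 := l h.left (G x).T (G x).Z1 (G x).Z2 (G x).W2
  have a3 := l h.right (G x).T (G x).Z1 (G x).W1 (G x).W2
  have a4 := l h.right (G x).T (G x).Z2 (G x).W1 (G x).W2
  have a5 := l' h.mid (G x).T (G x).Z1 (G x).Z2 (G x).W1 (G x).W2
  have b1 := l h'.left (G x).T (G x).Z1 (G x).Z2 (G x).W1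
  have b2 := l h'.left (G x).T (G x).Z1 (G x).Z2 (G x).W2
  have b3 := l h'.right (G x).T (G x).Z1 (G x).W1 (G x).W2
  have b4 := l h'.right (G x).T (G x).Z2 (G x).W1 (G x).W2
  have b5 := l' h'.mid (G x).T (G x).Z1 (G x).Z2 (G x).W1 (G x).W2
  simp [ep] at a1 a2 b1 b2
  simp [ec] at a3 a4 b3 b4
  simp [e5_w23, ec, ep, hq] at a5 b5
  apply (G x).ext1
  · exact mul_right_cancel₀ hp (by linear_combination a5 - b5)
  · exact mul_right_cancel₀ hq (by linear_combination b3 - a3)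
  · exact mul_right_cancel₀ hq (by linear_combination b4 - a4)
  · exact mul_right_cancel₀ hp (by linear_combination a1 - b1)
  · exact mul_right_cancel₀ hp (by linear_combination a2 - b2)

lemma dFn_inv (hU : IsOpen U) (hx : x ∈ U) {v : M → ℂ} (hv : SmFn v U)
    (h0 : ∀ y ∈ U, v y ≠ 0) (a : ℂT x) :
    e1 (dFn fun y => (v y)⁻¹) x a = -(v x)⁻¹ * (v x)⁻¹ * e1 (dFn v) x a := by
  have h1 := dFn_mul hU hx hv (hv.inv h0)
  rw [dFn_congr hU hx (g := fun _ => (1 : ℂ)) (fun y hy => mul_inv_cancel₀ (h0 y hy)),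
    dFn_const] at h1
  have h2 : e1 (0 : Ω 1) x a = evalC (v x • (dFn fun y => (v y)⁻¹) x + (v x)⁻¹ • dFn v x) ![a] := by
    rw [← h1]; rfl
  rw [evalC_add, evalC_smul, evalC_smul, e1_zero] at h2
  change 0 = v x * e1 _ x a + (v x)⁻¹ * e1 _ x a at h2
  have := h0 x hx
  field_simp at h2 ⊢
  linear_combination -h2

/-- The logarithmic differential is closed. -/
lemma d1_dlog (hU : IsOpen U) (hx : x ∈ U) {v : M → ℂ} (hv : SmFn v U)
    (h0 : ∀ y ∈ U, v y ≠ 0) (G : SF T10 θ x) : d1 (fsmul (fun y => (v y)⁻¹) (dFn v)) x = 0 := by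
  rw [d1_fsmul hU hx (hv.inv h0) (hv.dFn hU), d1_dFn hU hx hv]
  have : w11 (dFn fun y => (v y)⁻¹) (dFn v) x = (0 : Ω 2) x := by
    apply G.ext2 <;> simp [dFn_inv hU hx hv h0] <;> ring
  rw [this]
  change (0 : TS x [⋀^Fin 2]→L[ℝ] ℂ) + (v x)⁻¹ • (0 : TS x [⋀^Fin 2]→L[ℝ] ℂ) = 0
  module

/-- The effect of rescaling `ψ` on the connection form. -/
lemma IsVp.rescale (hU : IsOpen U) (hx : x ∈ U) {ψ χ ψ' χ' : Ω 2} {ϖ : Ω 1}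
    {v : M → ℂ} (hv : SmFn v U) (h0 : ∀ y ∈ U, v y ≠ 0) (hψ : SmoothOn ψ U) (hχ : SmoothOn χ U)
    (h1 : ∀ y ∈ U, ψ' y = v y • ψ y) (h2 : ∀ y ∈ U, χ' y = (v y)⁻¹ • χ y) (G : SF T10 θ x)
    (h : IsVp θ ψ χ ϖ x) : IsVp θ ψ' χ' (ϖ - fsmul (fun y => (v y)⁻¹) (dFn v)) x := by
  have e1' : d2 ψ' x = w12 (dFn v) ψ x + v x • d2 ψ x := by
    rw [← d2_fsmul hU hx hv hψ]; exact extD_congr hU h1 hx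
  have e2' : d2 χ' x = w12 (dFn fun y => (v y)⁻¹) χ x + (v x)⁻¹ • d2 χ x := by
    rw [← d2_fsmul hU hx (hv.inv h0) hχ]; exact extD_congr hU h2 hx
  have hvx := h0 x hx
  have E1 : ∀ a b c, e3 (d2 ψ') x a b c = e3 (w12 (dFn v) ψ) x a b c + v x * e3 (d2 ψ) x a b c := by
    intro a b c; rw [e3, e1', evalC_add, evalC_smul]; rfl
  have E2 : ∀ a b c, e3 (d2 χ') x a b c = e3 (w12 (dFn fun y => (v y)⁻¹) χ) x a b c
      + (v x)⁻¹ * e3 (d2 χ) x a b c := by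
    intro a b c; rw [e3, e2', evalC_add, evalC_smul]; rfl
  have E3 : ∀ a b, e2 ψ' x a b = v x * e2 ψ x a b := fun a b => by rw [e2, h1 x hx, evalC_smul]; rfl
  have E4 : ∀ a b, e2 χ' x a b = (v x)⁻¹ * e2 χ x a b := fun a b => by
    rw [e2, h2 x hx, evalC_smul]; rfl
  have K1 : ∀ a b c, e3 (d2 ψ' + w12 (ϖ - fsmul (fun y => (v y)⁻¹) (dFn v)) ψ') x a b c =
      v x * e3 (d2 ψ + w12 ϖ ψ) x a b c := by
    intro a b c
    simp only [e3_add, E1, e3_w12, E3, e1_sub, e1_fsmul]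
    field_simp
    ring
  have K2 : ∀ a b c, e3 (d2 χ' - w12 (ϖ - fsmul (fun y => (v y)⁻¹) (dFn v)) χ') x a b c =
      (v x)⁻¹ * e3 (d2 χ - w12 ϖ χ) x a b c := by
    intro a b c
    simp only [e3_sub, E2, e3_w12, E4, e1_sub, e1_fsmul, dFn_inv hU hx hv h0]
    field_simp
    ring
  have z4 : ∀ μ : Ω 4, μ x = (0 : Ω 4) x → μ x = 0 := fun μ h => h
  have z5 : ∀ μ : Ω 5, μ x = (0 : Ω 5) x → μ x = 0 := fun μ h => h
  have l : ∀ {μ : Ω 4}, μ x = 0 → ∀ a b c d, e4 μ x a b c d = 0 := fun h a b c d => by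
    rw [e4, h, evalC_zero]
  have l' : ∀ {μ : Ω 5}, μ x = 0 → ∀ a b c d e, e5 μ x a b c d e = 0 :=
    fun h a b c d e => by rw [e5, h, evalC_zero]
  have L1 := l h.left
  have L2 := l h.right
  have L3 := l' h.mid
  simp only [e4_w13] at L1 L2
  simp only [e5_w23] at L3
  refine ⟨z4 _ ?_, z4 _ ?_, z5 _ ?_⟩
  · apply G.ext4 <;> rw [e4_w13, K1, K1, K1, K1, e4_zero]
    · linear_combination v x * L1 G.T G.Z1 G.Z2 G.W1
    · linear_combination v x * L1 G.T G.Z1 G.Z2 G.W2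
    · linear_combination v x * L1 G.T G.Z1 G.W1 G.W2
    · linear_combination v x * L1 G.T G.Z2 G.W1 G.W2
    · linear_combination v x * L1 G.Z1 G.Z2 G.W1 G.W2
  · apply G.ext4 <;> rw [e4_w13, K2, K2, K2, K2, e4_zero]
    · linear_combination (v x)⁻¹ * L2 G.T G.Z1 G.Z2 G.W1
    · linear_combination (v x)⁻¹ * L2 G.T G.Z1 G.Z2 G.W2
    · linear_combination (v x)⁻¹ * L2 G.T G.Z1 G.W1 G.W2
    · linear_combination (v x)⁻¹ * L2 G.T G.Z2 G.W1 G.W2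
    · linear_combination (v x)⁻¹ * L2 G.Z1 G.Z2 G.W1 G.W2
  · apply G.ext5
    rw [e5_w23, e5_zero]
    simp only [K1, E4]
    linear_combination v x * (v x)⁻¹ * L3 G.T G.Z1 G.Z2 G.W1 G.W2

/-- The curvature of the trace of the connection does not depend on the frame. -/
lemma IsVp.d1_eq (hT10 : IsCRStructure T10) (hθ : IsContactForm T10 θ) (hG : SmSF G U)
    {ψ χ : Ω 2} {ϖ : Ω 1} (hψ : SmoothOn ψ U)
    (h1 : ∀ y ∈ U, ψ y = e2 ψ y (G y).Z1 (G y).Z2 • psiF G y)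
    (h2 : ∀ y ∈ U, χ y = e2 χ y (G y).W1 (G y).W2 • chiF G y)
    (h3 : ∀ y ∈ U, e2 ψ y (G y).Z1 (G y).Z2 * e2 χ y (G y).W1 (G y).W2 = 1)
    (h : ∀ y ∈ U, IsVp θ ψ χ ϖ y) (hx : x ∈ U) : d1 ϖ x = d1 (vpi G) x := by
  have hU := hG.isOpen
  have hv : SmFn (fun y => e2 ψ y (G y).Z1 (G y).Z2) U := hG.Z1.smFn_e2 hG.Z2 hψ
  set v : M → ℂ := fun y => e2 ψ y (G y).Z1 (G y).Z2 with hvdef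
  have h0 : ∀ y ∈ U, v y ≠ 0 := fun y hy hz => by
    have := h3 y hy
    rw [show e2 ψ y (G y).Z1 (G y).Z2 = 0 from hz, zero_mul] at this
    exact zero_ne_one this
  have hq : ∀ y ∈ U, e2 χ y (G y).W1 (G y).W2 = (v y)⁻¹ := fun y hy =>
    eq_inv_of_mul_eq_one_right (h3 y hy)
  have key : ∀ y ∈ U, ϖ y = (vpi G - fsmul (fun y => (v y)⁻¹) (dFn v)) y := by
    intro y hy
    refine IsVp.unique (G := G) (h y hy) ?_ (h0 y hy) (inv_ne_zero (h0 y hy)) (h1 y hy)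
      (by rw [h2 y hy, hq y hy])
    exact IsVp.rescale hU hy hv h0 (hG.psiF hθ) (hG.chiF hθ) h1
      (fun z hz => by rw [h2 z hz, hq z hz]) (G y) (isVp_vpi hT10 hθ hG hy)
  have e := extD_congr hU key hx
  have e' := extD_sub hU hx (hG.vpi hθ) (SmoothOn.fsmul (hv.inv h0) (hv.dFn hU))
  have e'' := d1_dlog hU hx hv h0 (G x)
  change d1 ϖ x = _
  rw [d1, e, e']
  change d1 (vpi G) x - d1 (fsmul (fun y => (v y)⁻¹) (dFn v)) x = _
  rw [e'', sub_zero]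

end Volume

namespace AdmissibleCoframe

variable (A : AdmissibleCoframe T10 θ U)

lemma coframe_W (hx : x ∈ U) (α : Fin 2) {W : ℂT x} (hW : conjC W ∈ T10 x) :
    e1 (A.coframe α) x W = 0 := by
  have := A.coframe_conj α x hx _ hW
  rwa [conjC_conjC] at this

lemma coframe_T (hθ : IsContactForm T10 θ) (hx : x ∈ U) (α : Fin 2) (G : SF T10 θ x) :
    e1 (A.coframe α) x G.T = 0 := by
  obtain ⟨v, hv⟩ := G.exists_real hθ
  have h : IsReebAt θ x v := by
    refine ⟨?_, fun w => ?_⟩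
    · rw [← e1_real, ← hv, G.tT]
    · have := e2_real (d1 θ) x v w
      rw [← hv, G.dT] at this
      exact this.symm
  rw [hv, e1_real]
  exact A.coframe_reeb α x hx v h

lemma coframe_frame (hx : x ∈ U) (α β : Fin 2) :
    e1 (A.coframe α) x (A.frame β x) = if α = β then 1 else 0 := A.frame_dual α β x hx

/-- The coframe of type `(0,1)`. -/
def cobar (α : Fin 2) : Ω 1 := conjF (A.coframe α)
/-- The conjugate connection forms. -/
def conbar (α γ : Fin 2) : Ω 1 := conjF (A.conn α γ)
/-- The conjugate frame. -/
def framebar (α : Fin 2) (x : M) : ℂT x := conjC (A.frame α x)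

lemma framebar_mem (hx : x ∈ U) (α : Fin 2) : conjC (A.framebar α x) ∈ T10 x := by
  rw [framebar, conjC_conjC]; exact A.frame_mem α x hx

lemma coframe_framebar (hx : x ∈ U) (α β : Fin 2) :
    e1 (A.coframe α) x (A.framebar β x) = 0 := A.coframe_W hx α (A.framebar_mem hx β)

lemma cobar_Z (hx : x ∈ U) (α : Fin 2) {Z : ℂT x} (hZ : Z ∈ T10 x) : e1 (A.cobar α) x Z = 0 := by
  rw [cobar, e1_conjF, A.coframe_W hx α (by rwa [conjC_conjC]), map_zero]

lemma cobar_T (hθ : IsContactForm T10 θ) (hx : x ∈ U) (α : Fin 2) (G : SF T10 θ x) :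
    e1 (A.cobar α) x G.T = 0 := by
  rw [cobar, e1_conjF, SF.conjT hθ G, A.coframe_T hθ hx, map_zero]

lemma cobar_framebar (hx : x ∈ U) (α β : Fin 2) :
    e1 (A.cobar α) x (A.framebar β x) = if α = β then 1 else 0 := by
  rw [cobar, e1_conjF, framebar, conjC_conjC, A.coframe_frame hx]
  split_ifs <;> simp

lemma levi_eval (hx : x ∈ U) (a b : ℂT x) : e2 (d1 θ) x a b =
    ∑ α, ∑ β, I * A.h x α β * e2 (w11 (A.coframe α) (A.cobar β)) x a b := by
  have : d1 θ x = _ := A.levi x hx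
  rw [e2, this, evalC_sum]
  refine Finset.sum_congr rfl fun α _ => ?_
  rw [evalC_sum]
  refine Finset.sum_congr rfl fun β _ => ?_
  rw [evalC_smul]; rfl

lemma levi_frame (hx : x ∈ U) (α β : Fin 2) :
    e2 (d1 θ) x (A.frame α x) (A.framebar β x) = I * A.h x α β := by
  have k := fun i => A.cobar_Z hx i (A.frame_mem α x hx)
  rw [A.levi_eval hx]
  simp only [e2_w11, A.coframe_frame hx, A.cobar_framebar hx, k]
  simp

lemma h_conj (hθ : IsContactForm T10 θ) (hx : x ∈ U) (α β : Fin 2) :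
    cj (A.h x α β) = A.h x β α := by
  have h1 := A.levi_frame hx α β
  have h2 := A.levi_frame hx β α
  have h3 := hθ.e2_conj (A.frame α x) (A.framebar β x)
  rw [h1] at h3
  rw [show conjC (A.framebar β x) = A.frame β x from conjC_conjC _,
    show conjC (A.frame α x) = A.framebar α x from rfl, e2_swap, h2, map_mul, conj_I] at h3
  exact mul_left_cancel₀ I_ne_zero (by linear_combination h3)

section

variable (hx : x ∈ U) (G : SF T10 θ x)

include hx

/-- The change of frame matrix. -/
lemma frame_eq : A.frame 0 x = (e1 (A.coframe 1) x G.Z2 /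
      (e1 (A.coframe 0) x G.Z1 * e1 (A.coframe 1) x G.Z2
        - e1 (A.coframe 0) x G.Z2 * e1 (A.coframe 1) x G.Z1)) • G.Z1 + (-e1 (A.coframe 1) x G.Z1 /
      (e1 (A.coframe 0) x G.Z1 * e1 (A.coframe 1) x G.Z2
        - e1 (A.coframe 0) x G.Z2 * e1 (A.coframe 1) x G.Z1)) • G.Z2 ∧
    A.frame 1 x = (-e1 (A.coframe 0) x G.Z2 / (e1 (A.coframe 0) x G.Z1 * e1 (A.coframe 1) x G.Z2
        - e1 (A.coframe 0) x G.Z2 * e1 (A.coframe 1) x G.Z1)) • G.Z1 + (e1 (A.coframe 0) x G.Z1 /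
      (e1 (A.coframe 0) x G.Z1 * e1 (A.coframe 1) x G.Z2
        - e1 (A.coframe 0) x G.Z2 * e1 (A.coframe 1) x G.Z1)) • G.Z2 ∧
    e1 (A.coframe 0) x G.Z1 * e1 (A.coframe 1) x G.Z2
        - e1 (A.coframe 0) x G.Z2 * e1 (A.coframe 1) x G.Z1 ≠ 0 := by
  obtain ⟨a, b, h0⟩ := G.spanZ _ (A.frame_mem 0 x hx)
  obtain ⟨c, d, h1⟩ := G.spanZ _ (A.frame_mem 1 x hx)
  have k00 := A.coframe_frame hx 0 0
  have k01 := A.coframe_frame hx 0 1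
  have k10 := A.coframe_frame hx 1 0
  have k11 := A.coframe_frame hx 1 1
  rw [h0] at k00 k10
  rw [h1] at k01 k11
  simp only [e1_add_vec, e1_smul_vec, if_true, Fin.isValue, zero_ne_one, one_ne_zero, if_false]
    at k00 k01 k10 k11
  set p := e1 (A.coframe 0) x G.Z1
  set q := e1 (A.coframe 0) x G.Z2
  set r := e1 (A.coframe 1) x G.Z1
  set s := e1 (A.coframe 1) x G.Z2
  have hdet : p * s - q * r ≠ 0 := fun h => by
    have : (1 : ℂ) = (p * s - q * r) * (a * d - b * c) := by
      linear_combination -(c * r + d * s) * k00 - k11 + (c * p + d * q) * k10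
    rw [h, zero_mul] at this
    exact one_ne_zero this
  have ea : a = s / (p * s - q * r) := by rw [eq_div_iff hdet]; linear_combination s * k00 - q * k10
  have eb : b = -r / (p * s - q * r) := by
    rw [eq_div_iff hdet]; linear_combination p * k10 - r * k00
  have ec : c = -q / (p * s - q * r) := by
    rw [eq_div_iff hdet]; linear_combination s * k01 - q * k11
  have ed : d = p / (p * s - q * r) := by rw [eq_div_iff hdet]; linear_combination p * k11 - r * k01
  rw [← ea, ← eb, ← ec, ← ed]
  exact ⟨h0, h1, hdet⟩

/-- `θ ∧ dθ² ≠ 0` in terms of the coframe. -/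
lemma det_mul : (e1 (A.coframe 0) x G.Z1 * e1 (A.coframe 1) x G.Z2
        - e1 (A.coframe 0) x G.Z2 * e1 (A.coframe 1) x G.Z1)
    * ((A.h x 0 0 * A.h x 1 1 - A.h x 0 1 * A.h x 1 0)
      * (e1 (A.cobar 0) x G.W1 * e1 (A.cobar 1) x G.W2
        - e1 (A.cobar 0) x G.W2 * e1 (A.cobar 1) x G.W1)) = 1 := by
  have k1 := fun i => A.cobar_Z hx i G.mZ1
  have k2 := fun i => A.cobar_Z hx i G.mZ2
  have h11 := A.levi_eval hx G.Z1 G.W1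
  have h12 := A.levi_eval hx G.Z1 G.W2
  have h21 := A.levi_eval hx G.Z2 G.W1
  have h22 := A.levi_eval hx G.Z2 G.W2
  simp only [Fin.sum_univ_two, e2_w11, k1, k2, zero_mul, sub_zero, SF.d11, SF.d12, SF.d21,
    SF.d22] at h11 h12 h21 h22
  have hI := I_mul_I
  have k := congrArg₂ HMul.hMul h11 h22
  have k' := congrArg₂ HMul.hMul h12 h21
  linear_combination k - k' + ((e1 (A.coframe 0) x G.Z1 * e1 (A.coframe 1) x G.Z2
        - e1 (A.coframe 0) x G.Z2 * e1 (A.coframe 1) x G.Z1)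
    * ((A.h x 0 0 * A.h x 1 1 - A.h x 0 1 * A.h x 1 0)
      * (e1 (A.cobar 0) x G.W1 * e1 (A.cobar 1) x G.W2
        - e1 (A.cobar 0) x G.W2 * e1 (A.cobar 1) x G.W1)) - 1) * hI

end

end AdmissibleCoframe

lemma e1_congr {α β : Ω 1} (h : α x = β x) (a : ℂT x) : e1 α x a = e1 β x a := by rw [e1, h]; rfl

lemma e2_congr {α β : Ω 2} (h : α x = β x) (a b : ℂT x) : e2 α x a b = e2 β x a b := by
  rw [e2, h]; rfl

lemma e3_congr {α β : Ω 3} (h : α x = β x) (a b c : ℂT x) : e3 α x a b c = e3 β x a b c := by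
  rw [e3, h]; rfl

lemma e4_congr {α β : Ω 4} (h : α x = β x) (a b c d : ℂT x) : e4 α x a b c d = e4 β x a b c d := by
  rw [e4, h]; rfl

namespace AdmissibleCoframe

variable (A : AdmissibleCoframe T10 θ U)

/-- The trace of the connection. -/
def vpt : Ω 1 := A.conn 0 0 + A.conn 1 1

/-- The determinant of the Levi form. -/
def dett (y : M) : ℂ := A.h y 0 0 * A.h y 1 1 - A.h y 0 1 * A.h y 1 0

lemma smoothOn_cobar (α : Fin 2) : SmoothOn (A.cobar α) U := (A.coframe_smooth α).conjF
lemma smoothOn_conbar (α γ : Fin 2) : SmoothOn (A.conbar α γ) U := (A.conn_smooth α γ).conjF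

lemma dett_ne_zero (hx : x ∈ U) (G : SF T10 θ x) : A.dett x ≠ 0 := fun h => by
  have := A.det_mul hx G
  rw [show A.h x 0 0 * A.h x 1 1 - A.h x 0 1 * A.h x 1 0 = 0 from h, zero_mul, mul_zero] at this
  exact zero_ne_one this

lemma h_smooth (hT10 : IsCRStructure T10) (hθ : IsContactForm T10 θ) (α β : Fin 2) :
    SmFn (fun y => A.h y α β) U := by
  refine smFn_of_frames hT10 hθ A.isOpen fun G W hG hW => ?_
  have c := fun i => (A.coframe_smooth i).mono hW
  have hp := hG.Z1.smFn_e1 (c 0)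
  have hq := hG.Z2.smFn_e1 (c 0)
  have hr := hG.Z1.smFn_e1 (c 1)
  have hs := hG.Z2.smFn_e1 (c 1)
  have hd := (hp.mul hs).sub (hq.mul hr)
  have h0 := fun y (hy : y ∈ W) => (A.frame_eq (hW hy) (G y)).2.2
  have f0 : SmCV (fun y => A.frame 0 y) W :=
    ((hG.Z1.smul (hs.div hd h0)).add (hG.Z2.smul (hr.neg.div hd h0))).congr
      fun y hy => (A.frame_eq (hW hy) (G y)).1
  have f1 : SmCV (fun y => A.frame 1 y) W :=
    ((hG.Z1.smul (hq.neg.div hd h0)).add (hG.Z2.smul (hp.div hd h0))).congr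
      fun y hy => (A.frame_eq (hW hy) (G y)).2.1
  have f : ∀ i, SmCV (fun y => A.frame i y) W := fun i => by fin_cases i; exacts [f0, f1]
  refine ((smFn_const (-I) W).mul
    ((f α).smFn_e2 (f β).conjC ((hθ.smooth.mono W.subset_univ).d1 hG.isOpen))).congr
      fun y hy => ?_
  have := A.levi_frame (hW hy) α β
  rw [framebar] at this
  rw [this]
  linear_combination A.h y α β * I_mul_I

lemma d1_coframe_eval (hx : x ∈ U) (α : Fin 2) (u v : ℂT x) : e2 (d1 (A.coframe α)) x u v =
      e1 (A.coframe 0) x u * e1 (A.conn 0 α) x v - e1 (A.coframe 0) x v * e1 (A.conn 0 α) x u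
      + (e1 (A.coframe 1) x u * e1 (A.conn 1 α) x v - e1 (A.coframe 1) x v * e1 (A.conn 1 α) x u)
      + (A.tor x α 0 * (e1 θ x u * e1 (A.cobar 0) x v - e1 θ x v * e1 (A.cobar 0) x u)
        + A.tor x α 1 * (e1 θ x u * e1 (A.cobar 1) x v - e1 θ x v * e1 (A.cobar 1) x u)) := by
  have : d1 (A.coframe α) x = (w11 (A.coframe 0) (A.conn 0 α) + w11 (A.coframe 1) (A.conn 1 α)
      + (fsmul (fun y => A.tor y α 0) (w11 θ (A.cobar 0))
        + fsmul (fun y => A.tor y α 1) (w11 θ (A.cobar 1)))) x := by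
    rw [d1, A.structure_eq α x hx, Fin.sum_univ_two, Fin.sum_univ_two]; rfl
  rw [e2, this]
  change e2 _ x u v = _
  simp only [e2_add, e2_w11, e2_fsmul]; ring

lemma dFn_h_eval (hx : x ∈ U) (α β : Fin 2) (u : ℂT x) : e1 (dFn fun y => A.h y α β) x u =
      A.h x 0 β * e1 (A.conn α 0) x u + A.h x 1 β * e1 (A.conn α 1) x u
      + (A.h x α 0 * e1 (A.conbar β 0) x u + A.h x α 1 * e1 (A.conbar β 1) x u) := by
  have : dFn (fun y => A.h y α β) x = (fsmul (fun y => A.h y 0 β) (A.conn α 0)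
      + fsmul (fun y => A.h y 1 β) (A.conn α 1) + (fsmul (fun y => A.h y α 0) (A.conbar β 0)
      + fsmul (fun y => A.h y α 1) (A.conbar β 1))) x := by
    rw [dFn, A.metric α β x hx, Fin.sum_univ_two, Fin.sum_univ_two]; rfl
  rw [e1, this]
  change e1 _ x u = _
  simp only [e1_add, e1_fsmul]

lemma riem_eq (α γ ρ σ : Fin 2) : A.riem x α γ ρ σ =
    e2 (d1 (A.conn α γ)) x (A.frame ρ x) (A.framebar σ x)
      - (e1 (A.conn α 0) x (A.frame ρ x) * e1 (A.conn 0 γ) x (A.framebar σ x)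
        - e1 (A.conn α 0) x (A.framebar σ x) * e1 (A.conn 0 γ) x (A.frame ρ x)
        + (e1 (A.conn α 1) x (A.frame ρ x) * e1 (A.conn 1 γ) x (A.framebar σ x)
        - e1 (A.conn α 1) x (A.framebar σ x) * e1 (A.conn 1 γ) x (A.frame ρ x))) := by
  have : A.curvForm α γ = d1 (A.conn α γ)
      - (w11 (A.conn α 0) (A.conn 0 γ) + w11 (A.conn α 1) (A.conn 1 γ)) := by
    rw [curvForm, Fin.sum_univ_two]; rfl
  rw [riem, this]
  change e2 _ x (A.frame ρ x) (A.framebar σ x) = _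
  simp only [e2_sub, e2_add, e2_w11]; ring

lemma riem_symm (hT10 : IsCRStructure T10) (hθ : IsContactForm T10 θ) (hx : x ∈ U)
    (α σ : Fin 2) : A.riem x 0 α 1 σ = A.riem x 1 α 0 σ := by
  obtain ⟨G⟩ := exists_SF hT10 hθ x
  have sθ := hθ.smooth.mono (subset_univ U)
  have c := A.coframe_smooth
  have n := A.conn_smooth
  have hU := A.isOpen
  have s0 := (c 0).w11 (n 0 α)
  have s1 := (c 1).w11 (n 1 α)
  have hs := ((c α).d1 hU).sub (s0.add s1)
  set τ := d1 (A.coframe α) - (w11 (A.coframe 0) (A.conn 0 α) + w11 (A.coframe 1) (A.conn 1 α))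
    with hτ
  have eτ : ∀ y (hy : y ∈ U) (u v : ℂT y), e2 τ y u v =
      A.tor y α 0 * (e1 θ y u * e1 (A.cobar 0) y v - e1 θ y v * e1 (A.cobar 0) y u)
        + A.tor y α 1 * (e1 θ y u * e1 (A.cobar 1) y v - e1 θ y v * e1 (A.cobar 1) y u) := by
    intro y hy u v
    rw [hτ, e2_sub, e2_add, e2_w11, e2_w11, A.d1_coframe_eval hy]; ring
  have h0 : ∀ y ∈ U, w12 θ τ y = (0 : Ω 3) y := fun y hy => by
    obtain ⟨H⟩ := exists_SF hT10 hθ y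
    apply H.ext3 <;> simp only [e3_w12, eτ y hy, e3_zero, SF.tT, SF.tZ1, SF.tZ2, SF.tW1, SF.tW2] <;>
      ring
  have h1 : w22 (d1 θ) τ x - w13 θ (d2 τ) x = 0 := by
    rw [← d3_w12 hU hx sθ hs, d3, extD_congr hU h0 hx]
    exact extD_zero_apply 3 x
  have z0 := A.frame_mem 0 x hx
  have z1 := A.frame_mem 1 x hx
  have b := A.framebar_mem hx σ
  have h2 : e4 (w22 (d1 θ) τ - w13 θ (d2 τ)) x G.T (A.frame 0 x) (A.frame 1 x) (A.framebar σ x)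
      = 0 := by
    rw [e4, show (w22 (d1 θ) τ - w13 θ (d2 τ)) x = 0 from h1]; exact evalC_zero _
  have t0 := G.t_Z z0
  have t1 := G.t_Z z1
  have tb := G.t_W b
  rw [e4_sub, e4_w22, e4_w13] at h2
  simp only [G.dT, eτ x hx, A.cobar_Z hx _ z0, A.cobar_Z hx _ z1, t0, t1, tb, G.tT,
    hθ.e2_T10 hT10 z0 z1, A.cobar_T hθ hx] at h2
  have h3 : d2 τ x = (-(w12 (A.conn 0 α) (d1 (A.coframe 0)) - w12 (A.coframe 0) (d1 (A.conn 0 α))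
      + (w12 (A.conn 1 α) (d1 (A.coframe 1)) - w12 (A.coframe 1) (d1 (A.conn 1 α))))) x := by
    have e := extD_sub hU hx ((c α).d1 hU) (s0.add s1)
    have e' := extD_add hU hx s0 s1
    have e2 : d2 τ x = d2 (d1 (A.coframe α)) x - (d2 (w11 (A.coframe 0) (A.conn 0 α)) x
        + d2 (w11 (A.coframe 1) (A.conn 1 α)) x) := by rw [d2, hτ, e, e']; rfl
    rw [e2, d2_d1 hU hx (c α), d2_w11 hU hx (c 0) (n 0 α), d2_w11 hU hx (c 1) (n 1 α), zero_sub]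
    rfl
  have h4 := e3_congr h3 (A.frame 0 x) (A.frame 1 x) (A.framebar σ x)
  rw [e3_neg, e3_add, e3_sub, e3_sub] at h4
  simp only [e3_w12, A.d1_coframe_eval hx, A.coframe_frame hx, A.coframe_framebar hx, t0, t1, tb]
    at h4
  simp at h2 h4
  rw [h2] at h4
  rw [riem_eq, riem_eq]
  linear_combination -h4

end AdmissibleCoframe

lemma e2_d1_fsmul (hU : IsOpen U) (hx : x ∈ U)
    {f : M → ℂ} {β : Ω 1} (hf : SmFn f U) (hβ : SmoothOn β U) (a b : ℂT x) :
    e2 (d1 (fsmul f β)) x a b =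
      e1 (dFn f) x a * e1 β x b - e1 β x a * e1 (dFn f) x b + f x * e2 (d1 β) x a b := by
  have h : d1 (fsmul f β) x = (w11 (dFn f) β + fsmul f (d1 β)) x := d1_fsmul hU hx hf hβ
  rw [e2_congr h, e2_add, e2_w11, e2_fsmul]

lemma conjC_comb_mem {a b : ℂT x} (ha : conjC a ∈ T10 x) (hb : conjC b ∈ T10 x) {c d : ℂ} :
    conjC (c • a + d • b) ∈ T10 x := by
  rw [map_add, conjC_smul, conjC_smul]
  exact add_mem ((T10 x).smul_mem _ ha) ((T10 x).smul_mem _ hb)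

namespace AdmissibleCoframe

variable (A : AdmissibleCoframe T10 θ U)

lemma riem_conj (hT10 : IsCRStructure T10) (hθ : IsContactForm T10 θ) (hx : x ∈ U)
    (α β ρ σ : Fin 2) : A.h x 0 β * A.riem x α 0 ρ σ + A.h x 1 β * A.riem x α 1 ρ σ =
      A.h x α 0 * cj (A.riem x β 0 σ ρ) + A.h x α 1 * cj (A.riem x β 1 σ ρ) := by
  have hU := A.isOpen
  have n := A.conn_smooth
  have nb := A.smoothOn_conbar
  have h := A.h_smooth hT10 hθ
  have s0 := (n α 0).fsmul (h 0 β)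
  have s1 := (n α 1).fsmul (h 1 β)
  have s2 := (nb β 0).fsmul (h α 0)
  have s3 := (nb β 1).fsmul (h α 1)
  have e : ∀ y ∈ U, dFn (fun y => A.h y α β) y = (fsmul (fun y => A.h y 0 β) (A.conn α 0)
      + fsmul (fun y => A.h y 1 β) (A.conn α 1) + (fsmul (fun y => A.h y α 0) (A.conbar β 0)
      + fsmul (fun y => A.h y α 1) (A.conbar β 1))) y := fun y hy => by
    rw [dFn, A.metric α β y hy, Fin.sum_univ_two, Fin.sum_univ_two]; rfl
  have k := d1_dFn hU hx (h α β)
  rw [d1, extD_congr hU e hx, extD_add hU hx (s0.add s1) (s2.add s3), extD_add hU hx s0 s1,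
    extD_add hU hx s2 s3] at k
  have k' : (d1 (fsmul (fun y => A.h y 0 β) (A.conn α 0))
      + d1 (fsmul (fun y => A.h y 1 β) (A.conn α 1))
      + (d1 (fsmul (fun y => A.h y α 0) (A.conbar β 0))
        + d1 (fsmul (fun y => A.h y α 1) (A.conbar β 1)))) x = (0 : Ω 2) x := k
  have k2 := e2_congr k' (A.frame ρ x) (A.framebar σ x)
  simp only [e2_add, e2_zero, e2_d1_fsmul hU hx (h 0 β) (n α 0),
    e2_d1_fsmul hU hx (h 1 β) (n α 1), e2_d1_fsmul hU hx (h α 0) (nb β 0),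
    e2_d1_fsmul hU hx (h α 1) (nb β 1), A.dFn_h_eval hx] at k2
  have dc : ∀ γ, cj (e2 (d1 (A.conn β γ)) x (A.frame σ x) (A.framebar ρ x)) =
      -e2 (d1 (A.conbar β γ)) x (A.frame ρ x) (A.framebar σ x) := fun γ => by
    have e1 : d1 (A.conbar β γ) x = conjF (d1 (A.conn β γ)) x := extD_conjF hU hx (n β γ)
    rw [e2_congr e1, e2_conjF, show conjC (A.framebar σ x) = A.frame σ x from conjC_conjC _,
      show conjC (A.frame ρ x) = A.framebar ρ x from rfl, e2_swap, map_neg]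
  have nc : ∀ i j k, cj (e1 (A.conn i j) x (A.frame k x))
      = e1 (A.conbar i j) x (A.framebar k x) := fun i j k => by
    rw [conbar, e1_conjF, framebar, conjC_conjC]
  have nc' : ∀ i j k, cj (e1 (A.conn i j) x (A.framebar k x))
      = e1 (A.conbar i j) x (A.frame k x) := fun i j k => by
    rw [conbar, e1_conjF, framebar]
  rw [riem_eq, riem_eq, riem_eq, riem_eq]
  simp only [map_sub, map_add, map_mul, dc, nc, nc']
  linear_combination k2

lemma inv_h (x : M) : (A.h x)⁻¹ 0 0 = A.h x 1 1 / A.dett x ∧ (A.h x)⁻¹ 0 1 = -A.h x 0 1 / A.dett x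
    ∧ (A.h x)⁻¹ 1 0 = -A.h x 1 0 / A.dett x ∧ (A.h x)⁻¹ 1 1 = A.h x 0 0 / A.dett x := by
  rw [Matrix.inv_def, Matrix.adjugate_fin_two, Ring.inverse_eq_inv', Matrix.det_fin_two]
  simp [dett, div_eq_inv_mul]

lemma ricci_eq (hT10 : IsCRStructure T10) (hθ : IsContactForm T10 θ) (hx : x ∈ U)
    (α β : Fin 2) : A.ricci x α β = e2 (d1 A.vpt) x (A.frame α x) (A.framebar β x) := by
  obtain ⟨G⟩ := exists_SF hT10 hθ x
  have hD := A.dett_ne_zero hx G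
  have hs : ∀ a b c d, A.riem x a b c d = A.riem x c b a d := fun a b c d => by
    have := A.riem_symm hT10 hθ hx b d
    fin_cases a <;> fin_cases c
    exacts [rfl, this, this.symm, rfl]
  have hc := A.h_conj hθ hx
  have key : ∀ a b c d, A.h x 0 b * A.riem x a 0 c d + A.h x 1 b * A.riem x a 1 c d
      = A.h x 0 d * A.riem x c 0 a b + A.h x 1 d * A.riem x c 1 a b := fun a b c d => by
    have e1 := A.riem_conj hT10 hθ hx c b a d
    have e2 := congrArg cj (A.riem_conj hT10 hθ hx d c b a)
    simp only [map_add, map_mul, conj_conj, hc] at e2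
    rw [hs a 0 c d, hs a 1 c d, e1, hs b 0 d a, hs b 1 d a]
    exact e2
  have tr : e2 (d1 A.vpt) x (A.frame α x) (A.framebar β x)
      = A.riem x 0 0 α β + A.riem x 1 1 α β := by
    have e : d1 A.vpt x = (d1 (A.conn 0 0) + d1 (A.conn 1 1)) x :=
      extD_add A.isOpen hx (A.conn_smooth 0 0) (A.conn_smooth 1 1)
    rw [riem_eq, riem_eq, e2_congr e, e2_add]; ring
  obtain ⟨i1, i2, i3, i4⟩ := A.inv_h x
  have k00 := key α β 0 0
  have k01 := key α β 0 1
  have k10 := key α β 1 0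
  have k11 := key α β 1 1
  rw [tr, ricci]
  simp only [Fin.sum_univ_two, i1, i2, i3, i4]
  have : A.dett x * (A.dett x)⁻¹ = 1 := mul_inv_cancel₀ hD
  simp only [div_eq_mul_inv]
  have e : A.dett x = A.h x 0 0 * A.h x 1 1 - A.h x 0 1 * A.h x 1 0 := rfl
  linear_combination (A.h x 1 1 * (A.dett x)⁻¹) * k00 - (A.h x 1 0 * (A.dett x)⁻¹) * k01
    - (A.h x 0 1 * (A.dett x)⁻¹) * k10 + (A.h x 0 0 * (A.dett x)⁻¹) * k11
    + (A.riem x 0 0 α β + A.riem x 1 1 α β) * this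
    - (A.riem x 0 0 α β + A.riem x 1 1 α β) * (A.dett x)⁻¹ * e

lemma comb_framebar_mem (hx : x ∈ U) {c d : ℂ} :
    conjC (c • A.framebar 0 x + d • A.framebar 1 x) ∈ T10 x :=
  conjC_comb_mem (A.framebar_mem hx 0) (A.framebar_mem hx 1)

/-- The adapted frame of an admissible coframe. -/
def sf (hT10 : IsCRStructure T10) (hθ : IsContactForm T10 θ) (hx : x ∈ U) (G : SF T10 θ x) :
    SF T10 θ x where
  T := G.T
  Z1 := A.frame 0 x
  Z2 := A.frame 1 x
  W1 := (A.h x)⁻¹ 0 0 • A.framebar 0 x + (A.h x)⁻¹ 1 0 • A.framebar 1 x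
  W2 := (A.h x)⁻¹ 0 1 • A.framebar 0 x + (A.h x)⁻¹ 1 1 • A.framebar 1 x
  mZ1 := A.frame_mem 0 x hx
  mZ2 := A.frame_mem 1 x hx
  mW1 := A.comb_framebar_mem hx
  mW2 := A.comb_framebar_mem hx
  spanZ := fun Z hZ => by
    obtain ⟨a, b, h⟩ := G.spanZ Z hZ
    obtain ⟨h0, h1, hd⟩ := A.frame_eq hx G
    set p := e1 (A.coframe 0) x G.Z1
    set q := e1 (A.coframe 0) x G.Z2
    set r := e1 (A.coframe 1) x G.Z1
    set s := e1 (A.coframe 1) x G.Z2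
    refine ⟨a * p + b * q, a * r + b * s, ?_⟩
    rw [h, h0, h1]
    match_scalars <;> field_simp <;> ring
  tT := G.tT
  tZ1 := G.t_Z (A.frame_mem 0 x hx)
  tZ2 := G.t_Z (A.frame_mem 1 x hx)
  tW1 := G.t_W (A.comb_framebar_mem hx)
  tW2 := G.t_W (A.comb_framebar_mem hx)
  dTZ1 := G.dT _
  dTZ2 := G.dT _
  dTW1 := G.dT _
  dTW2 := G.dT _
  dZZ := hθ.e2_T10 hT10 (A.frame_mem 0 x hx) (A.frame_mem 1 x hx)
  dWW := hθ.e2_T01 hT10 (A.comb_framebar_mem hx) (A.comb_framebar_mem hx)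
  d11 := by
    obtain ⟨i1, i2, i3, i4⟩ := A.inv_h x
    have hD := A.dett_ne_zero hx G
    rw [e2_add_right, e2_smul_right, e2_smul_right, A.levi_frame hx, A.levi_frame hx, i1, i3]
    field_simp
    rw [dett]; ring
  d12 := by
    obtain ⟨i1, i2, i3, i4⟩ := A.inv_h x
    rw [e2_add_right, e2_smul_right, e2_smul_right, A.levi_frame hx, A.levi_frame hx, i2, i4]
    ring
  d21 := by
    obtain ⟨i1, i2, i3, i4⟩ := A.inv_h x
    rw [e2_add_right, e2_smul_right, e2_smul_right, A.levi_frame hx, A.levi_frame hx, i1, i3]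
    ring
  d22 := by
    obtain ⟨i1, i2, i3, i4⟩ := A.inv_h x
    have hD := A.dett_ne_zero hx G
    rw [e2_add_right, e2_smul_right, e2_smul_right, A.levi_frame hx, A.levi_frame hx, i2, i4]
    field_simp
    rw [dett]; ring

open Classical in
/-- The adapted frames of an admissible coframe, extended arbitrarily. -/
def sfs (hT10 : IsCRStructure T10) (hθ : IsContactForm T10 θ) (F : ∀ y, SF T10 θ y) (y : M) :
    SF T10 θ y := if h : y ∈ U then A.sf hT10 hθ h (F y) else F y

section

variable (hT10 : IsCRStructure T10) (hθ : IsContactForm T10 θ) (hx : x ∈ U) (F : ∀ y, SF T10 θ y)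

include hT10 hθ hx

lemma sfs_eq : A.sfs hT10 hθ F x = A.sf hT10 hθ hx (F x) := dif_pos hx

lemma scal_eq : A.scal x = tr2 F (d1 A.vpt) x := by
  rw [tr2_frame F (A.sfs hT10 hθ F), tr2, A.sfs_eq hT10 hθ hx, scal]
  simp only [sf, Fin.sum_univ_two, A.ricci_eq hT10 hθ hx, e2_add_right, e2_smul_right]

lemma leeH_eq : w12 θ A.leeH x = (-I / 4) • Q21 F (w12 θ (d1 A.vpt)) x := by
  obtain ⟨i1, i2, i3, i4⟩ := A.inv_h x
  have hD := A.dett_ne_zero hx (F x)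
  have eD : A.dett x = A.h x 0 0 * A.h x 1 1 - A.h x 0 1 * A.h x 1 0 := rfl
  have eS := A.scal_eq hT10 hθ hx F
  rw [tr2_frame F (A.sfs hT10 hθ F), tr2] at eS
  rw [Q21_frame F (A.sfs hT10 hθ F) (w13_theta_w12 (F x) _)]
  have hs := A.sfs_eq hT10 hθ hx F
  set H := A.sfs hT10 hθ F
  have hZ1 : (H x).Z1 = A.frame 0 x := by rw [hs]; rfl
  have hZ2 : (H x).Z2 = A.frame 1 x := by rw [hs]; rfl
  have hW1 : (H x).W1 = (A.h x)⁻¹ 0 0 • A.framebar 0 x + (A.h x)⁻¹ 1 0 • A.framebar 1 x := by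
    rw [hs]; rfl
  have hW2 : (H x).W2 = (A.h x)⁻¹ 0 1 • A.framebar 0 x + (A.h x)⁻¹ 1 1 • A.framebar 1 x := by
    rw [hs]; rfl
  have eL : ∀ a b, e2 A.leeH x a b = -I * A.tracefreeE x 0 0 *
      (e1 (A.coframe 0) x a * e1 (A.cobar 0) x b - e1 (A.cobar 0) x a * e1 (A.coframe 0) x b)
      + -I * A.tracefreeE x 0 1 *
      (e1 (A.coframe 0) x a * e1 (A.cobar 1) x b - e1 (A.cobar 1) x a * e1 (A.coframe 0) x b)
      + (-I * A.tracefreeE x 1 0 *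
      (e1 (A.coframe 1) x a * e1 (A.cobar 0) x b - e1 (A.cobar 0) x a * e1 (A.coframe 1) x b)
      + -I * A.tracefreeE x 1 1 *
      (e1 (A.coframe 1) x a * e1 (A.cobar 1) x b - e1 (A.cobar 1) x a * e1 (A.coframe 1) x b)) := by
    intro a b
    have : A.leeH x = (fsmul (fun y => -I * A.tracefreeE y 0 0) (w11 (A.coframe 0) (A.cobar 0))
      + fsmul (fun y => -I * A.tracefreeE y 0 1) (w11 (A.coframe 0) (A.cobar 1))
      + (fsmul (fun y => -I * A.tracefreeE y 1 0) (w11 (A.coframe 1) (A.cobar 0))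
      + fsmul (fun y => -I * A.tracefreeE y 1 1) (w11 (A.coframe 1) (A.cobar 1)))) x := by
      rw [leeH, Fin.sum_univ_two, Fin.sum_univ_two, Fin.sum_univ_two]; rfl
    rw [e2_congr this]
    simp only [e2_add, e2_fsmul, e2_w11]
  have cZ : ∀ i, e1 (A.cobar i) x (A.frame 0 x) = 0 ∧ e1 (A.cobar i) x (A.frame 1 x) = 0 :=
    fun i => ⟨A.cobar_Z hx i (A.frame_mem 0 x hx), A.cobar_Z hx i (A.frame_mem 1 x hx)⟩
  have ZZ : e2 A.leeH x (H x).Z1 (H x).Z2 = 0 := by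
    rw [eL, hZ1, hZ2]; simp only [(cZ _).1, (cZ _).2]; ring
  have WW : e2 A.leeH x (H x).W1 (H x).W2 = 0 := by
    rw [eL]; simp only [A.coframe_W hx _ (H x).mW1, A.coframe_W hx _ (H x).mW2]; ring
  have fb : ∀ a b : Fin 2, e2 A.leeH x (A.frame a x) (A.framebar b x)
      = -I * A.tracefreeE x a b := fun a b => by
    rw [eL]
    simp only [A.cobar_Z hx _ (A.frame_mem a x hx), A.cobar_framebar hx, A.coframe_frame hx]
    fin_cases a <;> fin_cases b <;> simp
  have e11 : e2 A.leeH x (H x).Z1 (H x).W1 = -I / 4 *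
    ((e2 (d1 A.vpt) x (H x).Z1 (H x).W1 - e2 (d1 A.vpt) x (H x).Z2 (H x).W2) / 2) := by
    have : A.h x 0 0 * (A.h x)⁻¹ 0 0 + A.h x 0 1 * (A.h x)⁻¹ 1 0 = 1 := by
      rw [i1, i3]; field_simp; rw [eD]; ring
    simp only [hZ1, hZ2, hW1, hW2, e2_add_right, e2_smul_right, fb, tracefreeE, A.ricci_eq hT10 hθ hx] at eS ⊢
    linear_combination (I * A.scal x / 8) * this + (I / 8) * eS
  have e12 : e2 A.leeH x (H x).Z1 (H x).W2 = -I / 4 *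
    e2 (d1 A.vpt) x (H x).Z1 (H x).W2 := by
    have : A.h x 0 0 * (A.h x)⁻¹ 0 1 + A.h x 0 1 * (A.h x)⁻¹ 1 1 = 0 := by
      rw [i2, i4]; field_simp; ring
    simp only [hZ1, hZ2, hW1, hW2, e2_add_right, e2_smul_right, fb, tracefreeE, A.ricci_eq hT10 hθ hx] at eS ⊢
    linear_combination (I * A.scal x / 8) * this
  have e21 : e2 A.leeH x (H x).Z2 (H x).W1 = -I / 4 *
    e2 (d1 A.vpt) x (H x).Z2 (H x).W1 := by
    have : A.h x 1 0 * (A.h x)⁻¹ 0 0 + A.h x 1 1 * (A.h x)⁻¹ 1 0 = 0 := by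
      rw [i1, i3]; field_simp; ring
    simp only [hZ1, hZ2, hW1, hW2, e2_add_right, e2_smul_right, fb, tracefreeE, A.ricci_eq hT10 hθ hx] at eS ⊢
    linear_combination (I * A.scal x / 8) * this
  have e22 : e2 A.leeH x (H x).Z2 (H x).W2 = -I / 4 *
    ((e2 (d1 A.vpt) x (H x).Z2 (H x).W2 - e2 (d1 A.vpt) x (H x).Z1 (H x).W1) / 2) := by
    have : A.h x 1 0 * (A.h x)⁻¹ 0 1 + A.h x 1 1 * (A.h x)⁻¹ 1 1 = 1 := by
      rw [i2, i4]; field_simp; rw [eD]; ring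
    simp only [hZ1, hZ2, hW1, hW2, e2_add_right, e2_smul_right, fb, tracefreeE, A.ricci_eq hT10 hθ hx] at eS ⊢
    linear_combination (I * A.scal x / 8) * this + (I / 8) * eS
  change w12 θ A.leeH x = ((-I / 4) • Q21 H (w12 θ (d1 A.vpt))) x
  apply (H x).ext3 <;> simp only [e3_w12, Q21, e3_smul, e3_add, e3_sub, e3_fsmul, e2_w11, SF.tT,
    SF.tZ1, SF.tZ2, SF.tW1, SF.tW2, cf1_Z1, cf1_Z2, cf1_W1, cf1_W2, cf2_Z1, cf2_Z2, cf2_W1, cf2_W2,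
    cf3_Z1, cf3_Z2, cf3_W1, cf3_W2, cf4_Z1, cf4_Z2, cf4_W1, cf4_W2, ZZ, WW, e11, e12, e21, e22] <;>
    ring

end

end AdmissibleCoframe

lemma w13_theta_of_horizontal (G : SF T10 θ x) {ν : Ω 3}
    (h : ∀ u v w, e1 θ x u = 0 → e1 θ x v = 0 → e1 θ x w = 0 → e3 ν x u v w = 0) :
    w13 θ ν x = 0 := by
  change w13 θ ν x = (0 : Ω 4) x
  have k1 := h _ _ _ G.tZ1 G.tZ2 G.tW1
  have k2 := h _ _ _ G.tZ1 G.tZ2 G.tW2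
  have k3 := h _ _ _ G.tZ1 G.tW1 G.tW2
  have k4 := h _ _ _ G.tZ2 G.tW1 G.tW2
  apply G.ext4 <;> simp only [e4_w13, e4_zero, SF.tT, SF.tZ1, SF.tZ2, SF.tW1, SF.tW2, k1, k2, k3,
    k4] <;> ring

namespace AdmissibleCoframe

variable (A : AdmissibleCoframe T10 θ U)

/-- The `(2,0)`-form of an admissible coframe. -/
def psi : Ω 2 := w11 (A.coframe 0) (A.coframe 1)
/-- The `(0,2)`-form dual to `psi` with respect to the Levi form. -/
def chi : Ω 2 := fsmul A.dett (w11 (A.cobar 0) (A.cobar 1))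

section

variable (hT10 : IsCRStructure T10) (hθ : IsContactForm T10 θ)

include hT10 hθ

lemma dett_smooth : SmFn A.dett U :=
  ((A.h_smooth hT10 hθ 0 0).mul (A.h_smooth hT10 hθ 1 1)).sub
    ((A.h_smooth hT10 hθ 0 1).mul (A.h_smooth hT10 hθ 1 0))

lemma dFn_dett_eval (hx : x ∈ U) (u : ℂT x) : e1 (dFn A.dett) x u = A.dett x *
    (e1 (A.conn 0 0) x u + e1 (A.conn 1 1) x u
      + (e1 (A.conbar 0 0) x u + e1 (A.conbar 1 1) x u)) := by
  have h := A.h_smooth hT10 hθ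
  have hU := A.isOpen
  have e : dFn A.dett x = (fsmul (fun y => A.h y 0 0) (dFn fun y => A.h y 1 1)
      + fsmul (fun y => A.h y 1 1) (dFn fun y => A.h y 0 0)
      - (fsmul (fun y => A.h y 0 1) (dFn fun y => A.h y 1 0)
      + fsmul (fun y => A.h y 1 0) (dFn fun y => A.h y 0 1))) x := by
    have e1 := extD_sub hU hx (smoothOn_fnForm ((h 0 0).mul (h 1 1)))
      (smoothOn_fnForm ((h 0 1).mul (h 1 0)))
    have e2 := dFn_mul hU hx (h 0 0) (h 1 1)
    have e3 := dFn_mul hU hx (h 0 1) (h 1 0)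
    have e0 : dFn A.dett x = dFn (fun y => A.h y 0 0 * A.h y 1 1) x
        - dFn (fun y => A.h y 0 1 * A.h y 1 0) x := by
      refine Eq.trans ?_ e1
      rw [dFn]
      congr 1
    rw [e0, e2, e3]; rfl
  rw [e1_congr e]
  simp only [e1_sub, e1_add, e1_fsmul, A.dFn_h_eval hx, dett]
  ring

lemma d1_cobar_eval (hx : x ∈ U) (α : Fin 2) (u v : ℂT x) (hu : e1 θ x u = 0) (hv : e1 θ x v = 0) :
    e2 (d1 (A.cobar α)) x u v =
      e1 (A.cobar 0) x u * e1 (A.conbar 0 α) x v - e1 (A.cobar 0) x v * e1 (A.conbar 0 α) x u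
      + (e1 (A.cobar 1) x u * e1 (A.conbar 1 α) x v
        - e1 (A.cobar 1) x v * e1 (A.conbar 1 α) x u) := by
  have e : d1 (A.cobar α) x = conjF (d1 (A.coframe α)) x := extD_conjF A.isOpen hx (A.coframe_smooth α)
  have tu : e1 θ x (conjC u) = 0 := by rw [hθ.e1_conj, hu, map_zero]
  have tv : e1 θ x (conjC v) = 0 := by rw [hθ.e1_conj, hv, map_zero]
  rw [e2_congr e, e2_conjF, A.d1_coframe_eval hx, tu, tv]
  simp only [map_add, map_sub, map_mul, cobar, conbar, e1_conjF, map_zero]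
  ring

lemma isVp_vpt (hx : x ∈ U) : IsVp θ A.psi A.chi A.vpt x := by
  obtain ⟨G⟩ := exists_SF hT10 hθ x
  have hU := A.isOpen
  have c := A.coframe_smooth
  have cb := A.smoothOn_cobar
  have hψ : (d2 A.psi + w12 A.vpt A.psi) x = (w12 (A.coframe 1) (d1 (A.coframe 0))
      - w12 (A.coframe 0) (d1 (A.coframe 1))
      + w12 (A.conn 0 0 + A.conn 1 1) (w11 (A.coframe 0) (A.coframe 1))) x := by
    change d2 (w11 _ _) x + _ = _
    rw [d2_w11 hU hx (c 0) (c 1)]; rfl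
  have hχ : (d2 A.chi - w12 A.vpt A.chi) x = (w12 (dFn A.dett) (w11 (A.cobar 0) (A.cobar 1))
      + fsmul A.dett (w12 (A.cobar 1) (d1 (A.cobar 0)) - w12 (A.cobar 0) (d1 (A.cobar 1)))
      - w12 (A.conn 0 0 + A.conn 1 1) (fsmul A.dett (w11 (A.cobar 0) (A.cobar 1)))) x := by
    change d2 (fsmul _ _) x - _ = _
    rw [d2_fsmul hU hx (A.dett_smooth hT10 hθ) ((cb 0).w11 (cb 1)), d2_w11 hU hx (cb 0) (cb 1)]; rfl
  have left : ∀ u v w, e1 θ x u = 0 → e1 θ x v = 0 → e1 θ x w = 0 →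
      e3 (d2 A.psi + w12 A.vpt A.psi) x u v w = 0 := fun u v w hu hv hw => by
    rw [e3_congr hψ]
    simp only [e3_add, e3_sub, e3_w12, e2_w11, e1_add, A.d1_coframe_eval hx, hu, hv, hw]
    ring
  have mid : e3 (d2 A.psi + w12 A.vpt A.psi) x G.T G.Z1 G.Z2 = 0 := by
    rw [e3_congr hψ]
    simp only [e3_add, e3_sub, e3_w12, e2_w11, e1_add, A.d1_coframe_eval hx, A.cobar_T hθ hx,
      A.cobar_Z hx _ G.mZ1, A.cobar_Z hx _ G.mZ2]
    ring
  refine ⟨w13_theta_of_horizontal G left, w13_theta_of_horizontal G fun u v w hu hv hw => ?_, ?_⟩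
  · rw [e3_congr hχ]
    simp only [e3_add, e3_sub, e3_w12, e2_w11, e1_add, e3_fsmul, e2_fsmul,
      A.d1_cobar_eval hT10 hθ hx _ _ _ hu hv, A.d1_cobar_eval hT10 hθ hx _ _ _ hu hw,
      A.d1_cobar_eval hT10 hθ hx _ _ _ hv hw, A.dFn_dett_eval hT10 hθ hx]
    ring
  · change _ = (0 : Ω 5) x
    apply G.ext5
    have e : ∀ a b, e2 A.chi x a b = A.dett x * (e1 (A.cobar 0) x a * e1 (A.cobar 1) x b
      - e1 (A.cobar 1) x a * e1 (A.cobar 0) x b) := fun a b => by rw [chi, e2_fsmul, e2_w11]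
    rw [e5_w23]
    simp only [e, A.cobar_T hθ hx, A.cobar_Z hx _ G.mZ1, A.cobar_Z hx _ G.mZ2, mid, e5_zero]
    ring

lemma d1_vpt_eq {G : ∀ y, SF T10 θ y} {W : Set M} (hG : SmSF G W) (hW : W ⊆ U) (hx : x ∈ W) :
    d1 A.vpt x = d1 (vpi G) x := by
  have e : ∀ y a b, e2 A.chi y a b = A.dett y * (e1 (A.cobar 0) y a * e1 (A.cobar 1) y b
      - e1 (A.cobar 1) y a * e1 (A.cobar 0) y b) := fun y a b => by
    rw [chi, e2_fsmul, e2_w11]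
  refine IsVp.d1_eq hT10 hθ hG (((A.coframe_smooth 0).w11 (A.coframe_smooth 1)).mono hW)
    (fun y hy => ?_) (fun y hy => ?_) (fun y hy => ?_)
    (fun y hy => A.isVp_vpt hT10 hθ (hW hy)) hx
  · change A.psi y = (fsmul (fun y => e2 A.psi y (G y).Z1 (G y).Z2) (w11 (cf1 G) (cf2 G))) y
    have hy := hW hy
    apply (G y).ext2 <;>
      simp only [psi, e2_fsmul, e2_w11, A.coframe_T hθ hy, A.coframe_W hy _ (G y).mW1,
        A.coframe_W hy _ (G y).mW2, cf1_T, cf1_Z1, cf1_Z2, cf1_W1, cf1_W2, cf2_T, cf2_Z1, cf2_Z2,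
        cf2_W1, cf2_W2] <;> ring
  · change A.chi y = (fsmul (fun y => e2 A.chi y (G y).W1 (G y).W2) (w11 (cf3 G) (cf4 G))) y
    have hy := hW hy
    apply (G y).ext2 <;>
      simp only [e, e2_fsmul, e2_w11, A.cobar_T hθ hy, A.cobar_Z hy _ (G y).mZ1,
        A.cobar_Z hy _ (G y).mZ2, cf3_T, cf3_Z1, cf3_Z2, cf3_W1, cf3_W2, cf4_T, cf4_Z1, cf4_Z2,
        cf4_W1, cf4_W2] <;> ring
  · rw [e, e2_w11]
    have := A.det_mul (hW hy) (G y)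
    rw [dett]
    linear_combination this

end

end AdmissibleCoframe

section

lemma SF.W_eq (G : SF T10 θ x) (W : ℂT x) (hW : conjC W ∈ T10 x) :
    ∃ a b : ℂ, W = a • conjC G.Z1 + b • conjC G.Z2 := by
  obtain ⟨a, b, h⟩ := G.spanZ _ hW
  refine ⟨cj a, cj b, ?_⟩
  rw [← conjC_conjC W, h, map_add, conjC_smul, conjC_smul]

lemma SF.ext1_conj (G : SF T10 θ x) {α β : Ω 1} (h0 : e1 α x G.T = e1 β x G.T)
    (h1 : e1 α x G.Z1 = e1 β x G.Z1) (h2 : e1 α x G.Z2 = e1 β x G.Z2)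
    (h3 : e1 α x (conjC G.Z1) = e1 β x (conjC G.Z1))
    (h4 : e1 α x (conjC G.Z2) = e1 β x (conjC G.Z2)) : α x = β x := by
  obtain ⟨a, b, k1⟩ := G.W_eq _ G.mW1
  obtain ⟨c, d, k2⟩ := G.W_eq _ G.mW2
  apply G.ext1 h0 h1 h2
  · rw [k1]; simp only [e1_add_vec, e1_smul_vec, h3, h4]
  · rw [k2]; simp only [e1_add_vec, e1_smul_vec, h3, h4]

lemma SF.ext2_conj (G : SF T10 θ x) {α β : Ω 2}
    (h01 : e2 α x G.T G.Z1 = e2 β x G.T G.Z1) (h02 : e2 α x G.T G.Z2 = e2 β x G.T G.Z2)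
    (h03 : e2 α x G.T (conjC G.Z1) = e2 β x G.T (conjC G.Z1))
    (h04 : e2 α x G.T (conjC G.Z2) = e2 β x G.T (conjC G.Z2))
    (h12 : e2 α x G.Z1 G.Z2 = e2 β x G.Z1 G.Z2)
    (h13 : e2 α x G.Z1 (conjC G.Z1) = e2 β x G.Z1 (conjC G.Z1))
    (h14 : e2 α x G.Z1 (conjC G.Z2) = e2 β x G.Z1 (conjC G.Z2))
    (h23 : e2 α x G.Z2 (conjC G.Z1) = e2 β x G.Z2 (conjC G.Z1))
    (h24 : e2 α x G.Z2 (conjC G.Z2) = e2 β x G.Z2 (conjC G.Z2))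
    (h34 : e2 α x (conjC G.Z1) (conjC G.Z2) = e2 β x (conjC G.Z1) (conjC G.Z2)) : α x = β x := by
  obtain ⟨a, b, k1⟩ := G.W_eq _ G.mW1
  obtain ⟨c, d, k2⟩ := G.W_eq _ G.mW2
  have h43 : e2 α x (conjC G.Z2) (conjC G.Z1) = e2 β x (conjC G.Z2) (conjC G.Z1) := by
    rw [e2_swap, h34, ← e2_swap]
  apply G.ext2 h01 h02 _ _ h12
  all_goals simp only [k1, k2, e2_add_left, e2_smul_left, e2_add_right, e2_smul_right, h03, h04,
    h13, h14, h23, h24, h34, h43, e2_self]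

variable (G : ∀ y, SF T10 θ y)

/-- The `(1,0)`-coframe of an adapted frame. -/
def ec (α : Fin 2) : Ω 1 := ![cf1 G, cf2 G] α
/-- Its conjugate. -/
def eb (α : Fin 2) : Ω 1 := conjF (ec G α)
/-- The `(1,0)`-frame of an adapted frame. -/
def zc (α : Fin 2) (y : M) : ℂT y := ![(G y).Z1, (G y).Z2] α
/-- Its conjugate. -/
def zb (α : Fin 2) (y : M) : ℂT y := conjC (zc G α y)
/-- The Levi form of an adapted frame. -/
def hh (α β : Fin 2) (y : M) : ℂ := -I * e2 (d1 θ) y (zc G α y) (zb G β y)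
/-- Its determinant. -/
def hD (y : M) : ℂ := hh G 0 0 y * hh G 1 1 y - hh G 0 1 y * hh G 1 0 y

/-- The `(0,1)`-coefficients of the connection. -/
def qq (α μ σ : Fin 2) (y : M) : ℂ := e2 (d1 (ec G α)) y (zc G μ y) (zb G σ y)
/-- The Reeb coefficients of the connection. -/
def rr (α μ : Fin 2) (y : M) : ℂ := e2 (d1 (ec G α)) y (zc G μ y) (G y).T
/-- The `(1,0)`-coefficients of the connection, with the upper index lowered. -/
def xx (α β ρ : Fin 2) (y : M) : ℂ := e1 (dFn (hh G α β)) y (zc G ρ y)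
  - (hh G α 0 y * cj (qq G 0 β ρ y) + hh G α 1 y * cj (qq G 1 β ρ y))
/-- The `(1,0)`-coefficients of the connection. -/
def pp (γ α ρ : Fin 2) (y : M) : ℂ :=
  ![(hh G 1 1 y * xx G α 0 ρ y - hh G 1 0 y * xx G α 1 ρ y) / hD G y,
    (hh G 0 0 y * xx G α 1 ρ y - hh G 0 1 y * xx G α 0 ρ y) / hD G y] γ
/-- The Tanaka--Webster connection forms of an adapted frame. -/
def cn (μ α : Fin 2) : Ω 1 :=
  fsmul (qq G α μ 0) (eb G 0) + fsmul (qq G α μ 1) (eb G 1)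
    + (fsmul (pp G α μ 0) (ec G 0) + fsmul (pp G α μ 1) (ec G 1)) + fsmul (rr G α μ) θ

variable {G}

lemma zc_mem (α : Fin 2) (y : M) : zc G α y ∈ T10 y := by fin_cases α; exacts [(G y).mZ1, (G y).mZ2]

lemma zb_mem (α : Fin 2) (y : M) : conjC (zb G α y) ∈ T10 y := by
  rw [zb, conjC_conjC]; exact zc_mem α y

lemma ec_W (α : Fin 2) {W : ℂT x} (hW : conjC W ∈ T10 x) : e1 (ec G α) x W = 0 := by
  fin_cases α; exacts [cf1_W hW, cf2_W hW]

lemma ec_zb (α β : Fin 2) : e1 (ec G α) x (zb G β x) = 0 := ec_W α (zb_mem β x)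

lemma ec_T (α : Fin 2) : e1 (ec G α) x (G x).T = 0 := by
  fin_cases α
  · change e1 (cf1 G) x _ = 0; simp
  · change e1 (cf2 G) x _ = 0; simp

lemma ec_zc (α β : Fin 2) : e1 (ec G α) x (zc G β x) = if α = β then 1 else 0 := by
  fin_cases α <;> fin_cases β
  · change e1 (cf1 G) x (G x).Z1 = _; simp
  · change e1 (cf1 G) x (G x).Z2 = _; simp
  · change e1 (cf2 G) x (G x).Z1 = _; simp
  · change e1 (cf2 G) x (G x).Z2 = _; simp

lemma eb_zc (α β : Fin 2) : e1 (eb G α) x (zc G β x) = 0 := by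
  rw [eb, e1_conjF]
  have := ec_zb (G := G) (x := x) α β
  rw [zb] at this
  rw [this, map_zero]

lemma eb_zb (α β : Fin 2) : e1 (eb G α) x (zb G β x) = if α = β then 1 else 0 := by
  rw [eb, e1_conjF, zb, conjC_conjC, ec_zc]
  split_ifs <;> simp

lemma eb_T (hθ : IsContactForm T10 θ) (α : Fin 2) : e1 (eb G α) x (G x).T = 0 := by
  rw [eb, e1_conjF, (G x).conjT hθ, ec_T, map_zero]

lemma hh_conj (hθ : IsContactForm T10 θ) (α β : Fin 2) : cj (hh G α β x) = hh G β α x := by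
  have h3 := hθ.e2_conj (zc G β x) (zb G α x)
  rw [zb, conjC_conjC, e2_swap] at h3
  rw [hh, hh, map_mul, map_neg, conj_I, zb, zb, ← hθ.e2_conj, conjC_conjC]
  rw [e2_swap]; ring

lemma e2_zc_zb (α β : Fin 2) : e2 (d1 θ) x (zc G α x) (zb G β x) = I * hh G α β x := by
  rw [hh]; linear_combination e2 (d1 θ) x (zc G α x) (zb G β x) * I_mul_I

lemma hD_ne_zero : hD G x ≠ 0 := by
  intro h0
  obtain ⟨a, b, k1⟩ := (G x).W_eq _ (G x).mW1
  obtain ⟨c, d, k2⟩ := (G x).W_eq _ (G x).mW2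
  have d11 := (G x).d11
  have d12 := (G x).d12
  have d21 := (G x).d21
  have d22 := (G x).d22
  rw [k1, e2_add_right, e2_smul_right, e2_smul_right] at d11 d21
  rw [k2, e2_add_right, e2_smul_right, e2_smul_right] at d12 d22
  have h00 : hh G 0 0 x = -I * e2 (d1 θ) x (G x).Z1 (conjC (G x).Z1) := rfl
  have h01 : hh G 0 1 x = -I * e2 (d1 θ) x (G x).Z1 (conjC (G x).Z2) := rfl
  have h10 : hh G 1 0 x = -I * e2 (d1 θ) x (G x).Z2 (conjC (G x).Z1) := rfl
  have h11 : hh G 1 1 x = -I * e2 (d1 θ) x (G x).Z2 (conjC (G x).Z2) := rfl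
  rw [hD, h00, h01, h10, h11] at h0
  have k := congrArg₂ HMul.hMul d11 d22
  have k' := congrArg₂ HMul.hMul d12 d21
  have : I * I * (I * I) = 0 := by
    linear_combination (a * d - b * c) * h0 - I * I * k
      + I * I * k'
  simp at this

variable (hT10 : IsCRStructure T10) (hθ : IsContactForm T10 θ) (hG : SmSF G U)

section

include hθ hG

lemma SmSF.ec (α : Fin 2) : SmoothOn (_root_.ec G α) U := by
  fin_cases α; exacts [hG.cf1 hθ, hG.cf2 hθ]

lemma SmSF.eb (α : Fin 2) : SmoothOn (_root_.eb G α) U := (SmSF.ec hθ hG α).conjF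

omit hθ in
lemma SmSF.zc (α : Fin 2) : SmCV (_root_.zc G α) U := by fin_cases α; exacts [hG.Z1, hG.Z2]

omit hθ in
lemma SmSF.zb (α : Fin 2) : SmCV (_root_.zb G α) U := (hG.zc α).conjC

lemma SmSF.hh (α β : Fin 2) : SmFn (_root_.hh G α β) U :=
  (smFn_const _ _).mul ((hG.zc α).smFn_e2 (hG.zb β) ((hθ.smooth.mono U.subset_univ).d1 hG.isOpen))

lemma SmSF.hD : SmFn (_root_.hD G) U :=
  ((SmSF.hh hθ hG 0 0).mul (SmSF.hh hθ hG 1 1)).sub ((SmSF.hh hθ hG 0 1).mul (SmSF.hh hθ hG 1 0))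

lemma SmSF.qq (α μ σ : Fin 2) : SmFn (_root_.qq G α μ σ) U :=
  (hG.zc μ).smFn_e2 (hG.zb σ) ((SmSF.ec hθ hG α).d1 hG.isOpen)

lemma SmSF.rr (α μ : Fin 2) : SmFn (_root_.rr G α μ) U :=
  (hG.zc μ).smFn_e2 hG.T ((SmSF.ec hθ hG α).d1 hG.isOpen)

lemma SmSF.xx (α β ρ : Fin 2) : SmFn (_root_.xx G α β ρ) U :=
  ((hG.zc ρ).smFn_e1 ((SmSF.hh hθ hG α β).dFn hG.isOpen)).sub
    (((SmSF.hh hθ hG α 0).mul (SmSF.qq hθ hG 0 β ρ).conj).add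
      ((SmSF.hh hθ hG α 1).mul (SmSF.qq hθ hG 1 β ρ).conj))

lemma SmSF.pp (γ α ρ : Fin 2) : SmFn (_root_.pp G γ α ρ) U := by
  have h := SmSF.hh hθ hG
  have X := SmSF.xx hθ hG
  fin_cases γ
  · exact (((h 1 1).mul (X α 0 ρ)).sub ((h 1 0).mul (X α 1 ρ))).div (SmSF.hD hθ hG)
      fun y _ => hD_ne_zero
  · exact (((h 0 0).mul (X α 1 ρ)).sub ((h 0 1).mul (X α 0 ρ))).div (SmSF.hD hθ hG)
      fun y _ => hD_ne_zero

lemma SmSF.cn (μ α : Fin 2) : SmoothOn (_root_.cn G μ α) U :=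
  ((((SmSF.eb hθ hG 0).fsmul (SmSF.qq hθ hG α μ 0)).add
    ((SmSF.eb hθ hG 1).fsmul (SmSF.qq hθ hG α μ 1))).add
    (((SmSF.ec hθ hG 0).fsmul (SmSF.pp hθ hG α μ 0)).add
      ((SmSF.ec hθ hG 1).fsmul (SmSF.pp hθ hG α μ 1)))).add
    ((hθ.smooth.mono U.subset_univ).fsmul (SmSF.rr hθ hG α μ))

end

lemma cn_zc (μ α ρ : Fin 2) : e1 (cn G μ α) x (zc G ρ x) = pp G α μ ρ x := by
  simp only [cn, e1_add, e1_fsmul, eb_zc, ec_zc, (G x).t_Z (zc_mem ρ x)]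
  fin_cases ρ <;> simp

lemma cn_zb (μ α ρ : Fin 2) : e1 (cn G μ α) x (zb G ρ x) = qq G α μ ρ x := by
  simp only [cn, e1_add, e1_fsmul, eb_zb, ec_zb, (G x).t_W (zb_mem ρ x)]
  fin_cases ρ <;> simp

lemma cn_T (hθ : IsContactForm T10 θ) (μ α : Fin 2) : e1 (cn G μ α) x (G x).T = rr G α μ x := by
  simp only [cn, e1_add, e1_fsmul, eb_T hθ, ec_T, (G x).tT]; ring

lemma xx_eq (α β ρ : Fin 2) :
    hh G 0 β x * pp G 0 α ρ x + hh G 1 β x * pp G 1 α ρ x = xx G α β ρ x := by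
  have h0 : hD G x ≠ 0 := hD_ne_zero
  have e0 : pp G 0 α ρ x = (hh G 1 1 x * xx G α 0 ρ x - hh G 1 0 x * xx G α 1 ρ x) / hD G x := rfl
  have e1 : pp G 1 α ρ x = (hh G 0 0 x * xx G α 1 ρ x - hh G 0 1 x * xx G α 0 ρ x) / hD G x := rfl
  rw [e0, e1]
  field_simp
  rw [hD]
  fin_cases β <;> simp <;> ring

/-- The torsion coefficients of an adapted frame. -/
def tt (G : ∀ y, SF T10 θ y) (α β : Fin 2) (y : M) : ℂ := e2 (d1 (ec G α)) y (G y).T (zb G β y)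

lemma ext1_zc {α β : Ω 1} (hT : e1 α x (G x).T = e1 β x (G x).T)
    (hz : ∀ μ, e1 α x (zc G μ x) = e1 β x (zc G μ x))
    (hb : ∀ μ, e1 α x (zb G μ x) = e1 β x (zb G μ x)) : α x = β x :=
  (G x).ext1_conj hT (hz 0) (hz 1) (hb 0) (hb 1)

lemma ext2_zc {α β : Ω 2} (hT : ∀ μ, e2 α x (G x).T (zc G μ x) = e2 β x (G x).T (zc G μ x))
    (hTb : ∀ μ, e2 α x (G x).T (zb G μ x) = e2 β x (G x).T (zb G μ x))
    (hz : e2 α x (zc G 0 x) (zc G 1 x) = e2 β x (zc G 0 x) (zc G 1 x))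
    (hm : ∀ μ σ, e2 α x (zc G μ x) (zb G σ x) = e2 β x (zc G μ x) (zb G σ x))
    (hb : e2 α x (zb G 0 x) (zb G 1 x) = e2 β x (zb G 0 x) (zb G 1 x)) : α x = β x :=
  (G x).ext2_conj (hT 0) (hT 1) (hTb 0) (hTb 1) hz (hm 0 0) (hm 0 1) (hm 1 0) (hm 1 1) hb

/-- `h_{αβ̄} θ^α ∧ θ^{β̄}` -/
def leviTerm (G : ∀ y, SF T10 θ y) (α β : Fin 2) : Ω 2 := fsmul (hh G α β) (w11 (ec G α) (eb G β))

lemma e2_leviTerm (α β : Fin 2) (u v : ℂT x) : e2 (leviTerm G α β) x u v =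
    hh G α β x * (e1 (ec G α) x u * e1 (eb G β) x v - e1 (eb G β) x u * e1 (ec G α) x v) := by
  rw [leviTerm, e2_fsmul, e2_w11]

include hT10 hθ

lemma levi_zc : d1 θ x = (I • (leviTerm G 0 0 + leviTerm G 0 1
    + (leviTerm G 1 0 + leviTerm G 1 1))) x := by
  apply ext2_zc (G := G)
  · intro μ; simp only [e2_smul, e2_add, e2_leviTerm, (G x).dT, eb_T hθ, ec_T]; ring
  · intro μ; simp only [e2_smul, e2_add, e2_leviTerm, (G x).dT, eb_T hθ, ec_T]; ring
  · rw [hθ.e2_T10 hT10 (zc_mem 0 x) (zc_mem 1 x)]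
    simp only [e2_smul, e2_add, e2_leviTerm, eb_zc]; ring
  · intro μ σ
    rw [e2_zc_zb]
    simp only [e2_smul, e2_add, e2_leviTerm, eb_zc, eb_zb, ec_zc]
    fin_cases μ <;> fin_cases σ <;> simp
  · rw [hθ.e2_T01 hT10 (zb_mem 0 x) (zb_mem 1 x)]
    simp only [e2_smul, e2_add, e2_leviTerm, ec_zb]; ring

include hG

lemma e3_d2_leviTerm (hx : x ∈ U) (α β : Fin 2) (u v w : ℂT x) : e3 (d2 (leviTerm G α β)) x u v w =
      e3 (w12 (dFn (hh G α β)) (w11 (ec G α) (eb G β))) x u v w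
      + hh G α β x * (e3 (w12 (eb G β) (d1 (ec G α))) x u v w
        - e3 (w12 (ec G α) (d1 (eb G β))) x u v w) := by
  have e : d2 (leviTerm G α β) x = (w12 (dFn (hh G α β)) (w11 (ec G α) (eb G β))
      + fsmul (hh G α β) (w12 (eb G β) (d1 (ec G α)) - w12 (ec G α) (d1 (eb G β)))) x := by
    have c := SmSF.ec hθ hG α
    have b := SmSF.eb hθ hG β
    rw [leviTerm, d2_fsmul hG.isOpen hx (SmSF.hh hθ hG α β) (c.w11 b), d2_w11 hG.isOpen hx c b]
    rfl
  rw [e3_congr e, e3_add, e3_fsmul, e3_sub]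

lemma d2_levi (hx : x ∈ U) (u v w : ℂT x) :
    e3 (d2 (leviTerm G 0 0)) x u v w + e3 (d2 (leviTerm G 0 1)) x u v w
      + (e3 (d2 (leviTerm G 1 0)) x u v w + e3 (d2 (leviTerm G 1 1)) x u v w) = 0 := by
  have hU := hG.isOpen
  have s : ∀ α β, SmoothOn (leviTerm G α β) U := fun α β =>
    ((SmSF.ec hθ hG α).w11 (SmSF.eb hθ hG β)).fsmul (SmSF.hh hθ hG α β)
  have k := d2_d1 hU hx (hθ.smooth.mono U.subset_univ)
  rw [d2, extD_congr hU (fun y _ => levi_zc hT10 hθ (G := G) (x := y)) hx,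
    extD_const_smul hU hx _ (((s 0 0).add (s 0 1)).add ((s 1 0).add (s 1 1))),
    extD_add hU hx ((s 0 0).add (s 0 1)) ((s 1 0).add (s 1 1)), extD_add hU hx (s 0 0) (s 0 1),
    extD_add hU hx (s 1 0) (s 1 1)] at k
  have k' : (I • (d2 (leviTerm G 0 0) + d2 (leviTerm G 0 1)
    + (d2 (leviTerm G 1 0) + d2 (leviTerm G 1 1)))) x = (0 : Ω 3) x := k
  have := e3_congr k' u v w
  simp only [e3_smul, e3_add, e3_zero] at this
  exact (mul_eq_zero.1 this).resolve_left I_ne_zero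

lemma d1_eb_eval (hx : x ∈ U) (β : Fin 2) (u v : ℂT x) :
    e2 (d1 (eb G β)) x u v = cj (e2 (d1 (ec G β)) x (conjC u) (conjC v)) := by
  have e : d1 (eb G β) x = conjF (d1 (ec G β)) x := extD_conjF hG.isOpen hx (SmSF.ec hθ hG β)
  rw [e2_congr e, e2_conjF]

lemma d1_eb_T_zb (hx : x ∈ U) (β σ : Fin 2) :
    e2 (d1 (eb G β)) x (G x).T (zb G σ x) = -cj (rr G β σ x) := by
  rw [d1_eb_eval hT10 hθ hG hx, (G x).conjT hθ, zb, conjC_conjC, e2_swap, map_neg, rr]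

lemma d1_eb_zc_zb (hx : x ∈ U) (β ρ σ : Fin 2) :
    e2 (d1 (eb G β)) x (zc G ρ x) (zb G σ x) = -cj (qq G β σ ρ x) := by
  rw [d1_eb_eval hT10 hθ hG hx, zb, conjC_conjC, e2_swap, map_neg, qq, zb]

lemma d1_ec_zb_zb (hx : x ∈ U) (α : Fin 2) : e2 (d1 (ec G α)) x (zb G 0 x) (zb G 1 x) = 0 := by
  fin_cases α
  · exact d1_cf1_WW hT10 hθ hG hx (zb_mem 0 x) (zb_mem 1 x)
  · exact d1_cf2_WW hT10 hθ hG hx (zb_mem 0 x) (zb_mem 1 x)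

lemma metric_T (hx : x ∈ U) (α β : Fin 2) : e1 (dFn (hh G α β)) x (G x).T =
    hh G 0 β x * rr G 0 α x + hh G 1 β x * rr G 1 α x
      + (hh G α 0 x * cj (rr G 0 β x) + hh G α 1 x * cj (rr G 1 β x)) := by
  have k := d2_levi hT10 hθ hG hx (G x).T (zc G α x) (zb G β x)
  have r : ∀ γ, e2 (d1 (ec G γ)) x (G x).T (zc G α x) = -rr G γ α x := fun γ => by rw [rr, e2_swap]
  simp only [e3_d2_leviTerm hT10 hθ hG hx, e3_w12, e2_w11, eb_T hθ, ec_T, eb_zc, eb_zb, ec_zc, ec_zb,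
    d1_eb_T_zb hT10 hθ hG hx, r] at k
  fin_cases α <;> fin_cases β <;> simp at k ⊢ <;> linear_combination k

lemma tt_symm (hx : x ∈ U) : tt G 0 0 x * hh G 0 1 x + tt G 1 0 x * hh G 1 1 x
    = tt G 0 1 x * hh G 0 0 x + tt G 1 1 x * hh G 1 0 x := by
  have k := d2_levi hT10 hθ hG hx (G x).T (zb G 0 x) (zb G 1 x)
  simp only [e3_d2_leviTerm hT10 hθ hG hx, e3_w12, e2_w11, eb_T hθ, ec_T, eb_zb, ec_zb] at k
  simp only [tt]
  simp at k
  linear_combination k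

lemma d1_ec_zc (hx : x ∈ U) (α : Fin 2) :
    e2 (d1 (ec G α)) x (zc G 0 x) (zc G 1 x) = pp G α 0 1 x - pp G α 1 0 x := by
  have key : ∀ β, hh G 0 β x * (e2 (d1 (ec G 0)) x (zc G 0 x) (zc G 1 x) - pp G 0 0 1 x
      + pp G 0 1 0 x) + hh G 1 β x * (e2 (d1 (ec G 1)) x (zc G 0 x) (zc G 1 x) - pp G 1 0 1 x
      + pp G 1 1 0 x) = 0 := fun β => by
    have k := d2_levi hT10 hθ hG hx (zc G 0 x) (zc G 1 x) (zb G β x)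
    have x0 := xx_eq (G := G) (x := x) 0 β 1
    have x1 := xx_eq (G := G) (x := x) 1 β 0
    rw [xx] at x0 x1
    simp only [e3_d2_leviTerm hT10 hθ hG hx, e3_w12, e2_w11, eb_zc, eb_zb, ec_zc, ec_zb,
      d1_eb_zc_zb hT10 hθ hG hx] at k
    fin_cases β <;> simp at k x0 x1 ⊢ <;> linear_combination k - x0 + x1
  have k0 := key 0
  have k1 := key 1
  have h0 : hD G x ≠ 0 := hD_ne_zero
  have e0 : hD G x * (e2 (d1 (ec G 0)) x (zc G 0 x) (zc G 1 x) - pp G 0 0 1 x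
      + pp G 0 1 0 x) = 0 := by
    rw [hD]; linear_combination hh G 1 1 x * k0 - hh G 1 0 x * k1
  have e1 : hD G x * (e2 (d1 (ec G 1)) x (zc G 0 x) (zc G 1 x) - pp G 1 0 1 x
      + pp G 1 1 0 x) = 0 := by
    rw [hD]; linear_combination hh G 0 0 x * k1 - hh G 0 1 x * k0
  fin_cases α
  · have : e2 (d1 (ec G 0)) x (zc G 0 x) (zc G 1 x) = pp G 0 0 1 x - pp G 0 1 0 x := by
      linear_combination (mul_eq_zero.1 e0).resolve_left h0
    exact this
  · have : e2 (d1 (ec G 1)) x (zc G 0 x) (zc G 1 x) = pp G 1 0 1 x - pp G 1 1 0 x := by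
      linear_combination (mul_eq_zero.1 e1).resolve_left h0
    exact this

lemma structure_ec (hx : x ∈ U) (α : Fin 2) : d1 (ec G α) x =
    (w11 (ec G 0) (cn G 0 α) + w11 (ec G 1) (cn G 1 α)
      + (fsmul (tt G α 0) (w11 θ (eb G 0)) + fsmul (tt G α 1) (w11 θ (eb G 1)))) x := by
  have tz := fun μ => (G x).t_Z (zc_mem (G := G) μ x)
  have tb := fun μ => (G x).t_W (zb_mem (G := G) μ x)
  apply ext2_zc (G := G)
  · intro μ
    have r : e2 (d1 (ec G α)) x (G x).T (zc G μ x) = -rr G α μ x := by rw [rr, e2_swap]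
    rw [r]
    simp only [e2_add, e2_fsmul, e2_w11, ec_T, eb_T hθ, eb_zc, ec_zc, tz, cn_T hθ]
    fin_cases μ <;> simp
  · intro μ
    simp only [e2_add, e2_fsmul, e2_w11, ec_T, eb_T hθ, eb_zb, ec_zb, tb, (G x).tT]
    fin_cases μ <;> simp <;> rfl
  · rw [d1_ec_zc hT10 hθ hG hx]
    simp only [e2_add, e2_fsmul, e2_w11, eb_zc, ec_zc, tz, cn_zc]
    simp; ring
  · intro μ σ
    simp only [e2_add, e2_fsmul, e2_w11, eb_zc, ec_zc, ec_zb, tz, tb, cn_zb]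
    fin_cases μ <;> simp <;> rfl
  · rw [d1_ec_zb_zb hT10 hθ hG hx]
    simp only [e2_add, e2_fsmul, e2_w11, ec_zb, tb]; ring

lemma metric_hh (hx : x ∈ U) (α β : Fin 2) : dFn (hh G α β) x =
    (fsmul (hh G 0 β) (cn G α 0) + fsmul (hh G 1 β) (cn G α 1)
      + (fsmul (hh G α 0) (conjF (cn G β 0)) + fsmul (hh G α 1) (conjF (cn G β 1)))) x := by
  have hz : ∀ α β μ : Fin 2, e1 (dFn (hh G α β)) x (zc G μ x) =
      hh G 0 β x * pp G 0 α μ x + hh G 1 β x * pp G 1 α μ x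
      + (hh G α 0 x * cj (qq G 0 β μ x) + hh G α 1 x * cj (qq G 1 β μ x)) :=
    fun α β μ => by rw [xx_eq, xx]; ring
  have hb : ∀ α β μ : Fin 2, e1 (dFn (hh G α β)) x (zb G μ x) =
      cj (e1 (dFn (hh G β α)) x (zc G μ x)) := fun α β μ => by
    have e : dFn (hh G α β) x = conjF (dFn (hh G β α)) x := by
      rw [← dFn_conj hG.isOpen hx (SmSF.hh hθ hG β α)]
      exact dFn_congr hG.isOpen hx fun y _ => (hh_conj hθ β α).symm
    rw [e1_congr e, e1_conjF, zb, conjC_conjC]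
  apply ext1_zc (G := G)
  · simp only [e1_add, e1_fsmul, e1_conjF, (G x).conjT hθ, cn_T hθ, metric_T hT10 hθ hG hx]
  · intro μ
    rw [hz]
    simp only [e1_add, e1_fsmul, e1_conjF, cn_zc]
    simp only [show conjC (zc G μ x) = zb G μ x from rfl, cn_zb]
  · intro μ
    rw [hb, hz]
    simp only [e1_add, e1_fsmul, e1_conjF, cn_zb, map_add, map_mul, conj_conj, hh_conj hθ]
    simp only [show conjC (zb G μ x) = zc G μ x from conjC_conjC _, cn_zc]
    ring

/-- The admissible coframe of an adapted frame. -/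
def admissibleOf : AdmissibleCoframe T10 θ U where
  coframe := ec G
  frame := zc G
  h y := Matrix.of fun α β => hh G α β y
  conn := cn G
  tor y := Matrix.of fun α β => tt G α β y
  isOpen := hG.isOpen
  coframe_smooth := SmSF.ec hθ hG
  conn_smooth := SmSF.cn hθ hG
  coframe_conj α x _ Z hZ := ec_W α (by rwa [conjC_conjC])
  coframe_reeb α x _ v hv := by
    have e : (1 : ℂ) ⊗ₜ[ℝ] v = (G x).T := by
      refine (G x).eq_T (by rw [e1_real]; exact hv.1) fun w => ?_
      induction w using TensorProduct.induction_on with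
      | zero => exact e2_zero_right _ _
      | tmul c w =>
        rw [show c ⊗ₜ[ℝ] w = c • ((1 : ℂ) ⊗ₜ[ℝ] w) by rw [TensorProduct.smul_tmul', smul_eq_mul,
          mul_one], e2_smul_right, e2_real]
        exact mul_eq_zero_of_right _ (hv.2 w)
      | add a b ha hb => rw [e2_add_right, ha, hb, add_zero]
    have := ec_T (G := G) (x := x) α
    rwa [← e, e1_real] at this
  frame_mem α x _ := zc_mem α x
  frame_dual α β x _ := ec_zc α β
  levi x hx := by
    have := levi_zc hT10 hθ (G := G) (x := x)
    rw [← d1, this]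
    simp only [Fin.sum_univ_two]
    change I • (hh G 0 0 x • w11 (ec G 0) (eb G 0) x
        + hh G 0 1 x • w11 (ec G 0) (eb G 1) x + (hh G 1 0 x • w11 (ec G 1) (eb G 0) x
        + hh G 1 1 x • w11 (ec G 1) (eb G 1) x))
      = (I * hh G 0 0 x) • w11 (ec G 0) (eb G 0) x
        + (I * hh G 0 1 x) • w11 (ec G 0) (eb G 1) x
        + ((I * hh G 1 0 x) • w11 (ec G 1) (eb G 0) x
        + (I * hh G 1 1 x) • w11 (ec G 1) (eb G 1) x)
    simp only [smul_add, smul_smul]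
  structure_eq α x hx := by
    have := structure_ec hT10 hθ hG hx α
    rw [← d1, this]
    simp only [Fin.sum_univ_two]
    rfl
  metric α β x hx := by
    have := metric_hh hT10 hθ hG hx α β
    simp only [Fin.sum_univ_two]
    exact this
  tor_symm β γ x hx := by
    have := tt_symm hT10 hθ hG hx
    simp only [Fin.sum_univ_two, Matrix.of_apply]
    fin_cases β <;> fin_cases γ
    · rfl
    · exact this
    · exact this.symm
    · rfl

end

section

variable (hT10 : IsCRStructure T10) (hθ : IsContactForm T10 θ)

lemma d1_vpi_frame (hT10 : IsCRStructure T10) (hθ : IsContactForm T10 θ)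
    {G H : ∀ y, SF T10 θ y} {U V : Set M} (hG : SmSF G U) (hH : SmSF H V)
    (hx : x ∈ U) (hx' : x ∈ V) : d1 (vpi G) x = d1 (vpi H) x := by
  have hU := hG.mono (hG.isOpen.inter hH.isOpen) inter_subset_left
  have hV := hH.mono (hG.isOpen.inter hH.isOpen) inter_subset_right
  rw [← (admissibleOf hT10 hθ hU).d1_vpt_eq hT10 hθ hU subset_rfl ⟨hx, hx'⟩,
    (admissibleOf hT10 hθ hU).d1_vpt_eq hT10 hθ hV subset_rfl ⟨hx, hx'⟩]

lemma exists_smSF (hT10 : IsCRStructure T10) (hθ : IsContactForm T10 θ) (x : M) :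
    ∃ G : ∀ y, SF T10 θ y, ∃ U : Set M, x ∈ U ∧ SmSF G U := by
  obtain ⟨U, hx, G, h⟩ := exists_local_frame hT10 hθ x
  exact ⟨G, U, hx, h⟩

/-- The exterior derivative of the trace of the Tanaka--Webster connection. -/
def ricF (hT10 : IsCRStructure T10) (hθ : IsContactForm T10 θ) : Ω 2 :=
  fun x => d1 (vpi (exists_smSF hT10 hθ x).choose) x

lemma ricF_eq {G : ∀ y, SF T10 θ y} (hG : SmSF G U) (hx : x ∈ U) :
    ricF hT10 hθ x = d1 (vpi G) x := by
  obtain ⟨V, hxV, hV⟩ := (exists_smSF hT10 hθ x).choose_spec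
  exact d1_vpi_frame hT10 hθ hV hG hxV hx

lemma smoothOn_ricF : SmoothOn (ricF hT10 hθ) univ :=
  smoothOn_of_frames hT10 hθ isOpen_univ fun G W hG _ =>
    ((SmSF.vpi hθ hG).d1 hG.isOpen).congr fun y hy => ricF_eq hT10 hθ hG hy

lemma AdmissibleCoframe.d1_vpt_eq_ricF (A : AdmissibleCoframe T10 θ U) (hx : x ∈ U) :
    d1 A.vpt x = ricF hT10 hθ x := by
  obtain ⟨G, V, hxV, hG⟩ := exists_smSF hT10 hθ x
  have hG' := hG.mono (hG.isOpen.inter A.isOpen) inter_subset_left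
  rw [A.d1_vpt_eq hT10 hθ hG' inter_subset_right ⟨hxV, hx⟩, ricF_eq hT10 hθ hG hxV]

variable (F : ∀ y, SF T10 θ y)

lemma tr2_congr {X Y : Ω 2} (h : X x = Y x) : tr2 F X x = tr2 F Y x := by
  rw [tr2, tr2, e2_congr h, e2_congr h]

lemma scalarCurvature_eq : scalarCurvature T10 θ = tr2 F (ricF hT10 hθ) := by
  have h : ∀ (U : Set M) (A : AdmissibleCoframe T10 θ U), ∀ x ∈ U,
      A.scal x = tr2 F (ricF hT10 hθ) x := fun U A x hx => by
    rw [A.scal_eq hT10 hθ hx F, tr2_congr F (A.d1_vpt_eq_ricF hT10 hθ hx)]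
  refine theUnique_eq (fun U A x hx => (h U A x hx).symm) fun R hR => funext fun x => ?_
  obtain ⟨G, V, hxV, hG⟩ := exists_smSF hT10 hθ x
  rw [hR V (admissibleOf hT10 hθ hG) x hxV, h V (admissibleOf hT10 hθ hG) x hxV]

include hT10 hθ in
lemma smFn_scalarCurvature : SmFn (scalarCurvature T10 θ) univ := by
  have F : ∀ y, SF T10 θ y := fun y => (exists_SF hT10 hθ y).some
  rw [scalarCurvature_eq hT10 hθ F]
  exact smFn_tr2 hT10 hθ F isOpen_univ (smoothOn_ricF hT10 hθ)

lemma Q21_congr_form {a b : Ω 3} (h : a x = b x) : Q21 F a x = Q21 F b x :=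
  Q21_congr F fun _ _ _ _ => e3_congr h _ _ _

lemma w12_congr {α : Ω 1} {a b : Ω 2} (h : a x = b x) : w12 α a x = w12 α b x := by
  change wedgeAt _ _ = wedgeAt _ _
  rw [h]

lemma leeForm_spec : leeForm T10 θ ∈ RSpace T10 θ 2 1 1 ∧
    w12 θ (leeForm T10 θ) = (-I / 4) • Q21 F (w12 θ (ricF hT10 hθ)) := by
  have h : ∀ (U : Set M) (A : AdmissibleCoframe T10 θ U), ∀ x ∈ U,
      w12 θ A.leeH x = ((-I / 4) • Q21 F (w12 θ (ricF hT10 hθ))) x := fun U A x hx => by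
    rw [A.leeH_eq hT10 hθ hx F, Q21_congr_form F (w12_congr (A.d1_vpt_eq_ricF hT10 hθ hx))]
    rfl
  have s0 := hθ.smooth.w12 (smoothOn_ricF hT10 hθ)
  have h0 : w13 θ (w12 θ (ricF hT10 hθ)) = 0 := funext fun x => w13_theta_w12 (F x) _
  have h0' : w13 θ (Q21 F (w12 θ (ricF hT10 hθ))) = 0 := funext fun x => w13_theta_Q21 F _
  obtain ⟨-, s1, r1, b1⟩ := Q21_mem hT10 hθ F s0 h0
  obtain ⟨m1, m2⟩ := isRumin_three.1 r1
  set ν := Q21 F (w12 θ (ricF hT10 hθ))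
  have z3 : w13 θ ((-I / 4) • ν) = 0 := by rw [w13_smul F, m1]; ext x v; exact mul_zero _
  have z4 : w14 θ (d3 ((-I / 4) • ν)) = 0 := by
    rw [d3_smul _ s1]
    funext x
    change _ = (0 : Ω 5) x
    have := (w14_theta_eq_zero (F x)).1 (congrFun m2 x)
    apply (F x).ext5
    rw [e5_w14_theta, e4_smul, this, mul_zero, e5_zero]
  obtain ⟨σ, sσ, rσ, hσ⟩ := exists_rumin_two hT10 hθ F (s1.const_smul (-I / 4)) z3 z4
  have bσ : HasBidegree T10 1 σ := by
    rw [hasBidegree_two_iff hθ F, hσ, hasBidegree_three_iff hθ F z3]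
    rw [hasBidegree_three_iff hθ F m1] at b1
    intro x
    obtain ⟨c1, c2, c3⟩ := b1 x
    refine ⟨fun hp Z hZ Z' hZ' => ?_, fun hp => absurd rfl hp, fun hp W hW W' hW' => ?_⟩
    · rw [e3_smul, c1 hp Z hZ Z' hZ', mul_zero]
    · rw [e3_smul, c3 hp W hW W' hW', mul_zero]
  have key : leeForm T10 θ = σ := by
    refine theUnique_eq ⟨⟨rfl, sσ, rσ, bσ⟩, fun U A x hx => ?_⟩ fun σ' h' => ?_
    · have := h U A x hx
      rw [← hσ] at this
      exact this.symm
    · obtain ⟨⟨-, sσ', rσ', -⟩, hA⟩ := h'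
      have e : w12 θ σ' = w12 θ σ := funext fun x => by
        obtain ⟨G, V, hxV, hG⟩ := exists_smSF hT10 hθ x
        rw [hσ, ← h V (admissibleOf hT10 hθ hG) x hxV]
        exact hA V (admissibleOf hT10 hθ hG) x hxV
      refine sub_eq_zero.1 (rumin_two_eq_zero hθ F (sσ'.sub sσ) ?_ ?_)
      · rw [d2_sub sσ' sσ, w13_sub F, (isRumin_two.1 rσ').2, (isRumin_two.1 rσ).2, sub_zero]
      · rw [w12_sub F, e, sub_self]
  rw [key]
  exact ⟨⟨rfl, sσ, rσ, bσ⟩, hσ⟩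

end

section

/-- The exponential of a function, as a complex-valued function. -/
def eY (f : M → ℝ) (x : M) : ℂ := (Real.exp (f x) : ℂ)
/-- The differential of a real function. -/
def dY (f : M → ℝ) : Ω 1 := dFn fun x => (f x : ℂ)

lemma eY_ne_zero : eY f x ≠ 0 := Complex.ofReal_ne_zero.2 (Real.exp_pos _).ne'

variable (hf : ContMDiff 𝓔 𝓘(ℝ, ℝ) (⊤ : ℕ∞) f)

include hf

lemma smoothOn_dY (U : Set M) : SmoothOn (dY f) U :=
  ((smFn_of_contMDiff hf).dFn isOpen_univ).mono U.subset_univ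

lemma smFn_eY (U : Set M) : SmFn (eY f) U :=
  ((smFn_of_contMDiff hf).cexp.congr fun x _ => by simp [eY]).mono U.subset_univ

lemma dFn_eY : dFn (eY f) = fsmul (eY f) (dY f) := by
  funext x
  have := dFn_cexp isOpen_univ (mem_univ x) (smFn_of_contMDiff hf)
  have e : (fun y => Complex.exp (f y : ℂ)) = eY f := by funext y; simp [eY]
  rw [e] at this
  rw [this]
  change _ = eY f x • dY f x
  rw [← e]
  rfl

lemma d1_dY : d1 (dY f) = 0 := d1_dFn_univ (smFn_of_contMDiff hf)

lemma e1_dY_conj (a : ℂT x) : e1 (dY f) x (conjC a) = cj (e1 (dY f) x a) := by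
  have h : conjF (dY f) x = dY f x := by
    rw [dY, ← dFn_conj isOpen_univ (mem_univ x) (smFn_of_contMDiff hf)]
    simp
  rw [← e1_congr h, e1_conjF, conjC_conjC]

lemma e2_d1_hat (hθ : IsContactForm T10 θ) (a b : ℂT x) :
    e2 (d1 (rescale f θ)) x a b = eY f x * (e1 (dY f) x a * e1 θ x b - e1 θ x a * e1 (dY f) x b
      + e2 (d1 θ) x a b) := by
  have := e2_d1_fsmul isOpen_univ (mem_univ x) (smFn_eY hf _) hθ.smooth a b
  rw [dFn_eY hf] at this
  simp only [e1_fsmul] at this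
  rw [show rescale f θ = fsmul (eY f) θ from rfl, this]; ring

lemma IsContactForm.rescale (hθ : IsContactForm T10 θ) : IsContactForm T10 (rescale f θ) where
  smooth := hθ.smooth.fsmul (smFn_eY hf _)
  real := by
    funext x
    ext v
    have := congrArg (fun ω : Ω 1 => ω x v) hθ.real
    change cj (eY f x * θ x v) = eY f x * θ x v
    rw [map_mul, show cj (θ x v) = θ x v from this, eY, Complex.conj_ofReal]
  ker x v := by
    rw [← hθ.ker x v]
    change eY f x * θ x ![v] = 0 ↔ _
    rw [mul_eq_zero]
    exact or_iff_right eY_ne_zero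

/-- The adapted frame of a rescaled contact form. -/
def hatSF (hθ : IsContactForm T10 θ) (G : SF T10 θ x) : SF T10 (rescale f θ) x where
  T := (eY f x)⁻¹ • (G.T + ((-I * e1 (dY f) x G.W1) • G.Z1
    + (-I * e1 (dY f) x G.W2) • G.Z2 + (I * e1 (dY f) x G.Z1) • G.W1
    + (I * e1 (dY f) x G.Z2) • G.W2))
  Z1 := G.Z1
  Z2 := G.Z2
  W1 := (eY f x)⁻¹ • G.W1
  W2 := (eY f x)⁻¹ • G.W2
  mZ1 := G.mZ1
  mZ2 := G.mZ2
  mW1 := by rw [conjC_smul]; exact (T10 x).smul_mem _ G.mW1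
  mW2 := by rw [conjC_smul]; exact (T10 x).smul_mem _ G.mW2
  spanZ := G.spanZ
  tT := by
    rw [rescale, e1_fsmul]
    simp only [e1_smul_vec, e1_add_vec, SF.tT, SF.tZ1, SF.tZ2, SF.tW1, SF.tW2]
    change eY f x * _ = 1
    rw [← mul_assoc, mul_inv_cancel₀ eY_ne_zero]; ring
  tZ1 := by rw [rescale, e1_fsmul, G.tZ1, mul_zero]
  tZ2 := by rw [rescale, e1_fsmul, G.tZ2, mul_zero]
  tW1 := by rw [rescale, e1_fsmul, e1_smul_vec, G.tW1, mul_zero, mul_zero]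
  tW2 := by rw [rescale, e1_fsmul, e1_smul_vec, G.tW2, mul_zero, mul_zero]
  dTZ1 := by
    rw [e2_d1_hat hf hθ]
    simp only [e1_smul_vec, e1_add_vec, e2_smul_left, e2_add_left, SF.tT, SF.tZ1, SF.tZ2, SF.tW1,
      SF.tW2, SF.dTZ1, e2_self, SF.dZZ', SF.d11', SF.d12']
    linear_combination (-eY f x * (eY f x)⁻¹ * e1 (dY f) x G.Z1) * I_mul_I
  dTZ2 := by
    rw [e2_d1_hat hf hθ]
    simp only [e1_smul_vec, e1_add_vec, e2_smul_left, e2_add_left, SF.tT, SF.tZ1, SF.tZ2, SF.tW1,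
      SF.tW2, SF.dTZ2, e2_self, SF.dZZ, SF.d21', SF.d22']
    linear_combination (-eY f x * (eY f x)⁻¹ * e1 (dY f) x G.Z2) * I_mul_I
  dTW1 := by
    rw [e2_d1_hat hf hθ]
    simp only [e1_smul_vec, e1_add_vec, e2_smul_left, e2_smul_right, e2_add_left, SF.tT, SF.tZ1,
      SF.tZ2, SF.tW1, SF.tW2, SF.dTW1, e2_self, SF.dWW', SF.d11, SF.d21]
    linear_combination (-eY f x * (eY f x)⁻¹ * (eY f x)⁻¹ * e1 (dY f) x G.W1) * I_mul_I
  dTW2 := by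
    rw [e2_d1_hat hf hθ]
    simp only [e1_smul_vec, e1_add_vec, e2_smul_left, e2_smul_right, e2_add_left, SF.tT, SF.tZ1,
      SF.tZ2, SF.tW1, SF.tW2, SF.dTW2, e2_self, SF.dWW, SF.d12, SF.d22]
    linear_combination (-eY f x * (eY f x)⁻¹ * (eY f x)⁻¹ * e1 (dY f) x G.W2) * I_mul_I
  dZZ := by rw [e2_d1_hat hf hθ, G.tZ1, G.tZ2, G.dZZ]; ring
  dWW := by
    rw [e2_d1_hat hf hθ, e1_smul_vec, e1_smul_vec, e2_smul_left, e2_smul_right, e1_smul_vec,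
      e1_smul_vec, G.tW1, G.tW2, G.dWW]; ring
  d11 := by
    rw [e2_d1_hat hf hθ, e1_smul_vec, e2_smul_right, e1_smul_vec, G.tW1, G.tZ1, G.d11]
    field_simp [eY_ne_zero (f := f) (x := x)]; ring
  d12 := by rw [e2_d1_hat hf hθ, e1_smul_vec, e2_smul_right, e1_smul_vec, G.tW2, G.tZ1, G.d12]; ring
  d21 := by rw [e2_d1_hat hf hθ, e1_smul_vec, e2_smul_right, e1_smul_vec, G.tW1, G.tZ2, G.d21]; ring
  d22 := by
    rw [e2_d1_hat hf hθ, e1_smul_vec, e2_smul_right, e1_smul_vec, G.tW2, G.tZ2, G.d22]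
    field_simp [eY_ne_zero (f := f) (x := x)]; ring

/-- The adapted frames of a rescaled contact form. -/
def hatF (hθ : IsContactForm T10 θ) (F : ∀ y, SF T10 θ y) (y : M) : SF T10 (rescale f θ) y :=
  hatSF hf hθ (F y)

variable (hθ : IsContactForm T10 θ) {G : ∀ y, SF T10 θ y}

lemma smSF_hatF (hG : SmSF G U) : SmSF (hatF hf hθ G) U := by
  have s := smoothOn_dY hf U
  have e := (smFn_eY hf U).inv fun _ _ => eY_ne_zero
  have i : ∀ c : ℂ, SmFn (fun _ : M => c) U := fun c => smFn_const c U
  exact ⟨hG.isOpen, (hG.T.add ((((hG.Z1.smul ((i _).mul (hG.W1.smFn_e1 s))).add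
    (hG.Z2.smul ((i _).mul (hG.W2.smFn_e1 s)))).add (hG.W1.smul ((i _).mul (hG.Z1.smFn_e1 s)))).add
    (hG.W2.smul ((i _).mul (hG.Z2.smFn_e1 s))))).smul e, hG.Z1, hG.Z2, hG.W1.smul e, hG.W2.smul e⟩

lemma cf1_hat : cf1 (hatF hf hθ G) = cf1 G + fsmul (fun y => I * e1 (dY f) y (G y).W1) θ := by
  funext x
  have h0 := eY_ne_zero (f := f) (x := x)
  apply (G x).ext1 <;> simp only [cf1, hatF, hatSF, e1_add, e1_fsmul, e1_smul, e1_iot, e2_d1_hat hf hθ,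
    e2_smul_left, e1_smul_vec, SF.tT, SF.tZ1, SF.tZ2, SF.tW1, SF.tW2] <;> field_simp <;> ring

lemma cf2_hat : cf2 (hatF hf hθ G) = cf2 G + fsmul (fun y => I * e1 (dY f) y (G y).W2) θ := by
  funext x
  have h0 := eY_ne_zero (f := f) (x := x)
  apply (G x).ext1 <;> simp only [cf2, hatF, hatSF, e1_add, e1_fsmul, e1_smul, e1_iot, e2_d1_hat hf hθ,
    e2_smul_left, e1_smul_vec, SF.tT, SF.tZ1, SF.tZ2, SF.tW1, SF.tW2] <;> field_simp <;> ring

lemma cf3_hat : cf3 (hatF hf hθ G) =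
    fsmul (eY f) (cf3 G + fsmul (fun y => -I * e1 (dY f) y (G y).Z1) θ) := by
  funext x
  apply (G x).ext1 <;> simp only [cf3, hatF, hatSF, e1_add, e1_fsmul, e1_smul, e1_iot, e2_d1_hat hf hθ,
    SF.tT, SF.tZ1, SF.tZ2, SF.tW1, SF.tW2] <;> ring

lemma cf4_hat : cf4 (hatF hf hθ G) =
    fsmul (eY f) (cf4 G + fsmul (fun y => -I * e1 (dY f) y (G y).Z2) θ) := by
  funext x
  apply (G x).ext1 <;> simp only [cf4, hatF, hatSF, e1_add, e1_fsmul, e1_smul, e1_iot, e2_d1_hat hf hθ,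
    SF.tT, SF.tZ1, SF.tZ2, SF.tW1, SF.tW2] <;> ring

end

section

lemma d1_theta_eq (G : ∀ y, SF T10 θ y) :
    d1 θ x = (I • (w11 (cf1 G) (cf3 G) + w11 (cf2 G) (cf4 G))) x := by
  apply (G x).ext2 <;> simp only [e2_smul, e2_add, e2_w11, cf1_T, cf1_Z1, cf1_Z2, cf1_W1, cf1_W2,
    cf2_T, cf2_Z1, cf2_Z2, cf2_W1, cf2_W2, cf3_T, cf3_Z1, cf3_Z2, cf3_W1, cf3_W2, cf4_T, cf4_Z1,
    cf4_Z2, cf4_W1, cf4_W2, SF.dTZ1, SF.dTZ2, SF.dTW1, SF.dTW2, SF.dZZ, SF.dWW, SF.d11, SF.d12,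
    SF.d21, SF.d22] <;> ring

lemma e3_of_w13 (G : SF T10 θ x) {ν : Ω 3} (h : w13 θ ν x = 0) {u v w : ℂT x}
    (hu : e1 θ x u = 0) (hv : e1 θ x v = 0) (hw : e1 θ x w = 0) : e3 ν x u v w = 0 := by
  have := e4_congr (β := 0) h G.T u v w
  simpa [hu, hv, hw, e4_zero] using this

lemma e1_dFn_const_mul (hU : IsOpen U) (hx : x ∈ U) (c : ℂ) {a : M → ℂ}
    (ha : SmFn a U) (v : ℂT x) : e1 (dFn fun y => c * a y) x v = c * e1 (dFn a) x v := by
  have h : dFn (fun y => c * a y) x = (c • dFn a + fsmul a (dFn fun _ => c)) x :=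
    dFn_mul hU hx (smFn_const c U) ha
  rw [e1_congr h, e1_add, e1_smul, e1_fsmul, e1_congr (β := 0) (dFn_const c x), e1_zero, mul_zero,
    add_zero]

lemma e2_d1_add (hU : IsOpen U) (hx : x ∈ U) {α β : Ω 1} (hα : SmoothOn α U)
    (hβ : SmoothOn β U) (a b : ℂT x) :
    e2 (d1 (α + β)) x a b = e2 (d1 α) x a b + e2 (d1 β) x a b := by
  have h : d1 (α + β) x = (d1 α + d1 β) x := extD_add hU hx hα hβ
  rw [e2_congr h, e2_add]

lemma e3_d2_w11 (hU : IsOpen U) (hx : x ∈ U) {α β : Ω 1} (hα : SmoothOn α U)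
    (hβ : SmoothOn β U) (a b c : ℂT x) :
    e3 (d2 (w11 α β)) x a b c = e3 (w12 β (d1 α)) x a b c - e3 (w12 α (d1 β)) x a b c := by
  have h : d2 (w11 α β) x = (w12 β (d1 α) - w12 α (d1 β)) x := d2_w11 hU hx hα hβ
  rw [e3_congr h, e3_sub]

/-- Minus half the trace of `i dΥ''`, where `Υ''` is the `(0,1)`-part of `dΥ`. -/
def gF (F : ∀ y, SF T10 θ y) (f : M → ℝ) (y : M) : ℂ := I / 2 * tr2 F (d1 (P01 F (dY f))) y
/-- The squared length of `∂_b Υ`. -/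
def nF (F : ∀ y, SF T10 θ y) (f : M → ℝ) (y : M) : ℂ := tr2 F (w11 (P10 F (dY f)) (P01 F (dY f))) y
/-- The change of the trace of the Tanaka--Webster connection. -/
def nuF (F : ∀ y, SF T10 θ y) (f : M → ℝ) : Ω 1 :=
  (3 : ℂ) • P10 F (dY f) - P01 F (dY f) + fsmul (fun y => 2 * gF F f y + 3 * I * nF F f y) θ

variable (hT10 : IsCRStructure T10) (hθ : IsContactForm T10 θ)
  (hf : ContMDiff 𝓔 𝓘(ℝ, ℝ) (⊤ : ℕ∞) f)

lemma nuF_frame (F G : ∀ y, SF T10 θ y) : nuF F f = nuF G f := by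
  have h1 : gF F f = gF G f := by funext y; rw [gF, gF, P01_frame F G, tr2_frame F G]
  have h2 : nF F f = nF G f := by funext y; rw [nF, nF, P01_frame F G, P10_frame F G, tr2_frame F G]
  rw [nuF, nuF, h1, h2, P01_frame F G, P10_frame F G]

include hT10 hθ hf

lemma vpi_hat {G : ∀ y, SF T10 θ y} (hG : SmSF G U) (hx : x ∈ U) :
    vpi (hatF hf hθ G) x = (vpi G + nuF G f) x := by
  have hU := hG.isOpen
  have hH := smSF_hatF hf hθ hG
  have hθ' := hθ.rescale hf
  have hY := smoothOn_dY hf U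
  have sθ := hθ.smooth.mono (subset_univ U)
  have sa := hG.W1.smFn_e1 hY
  have sb := hG.W2.smFn_e1 hY
  have sc := hG.Z1.smFn_e1 hY
  have sd := hG.Z2.smFn_e1 hY
  have k := fun c : ℂ => smFn_const (M := M) c U
  have c1 := hG.cf1 hθ
  have c2 := hG.cf2 hθ
  have c3 := hG.cf3 hθ
  have c4 := hG.cf4 hθ
  have h0 := eY_ne_zero (f := f) (x := x)
  have hI := I_mul_I
  have dd : ∀ u v w, e3 (w12 (cf3 G) (d1 (cf1 G))) x u v w - e3 (w12 (cf1 G) (d1 (cf3 G))) x u v w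
      + (e3 (w12 (cf4 G) (d1 (cf2 G))) x u v w - e3 (w12 (cf2 G) (d1 (cf4 G))) x u v w) = 0 := by
    intro u v w
    have q := d2_d1 hU hx sθ
    rw [d2, extD_congr hU (fun y _ => d1_theta_eq G) hx,
      extD_const_smul hU hx _ ((c1.w11 c3).add (c2.w11 c4)),
      extD_add hU hx (c1.w11 c3) (c2.w11 c4)] at q
    have q' : (I • (d2 (w11 (cf1 G) (cf3 G)) + d2 (w11 (cf2 G) (cf4 G)))) x
      = (0 : Ω 3) x := q
    have := e3_congr q' u v w
    simp only [e3_smul, e3_add, e3_zero, e3_d2_w11 hU hx c1 c3, e3_d2_w11 hU hx c2 c4] at this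
    exact (mul_eq_zero.1 this).resolve_left I_ne_zero
  have D1 : ∀ u v, e2 (d1 (cf1 (hatF hf hθ G))) x u v = _ := fun u v => by
    rw [cf1_hat hf hθ, e2_d1_add hU hx c1 (sθ.fsmul ((k _).mul sa)),
      e2_d1_fsmul hU hx ((k _).mul sa) sθ, e1_dFn_const_mul hU hx _ sa, e1_dFn_const_mul hU hx _ sa]
  have D2 : ∀ u v, e2 (d1 (cf2 (hatF hf hθ G))) x u v = _ := fun u v => by
    rw [cf2_hat hf hθ, e2_d1_add hU hx c2 (sθ.fsmul ((k _).mul sb)),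
      e2_d1_fsmul hU hx ((k _).mul sb) sθ, e1_dFn_const_mul hU hx _ sb, e1_dFn_const_mul hU hx _ sb]
  have D3 : ∀ u v, e2 (d1 (cf3 (hatF hf hθ G))) x u v = _ := fun u v => by
    rw [cf3_hat hf hθ, e2_d1_fsmul hU hx (smFn_eY hf U) (c3.add (sθ.fsmul ((k _).mul sc))), e2_d1_add hU hx c3
      (sθ.fsmul ((k _).mul sc)), e2_d1_fsmul hU hx ((k _).mul sc) sθ, dFn_eY hf]
  have D4 : ∀ u v, e2 (d1 (cf4 (hatF hf hθ G))) x u v = _ := fun u v => by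
    rw [cf4_hat hf hθ, e2_d1_fsmul hU hx (smFn_eY hf U) (c4.add (sθ.fsmul ((k _).mul sd))), e2_d1_add hU hx c4
      (sθ.fsmul ((k _).mul sd)), e2_d1_fsmul hU hx ((k _).mul sd) sθ, dFn_eY hf]
  have E1 : ∀ u, e1 (cf1 (hatF hf hθ G)) x u = _ := fun u => by rw [cf1_hat hf hθ, e1_add, e1_fsmul]
  have E2 : ∀ u, e1 (cf2 (hatF hf hθ G)) x u = _ := fun u => by rw [cf2_hat hf hθ, e1_add, e1_fsmul]
  have E3 : ∀ u, e1 (cf3 (hatF hf hθ G)) x u = _ := fun u => by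
    rw [cf3_hat hf hθ, e1_fsmul, e1_add, e1_fsmul]
  have E4 : ∀ u, e1 (cf4 (hatF hf hθ G)) x u = _ := fun u => by
    rw [cf4_hat hf hθ, e1_fsmul, e1_add, e1_fsmul]
  have g1 := e3_d2_w11 hU hx (hH.cf1 hθ') (hH.cf2 hθ')
  have g2 := e3_d2_w11 hU hx (hH.cf3 hθ') (hH.cf4 hθ')
  have g3 := e3_d2_w11 hU hx c1 c2
  have g4 := e3_d2_w11 hU hx c3 c4
  have tr : ∀ u v, e2 (d1 (P01 G (dY f))) x u v = _ := fun u v => by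
    rw [P01, e2_d1_add hU hx (c3.fsmul sa) (c4.fsmul sb), e2_d1_fsmul hU hx sa c3,
      e2_d1_fsmul hU hx sb c4]
  have s1 := fun X : Ω 2 => e2_swap (a := (G x).Z2) (b := (G x).Z1) X
  have s2 := fun X : Ω 2 => e2_swap (a := (G x).W1) (b := (G x).Z1) X
  have s3 := fun X : Ω 2 => e2_swap (a := (G x).W1) (b := (G x).Z2) X
  have s4 := fun X : Ω 2 => e2_swap (a := (G x).W2) (b := (G x).Z1) X
  have s5 := fun X : Ω 2 => e2_swap (a := (G x).W2) (b := (G x).Z2) X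
  have dd1 := dd (G x).Z1 (G x).Z2 (G x).W1
  have dd2 := dd (G x).Z1 (G x).Z2 (G x).W2
  have z3 := d1_cf3_ZZ hT10 hθ hG hx (G x).mZ1 (G x).mZ2
  have z4 := d1_cf4_ZZ hT10 hθ hG hx (G x).mZ1 (G x).mZ2
  have w1 := d1_cf1_WW hT10 hθ hG hx (G x).mW1 (G x).mW2
  have w2 := d1_cf2_WW hT10 hθ hG hx (G x).mW1 (G x).mW2
  apply (hatF hf hθ G x).ext1
  on_goal 1 => rw [e1_add, vpi_T, psiF, g1]
  on_goal 2 => rw [e1_add, vpi_Z1, chiF, g2]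
  on_goal 3 => rw [e1_add, vpi_Z2, chiF, g2]
  on_goal 4 => rw [e1_add, vpi_W1, psiF, g1]
  on_goal 5 => rw [e1_add, vpi_W2, psiF, g1]
  all_goals
    simp only [e3_w12, D1, D2, D3, D4, E1, E2, E3, E4]
    simp only [hatF, hatSF, nuF, gF, nF, tr, e1_smul_vec, e1_add_vec, e2_smul_left, e2_smul_right,
      e2_add_left, vpi_T, vpi_Z1, vpi_Z2, vpi_W1, vpi_W2, psiF, chiF, g3, g4, e3_w12, e1_add,
      e1_sub, e1_smul, e1_fsmul, P10_T, P10_Z1, P10_Z2, P10_W1, P10_W2, P01_T, P01_Z1, P01_Z2,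
      P01_W1, P01_W2, tr2, e2_w11, cf1_T, cf1_Z1, cf1_Z2, cf1_W1, cf1_W2, cf2_T, cf2_Z1, cf2_Z2,
      cf2_W1, cf2_W2, cf3_Z1, cf3_Z2, cf3_W1, cf3_W2, cf4_Z1, cf4_Z2, cf4_W1, cf4_W2,
      SF.dTZ1, SF.dTZ2, SF.dZZ, SF.dWW, SF.d11, SF.d12, SF.d21, SF.d22, SF.tT,
      SF.tZ1, SF.tZ2, SF.tW1, SF.tW2, e2_self, z3, z4, s1, s2, s3, s4, s5] at dd1 dd2 ⊢
  · linear_combination (eY f x)⁻¹ * I * (e1 (dY f) x (G x).W1 * dd2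
      - e1 (dY f) x (G x).W2 * dd1) + (eY f x)⁻¹ * I * (e1 (dY f) x (G x).W1
      * e1 (dY f) x (G x).Z1 + e1 (dY f) x (G x).W2 * e1 (dY f) x (G x).Z2) * hI
  all_goals field_simp
  · linear_combination -e1 (dY f) x (G x).Z1 * hI
  · linear_combination -e1 (dY f) x (G x).Z2 * hI
  · linear_combination e1 (dY f) x (G x).W1 * hI
  · linear_combination e1 (dY f) x (G x).W2 * hI

end

variable (F : ∀ y, SF T10 θ y) (hT10 : IsCRStructure T10) (hθ : IsContactForm T10 θ)
  (hf : ContMDiff 𝓔 𝓘(ℝ, ℝ) (⊤ : ℕ∞) f) {ω : CForm M 2}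
  (hω : ω ∈ RSpace T10 θ 2 1 1) (hd : d2 ω = 0)

section

lemma one_form_decomp (α : Ω 1) : α = P10 F α + P01 F α + fsmul (fun y => e1 α y (F y).T) θ := by
  funext y
  apply (F y).ext1 <;> simp

/-- The derivative of a function along the Reeb field. -/
def tF (f : M → ℝ) (y : M) : ℂ := e1 (dY f) y (F y).T

lemma tr2_dY (y : M) : tr2 F (d1 (P01 F (dY f))) y = -2 * I * gF F f y := by
  rw [gF]; linear_combination tr2 F (d1 (P01 F (dY f))) y * I_mul_I

/-- The `(0,1)`-form `∂̄_b Υ` of the Rumin complex. -/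
def gaF (f : M → ℝ) : Ω 1 := P01 F (dY f) + fsmul (gF F f) θ

include hT10 hθ hf

lemma smoothOn_P01dY : SmoothOn (P01 F (dY f)) univ :=
  smoothOn_P01 hT10 hθ F isOpen_univ (smoothOn_dY hf _)
lemma smoothOn_P10dY : SmoothOn (P10 F (dY f)) univ :=
  smoothOn_P10 hT10 hθ F isOpen_univ (smoothOn_dY hf _)
lemma smFn_gF : SmFn (gF F f) univ :=
  (smFn_const _ _).mul (smFn_tr2 hT10 hθ F isOpen_univ
    ((smoothOn_P01dY F hT10 hθ hf).extD isOpen_univ))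
lemma smFn_nF : SmFn (nF F f) univ :=
  smFn_tr2 hT10 hθ F isOpen_univ
    ((smoothOn_P10dY F hT10 hθ hf).w11 (smoothOn_P01dY F hT10 hθ hf))
lemma smFn_tF : SmFn (tF F f) univ := by
  refine smFn_of_frames hT10 hθ isOpen_univ fun G W hG hW => ?_
  rw [show tF F f = fun y => e1 (dY f) y (G y).T from funext fun y => by
    rw [tF, (F y).T_eq (G y)]]
  exact hG.T.smFn_e1 (smoothOn_dY hf W)

lemma e2_ricF_hat {u v : ℂT x} (hu : e1 θ x u = 0) (hv : e1 θ x v = 0) :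
    e2 (ricF hT10 (hθ.rescale hf)) x u v = e2 (ricF hT10 hθ) x u v
      - 4 * e2 (d1 (P01 F (dY f))) x u v
      + (2 * gF F f x + 3 * I * nF F f x - 3 * tF F f x) * e2 (d1 θ) x u v := by
  obtain ⟨G, U, hx, hG⟩ := exists_smSF hT10 hθ x
  have hU := hG.isOpen
  have s : SmFn (fun y => 2 * gF F f y + 3 * I * nF F f y - 3 * tF F f y) univ :=
    (((smFn_const _ _).mul (smFn_gF F hT10 hθ hf)).add ((smFn_const _ _).mul
      (smFn_nF F hT10 hθ hf))).sub ((smFn_const _ _).mul (smFn_tF F hT10 hθ hf))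
  have e : nuF G f = (3 : ℂ) • dY f + (-4 : ℂ) • P01 F (dY f)
      + fsmul (fun y => 2 * gF F f y + 3 * I * nF F f y - 3 * tF F f y) θ := by
    rw [nuF_frame G F]
    funext y
    apply (F y).ext1 <;> simp [nuF, tF] <;> ring
  have sY := (smoothOn_dY hf univ).const_smul (3 : ℂ)
  have sP := (smoothOn_P01dY F hT10 hθ hf).const_smul (-4 : ℂ)
  have sν : SmoothOn (nuF G f) U := e ▸ ((sY.add sP).add (hθ.smooth.fsmul s)).mono U.subset_univ
  rw [ricF_eq hT10 (hθ.rescale hf) (smSF_hatF hf hθ hG) hx |> e2_congr (β := d1 (vpi _)),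
    e2_congr (α := d1 (vpi (hatF hf hθ G))) (β := d1 (vpi G + nuF G f))
      (extD_congr hU (fun y hy => vpi_hat hT10 hθ hf hG hy) hx),
    e2_d1_add hU hx (hG.vpi hθ) sν, ← e2_congr (ricF_eq hT10 hθ hG hx), e,
    d1_add (sY.add sP) (hθ.smooth.fsmul s), d1_add sY sP, d1_smul _ (smoothOn_dY hf _),
    d1_smul _ (smoothOn_P01dY F hT10 hθ hf), d1_dY hf, d1_fsmul_univ s hθ.smooth]
  simp only [e2_add, e2_smul, e2_fsmul, e2_w11, e2_zero, hu, hv]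
  ring

lemma scalarCurvature_hat : eY f x * scalarCurvature T10 (rescale f θ) x =
    scalarCurvature T10 θ x + 6 * I * (2 * gF F f x - tF F f x) - 6 * nF F f x := by
  have h := fun v (hv : e1 θ x v = 0) u (hu : e1 θ x u = 0) => e2_ricF_hat F hT10 hθ hf hu hv
  have ht := tr2_dY F (f := f) x
  rw [scalarCurvature_eq hT10 (hθ.rescale hf) (hatF hf hθ F), scalarCurvature_eq hT10 hθ F]
  simp only [tr2] at ht ⊢
  simp only [hatF, hatSF, e2_smul_right, h _ (F x).tW1 _ (F x).tZ1, h _ (F x).tW2 _ (F x).tZ2,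
    SF.d11, SF.d22]
  field_simp [eY_ne_zero (f := f) (x := x)]
  linear_combination -4 * ht + 6 * nF F f x * I_mul_I

omit hT10 in
include F in
lemma w12_dtheta_hat : w12 (rescale f θ) (d1 (rescale f θ)) x =
    (eY f x * eY f x) • w12 θ (d1 θ) x := by
  have : w12 (rescale f θ) (d1 (rescale f θ)) x =
      fsmul (fun y => eY f y * eY f y) (w12 θ (d1 θ)) x := by
    apply (F x).ext3 <;> simp only [e3_w12, e2_d1_hat hf hθ, e3_fsmul] <;>
      simp [show rescale f θ = fsmul (eY f) θ from rfl] <;> ring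
  exact this

omit hT10 in
lemma Q21_hat {ν : Ω 3} (h : w13 θ ν x = 0) : Q21 (hatF hf hθ F) ν x = Q21 F ν x := by
  have h0 := eY_ne_zero (f := f) (x := x)
  obtain ⟨ξ, hξ⟩ : ∃ ξ : ℂ, ν x = Q30 F ν x + Q21 F ν x + Q12 F ν x + ξ • w12 θ (d1 θ) x :=
    ⟨_, Q_decomp F h⟩
  refine Q21_eq (hatF hf hθ F) (A := Q30 F ν) (B := Q12 F ν) (ξ := ξ / (eY f x * eY f x)) ?_
    (fun Z hZ W hW => Q30_T_ZW F ν _ hZ hW) (fun Z hZ W hW => Q12_T_ZW F ν _ hZ hW) ?_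
    (fun _ a _ b => Q21_T_ZZ F ν _ a b) (fun _ a _ b => Q21_T_WW F ν _ a b) ?_
  · rw [w12_dtheta_hat F hθ hf, smul_smul, div_mul_cancel₀ _ (mul_ne_zero h0 h0)]
    exact hξ
  · change _ = (0 : Ω 4) x
    apply (F x).ext4 <;> simp [show rescale f θ = fsmul (eY f) θ from rfl, Q21]
  · simp [Q21, hatF, hatSF, e1_smul_vec, e1_add_vec]
    try ring

lemma smoothOn_gaF : SmoothOn (gaF F f) univ :=
  (smoothOn_P01dY F hT10 hθ hf).add (hθ.smooth.fsmul (smFn_gF F hT10 hθ hf))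

lemma d1_gaF : d1 (gaF F f) =
    d1 (P01 F (dY f)) + (w11 (dFn (gF F f)) θ + fsmul (gF F f) (d1 θ)) := by
  rw [gaF, d1_add (smoothOn_P01dY F hT10 hθ hf) (hθ.smooth.fsmul (smFn_gF F hT10 hθ hf)),
    d1_fsmul_univ (smFn_gF F hT10 hθ hf) hθ.smooth]

lemma d1_P01dY_ZZ : e2 (d1 (P01 F (dY f))) x (F x).Z1 (F x).Z2 = 0 :=
  e2_d1_eq_zero hT10 isOpen_univ (smoothOn_P01dY F hT10 hθ hf) (fun y _ Z hZ => P01_Z F _ hZ)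
    (mem_univ x) (F x).mZ1 (F x).mZ2

lemma d1_P01dY_WW : e2 (d1 (P01 F (dY f))) x (F x).W1 (F x).W2 = 0 := by
  have s1 := smoothOn_P01dY F hT10 hθ hf
  have s2 := smoothOn_P10dY F hT10 hθ hf
  have st := smFn_tF F hT10 hθ hf
  have h : d1 (dY f) = d1 (P10 F (dY f)) + d1 (P01 F (dY f))
      + (w11 (dFn (tF F f)) θ + fsmul (tF F f) (d1 θ)) := by
    conv_lhs => rw [one_form_decomp F (dY f), show (fun y => e1 (dY f) y (F y).T) = tF F f from rfl]
    rw [d1_add (s2.add s1) (hθ.smooth.fsmul st), d1_add s2 s1]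
    exact congrArg _ (d1_fsmul_univ st hθ.smooth)
  rw [d1_dY hf] at h
  have h' := e2_d1_eq_zero_conj hT10 isOpen_univ s2 (fun y _ W hW => P10_W F _ hW)
    (mem_univ x) (F x).mW1 (F x).mW2
  have := e2_congr (congrFun h x) (F x).W1 (F x).W2
  simpa [h', e2_zero] using this.symm

lemma w12_leeForm_hat : w12 θ (leeForm T10 (rescale f θ)) x =
    (-I / 4) • Q21 F (w12 θ (ricF hT10 (hθ.rescale hf))) x := by
  have h := congrFun (leeForm_spec hT10 (hθ.rescale hf) (hatF hf hθ F)).2 x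
  have h0 := eY_ne_zero (f := f) (x := x)
  have e : ∀ X : Ω 2, w12 (rescale f θ) X = fsmul (eY f) (w12 θ X) := fun X => by
    funext y
    apply (F y).ext3 <;> simp [show rescale f θ = fsmul (eY f) θ from rfl, e3_fsmul]
  have q : Q21 F (fsmul (eY f) (w12 θ (ricF hT10 (hθ.rescale hf)))) =
      fsmul (eY f) (Q21 F (w12 θ (ricF hT10 (hθ.rescale hf)))) := by
    funext y; apply (F y).ext3 <;> simp [Q21] <;> ring
  have hz : w13 θ (fsmul (eY f) (w12 θ (ricF hT10 (hθ.rescale hf)))) x = 0 := by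
    change _ = (0 : Ω 4) x
    apply (F x).ext4 <;> simp
  change _ = (-I / 4) • Q21 (hatF hf hθ F) _ x at h
  rw [e, e, Q21_hat F hθ hf hz, q] at h
  change eY f x • _ = (-I / 4) • eY f x • _ at h
  rw [smul_comm] at h
  exact smul_right_injective _ h0 h

lemma leeForm_hat : leeForm T10 (rescale f θ) = leeForm T10 θ + I • d1 (gaF F f) := by
  obtain ⟨⟨-, s, r, -⟩, e⟩ := leeForm_spec hT10 hθ F
  obtain ⟨⟨-, s', r', -⟩, -⟩ := leeForm_spec hT10 (hθ.rescale hf) (hatF hf hθ F)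
  have sg : SmoothOn (d1 (gaF F f)) univ := (smoothOn_gaF F hT10 hθ hf).extD isOpen_univ
  rw [isRumin_two] at r r'
  have r2 : w13 θ (d2 (leeForm T10 (rescale f θ))) = 0 := by
    funext y
    refine smul_right_injective _ (eY_ne_zero (f := f) (x := y)) (a₂ := 0) ?_
    change eY f y • _ = eY f y • (0 : Ω 4) y
    have : eY f y • w13 θ (d2 (leeForm T10 (rescale f θ))) y =
        w13 (rescale f θ) (d2 (leeForm T10 (rescale f θ))) y := by
      change fsmul (eY f) (w13 θ (d2 (leeForm T10 (rescale f θ)))) y = _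
      apply (F y).ext4 <;> simp [show rescale f θ = fsmul (eY f) θ from rfl]
    rw [this, r'.2]; ext v; exact (mul_zero _).symm
  rw [← sub_eq_zero]
  refine rumin_two_eq_zero hθ F (s'.sub (s.add (sg.const_smul _))) ?_ ?_
  · rw [d2_sub s' (s.add (sg.const_smul _)), d2_add s (sg.const_smul _), d2_smul _ sg]
    rw [d2_d1_univ (smoothOn_gaF F hT10 hθ hf), w13_sub F, w13_add F, r.2, r2, w13_smul F]
    funext y; apply (F y).ext4 <;> simp
  · funext y
    have h1 : ∀ a b c, e3 (w12 θ (leeForm T10 (rescale f θ))) y a b c = _ := fun a b c => by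
      rw [e3_congr (β := (-I / 4) • Q21 F (w12 θ (ricF hT10 (hθ.rescale hf))))
        (w12_leeForm_hat F hT10 hθ hf)]
    have h2 := e3_congr (congrFun e y)
    have h := fun v (hv : e1 θ y v = 0) u (hu : e1 θ y u = 0) => e2_ricF_hat F hT10 hθ hf hu hv
    have ht := tr2_dY F (f := f) y
    rw [w12_sub F, w12_add F, w12_smul F]
    apply (F y).ext3 <;> simp only [e3_sub, e3_add, e3_smul, h1, h2]
    all_goals simp [Q21, d1_gaF F hT10 hθ hf, d1_P01dY_ZZ F hT10 hθ hf, d1_P01dY_WW F hT10 hθ hf,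
      h _ (F y).tW1 _ (F y).tZ1, h _ (F y).tW2 _ (F y).tZ2, h _ (F y).tW2 _ (F y).tZ1,
      h _ (F y).tW1 _ (F y).tZ2]
    all_goals simp only [tr2] at ht
    · linear_combination -(I / 2) * ht
    · ring
    · ring
    · linear_combination -(I / 2) * ht
end

section

lemma e1_rescale (v : ℂT x) : e1 (rescale f θ) x v = eY f x * e1 θ x v := e1_fsmul ..

lemma e4_smul34 {a b c d : ℂT x} {z w : ℂ} (α : Ω 4) :
    e4 α x a b (z • c) (w • d) = z * w * e4 α x a b c d := by
  simp only [e4, evalC, cEval_cons, iC_smul_left, cEval_smul, iC_smul]; ring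

/-- The one-form `λ` with `θ ∧ dΥ ∧ ω = θ ∧ λ ∧ dθ`. -/
def laF (f : M → ℝ) (ω : Ω 2) : Ω 1 := lam F (w13 θ (w12 (dY f) ω))

/-- The difference of the `(0,1)`- and `(1,0)`-parts of a one-form. -/
def kap (α : Ω 1) : Ω 1 := P01 F α - P10 F α

include hθ hf

include hω F in
lemma mem_hat : ω ∈ RSpace T10 (rescale f θ) 2 1 1 := by
  obtain ⟨a, b, c, d⟩ := hω
  refine ⟨a, b, isRumin_two.2 ?_, d⟩
  rw [isRumin_two] at c
  constructor
  · funext y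
    have h := (w14_theta_eq_zero (F y)).1 (congrFun c.1 y)
    change _ = (0 : Ω 5) y
    apply (F y).ext5
    simp only [e5_w14, e4_w22, e2_d1_hat hf hθ, e5_zero, e1_rescale]
    simp at h
    simp
    right
    linear_combination eY f y * h
  · funext y
    have h := e4_congr (congrFun c.2 y)
    change _ = (0 : Ω 4) y
    apply (F y).ext4 <;> simp only [e4_w13, e1_rescale, mul_assoc, ← mul_add, ← mul_sub] <;>
     (rw [← e4_w13, h]; simp)

lemma C22_hat {μ : Ω 4} (h : w14 θ μ x = 0) : C22 (hatF hf hθ F) μ x = C22 F μ x := by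
  have h0 := eY_ne_zero (f := f) (x := x)
  have t := fun a b c => e4_of_theta (F x) h (hatF hf hθ F x).T (a := a) (b := b) (c := c)
  have q := (hatF hf hθ F x).tT
  rw [e1_rescale] at q
  replace q := eq_inv_of_mul_eq_one_right q
  have z1 : (hatF hf hθ F x).Z1 = (F x).Z1 := rfl
  have z2 : (hatF hf hθ F x).Z2 = (F x).Z2 := rfl
  have w1 : (hatF hf hθ F x).W1 = (eY f x)⁻¹ • (F x).W1 := rfl
  have w2 : (hatF hf hθ F x).W2 = (eY f x)⁻¹ • (F x).W2 := rfl
  have t3 := t _ _ _ (F x).tZ1 (F x).tW1 (F x).tW2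
  have t4 := t _ _ _ (F x).tZ2 (F x).tW1 (F x).tW2
  rw [w14_theta_eq_zero (F x)] at h
  apply (hatF hf hθ F x).ext4 <;> simp [C22, lam]
  all_goals simp [z1, z2, w1, w2, e1_smul_vec, e4_smul34, t3, t4, q, e2_smul_right]
  all_goals ring

include F in
lemma piFour_hat (μ : Ω 4) : piFour (rescale f θ) μ = piFour θ μ := by
  rw [piFour_eq (hatF hf hθ F), piFour_eq F]
  congr 2
  funext y
  have h0 := eY_ne_zero (f := f) (x := y)
  change _ • _ = _ • _
  rw [w12_dtheta_hat F hθ hf, smul_smul]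
  congr 1
  simp [top4, hatF, hatSF, e4_smul34]
  field_simp

omit hf in
lemma Q21_mod {α β : Ω 1} (hα : SmoothOn α univ) (hβ : SmoothOn β univ)
    (h : w11 θ α = w11 θ β) : Q21 F (w12 θ (d1 α)) = Q21 F (w12 θ (d1 β)) := by
  have h' := congrArg d2 h
  rw [d2_w11_univ hθ.smooth hα, d2_w11_univ hθ.smooth hβ] at h'
  funext y
  have e := e3_congr (congrFun h' y)
  have k := e2_congr (congrFun h y)
  simp only [e3_sub] at e
  have kT : ∀ v, e1 θ y v = 0 → e1 α y v = e1 β y v := fun v hv => by simpa [hv] using k (F y).T v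
  have key : Q21 F (w12 θ (d1 β) + fsmul (fun y => e1 α y (F y).T - e1 β y (F y).T)
      (w12 θ (d1 θ))) y = Q21 F (w12 θ (d1 β)) y := by
    apply (F y).ext3 <;> simp [Q21]
  rw [← key]
  refine Q21_congr F fun Z hZ W hW => ?_
  have e' := e (F y).T Z W
  have tZ := (F y).t_Z hZ
  have tW := (F y).t_W hW
  simp [kT _ tZ, kT _ tW, tZ, tW] at e' ⊢
  linear_combination -e'

omit hf in
include hT10 in
lemma smoothOn_kap {α : Ω 1} (hα : SmoothOn α univ) : SmoothOn (kap F α) univ :=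
  (smoothOn_P01 hT10 hθ F isOpen_univ hα).sub (smoothOn_P10 hT10 hθ F isOpen_univ hα)

include hω

include hT10 in
lemma smoothOn_laF : SmoothOn (laF F f ω) univ :=
  smoothOn_lamFn F hT10 hθ (smFn_of_contMDiff hf) hω.2.1

lemma theta_tau_hat : w13 (rescale f θ) (w12 (fsmul (fun y => (eY f y)⁻¹)
    (tauF F ω - laF F f ω)) (d1 (rescale f θ))) x = d3 (w12 (rescale f θ) ω) x := by
  have h0 := eY_ne_zero (f := f) (x := x)
  have e : w12 (rescale f θ) ω = fsmul (eY f) (w12 θ ω) := by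
    funext y; apply (F y).ext3 <;> simp [e1_rescale]
  have hz : w14 θ (w13 θ (w12 (dY f) ω)) x = 0 := w14_theta_w13 (F x) _
  have A : w13 (rescale f θ) (w12 (fsmul (fun y => (eY f y)⁻¹) (tauF F ω - laF F f ω))
      (d1 (rescale f θ))) x = eY f x • (w13 θ (w12 (tauF F ω) (d1 θ)) x
      - w13 θ (w12 (laF F f ω) (d1 θ)) x) := by
    change _ = (fsmul (eY f) (w13 θ (w12 (tauF F ω) (d1 θ)) - w13 θ (w12 (laF F f ω) (d1 θ)))) x
    apply (F x).ext4 <;> simp only [e4_w13, e3_w12, e1_rescale, e2_d1_hat hf hθ, e4_fsmul, e4_sub,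
      e1_fsmul, e1_sub] <;> simp <;> field_simp <;> (try simp) <;> ring
  have B : w13 (fsmul (eY f) (dY f)) (w12 θ ω) x = -(eY f x • w13 θ (w12 (dY f) ω) x) := by
    change _ = (-(fsmul (eY f) (w13 θ (w12 (dY f) ω)))) x
    apply (F x).ext4 <;> simp <;> ring
  rw [e, d3_fsmul_univ (smFn_eY hf _) (hθ.smooth.w12 hω.2.1), dFn_eY hf, A]
  change _ = w13 (fsmul (eY f) (dY f)) (w12 θ ω) x + eY f x • d3 (w12 θ ω) x
  rw [B, laF, lam_spec F hz, tauF, lam_spec F (congrFun (theta_d3_w12 F hθ hω) x), smul_sub]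
  abel

lemma theta_kap_hat : w11 θ (kap (hatF hf hθ F) (tauF (hatF hf hθ F) ω)) =
    w11 θ (fsmul (fun y => (eY f y)⁻¹) (kap F (tauF F ω - laF F f ω))) := by
  funext y
  have h := e2_congr (lam_mod (hatF hf hθ F) (theta_tau_hat F hθ hf hω (x := y)))
  have h0 := eY_ne_zero (f := f) (x := y)
  have k : ∀ v, e1 θ y v = 0 → e1 (tauF (hatF hf hθ F) ω) y v = 
      (eY f y)⁻¹ * (e1 (tauF F ω) y v - e1 (laF F f ω) y v) := fun v hv => by
    have := h (F y).T v
    simp only [e2_w11, e1_rescale, hv, SF.tT, e1_fsmul, e1_sub] at this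
    field_simp at this ⊢
    rw [tauF]
    linear_combination -this
  apply (F y).ext2 <;> simp [kap, e1_sub, P10_Z _ _ (F y).mZ1, P10_Z _ _ (F y).mZ2, P01_Z _ _ (F y).mZ1,
    P01_Z _ _ (F y).mZ2, P10_W _ _ (F y).mW1, P10_W _ _ (F y).mW2, P01_W _ _ (F y).mW1,
    P01_W _ _ (F y).mW2, k] <;> ring

include hT10 in
lemma Q21_kap_hat : Q21 (hatF hf hθ F) (w12 (rescale f θ)
    (d1 (kap (hatF hf hθ F) (tauF (hatF hf hθ F) ω)))) =
    Q21 F (w12 θ (d1 (kap F (tauF F ω - laF F f ω)) - w11 (dY f) (kap F (tauF F ω - laF F f ω)))) := by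
  have hτ := smoothOn_tauF F hT10 hθ hω
  have hτ' := smoothOn_tauF (hatF hf hθ F) hT10 (hθ.rescale hf) (mem_hat F hθ hf hω)
  have s1 := smoothOn_kap F hT10 hθ (hτ.sub (smoothOn_laF F hT10 hθ hf hω))
  have s2 := smoothOn_kap (hatF hf hθ F) hT10 (hθ.rescale hf) hτ'
  have si := (smFn_eY hf univ).inv fun _ _ => eY_ne_zero
  have m := Q21_mod F hθ s2 (s1.fsmul si) (theta_kap_hat F hθ hf hω)
  funext y
  have h0 := eY_ne_zero (f := f) (x := y)
  rw [Q21_hat F hθ hf (by change _ = (0 : Ω 4) y; apply (F y).ext4 <;> simp [e1_rescale])]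
  have e : w12 (rescale f θ) (d1 (kap (hatF hf hθ F) (tauF (hatF hf hθ F) ω))) =
    fsmul (eY f) (w12 θ (d1 (kap (hatF hf hθ F) (tauF (hatF hf hθ F) ω)))) := by
    funext y; apply (F y).ext3 <;> simp [e1_rescale]
  have q : ∀ ν, Q21 F (fsmul (eY f) ν) y = eY f y • Q21 F ν y := fun ν => by
    change _ = (fsmul (eY f) (Q21 F ν)) y
    apply (F y).ext3 <;> simp [Q21] <;> ring
  rw [e, q, m, ← q]
  have di : ∀ v, e1 (dFn fun y => (eY f y)⁻¹) y v = -(eY f y)⁻¹ * e1 (dY f) y v := fun v => by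
    rw [dFn_inv isOpen_univ (mem_univ y) (smFn_eY hf _) fun _ _ => eY_ne_zero, dFn_eY hf, e1_fsmul]
    field_simp
  refine Q21_congr F fun Z hZ W hW => ?_
  rw [d1_fsmul_univ si s1]
  have tZ := (F y).t_Z hZ
  have tW := (F y).t_W hW
  simp [tZ, tW, di]
  field_simp
  ring
end

section

lemma w14_sub (F : ∀ y, SF T10 θ y) (a b : Ω 4) : w14 θ (a - b) = w14 θ a - w14 θ b := by
  funext x; apply (F x).ext5; simp

lemma w14_smul (F : ∀ y, SF T10 θ y) (c : ℂ) (a : Ω 4) : w14 θ (c • a) = c • w14 θ a := by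
  funext x; apply (F x).ext5; simp

include hT10 hθ

lemma w14_d3_Q21 {ν : Ω 3} (hν : SmoothOn ν univ) (h0 : w13 θ ν = 0) :
    w14 θ (d3 (Q21 F ν)) = 0 := (isRumin_three.1 (Q21_mem hT10 hθ F hν h0).2.2.1).2

include hω

include F in
lemma w14_d3_fsmul {g : M → ℂ} (hg : SmFn g univ) : w14 θ (d3 (fsmul g (w12 θ ω))) = 0 := by
  rw [← theta_rMulFn F hT10 hθ hg hω]
  exact theta_d3_w12 F hθ (rMulFn_mem F hT10 hθ hg hω)

include hf

/-- The form whose derivative gives the linear part of the rescaled operator. -/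
def coreF (f : M → ℝ) (ω : Ω 2) : Ω 3 :=
  Q21 F (w12 θ (d1 (kap F (tauF F ω - laF F f ω)) - w11 (dY f) (kap F (tauF F ω - laF F f ω))))

/-- The change of the scalar curvature term. -/
def scF (f : M → ℝ) (y : M) : ℂ := I * (2 * gF F f y - tF F f y) - nF F f y

omit hω in
lemma smFn_scF : SmFn (scF F f) univ :=
  ((smFn_const _ _).mul (((smFn_const _ _).mul (smFn_gF F hT10 hθ hf)).sub
    (smFn_tF F hT10 hθ hf))).sub (smFn_nF F hT10 hθ hf)

lemma calD_hat : calD T10 (rescale f θ) ω = C22 F (d3 (I • coreF F f ω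
      - fsmul (fun y => scalarCurvature T10 θ y / 6 + scF F f y) (w12 θ ω)))
    + (2 : ℂ) • C22 F (piFour θ (w22 (leeForm T10 θ + I • d1 (gaF F f)) ω)) := by
  have hθ' := hθ.rescale hf
  have s1 := smoothOn_kap F hT10 hθ ((smoothOn_tauF F hT10 hθ hω).sub (smoothOn_laF F hT10 hθ hf hω))
  have sR : SmFn (fun y => scalarCurvature T10 θ y / 6 + scF F f y) univ :=
    ((smFn_scalarCurvature hT10 hθ).div (smFn_const 6 _) (fun _ _ => by norm_num)).add
      (smFn_scF F hT10 hθ hf)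
  have sν : SmoothOn (w12 θ (d1 (kap F (tauF F ω - laF F f ω))
      - w11 (dY f) (kap F (tauF F ω - laF F f ω)))) univ :=
    hθ.smooth.w12 ((s1.d1 isOpen_univ).sub ((smoothOn_dY hf _).w11 s1))
  have hz : ∀ X : Ω 2, w13 θ (w12 θ X) = 0 := fun X => funext fun y => w13_theta_w12 (F y) X
  have sq := smoothOn_Q21 hT10 hθ F isOpen_univ sν fun y _ => congrFun (hz _) y
  have sc := sq.const_smul I
  have sw := SmoothOn.fsmul sR (hθ.smooth.w12 hω.2.1)
  have sl := (leeForm_spec hT10 hθ' (hatF hf hθ F)).1.2.1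
  rw [calD_eq (hatF hf hθ F) hT10 hθ' (mem_hat F hθ hf hω) (smFn_scalarCurvature hT10 hθ') sl]
  have e1' := Q21_kap_hat F hT10 hθ hf hω
  rw [kap] at e1'
  have e2' : fsmul (fun x => scalarCurvature T10 (rescale f θ) x / 6) (w12 (rescale f θ) ω) =
      fsmul (fun y => scalarCurvature T10 θ y / 6 + scF F f y) (w12 θ ω) := by
    funext y
    have := scalarCurvature_hat F hT10 hθ hf (x := y)
    have e : w12 (rescale f θ) ω y = eY f y • w12 θ ω y := by
      change _ = fsmul (eY f) (w12 θ ω) y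
      apply (F y).ext3 <;> simp [e1_rescale]
    change (scalarCurvature T10 (rescale f θ) y / 6) • w12 (rescale f θ) ω y =
      (scalarCurvature T10 θ y / 6 + scF F f y) • w12 θ ω y
    rw [e, smul_smul, scF]
    congr 1
    linear_combination this / 6
  rw [e1', e2', piFour_hat F hθ hf, leeForm_hat F hT10 hθ hf]
  congr 1
  · funext y
    refine C22_hat F hθ hf (congrFun (g := (0 : Ω 5)) ?_ y)
    rw [d3_sub sc sw, w14_sub F, w14_d3_fsmul F hT10 hθ hω sR, d3_smul _ sq, w14_smul F,
      w14_d3_Q21 F hT10 hθ sν (hz _)]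
    funext z; apply (F z).ext5; simp
  · congr 1
    funext y
    refine C22_hat F hθ hf (congrFun (w14_piFour F hT10 hθ (μ := w22 _ ω) ?_) y)
    rw [← leeForm_hat F hT10 hθ hf]
    exact sl.w22 hω.2.1

end

section

include hθ hω

/-- The components of an element of the Rumin space of type `(1,1)`. -/
lemma mem_frame : e2 ω x (F x).Z1 (F x).Z2 = 0 ∧ e2 ω x (F x).W1 (F x).W2 = 0 ∧
    e2 ω x (F x).Z2 (F x).W2 = -e2 ω x (F x).Z1 (F x).W1 := by
  have h := e3_congr (congrFun (Q21_of_mem F hθ hω) x)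
  have h1 := h (F x).T (F x).Z1 (F x).Z2
  have h2 := h (F x).T (F x).W1 (F x).W2
  have h3 := h (F x).T (F x).Z1 (F x).W1
  simp [Q21] at h1 h2 h3
  exact ⟨h1.symm, h2.symm, by linear_combination -2 * h3⟩

include hd

lemma tau_frame : e2 ω x (F x).T (F x).Z1 = e1 (tauF F ω) x (F x).Z1 ∧
    e2 ω x (F x).T (F x).Z2 = e1 (tauF F ω) x (F x).Z2 ∧
    e2 ω x (F x).T (F x).W1 = e1 (tauF F ω) x (F x).W1 ∧
    e2 ω x (F x).T (F x).W2 = e1 (tauF F ω) x (F x).W2 := by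
  have e := d3_w12_univ hθ.smooth hω.2.1
  rw [hd] at e
  rw [tauF, e]
  refine ⟨?_, ?_, ?_, ?_⟩ <;> simp [lam] <;> ring_nf <;> simp

lemma w12_dY_eq : w12 (dY f) ω = w12 (laF F f ω) (d1 θ)
    + w12 θ (fsmul (tF F f) ω - w11 (dY f) (tauF F ω)) := by
  funext y
  obtain ⟨a1, a2, a3⟩ := mem_frame F hθ hω (x := y)
  obtain ⟨b1, b2, b3, b4⟩ := tau_frame F hθ hω hd (x := y)
  apply (F y).ext3 <;> simp [laF, lam, tF, a1, a2, a3, b1, b2, b3, b4]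
  all_goals (ring_nf; (try simp); try ring)

lemma w12_P01_eq : w12 (P01 F (dY f)) ω = w12 (P01 F (laF F f ω)) (d1 θ)
    - w12 θ (w11 (P01 F (dY f)) (tauF F ω)) := by
  funext y
  obtain ⟨a1, a2, a3⟩ := mem_frame F hθ hω (x := y)
  obtain ⟨b1, b2, b3, b4⟩ := tau_frame F hθ hω hd (x := y)
  apply (F y).ext3 <;> simp [laF, lam, a1, a2, a3, b1, b2, b3, b4]
  all_goals (ring_nf; (try simp); try ring)

omit hd in
lemma la_frame : e1 (laF F f ω) x (F x).Z1 = I * (e1 (dY f) x (F x).Z1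
      * e2 ω x (F x).Z1 (F x).W1 + e1 (dY f) x (F x).Z2 * e2 ω x (F x).Z1 (F x).W2) ∧
    e1 (laF F f ω) x (F x).Z2 = I * (e1 (dY f) x (F x).Z1 * e2 ω x (F x).Z2 (F x).W1
      - e1 (dY f) x (F x).Z2 * e2 ω x (F x).Z1 (F x).W1) ∧
    e1 (laF F f ω) x (F x).W1 = I * (e1 (dY f) x (F x).W1 * e2 ω x (F x).Z1 (F x).W1
      + e1 (dY f) x (F x).W2 * e2 ω x (F x).Z2 (F x).W1) ∧
    e1 (laF F f ω) x (F x).W2 = I * (e1 (dY f) x (F x).W1 * e2 ω x (F x).Z1 (F x).W2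
      - e1 (dY f) x (F x).W2 * e2 ω x (F x).Z1 (F x).W1) := by
  obtain ⟨a1, a2, a3⟩ := mem_frame F hθ hω (x := x)
  refine ⟨?_, ?_, ?_, ?_⟩ <;> simp [laF, lam, a1, a2, a3] <;> ring

/-- The form `X` with `d(Υω) = θ ∧ X` for a closed form `ω`. -/
def delF (f : M → ℝ) (ω : Ω 2) : Ω 2 := fsmul (tF F f) ω - w11 (dY f) (tauF F ω) + d1 (laF F f ω)
/-- The form `X` with `d∂̄_bΥ ∧ ω = d(θ ∧ X)` for a closed form `ω`. -/
def muF (f : M → ℝ) (ω : Ω 2) : Ω 2 := d1 (P01 F (laF F f ω)) - w11 (P01 F (dY f)) (tauF F ω) + fsmul (gF F f) ω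

omit hd hω hθ in
lemma Q21_theta_congr {X Y : Ω 2} (h : e2 X x (F x).Z1 (F x).W1 - e2 X x (F x).Z2 (F x).W2
      = e2 Y x (F x).Z1 (F x).W1 - e2 Y x (F x).Z2 (F x).W2)
    (h12 : e2 X x (F x).Z1 (F x).W2 = e2 Y x (F x).Z1 (F x).W2)
    (h21 : e2 X x (F x).Z2 (F x).W1 = e2 Y x (F x).Z2 (F x).W1) :
    Q21 F (w12 θ X) x = Q21 F (w12 θ Y) x := by
  apply (F x).ext3 <;> simp [Q21, h, h12, h21]

omit hd in
include hT10 hf in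
lemma core_algebra : I • coreF F f ω - fsmul (scF F f) (w12 θ ω)
      + (2 * I) • Q21 F (w12 θ (muF F f ω)) =
    I • Q21 F (w12 θ (d1 (kap F (tauF F ω)))) + I • Q21 F (w12 θ (delF F f ω)) := by
  have sl := smoothOn_laF F hT10 hθ hf hω
  have s1 := smoothOn_P01 hT10 hθ F isOpen_univ sl
  have s2 := smoothOn_P10 hT10 hθ F isOpen_univ sl
  have sτ := smoothOn_kap F hT10 hθ (smoothOn_tauF F hT10 hθ hω)
  have e0 : laF F f ω = P10 F (laF F f ω) + P01 F (laF F f ω) := by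
    funext y; apply (F y).ext1 <;> simp [laF, lam_T]
  have k1 : d1 (kap F (tauF F ω - laF F f ω)) =
      d1 (kap F (tauF F ω)) - d1 (P01 F (laF F f ω)) + d1 (P10 F (laF F f ω)) := by
    rw [← d1_sub sτ s1, ← d1_add (sτ.sub s1) s2]
    congr 1
    funext y; apply (F y).ext1 <;> simp [kap] <;> ring
  have k2 : d1 (laF F f ω) = d1 (P10 F (laF F f ω)) + d1 (P01 F (laF F f ω)) := by
    rw [← d1_add s2 s1, ← e0]
  have e1' : fsmul (scF F f) (w12 θ ω) = Q21 F (w12 θ (fsmul (scF F f) ω)) := by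
    conv_lhs => rw [← Q21_of_mem F hθ hω]
    funext y; apply (F y).ext3 <;> simp [Q21] <;> ring
  rw [e1', coreF, ← Q21_smul, ← Q21_smul, ← Q21_smul, ← Q21_smul, ← Q21_sub, ← Q21_add, ← Q21_add,
    ← w12_smul F, ← w12_smul F, ← w12_smul F, ← w12_smul F, ← w12_sub F, ← w12_add F, ← w12_add F]
  funext y
  obtain ⟨a1, a2, a3⟩ := mem_frame F hθ hω (x := y)
  obtain ⟨b1, b2, b3, b4⟩ := la_frame F hθ hω (f := f) (x := y)
  rw [delF, muF, k1, k2]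
  apply Q21_theta_congr <;> simp only [e2_add, e2_sub, e2_smul, e2_fsmul, e2_w11, kap, e1_sub, scF,
    nF, tr2, P10_Z1, P10_Z2, P10_W1, P10_W2, P01_Z1, P01_Z2, P01_W1, P01_W2, a3, b1, b2, b3,
    b4]
  · linear_combination 2 * e2 ω y (F y).Z1 (F y).W1 * (e1 (dY f) y (F y).Z1 * e1 (dY f) y (F y).W1
      + e1 (dY f) y (F y).Z2 * e1 (dY f) y (F y).W2) * I_mul_I
  · linear_combination e2 ω y (F y).Z1 (F y).W2 * (e1 (dY f) y (F y).Z1 * e1 (dY f) y (F y).W1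
      + e1 (dY f) y (F y).Z2 * e1 (dY f) y (F y).W2) * I_mul_I
  · linear_combination e2 ω y (F y).Z2 (F y).W1 * (e1 (dY f) y (F y).Z1 * e1 (dY f) y (F y).W1
      + e1 (dY f) y (F y).Z2 * e1 (dY f) y (F y).W2) * I_mul_I
end

section

include hT10 hθ

lemma C22_d3_Q30 (ν : Ω 3) (hν : SmoothOn ν univ) : C22 F (d3 (Q30 F ν)) = 0 := by
  funext x
  obtain ⟨G, U, hx, hG⟩ := exists_smSF hT10 hθ x
  have hU := hG.isOpen
  have hν' := hν.mono U.subset_univ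
  have sθ := hθ.smooth.mono U.subset_univ
  have ss := hG.T.smFn_e3 hG.Z1 hG.Z2 hν'
  have sp := hG.psiF hθ
  have e1' : d3 (Q30 F ν) x = d3 (fsmul (fun y => e3 ν y (G y).T (G y).Z1 (G y).Z2)
      (w12 θ (psiF G))) x := extD_congr hU (fun y _ => Q30_frame F G ν) hx
  have e2' : d3 (fsmul (fun y => e3 ν y (G y).T (G y).Z1 (G y).Z2) (w12 θ (psiF G))) x = 
      (w13 (dFn fun y => e3 ν y (G y).T (G y).Z1 (G y).Z2) (w12 θ (psiF G))
      + fsmul (fun y => e3 ν y (G y).T (G y).Z1 (G y).Z2) (d3 (w12 θ (psiF G)))) x :=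
    d3_fsmul hU hx ss (sθ.w12 sp)
  have e3' : d3 (w12 θ (psiF G)) x = (w22 (d1 θ) (psiF G) - w13 θ (d2 (psiF G))) x :=
    d3_w12 hU hx sθ sp
  have key : ∀ Z ∈ T10 x, e4 (d3 (Q30 F ν)) x (F x).T Z (F x).W1 (F x).W2 = 0 := fun Z hZ => by
    have q := d2_psiF_ZWW hT10 hθ hG hx (Z := Z) (F x).mW1 (F x).mW2
    rw [e4_congr (e1'.trans e2'), e4_add, e4_fsmul, e4_congr e3', e4_sub, e4_w13, e4_w13, e4_w22, q]
    simp [psiF, cf1_W (F x).mW1, cf2_W (F x).mW1, cf1_W (F x).mW2, cf2_W (F x).mW2, (F x).t_Z hZ]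
  change _ = (0 : Ω 4) x
  apply (F x).ext4 <;> simp [C22, lam, key _ (F x).mZ1, key _ (F x).mZ2]

lemma C22_d3 {ν : Ω 3} (hν : SmoothOn ν univ) (h0 : w13 θ ν = 0) (h1 : w14 θ (d3 ν) = 0) :
    C22 F (d3 ν) = C22 F (d3 (Q21 F ν)) + C22 F (d3 (Q12 F ν)) := by
  have s1 := smoothOn_Q30 hT10 hθ F isOpen_univ hν
  have s2 := smoothOn_Q21 hT10 hθ F isOpen_univ hν fun y _ => congrFun h0 y
  have s3 := smoothOn_Q12 hT10 hθ F isOpen_univ hν fun y _ => congrFun h0 y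
  conv_lhs => rw [rumin_three_decomp hθ F hν h0 h1]
  rw [d3_add (s1.add s2) s3, d3_add s1 s2, C22_add, C22_add, C22_d3_Q30 F hT10 hθ ν hν, zero_add]

include hω

lemma Q12_theta_congr (hf : ContMDiff 𝓔 𝓘(ℝ, ℝ) (⊤ : ℕ∞) f) (s : M → ℂ) :
    Q12 F (w12 θ (muF F f ω) - fsmul s (w12 θ (d1 θ))) = Q12 F (w12 θ (delF F f ω)) := by
  have sl := smoothOn_laF F hT10 hθ hf hω
  have s1 := smoothOn_P01 hT10 hθ F isOpen_univ sl
  have s2 := smoothOn_P10 hT10 hθ F isOpen_univ sl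
  have e0 : laF F f ω = P10 F (laF F f ω) + P01 F (laF F f ω) := by
    funext y; apply (F y).ext1 <;> simp [laF, lam_T]
  have k2 : d1 (laF F f ω) = d1 (P10 F (laF F f ω)) + d1 (P01 F (laF F f ω)) := by
    rw [← d1_add s2 s1, ← e0]
  have key : (fun y => e3 (w12 θ (muF F f ω) - fsmul s (w12 θ (d1 θ))) y (F y).T (F y).W1 (F y).W2) =
      fun y => e3 (w12 θ (delF F f ω)) y (F y).T (F y).W1 (F y).W2 := by
    funext y
    have h := e2_d1_eq_zero_conj hT10 isOpen_univ s2 (fun y _ W hW => P10_W F _ hW)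
      (mem_univ y) (F y).mW1 (F y).mW2
    simp [muF, delF, k2, h, (mem_frame F hθ hω (x := y)).2.1]
    try ring
  rw [Q12, key, Q12]

include hd hf

lemma d2_rMulFn : d2 (rMulFn θ (fun y => (f y : ℂ)) ω) = w12 θ (delF F f ω) := by
  have sf := smFn_of_contMDiff hf
  have sl := smoothOn_laF F hT10 hθ hf hω
  rw [rMulFn_eq F hT10 hθ sf hω]
  change d2 (fsmul _ ω - w11 θ (laF F f ω)) = _
  rw [d2_sub (SmoothOn.fsmul sf hω.2.1) (hθ.smooth.w11 sl), d2_fsmul_univ sf hω.2.1, hd,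
    d2_w11_univ hθ.smooth sl, delF, w12_add F, show dFn (fun y => (f y : ℂ)) = dY f from rfl,
    w12_dY_eq F hθ hω hd]
  rw [show fsmul (fun y => (f y : ℂ)) (0 : Ω 3) = 0 by funext y; ext v; exact mul_zero _]
  abel

lemma w22_gaF : w22 (d1 (gaF F f)) ω = d3 (w12 θ (muF F f ω)) := by
  have sl := smoothOn_laF F hT10 hθ hf hω
  have s1 := smoothOn_P01 hT10 hθ F isOpen_univ sl
  have sY := smoothOn_P01dY F hT10 hθ hf
  have sτ := smoothOn_tauF F hT10 hθ hω
  have sg := SmoothOn.fsmul (smFn_gF F hT10 hθ hf) hω.2.1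
  have h := d3_w12_univ (smoothOn_gaF F hT10 hθ hf) hω.2.1
  have e : w12 (gaF F f) ω = w12 (P01 F (laF F f ω)) (d1 θ)
      + w12 θ (fsmul (gF F f) ω - w11 (P01 F (dY f)) (tauF F ω)) := by
    have e0 : w12 (gaF F f) ω = w12 (P01 F (dY f)) ω + w12 θ (fsmul (gF F f) ω) := by
      funext y; apply (F y).ext3 <;> simp [gaF] <;> ring
    rw [e0, w12_P01_eq F hθ hω hd, w12_sub F]; abel
  have e' : muF F f ω = d1 (P01 F (laF F f ω))
      + (fsmul (gF F f) ω - w11 (P01 F (dY f)) (tauF F ω)) := by rw [muF]; abel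
  have z : w13 (gaF F f) (0 : Ω 3) = 0 := by funext y; apply (F y).ext4 <;> simp
  have zθ : w13 θ (0 : Ω 3) = 0 := by funext y; apply (F y).ext4 <;> simp
  have zl : w13 (P01 F (laF F f ω)) (0 : Ω 3) = 0 := by funext y; apply (F y).ext4 <;> simp
  have sx := hθ.smooth.w12 (sg.sub (sY.w11 sτ))
  have sd := s1.d1 isOpen_univ
  rw [hd, z, sub_zero] at h
  rw [← h, e, e', w12_add F, d3_add (s1.w12 (hθ.smooth.d1 isOpen_univ)) sx, d3_add
    (hθ.smooth.w12 sd) sx, d3_w12_univ s1 (hθ.smooth.d1 isOpen_univ), d3_w12_univ hθ.smooth sd,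
    d2_d1_univ hθ.smooth, d2_d1_univ s1, zθ, zl]
  congr 2
  funext y; apply (F y).ext4 <;> simp <;> ring

omit hd hf hω in
include F in
lemma piFour_add_smul {a b : Ω 4} (c : ℂ) (ha : SmoothOn a univ)
    (hb : SmoothOn b univ) : piFour θ (a + c • b) = piFour θ a + c • piFour θ b := by
  have st := hθ.smooth.w12 (hθ.smooth.d1 isOpen_univ)
  have s : ∀ {a : Ω 4}, SmoothOn a univ →
      SmoothOn (fsmul (fun y => top4 F a y / 2) (w12 θ (d1 θ))) univ := fun h =>
    st.fsmul ((smFn_top4 hT10 hθ F isOpen_univ h).div (smFn_const 2 _) fun _ _ => by norm_num)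
  have e : fsmul (fun y => top4 F (a + c • b) y / 2) (w12 θ (d1 θ)) =
      fsmul (fun y => top4 F a y / 2) (w12 θ (d1 θ))
      + c • fsmul (fun y => top4 F b y / 2) (w12 θ (d1 θ)) := by
    funext y; apply (F y).ext3 <;> simp [top4, add_div] <;> ring
  rw [piFour_eq F, piFour_eq F, piFour_eq F, e, d3_add (s ha) ((s hb).const_smul c),
    d3_smul c (s hb)]
  module

set_option maxHeartbeats 1000000 in
lemma calD_hat_sub : calD T10 (rescale f θ) ω = calD T10 θ ω +
    C22 F (d3 ((-I) • Q21 F (d2 (rMulFn θ (fun y => (f y : ℂ)) ω)))) := by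
  have sl := smoothOn_laF F hT10 hθ hf hω
  have s1 := smoothOn_P01 hT10 hθ F isOpen_univ sl
  have sτ := smoothOn_tauF F hT10 hθ hω
  have sY := smoothOn_dY hf univ
  have sw := hθ.smooth.w12 hω.2.1
  have sθ := hθ.smooth.w12 (hθ.smooth.d1 isOpen_univ)
  have hL := leeForm_spec hT10 hθ F
  have sg := (smoothOn_gaF F hT10 hθ hf).d1 isOpen_univ
  have sR := (smFn_scalarCurvature hT10 hθ).div (smFn_const 6 _) (fun _ _ => by norm_num)
  have sc := smFn_scF F hT10 hθ hf
  have hz : ∀ X : Ω 2, w13 θ (w12 θ X) = 0 := fun X => funext fun y => w13_theta_w12 (F y) X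
  have sQ : ∀ X : Ω 2, SmoothOn X univ → SmoothOn (Q21 F (w12 θ X)) univ := fun X hX =>
    smoothOn_Q21 hT10 hθ F isOpen_univ (hθ.smooth.w12 hX) fun y _ => congrFun (hz X) y
  have sk := smoothOn_kap F hT10 hθ (sτ.sub sl)
  have sκ := smoothOn_kap F hT10 hθ sτ
  have sμ : SmoothOn (muF F f ω) univ := ((s1.d1 isOpen_univ).sub
    ((smoothOn_P01dY F hT10 hθ hf).w11 sτ)).add (hω.2.1.fsmul (smFn_gF F hT10 hθ hf))
  have sδ : SmoothOn (delF F f ω) univ :=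
    ((hω.2.1.fsmul (smFn_tF F hT10 hθ hf)).sub (sY.w11 sτ)).add (sl.d1 isOpen_univ)
  have ss : SmFn (fun y => top4 F (w22 (d1 (gaF F f)) ω) y / 2) univ :=
    (smFn_top4 hT10 hθ F isOpen_univ (sg.w22 hω.2.1)).div (smFn_const 2 _) fun _ _ => by norm_num
  set s := fun y => top4 F (w22 (d1 (gaF F f)) ω) y / 2 with hs
  set ν := w12 θ (muF F f ω) - fsmul s (w12 θ (d1 θ)) with hν
  have sν : SmoothOn ν univ := (hθ.smooth.w12 sμ).sub (sθ.fsmul ss)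
  have hpi : piFour θ (w22 (d1 (gaF F f)) ω) = d3 ν := by
    rw [piFour_eq F, hν, d3_sub (hθ.smooth.w12 sμ) (sθ.fsmul ss), ← w22_gaF F hT10 hθ hf hω hd]
  have z1 : w13 θ ν = 0 := by funext y; apply (F y).ext4 <;> simp [hν]
  have q1 : Q21 F ν = Q21 F (w12 θ (muF F f ω)) := by funext y; apply (F y).ext3 <;> simp [hν, Q21]
  have q2 : Q12 F ν = Q12 F (w12 θ (delF F f ω)) := Q12_theta_congr F hT10 hθ hω hf s
  have dν : C22 F (d3 ν) = C22 F (d3 (Q21 F (w12 θ (muF F f ω))))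
      + C22 F (d3 (Q12 F (w12 θ (delF F f ω)))) := by
    rw [C22_d3 F hT10 hθ sν z1 (hpi ▸ w14_piFour F hT10 hθ (sg.w22 hω.2.1)), q1, q2]
  have hδ := d2_rMulFn F hT10 hθ hf hω hd
  have dδ : C22 F (d3 (Q21 F (w12 θ (delF F f ω))))
      + C22 F (d3 (Q12 F (w12 θ (delF F f ω)))) = 0 := by
    have h0 : d3 (w12 θ (delF F f ω)) = 0 := by
      rw [← hδ, d3_d2_univ (rMulFn_mem F hT10 hθ (smFn_of_contMDiff hf) hω).2.1]
    rw [← C22_d3 F hT10 hθ (hθ.smooth.w12 sδ) (hz _) (by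
      rw [h0]; funext y; apply (F y).ext5; simp), h0]
    funext y; apply (F y).ext4 <;> simp [C22, lam]
  have ca := core_algebra F hT10 hθ hf hω
  have sK : SmoothOn (coreF F f ω) univ := sQ _ ((sk.d1 isOpen_univ).sub (sY.w11 sk))
  have sa := sK.const_smul I
  have sb := SmoothOn.fsmul sR sw
  have sd := SmoothOn.fsmul sc sw
  have ef : fsmul (fun y => scalarCurvature T10 θ y / 6 + scF F f y) (w12 θ ω) =
      fsmul (fun y => scalarCurvature T10 θ y / 6) (w12 θ ω) + fsmul (scF F f) (w12 θ ω) := by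
    funext y; apply (F y).ext3 <;> simp <;> ring
  have ew : w22 (leeForm T10 θ + I • d1 (gaF F f)) ω =
      w22 (leeForm T10 θ) ω + I • w22 (d1 (gaF F f)) ω := by
    funext y; apply (F y).ext4 <;> simp <;> ring
  have s2 := sQ _ (sκ.d1 isOpen_univ)
  have s3 := sQ _ sδ
  have s4 := sQ _ sμ
  have ca' : C22 F (d3 _) = C22 F (d3 _) := congrArg (fun ν => C22 F (d3 ν)) ca
  rw [d3_add (sa.sub sd) (s4.const_smul _), d3_sub sa sd, d3_add (s2.const_smul _) (s3.const_smul _),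
    d3_smul _ sK, d3_smul _ s2, d3_smul _ s3, d3_smul _ s4, C22_add, C22_sub, C22_add, C22_smul,
    C22_smul, C22_smul, C22_smul] at ca'
  rw [calD_hat F hT10 hθ hf hω, calD_eq F hT10 hθ hω (smFn_scalarCurvature hT10 hθ) hL.1.2.1, hδ, ef,
    ew, piFour_add_smul F hT10 hθ _ (hL.1.2.1.w22 hω.2.1) (sg.w22 hω.2.1), hpi, d3_sub sa (sb.add sd),
    d3_add sb sd, d3_smul _ sK, d3_smul _ s3]
  erw [d3_sub (s2.const_smul I) sb, d3_smul _ s2]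
  simp only [C22_add, C22_sub, C22_smul, dν]
  linear_combination (norm := module) (1 : ℂ) • ca' + (2 * I) • dδ

end

section

/-- The complex conjugate of an adapted frame. -/
def conjSF (G : SF T10 θ x) : SF T10 θ x where
  T := conjC G.T
  Z1 := conjC G.W1
  Z2 := conjC G.W2
  W1 := conjC G.Z1
  W2 := conjC G.Z2
  mZ1 := G.mW1
  mZ2 := G.mW2
  mW1 := by rw [conjC_conjC]; exact G.mZ1
  mW2 := by rw [conjC_conjC]; exact G.mZ2
  spanZ Z hZ := by
    obtain ⟨a, b, h⟩ := G.spanW (conjC Z) (by rwa [conjC_conjC])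
    exact ⟨cj a, cj b, by
      rw [← conjC_conjC Z, h, map_add, conjC_smul, conjC_smul]⟩
  tT := by rw [hθ.e1_conj, G.tT, map_one]
  tZ1 := by rw [hθ.e1_conj, G.tW1, map_zero]
  tZ2 := by rw [hθ.e1_conj, G.tW2, map_zero]
  tW1 := by rw [hθ.e1_conj, G.tZ1, map_zero]
  tW2 := by rw [hθ.e1_conj, G.tZ2, map_zero]
  dTZ1 := by rw [hθ.e2_conj, G.dTW1, map_zero]
  dTZ2 := by rw [hθ.e2_conj, G.dTW2, map_zero]
  dTW1 := by rw [hθ.e2_conj, G.dTZ1, map_zero]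
  dTW2 := by rw [hθ.e2_conj, G.dTZ2, map_zero]
  dZZ := by rw [hθ.e2_conj, G.dWW, map_zero]
  dWW := by rw [hθ.e2_conj, G.dZZ, map_zero]
  d11 := by rw [hθ.e2_conj, G.d11', map_neg, conj_I, neg_neg]
  d12 := by rw [hθ.e2_conj, G.d21', map_zero]
  d21 := by rw [hθ.e2_conj, G.d12', map_zero]
  d22 := by rw [hθ.e2_conj, G.d22', map_neg, conj_I, neg_neg]

/-- The complex conjugates of adapted frames. -/
def conjFr (y : M) : SF T10 θ y := conjSF hθ (F y)

lemma conjF_conjF (α : Ω k) : conjF (conjF α) = α := by funext y; ext v; exact conj_conj _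

include F hθ

lemma w13_conjF {ν : Ω 3} (h : w13 θ ν = 0) : w13 θ (conjF ν) = 0 := by
  funext y
  refine w13_theta_of_horizontal (F y) fun u v w hu hv hw => ?_
  rw [e3_conjF, e3_of_w13 (F y) (congrFun h y) (by rw [hθ.e1_conj, hu, map_zero])
    (by rw [hθ.e1_conj, hv, map_zero]) (by rw [hθ.e1_conj, hw, map_zero]), map_zero]

lemma w14_conjF {μ : Ω 4} (h : w14 θ μ = 0) : w14 θ (conjF μ) = 0 := by
  funext y
  refine (w14_theta_eq_zero (conjSF hθ (F y))).2 ?_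
  rw [e4_conjF]
  simp only [conjSF, conjC_conjC]
  rw [e4_swap23, e4_swap12, e4_swap34, e4_swap23, (w14_theta_eq_zero (F y)).1 (congrFun h y)]
  simp

lemma lam_conjF {μ : Ω 4} (h : w14 θ μ = 0) : lam F (conjF μ) = conjF (lam F μ) := by
  funext y
  have h' := congrFun (w14_conjF F hθ h) y
  rw [lam_frame F (conjFr F hθ) h']
  have a1 : ∀ a, e4 μ y (F y).T (F y).W1 (F y).W2 a = e4 μ y (F y).T a (F y).W1 (F y).W2 :=
    fun a => by rw [e4_swap34, e4_swap23, neg_neg]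
  have a2 : ∀ a, e4 μ y (F y).T a (F y).Z1 (F y).Z2 = e4 μ y (F y).T (F y).Z1 (F y).Z2 a :=
    fun a => by rw [e4_swap23, e4_swap34, neg_neg]
  apply (conjFr F hθ y).ext1 <;> simp [lam]
  all_goals simp [conjFr, conjSF, e1_conjF, e4_conjF, conjC_conjC, a1, a2]

lemma C31_conjF {μ : Ω 4} (h : w14 θ μ = 0) : C31 F (conjF μ) = conjF (C22 F μ) := by
  funext y
  rw [C31, lam_conjF F hθ h, P10_frame F (conjFr F hθ)]
  apply (conjFr F hθ y).ext4 <;> simp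
  all_goals simp [conjFr, conjSF, e1_conjF, e4_conjF, conjC_conjC, C22]

lemma Q21_conjF {ν : Ω 3} (h : w13 θ ν = 0) : Q21 F (conjF ν) = conjF (Q21 F ν) := by
  funext y
  rw [Q21_frame F (conjFr F hθ) (congrFun (w13_conjF F hθ h) y)]
  have b1 := e3_swap23 (x := y) (F y).T (F y).W1 (F y).Z1 ν
  have b2 := e3_swap23 (x := y) (F y).T (F y).W1 (F y).Z2 ν
  have b3 := e3_swap23 (x := y) (F y).T (F y).W2 (F y).Z1 ν
  have b4 := e3_swap23 (x := y) (F y).T (F y).W2 (F y).Z2 ν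
  have c2 : cj 2 = 2 := map_ofNat _ 2
  apply (conjFr F hθ y).ext3 <;> simp [Q21]
  all_goals simp [conjFr, conjSF, e1_conjF, e3_conjF, conjC_conjC, Q21, b1, b2, b3, b4, c2]
  all_goals ring

omit hθ F in
include hω in
lemma conjF_hasBidegree : HasBidegree T10 1 (conjF ω) := by
  intro y s Z h1 h2 h3
  have := evalC_conjF ω y Z
  rw [evalC] at this
  rw [this, evalC, hω.2.2.2 y sᶜ (fun i => conjC (Z i)) (fun i hi => h2 i (Finset.mem_compl.1 hi))
    (fun i hi => by rw [conjC_conjC]; exact h1 i (by simpa using hi)) ?_, map_zero]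
  have := s.card_le_univ
  rw [Fintype.card_fin] at this
  rw [Finset.card_compl, Fintype.card_fin]
  change s.card ≤ 2 at this
  change 0 + (2 - s.card) ≠ 1
  omega

omit F hθ in
lemma d_conjF_two {α : Ω 2} (hα : SmoothOn α univ) : d2 (conjF α) = conjF (d2 α) :=
  funext fun x => extD_conjF isOpen_univ (mem_univ x) hα
omit F hθ in
lemma d_conjF_three {α : Ω 3} (hα : SmoothOn α univ) : d3 (conjF α) = conjF (d3 α) :=
  funext fun x => extD_conjF isOpen_univ (mem_univ x) hα

include hω

lemma conjF_mem : conjF ω ∈ RSpace T10 θ 2 1 1 := by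
  have r := isRumin_two.1 hω.2.2.1
  refine ⟨rfl, hω.2.1.conjF, isRumin_two.2 ⟨?_, ?_⟩, conjF_hasBidegree hω⟩
  · funext y
    refine (w14_theta_eq_zero (conjSF hθ (F y))).2 ?_
    have := (w14_theta_eq_zero (F y)).1 (congrFun r.1 y)
    simp at this ⊢
    simp [conjSF, e2_conjF, conjC_conjC, e2_swap (a := (F y).W1) (b := (F y).Z1),
      e2_swap (a := (F y).W2) (b := (F y).Z2)]
    have := congrArg cj this
    simp at this
    linear_combination this
  · rw [d_conjF_two hω.2.1]
    exact w13_conjF F hθ r.2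

include hf in
lemma rMulFn_conjF (hT10 : IsCRStructure T10) : rMulFn θ (fun y => (f y : ℂ)) (conjF ω) =
    conjF (rMulFn θ (fun y => (f y : ℂ)) ω) := by
  have sf := smFn_of_contMDiff hf
  rw [rMulFn_eq F hT10 hθ sf (conjF_mem F hθ hω), rMulFn_eq F hT10 hθ sf hω]
  have hz : w14 θ (w13 θ (w12 (dY f) ω)) = 0 := funext fun y => w14_theta_w13 (F y) _
  have e : w13 θ (w12 (dY f) (conjF ω)) = conjF (w13 θ (w12 (dY f) ω)) := by
    funext y
    apply (F y).ext4 <;> simp only [e4_conjF, e4_w13, e3_w12, e2_conjF, hθ.e1_conj, e1_dY_conj hf,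
      map_sub, map_add, map_mul, conj_conj]
  change fsmul _ _ - w11 θ (lam F (w13 θ (w12 (dY f) (conjF ω)))) =
    conjF (fsmul _ _ - w11 θ (lam F (w13 θ (w12 (dY f) ω))))
  rw [e, lam_conjF F hθ hz]
  funext y
  apply (F y).ext2 <;> simp [e2_conjF, e1_conjF, hθ.e1_conj]

lemma calD_mem (hT10 : IsCRStructure T10) : ∃ μ : Ω 4, SmoothOn μ univ ∧ w14 θ μ = 0 ∧
    calD T10 θ ω = C22 F μ := by
  have hL := leeForm_spec hT10 hθ F
  have sR := smFn_scalarCurvature hT10 hθ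
  have sR' := sR.div (smFn_const 6 _) (fun _ _ => by norm_num)
  have hz : ∀ X : Ω 2, w13 θ (w12 θ X) = 0 := fun X => funext fun y => w13_theta_w12 (F y) X
  have sk := hθ.smooth.w12 ((smoothOn_kap F hT10 hθ (smoothOn_tauF F hT10 hθ hω)).d1 isOpen_univ)
  have sQ := smoothOn_Q21 hT10 hθ F isOpen_univ sk fun y _ => congrFun (hz _) y
  have sw := SmoothOn.fsmul sR' (hθ.smooth.w12 hω.2.1)
  have sl := hL.1.2.1.w22 hω.2.1
  have e := calD_eq F hT10 hθ hω sR hL.1.2.1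
  rw [← C22_smul, ← C22_add] at e
  refine ⟨_, ?_, ?_, e⟩
  · exact (((sQ.const_smul _).sub sw).d3 isOpen_univ).add ((smoothOn_piFour F hT10 hθ sl).const_smul _)
  · have h1 := w14_d3_fsmul F hT10 hθ hω sR'
    have h2 := w14_d3_Q21 F hT10 hθ sk (hz _)
    have h3 := w14_piFour F hT10 hθ sl
    erw [d3_sub (sQ.const_smul _) sw, d3_smul _ sQ]
    funext y
    have k := fun μ (h : w14 θ μ = 0) => (w14_theta_eq_zero (F y)).1 (congrFun h y)
    refine (w14_theta_eq_zero (F y)).2 ?_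
    rw [e4_add, e4_sub, e4_smul, e4_smul, k _ h1, k _ h3]
    erw [k _ h2]
    simp
end

section

include F hT10 hθ hω

lemma neg_I_smul_conjF (μ : Ω 4) : -(I • conjF μ) = conjF (I • μ) := by
  funext y; ext v
  change -(I * cj (μ y v)) = cj (I * μ y v)
  rw [map_mul, conj_I, neg_mul]

lemma qOp_mem : ∃ α ∈ RSpace T10 θ 4 3 1, ∃ β ∈ RSpace T10 θ 4 2 2, qOp T10 θ ω = α + β := by
  obtain ⟨μ, s, z, e⟩ := calD_mem F hθ hω hT10
  obtain ⟨μ', s', z', e'⟩ := calD_mem F hθ (conjF_mem F hθ hω) hT10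
  have k : ∀ {μ : Ω 4}, w14 θ μ = 0 → w14 θ (I • μ) = 0 := fun h => by
    rw [w14_smul F, h]; funext y; ext v; exact mul_zero _
  refine ⟨_, C31_mem hT10 hθ F (s'.const_smul I).conjF (w14_conjF F hθ (k z')), _,
    C22_mem hT10 hθ F (s.const_smul I) (k z), ?_⟩
  rw [qOp, e, e', neg_I_smul_conjF F hT10 hθ hω, C31_conjF F hθ (k z'), C22_smul, C22_smul]

include hf

lemma qOp_rescale (hd : extD ω = 0) : qOp T10 (rescale f θ) ω = qOp T10 θ ω +
    bottChernGJMS T10 θ (rMulFn θ (fun x => (f x : ℂ)) ω) := by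
  have hm := rMulFn_mem F hT10 hθ (smFn_of_contMDiff hf) hω
  have hc := conjF_mem F hθ hω
  have hd' : d2 (conjF ω) = 0 := by
    rw [d_conjF_two hω.2.1, show d2 ω = 0 from hd]; funext y; ext v; exact map_zero cj
  have z : w13 θ (d2 (rMulFn θ (fun x => (f x : ℂ)) ω)) = 0 := (isRumin_two.1 hm.2.2.1).2
  have sδ := hm.2.1.d2 isOpen_univ
  have h0 := d3_d2_univ hm.2.1
  have w0 : w14 θ (d3 (d2 (rMulFn θ (fun x => (f x : ℂ)) ω))) = 0 := by
    rw [h0]; funext y; apply (F y).ext5; simp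
  have e0 : bottChernGJMS T10 θ (rMulFn θ (fun x => (f x : ℂ)) ω) =
      d3 (Q21 F (d2 (rMulFn θ (fun x => (f x : ℂ)) ω))) :=
    congrArg d3 (component_three hT10 hθ F sδ z w0)
  have e1 := calD_hat_sub F hT10 hθ hf hω hd
  have e2 := calD_hat_sub F hT10 hθ hf hc hd'
  rw [rMulFn_conjF F hθ hf hω hT10, d_conjF_two hm.2.1, Q21_conjF F hθ z] at e2
  have sQ := smoothOn_Q21 hT10 hθ F isOpen_univ sδ fun y _ => congrFun z y
  set q := Q21 F (d2 (rMulFn θ (fun x => (f x : ℂ)) ω)) with hq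
  have wq : w14 θ (d3 q) = 0 := w14_d3_Q21 F hT10 hθ sδ z
  rw [d3_smul _ sQ, C22_smul] at e1
  rw [d3_smul _ sQ.conjF, d_conjF_three sQ, C22_smul] at e2
  have e3 : conjF (C22 F (conjF (d3 q))) = C31 F (d3 q) := by
    rw [← C31_conjF F hθ (w14_conjF F hθ wq), conjF_conjF]
  rw [qOp, qOp, e0, e1, e2]
  have e4 := C31_add_C22 F wq
  have e5 : ∀ a b : Ω 4, conjF (a + (-I) • b) = conjF a + I • conjF b :=
    fun a b => by
      funext y; ext v
      change cj (a y v + -I * b y v) = cj (a y v)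
        + I * cj (b y v)
      rw [map_add, map_mul, map_neg, conj_I, neg_neg]
  rw [e5, e3]
  have hI := I_mul_I
  conv_rhs => rw [← e4]
  rw [smul_add, smul_add, smul_smul, smul_smul, mul_neg, hI]
  module

end

end

theorem theorem1p2 {M : Type*} [TopologicalSpace M] [T2Space M] [SecondCountableTopology M]
    [ChartedSpace E5 M] [IsManifold 𝓘(ℝ, E5) (⊤ : ℕ∞) M]
    (T10 : CDistribution M) (hT10 : IsCRStructure T10)
    (θ : CForm M 1) (hθ : IsContactForm T10 θ) :
    (∀ ω ∈ RSpace T10 θ 2 1 1,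
      ∃ α ∈ RSpace T10 θ 4 3 1, ∃ β ∈ RSpace T10 θ 4 2 2, qOp T10 θ ω = α + β) ∧
    ∀ ω ∈ RSpace T10 θ 2 1 1, extD ω = 0 →
      ∀ f : M → ℝ, ContMDiff 𝓘(ℝ, E5) 𝓘(ℝ, ℝ) (⊤ : ℕ∞) f →
        qOp T10 (rescale f θ) ω =
          qOp T10 θ ω + bottChernGJMS T10 θ (rMulFn θ (fun x => (f x : ℂ)) ω) := by
  have F : ∀ y, SF T10 θ y := fun y => (exists_SF hT10 hθ y).some
  exact ⟨fun ω hω => qOp_mem F hT10 hθ hω, fun ω hω hd f hf => qOp_rescale F hT10 hθ hf hω hd⟩
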